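/- Let $0<c<1$, $\ell_0>0$. For $0<\ell<\ell_0$ consider on the closed cylinder $\mathcal C=[-1,1]_\tau\times S^1_\theta$ ($S^1=\mathbb R/2\pi\mathbb Z$) the hyperbolic metric $$g_\ell=\frac{d\tau^2}{\tau^2+\ell^2}+(\tau^2+\ell^2)\,d\theta^2 ,$$ and the operator $P^{g}=B^{g}\circ(\delta^{g})^*$ on one-forms, where $((\delta^g)^*\omega)_{ij}=\tfrac12(\omega_{i;j}+\omega_{j;i})$, $B^g=\delta^g+\tfrac12\,d\,\mathrm{tr}^g$, and $\delta^g$ is the divergence $(\delta^g h)_k=-g^{ij}\nabla_ih_{jk}$. Let $$\widehat{\mathcal C}=[\,\mathcal C\times[0,\ell_0);\{\tau=\ell=0\}\,]$$ be the real blowup, with front face $\mathrm{ff}$ (the new face) and faces $L_\pm$ (the lifts of $\{\ell=0,\ \pm\tau\ge 0\}$). A function on $\widehat{\mathcal C}$ is called polyhomogeneous if it is smooth for $\ell>0$ (up to $\tau=\pm1$) and has, for some index sets in $\mathbb C\times\mathbb N_0$ attached to $\mathrm{ff},L_+,L_-$, complete asymptotic expansions in the terms $x^z(\log x)^p$ at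 each of these faces ($x$ a defining function of the face), which may be differentiated term by term, are of product type at the corners $\mathrm{ff}\cap L_\pm$, and are smooth up to the lateral boundary $\tau=\pm1$. It vanishes rapidly at $\mathrm{ff}$ if the index set at $\mathrm{ff}$ can be taken empty. A family of (complex) one-forms is polyhomogeneous if its components in the orthonormal coframe $\sigma_1=d\tau/\sqrt{\tau^2+\ell^2}$, $\sigma_2=\sqrt{\tau^2+\ell^2}\,d\theta$ are. Let $h=(h_\ell)_{0<\ell<\ell_0}$ be a family of one-forms that is polyhomogeneous on $\widehat{\mathcal C}$, vanishes for $|\tau|\le c$, and whose $k=0$ Fourier mode in $\theta$ (of the components in $\sigma_1,\sigma_2$) is zero. Let $\eta_\pm=\eta_\pm(\ell,\theta)$ be boundary values (the two components in $\sigma_1,\sigma_2$), smooth for $\ell>0$, polyhomogeneous in $\ell$ as $\ell\searrow0$, whose $k=0$ Fourier modes in $\theta$ are also zero. Then for every $\ell\in(0,\ell_0)$ the problem $$P^{g_\ell}\omega_\ell=h_\ell \ \text{ for } |\tau|<1,\qquad \omega_\ell(\pm1,\theta)=\eta_\pm(\ell,\theta)$$ has exactly one solution $\omega_\ell$ that is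 continuous on the closed cylinder and $C^2$ in its interior, and the family $\omega=(\omega_\ell)$ is polyhomogeneous on $\widehat{\mathcal C}$ and vanishes rapidly at the front face. -/

import Mathlib

noncomputable section

namespace HypCyl

open Set

/-! ### Index sets and polyhomogeneous expansions -/

/-- A (smooth) index set: a subset of `ℂ × ℕ` having only finitely many elements with real part
below any given bound, and closed under lowering the logarithmic power and under raising the
exponent by one. -/
structure IndexSet where
  carrier : Set (ℂ × ℕ)
  finite_re_le : ∀ N : ℝ, {e : ℂ × ℕ | e ∈ carrier ∧ e.1.re ≤ N}.Finite
  log_closed : ∀ z p q, (z, p) ∈ carrier → q ≤ p → (z, q) ∈ carrier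
  shift_closed : ∀ z p, (z, p) ∈ carrier → (z + 1, p) ∈ carrier

/-- The finitely many `(z, p)` in the index set with `Re z ≤ N`. -/
def IndexSet.upTo (E : IndexSet) (N : ℝ) : Finset (ℂ × ℕ) :=
  (E.finite_re_le N).toFinset

/-- The function `x ^ z * (log x) ^ p`, for `x > 0`. -/
def phgTerm (e : ℂ × ℕ) (x : ℝ) : ℂ :=
  (x : ℂ) ^ e.1 * ((Real.log x : ℝ) : ℂ) ^ e.2

/-- The derivation `x d/dx`. -/
def eulerD (f : ℝ → ℂ) : ℝ → ℂ := fun x => (x : ℂ) * deriv f x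

/-- `f x w ∼ ∑_{(z, p) ∈ E} a_{z,p}(w) x ^ z (log x) ^ p` as `x ↘ 0`, with smooth coefficients,
locally uniformly in the parameter `w` and with all derivatives `(x ∂_x) ^ j ∂_w ^ k`. -/
def HasPhgExpansion {P : Type*} [NormedAddCommGroup P] [NormedSpace ℝ P]
    (E : IndexSet) (f : ℝ → P → ℂ) : Prop :=
  ∃ a : ℂ × ℕ → P → ℂ,
    (∀ e ∈ E.carrier, ContDiff ℝ (⊤ : ℕ∞) (a e)) ∧
    ∀ (N j k : ℕ) (K : Set P), IsCompact K →
      ∃ C : ℝ, ∃ ε > 0, ∀ x ∈ Ioo (0 : ℝ) ε, ∀ w ∈ K,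
        ‖iteratedFDeriv ℝ k (fun w' =>
            (eulerD^[j] (fun x' => f x' w' - ∑ e ∈ E.upTo N, a e w' * phgTerm e x')) x) w‖
          ≤ C * x ^ N

/-- `(x ∂_x) ^ i (y ∂_y) ^ j ∂_θ ^ k`, applied to a function of `(x, y, θ)`. -/
def bDeriv (i j k : ℕ) (f : ℝ → ℝ → ℝ → ℂ) (x y θ : ℝ) : ℂ :=
  (eulerD^[i] (fun x' => (eulerD^[j] (fun y' => iteratedDeriv k (fun θ' => f x' y' θ') θ)) y)) x

/-- Polyhomogeneity of a function `f x y θ` at the codimension two corner `x = y = 0` of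
`[0, 1]_x × [0, 1]_y × S¹_θ`, with index set `E` at the face `x = 0` and `F` at the face `y = 0`:
there is an expansion at each of the two faces, whose coefficients are polyhomogeneous
on that face with the index set of the other face, and whose remainders, together with all their
`b`-derivatives, are of order `x ^ N` (resp. `y ^ N`), with a loss at the other face that is bounded
by a fixed power, independent of `N`. -/
def HasCornerExpansion (E F : IndexSet) (f : ℝ → ℝ → ℝ → ℂ) : Prop :=
  ∃ (a b : ℂ × ℕ → ℝ → ℝ → ℂ) (m : ℕ),
    (∀ e ∈ E.carrier,
      ContDiffOn ℝ (⊤ : ℕ∞) (fun q : ℝ × ℝ => a e q.1 q.2) (Ioc 0 1 ×ˢ univ) ∧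
      HasPhgExpansion F (a e)) ∧
    (∀ e ∈ F.carrier,
      ContDiffOn ℝ (⊤ : ℕ∞) (fun q : ℝ × ℝ => b e q.1 q.2) (Ioc 0 1 ×ˢ univ) ∧
      HasPhgExpansion E (b e)) ∧
    (∀ N i j k : ℕ, ∃ C : ℝ, ∃ ε > 0, ∀ x ∈ Ioo (0 : ℝ) ε, ∀ y ∈ Ioo (0 : ℝ) 1, ∀ θ : ℝ,
      ‖bDeriv i j k (fun x y θ => f x y θ - ∑ e ∈ E.upTo N, a e y θ * phgTerm e x) x y θ‖
        ≤ C * x ^ N / y ^ m) ∧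
    (∀ N i j k : ℕ, ∃ C : ℝ, ∃ ε > 0, ∀ x ∈ Ioo (0 : ℝ) 1, ∀ y ∈ Ioo (0 : ℝ) ε, ∀ θ : ℝ,
      ‖bDeriv i j k (fun x y θ => f x y θ - ∑ e ∈ F.upTo N, b e x θ * phgTerm e y) x y θ‖
        ≤ C * y ^ N / x ^ m)

/-! ### The blown-up cylinder

`Ĉ = [ [-1, 1]_τ × S¹_θ × [0, ℓ₀)_ℓ ; {τ = ℓ = 0} ]` has the front face `ff` (the new face), the two
faces `L₊`, `L₋` that cover `{ℓ = 0, ± τ > 0}`, and the lateral boundary `τ = ± 1`. Near the interior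
of `ff` it has the coordinates `(ℓ, T = τ / ℓ, θ)`, and near `L₊` and `L₋`, up to the front face, the
coordinates `(x = ℓ / |τ|, y = |τ|, θ)`. Functions on the circle are `2π`-periodic functions. -/

/-- One index set for each of the boundary hypersurfaces `ff`, `L₊`, `L₋`. A polyhomogeneous function
vanishes rapidly (to infinite order) at a face when its index set at that face can be taken empty. -/
structure IndexFamily where
  ff : IndexSet
  plus : IndexSet
  minus : IndexSet

/-- The function `u ℓ τ θ` is polyhomogeneous on `Ĉ` with the given index family (and smooth up to
the lateral boundary). -/
def IsPhgOnBlowup (ℓ₀ : ℝ) (I : IndexFamily) (u : ℝ → ℝ → ℝ → ℂ) : Prop :=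
  (∀ ℓ ∈ Ioo 0 ℓ₀, ∀ τ ∈ Icc (-1 : ℝ) 1, ∀ θ, u ℓ τ (θ + 2 * Real.pi) = u ℓ τ θ) ∧
  ContDiffOn ℝ (⊤ : ℕ∞) (fun q : ℝ × ℝ × ℝ => u q.1 q.2.1 q.2.2)
    (Ioo 0 ℓ₀ ×ˢ (Icc (-1) 1 ×ˢ univ)) ∧
  HasPhgExpansion I.ff (fun (ℓ : ℝ) (w : ℝ × ℝ) => u ℓ (ℓ * w.1) w.2) ∧
  HasCornerExpansion I.plus I.ff (fun x y θ => u (x * y) y θ) ∧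
  HasCornerExpansion I.minus I.ff (fun x y θ => u (x * y) (-y) θ)

/-- The function `η ℓ θ` on `[0, ℓ₀) × S¹` is polyhomogeneous in `ℓ`, with the given index set. -/
def IsPhgBoundary (ℓ₀ : ℝ) (E : IndexSet) (η : ℝ → ℝ → ℂ) : Prop :=
  (∀ ℓ ∈ Ioo 0 ℓ₀, ∀ θ, η ℓ (θ + 2 * Real.pi) = η ℓ θ) ∧
  ContDiffOn ℝ (⊤ : ℕ∞) (fun q : ℝ × ℝ => η q.1 q.2) (Ioo 0 ℓ₀ ×ˢ univ) ∧
  HasPhgExpansion E η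

/-! ### Riemannian geometry in a two-dimensional coordinate chart -/

/-- Points of the chart; for the cylinder, `q 0 = τ` and `q 1 = θ`. -/
abbrev Pt := Fin 2 → ℝ

/-- Complex one-forms, by their components in the coordinate coframe. -/
abbrev OneForm := Pt → Fin 2 → ℂ

/-- Complex covariant two-tensors, by their components in the coordinate coframe. -/
abbrev TwoTensor := Pt → Fin 2 → Fin 2 → ℂ

/-- Partial derivatives. -/
def pd {V : Type*} [NormedAddCommGroup V] [NormedSpace ℝ V] (i : Fin 2) (f : Pt → V) (q : Pt) : V :=
  fderiv ℝ f q (Pi.single i 1)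

/-- The Christoffel symbols `Γ^k_{ij}` of the Levi-Civita connection of `g`. -/
def christoffel (g : Pt → Matrix (Fin 2) (Fin 2) ℝ) (k i j : Fin 2) (q : Pt) : ℝ :=
  (1 / 2) * ∑ l, (g q)⁻¹ k l *
    (pd i (fun q => g q j l) q + pd j (fun q => g q i l) q - pd l (fun q => g q i j) q)

/-- `(∇_i ω)_j`. -/
def covOne (g : Pt → Matrix (Fin 2) (Fin 2) ℝ) (ω : OneForm) (q : Pt) (i j : Fin 2) : ℂ :=
  pd i (fun q => ω q j) q - ∑ k, (christoffel g k i j q : ℂ) * ω q k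

/-- `(∇_i h)_{jk}`. -/
def covTwo (g : Pt → Matrix (Fin 2) (Fin 2) ℝ) (h : TwoTensor) (q : Pt) (i j k : Fin 2) : ℂ :=
  pd i (fun q => h q j k) q - ∑ l, (christoffel g l i j q : ℂ) * h q l k
    - ∑ l, (christoffel g l i k q : ℂ) * h q j l

/-- The symmetrized covariant derivative `((δ^g)^* ω)_{ij} = (ω_{i;j} + ω_{j;i}) / 2`. -/
def deltaStar (g : Pt → Matrix (Fin 2) (Fin 2) ℝ) (ω : OneForm) : TwoTensor :=
  fun q i j => (1 / 2) * (covOne g ω q i j + covOne g ω q j i)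

/-- The divergence `(δ^g h)_k = - g^{ij} (∇_i h)_{jk}`, the formal adjoint of `(δ^g)^*`. -/
def divergence (g : Pt → Matrix (Fin 2) (Fin 2) ℝ) (h : TwoTensor) : OneForm :=
  fun q k => -∑ i, ∑ j, (((g q)⁻¹ i j : ℝ) : ℂ) * covTwo g h q i j k

/-- The trace `tr^g h = g^{ij} h_{ij}`. -/
def trace (g : Pt → Matrix (Fin 2) (Fin 2) ℝ) (h : TwoTensor) (q : Pt) : ℂ :=
  ∑ i, ∑ j, (((g q)⁻¹ i j : ℝ) : ℂ) * h q i j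

/-- The Bianchi operator `B^g h = δ^g h + d (tr^g h) / 2`. -/
def bianchi (g : Pt → Matrix (Fin 2) (Fin 2) ℝ) (h : TwoTensor) : OneForm :=
  fun q k => divergence g h q k + (1 / 2) * pd k (trace g h) q

/-- The operator `P^g = B^g ∘ (δ^g)^*` on one-forms. -/
def opP (g : Pt → Matrix (Fin 2) (Fin 2) ℝ) (ω : OneForm) : OneForm :=
  bianchi g (deltaStar g ω)

/-! ### The hyperbolic cylinders -/

/-- `g_ℓ = dτ² / (τ² + ℓ²) + (τ² + ℓ²) dθ²`. -/
def cylMetric (ℓ : ℝ) (q : Pt) : Matrix (Fin 2) (Fin 2) ℝ :=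
  !![1 / (q 0 ^ 2 + ℓ ^ 2), 0; 0, q 0 ^ 2 + ℓ ^ 2]

/-- The components of a one-form with respect to the `g_ℓ`-orthonormal coframe
`σ₁ = dτ / √(τ² + ℓ²)`, `σ₂ = √(τ² + ℓ²) dθ`. -/
def frameCoeff (ℓ : ℝ) (ω : OneForm) (τ θ : ℝ) : Fin 2 → ℂ :=
  ![(Real.sqrt (τ ^ 2 + ℓ ^ 2) : ℂ) * ω ![τ, θ] 0,
    ω ![τ, θ] 1 / (Real.sqrt (τ ^ 2 + ℓ ^ 2) : ℂ)]

/-- A family of one-forms on the cylinders is polyhomogeneous on `Ĉ` if its two components in the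
orthonormal coframe are. -/
def IsPhgForm (ℓ₀ : ℝ) (I : IndexFamily) (ω : ℝ → OneForm) : Prop :=
  ∀ i, IsPhgOnBlowup ℓ₀ I (fun ℓ τ θ => frameCoeff ℓ (ω ℓ) τ θ i)

/-- The `k`-th Fourier coefficient of a function on the circle. -/
def fourierMode (k : ℤ) (f : ℝ → ℂ) : ℂ :=
  (1 / (2 * Real.pi)) * ∫ θ in (0 : ℝ)..(2 * Real.pi), Complex.exp (-Complex.I * k * θ) * f θ

/-- `ω` is a classical solution on the closed cylinder `[-1, 1] × S¹` of `P^{g_ℓ} ω = h` with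
`ω(± 1, θ) = η_±(θ)`, where `η_±` is given by its components in the orthonormal coframe. -/
structure IsSolution (ℓ : ℝ) (h : OneForm) (ηp ηm : ℝ → Fin 2 → ℂ) (ω : OneForm) : Prop where
  periodic : ∀ τ ∈ Icc (-1 : ℝ) 1, ∀ θ, ω ![τ, θ + 2 * Real.pi] = ω ![τ, θ]
  continuousOn : ContinuousOn ω {q | q 0 ∈ Icc (-1 : ℝ) 1}
  contDiffOn : ContDiffOn ℝ 2 ω {q | q 0 ∈ Ioo (-1 : ℝ) 1}
  equation : ∀ q : Pt, q 0 ∈ Ioo (-1 : ℝ) 1 → opP (cylMetric ℓ) ω q = h q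
  boundary_plus : ∀ θ, frameCoeff ℓ ω 1 θ = ηp θ
  boundary_minus : ∀ θ, frameCoeff ℓ ω (-1) θ = ηm θ

end HypCyl

end

namespace HypCyl
open Set Filter Topology

/-! ### Smoothness up to the boundary -/

/-! Write r = τ² + ℓ². The operator decouples into scalar ones: for ε = ±1 put u = r ω_τ + iε ω_θ.
Then -2r times the same combination of the components of Pω equals r² ∂_τ² u + ∂_θ² u + 2iετ ∂_θ u -
2r u (`scal_opP`), and the two scalars determine ω. On the k-th Fourier mode this is the ordinary
differential operator Q = r² ∂_τ² - V with V = (τ + εk)² + τ² + 2ℓ² (`Qop`, `synth_Qop`).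

Uniqueness is a maximum principle for |u|² / r on the cylinder (`eq_zero_of_scalar_eq`); it needs no
condition on the modes.

Existence for a single mode is explicit: F = r exp(εk arctan(τ/ℓ)/ℓ) is a positive solution of Q F =
0, and reduction of order then solves the Dirichlet problem by quadratures that are smooth in (ℓ, τ)
(`solve`, `Qop_solve`).

The analytic heart is an estimate uniform in k and ℓ (`norm_le_weight_of_eq`). Always V ≥ r > 0, and
for |k| ≥ 1 and |τ| ≤ 1/2 even V ≥ 1/4 + r. Since r² (r^m)'' = O(r^(m+1)), a multiple of r^m is a
supersolution near τ = ℓ = 0, for every m. A source that decreases rapidly in r and k therefore has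
a solution that does so too, and this is the rapid vanishing at the front face. For k = 0 one has V
= 2r and the argument breaks down, whence the condition on the modes. The derivatives follow: ∂_τ² f
from the equation, ∂_τ f by interpolation, and ℓ-derivatives by commuting ℓ^σ ∂_ℓ through Q, which
costs only terms that are already controlled (`clR_of_Qop`).

For the expansions at the side faces, Q contains no ℓ-derivative and so commutes with multiplication
by ℓ^z (log ℓ)^p. Solving for each coefficient of the source gives the coefficients of the solution.
The remainder solves Q = O(ℓ^N) on τ > 0, vanishes at τ = 1, and is O(ℓ^∞) at τ = 0 by rapid
decrease, so it is O(ℓ^N) (`Phg.of_Qop`). The line τ = 0 thus decouples the two sides and each keeps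
its own index set. The coefficients still depend smoothly on ℓ; a Taylor expansion at ℓ = 0 removes
this dependence (`Phg.hasExpansion`), and (xy)^z (log xy)^p is re-expanded to pass to the
coordinates x = ℓ/τ, y = τ (`hasCornerExpansion_synth`).

Around this core stand two translations between functions and families of modes. Since h vanishes
for |τ| ≤ c, only its expansions at the side faces matter, and they give expansions of its Fourier
coefficients (`phg_source`, `phg_fhat`). Conversely, rapid decrease in k lets Fourier series be
differentiated termwise and estimated (`hasFDerivAt_synth`, `isPhgOnBlowup_synth`). Boundary values
are absorbed by lifting them into collars of τ = ±1 (`exists_Qop_eq`). -/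

theorem contDiffOn_succ_of_hasFDerivWithinAt {E F : Type} [NormedAddCommGroup E] [NormedSpace ℝ E]
    [NormedAddCommGroup F] [NormedSpace ℝ F] {K : Set E} (hK : UniqueDiffOn ℝ K) {n : ℕ}
    {f : E → F} {f' : E → E →L[ℝ] F} (h' : ContDiffOn ℝ n f' K)
    (h : ∀ x ∈ K, HasFDerivWithinAt f (f' x) K x) : ContDiffOn ℝ ((n + 1 : ℕ) : WithTop ℕ∞) f K := by
  have := (contDiffOn_succ_iff_hasFDerivWithinAt_of_uniqueDiffOn (n := (n : WithTop ℕ∞)) (f := f)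
    hK).2 ⟨by simp, f', h', h⟩
  exact_mod_cast this

/-- Differentiation under the integral within a convex set that need not be open. Compactness of [a,
b] makes the continuity of `G'` at `q` uniform in θ, and the mean value inequality on a convex
neighbourhood of `q` in `K` turns this into a uniform little-o. -/
theorem norm_intervalIntegral_sub_le_of_hasFDerivWithinAt {E F : Type} [NormedAddCommGroup E]
    [NormedSpace ℝ E] [NormedAddCommGroup F] [NormedSpace ℝ F] [CompleteSpace F] {K : Set E}
    (hK : Convex ℝ K) {a b : ℝ} (hab : a < b) {G : E → ℝ → F} {G' : E → ℝ → E →L[ℝ] F}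
    (hG : ContinuousOn (Function.uncurry G) (K ×ˢ Icc a b))
    (hG' : ContinuousOn (Function.uncurry G') (K ×ˢ Icc a b))
    (h : ∀ q ∈ K, ∀ θ ∈ Icc a b, HasFDerivWithinAt (fun q => G q θ) (G' q θ) K q) {q : E}
    (hq : q ∈ K) :
    HasFDerivWithinAt (fun q => ∫ θ in a..b, G q θ) (∫ θ in a..b, G' q θ) K q := by
  have hint : ∀ p ∈ K, IntervalIntegrable (G p) MeasureTheory.volume a b := fun p hp => by
    refine ContinuousOn.intervalIntegrable ?_
    rw [uIcc_of_le hab.le]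
    exact hG.comp (f := fun θ => (p, θ)) (by fun_prop) fun θ hθ => ⟨hp, hθ⟩
  have hint' : IntervalIntegrable (G' q) MeasureTheory.volume a b := by
    refine ContinuousOn.intervalIntegrable ?_
    rw [uIcc_of_le hab.le]
    exact hG'.comp (f := fun θ => (q, θ)) (by fun_prop) fun θ hθ => ⟨hq, hθ⟩
  rw [hasFDerivWithinAt_iff_isLittleO, Asymptotics.isLittleO_iff]
  intro c hc
  have hc' : 0 < c / (b - a) := div_pos hc (sub_pos.2 hab)
  obtain ⟨v, hv, hvc⟩ := (isCompact_Icc (a := a) (b := b)).mem_uniformity_of_prod hG' hq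
    (Metric.dist_mem_uniformity hc')
  obtain ⟨δ, hδ, hδv⟩ := Metric.mem_nhdsWithin_iff.1 hv
  have hb : Metric.ball q δ ∩ K ∈ 𝓝[K] q :=
    inter_mem (mem_nhdsWithin_of_mem_nhds (Metric.ball_mem_nhds q hδ)) self_mem_nhdsWithin
  filter_upwards [hb] with p hp
  have key : ∀ θ ∈ Icc a b, ‖G p θ - G q θ - G' q θ (p - q)‖ ≤ c / (b - a) * ‖p - q‖ := by
    intro θ hθ
    refine Convex.norm_image_sub_le_of_norm_hasFDerivWithin_le' (s := Metric.ball q δ ∩ K)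
      (f' := fun x => G' x θ) (fun x hx => (h x hx.2 θ hθ).mono inter_subset_right)
      (fun x hx => ?_) ((convex_ball q δ).inter hK) ⟨Metric.mem_ball_self hδ, hq⟩ hp
    have := hvc x (hδv hx) θ hθ
    rw [← dist_eq_norm]
    exact (le_of_lt this)
  have e : (∫ θ in a..b, G p θ) - (∫ θ in a..b, G q θ) - (∫ θ in a..b, G' q θ) (p - q)
      = ∫ θ in a..b, (G p θ - G q θ - G' q θ (p - q)) := by
    rw [intervalIntegral.integral_sub ((hint p hp.2).sub (hint q hq)),
      intervalIntegral.integral_sub (hint p hp.2) (hint q hq),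
      ContinuousLinearMap.intervalIntegral_apply hint']
    exact ⟨MeasureTheory.Integrable.apply_continuousLinearMap hint'.1 _,
      MeasureTheory.Integrable.apply_continuousLinearMap hint'.2 _⟩
  rw [e]
  refine (intervalIntegral.norm_integral_le_of_norm_le_const (C := c / (b - a) * ‖p - q‖)
    fun θ hθ => key θ ?_).trans ?_
  · rw [uIoc_of_le hab.le] at hθ
    exact ⟨hθ.1.le, hθ.2⟩
  · rw [abs_of_pos (sub_pos.2 hab)]
    have := (sub_pos.2 hab).ne'
    exact le_of_eq (by field_simp)

theorem continuousOn_intervalIntegral_param {E F : Type} [NormedAddCommGroup E]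
    [NormedAddCommGroup F] [NormedSpace ℝ F] {K : Set E} {a b : ℝ} (hab : a < b)
    {G : E → ℝ → F} (hG : ContinuousOn (Function.uncurry G) (K ×ˢ Icc a b)) :
    ContinuousOn (fun q => ∫ θ in a..b, G q θ) K := by
  have hint : ∀ p ∈ K, IntervalIntegrable (G p) MeasureTheory.volume a b := fun p hp => by
    refine ContinuousOn.intervalIntegrable ?_
    rw [uIcc_of_le hab.le]
    exact hG.comp (f := fun θ => (p, θ)) (by fun_prop) fun θ hθ => ⟨hp, hθ⟩
  intro q hq
  rw [ContinuousWithinAt, Metric.tendsto_nhds]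
  intro c hc
  have hc' : 0 < c / (2 * (b - a)) := div_pos hc (by linarith)
  obtain ⟨v, hv, hvc⟩ := (isCompact_Icc (a := a) (b := b)).mem_uniformity_of_prod hG hq
    (Metric.dist_mem_uniformity hc')
  filter_upwards [hv, self_mem_nhdsWithin] with p hp hpK
  rw [dist_eq_norm, ← intervalIntegral.integral_sub (hint p hpK) (hint q hq)]
  refine (intervalIntegral.norm_integral_le_of_norm_le_const (C := c / (2 * (b - a)))
    fun θ hθ => ?_).trans_lt ?_
  · rw [uIoc_of_le hab.le] at hθ
    rw [← dist_eq_norm]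
    exact (le_of_lt (hvc p hp θ ⟨hθ.1.le, hθ.2⟩))
  · rw [abs_of_pos (sub_pos.2 hab)]
    have := (sub_pos.2 hab).ne'
    have e : c / (2 * (b - a)) * (b - a) = c / 2 := by field_simp
    rw [e]; linarith

theorem hasFDerivWithinAt_slice {E F : Type} [NormedAddCommGroup E] [NormedSpace ℝ E]
    [NormedAddCommGroup F] [NormedSpace ℝ F] {K : Set E} {I : Set ℝ} {G : E → ℝ → F}
    (hG : DifferentiableOn ℝ (Function.uncurry G) (K ×ˢ I)) {q : E} (hq : q ∈ K) {θ : ℝ}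
    (hθ : θ ∈ I) :
    HasFDerivWithinAt (fun q => G q θ) ((fderivWithin ℝ (Function.uncurry G) (K ×ˢ I) (q, θ)).comp
      (ContinuousLinearMap.inl ℝ E ℝ)) K q := by
  have h1 : HasFDerivWithinAt (fun q : E => (q, θ)) (ContinuousLinearMap.inl ℝ E ℝ) K q :=
    (hasFDerivAt_prodMk_left q θ).hasFDerivWithinAt
  exact ((hG (q, θ) ⟨hq, hθ⟩).hasFDerivWithinAt).comp (f := fun q : E => (q, θ)) q h1
    fun p hp => ⟨hp, hθ⟩

/-- The target space is quantified inside the induction because the derivative of the integrand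
takes values in continuous linear maps. -/
theorem contDiffOn_nat_intervalIntegral {E : Type} [NormedAddCommGroup E] [NormedSpace ℝ E]
    {K : Set E} (hK : Convex ℝ K) (hKi : (interior K).Nonempty) {a b : ℝ} (hab : a < b) (n : ℕ) :
    ∀ {F : Type} [NormedAddCommGroup F] [NormedSpace ℝ F] [CompleteSpace F] {G : E → ℝ → F},
      ContDiffOn ℝ n (Function.uncurry G) (K ×ˢ Icc a b) →
      ContDiffOn ℝ n (fun q => ∫ θ in a..b, G q θ) K := by
  have hu : UniqueDiffOn ℝ (K ×ˢ Icc a b) :=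
    (uniqueDiffOn_convex hK hKi).prod (uniqueDiffOn_Icc hab)
  induction n with
  | zero =>
    intro F _ _ _ G hG
    exact contDiffOn_zero.2 (continuousOn_intervalIntegral_param hab hG.continuousOn)
  | succ n ih =>
    intro F _ _ _ G hG
    have h1 : ContDiffOn ℝ n (fderivWithin ℝ (Function.uncurry G) (K ×ˢ Icc a b)) (K ×ˢ Icc a b) :=
      hG.fderivWithin hu (by norm_cast)
    have h2 : ContDiffOn ℝ n (Function.uncurry fun q θ =>
        (fderivWithin ℝ (Function.uncurry G) (K ×ˢ Icc a b) (q, θ)).comp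
          (ContinuousLinearMap.inl ℝ E ℝ)) (K ×ˢ Icc a b) :=
      h1.clm_comp contDiffOn_const
    refine contDiffOn_succ_of_hasFDerivWithinAt (uniqueDiffOn_convex hK hKi) (ih h2) fun q hq => ?_
    exact norm_intervalIntegral_sub_le_of_hasFDerivWithinAt hK hab hG.continuousOn h2.continuousOn
      (fun q hq θ hθ => hasFDerivWithinAt_slice (hG.differentiableOn (by simp)) hq hθ) hq

/-- Integrals of smooth functions over a parameter are smooth, up to the boundary. -/
theorem contDiffOn_intervalIntegral {E : Type} [NormedAddCommGroup E] [NormedSpace ℝ E]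
    {K : Set E} (hK : Convex ℝ K) (hKi : (interior K).Nonempty) {a b : ℝ} (hab : a < b)
    {F : Type} [NormedAddCommGroup F] [NormedSpace ℝ F] [CompleteSpace F] {G : E → ℝ → F}
    (hG : ContDiffOn ℝ (⊤ : ℕ∞) (Function.uncurry G) (K ×ˢ Icc a b)) :
    ContDiffOn ℝ (⊤ : ℕ∞) (fun q => ∫ θ in a..b, G q θ) K :=
  contDiffOn_infty.2 fun n =>
    contDiffOn_nat_intervalIntegral hK hKi hab n (contDiffOn_infty.1 hG n)

/-- A differentiable function with locally bounded derivative on the interior of a convex set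
extends continuously. -/
theorem exists_tendsto_of_bounded_fderiv {E F : Type} [NormedAddCommGroup E] [NormedSpace ℝ E]
    [NormedAddCommGroup F] [NormedSpace ℝ F] [CompleteSpace F] {s : Set E} (hs : IsOpen s)
    (hc : Convex ℝ s) {f : E → F} (hf : DifferentiableOn ℝ f s) {x : E} (hx : x ∈ closure s)
    {δ C : ℝ} (hδ : 0 < δ) (hC : ∀ y ∈ s ∩ Metric.ball x δ, ‖fderiv ℝ f y‖ ≤ C) :
    ∃ y, Tendsto f (𝓝[s] x) (𝓝 y) := by
  have hl : LipschitzOnWith (Real.toNNReal C) f (s ∩ Metric.ball x δ) := by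
    refine (hc.inter (convex_ball x δ)).lipschitzOnWith_of_nnnorm_fderivWithin_le
      (hf.mono inter_subset_left) fun y hy => ?_
    rw [fderivWithin_of_isOpen (hs.inter Metric.isOpen_ball) hy, ← NNReal.coe_le_coe, coe_nnnorm]
    exact (hC y hy).trans (Real.le_coe_toNNReal C)
  have hn : 𝓝[s] x = 𝓝[s ∩ Metric.ball x δ] x := by
    rw [inter_comm,
      nhdsWithin_inter_of_mem (mem_nhdsWithin_of_mem_nhds (Metric.ball_mem_nhds x hδ))]
  have : (𝓝[s] x).NeBot := mem_closure_iff_nhdsWithin_neBot.1 hx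
  have hcau : Cauchy (map f (𝓝[s] x)) := by
    refine Cauchy.map_of_le (s := s ∩ Metric.ball x δ) ?_ hl.uniformContinuousOn ?_
    · exact cauchy_nhds.mono nhdsWithin_le_nhds
    · rw [hn]; exact le_principal_iff.2 self_mem_nhdsWithin
  exact CompleteSpace.complete hcau

/-- A bound on the second derivative makes the first one locally Lipschitz, so it extends
continuously from the interior to `K`. The extension is the derivative within `K`, by the theorem on
limits of derivatives, and satisfies the same hypotheses, which allows induction on the order. -/
theorem contDiffOn_nat_of_bounded_iteratedFDeriv {E : Type} [NormedAddCommGroup E]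
    [NormedSpace ℝ E] {K U Z : Set E} (hK : Convex ℝ K) (hKi : (interior K).Nonempty)
    (hU : IsOpen U) (hZ : IsClosed Z) (hKUZ : K = U ∩ Z) (n : ℕ) :
    ∀ {F : Type} [NormedAddCommGroup F] [NormedSpace ℝ F] [CompleteSpace F] {f : E → F},
      ContinuousOn f K → ContDiffOn ℝ (⊤ : ℕ∞) f (interior K) →
      (∀ m : ℕ, ∀ x ∈ K, ∃ δ > 0, ∃ C, ∀ y ∈ interior K ∩ Metric.ball x δ,
        ‖iteratedFDeriv ℝ m f y‖ ≤ C) →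
      ContDiffOn ℝ n f K := by
  have hcl : K ⊆ closure (interior K) := by
    rw [hK.closure_interior_eq_closure_of_nonempty_interior hKi]; exact subset_closure
  induction n with
  | zero => intro F _ _ _ f hf _ _; exact contDiffOn_zero.2 hf
  | succ n ih =>
    intro F _ _ _ f hf hs hb
    have hs' : ContDiffOn ℝ (⊤ : ℕ∞) (fderiv ℝ f) (interior K) :=
      hs.fderiv_of_isOpen isOpen_interior (by norm_cast)
    have hlim : ∀ x ∈ K, ∃ y, Tendsto (fderiv ℝ f) (𝓝[interior K] x) (𝓝 y) := by
      intro x hx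
      obtain ⟨δ, hδ, C, hC⟩ := hb 2 x hx
      refine exists_tendsto_of_bounded_fderiv isOpen_interior hK.interior
        (hs'.differentiableOn (by simp)) (hcl hx) hδ (C := C) fun y hy => ?_
      refine le_trans (le_of_eq ?_) (hC y hy)
      rw [← norm_iteratedFDeriv_fderiv, ← norm_iteratedFDeriv_fderiv, norm_iteratedFDeriv_zero]
    set f' := extendFrom (interior K) (fderiv ℝ f) with hf'
    have hc' : ContinuousOn f' K := continuousOn_extendFrom hcl hlim
    have heq : EqOn f' (fderiv ℝ f) (interior K) := fun x hx =>
      extendFrom_eq (subset_closure hx)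
        ((hs'.continuousOn.continuousAt (isOpen_interior.mem_nhds hx)).mono_left nhdsWithin_le_nhds)
    refine contDiffOn_succ_of_hasFDerivWithinAt (uniqueDiffOn_convex hK hKi)
      (ih (f := f') hc' (hs'.congr heq) ?_) ?_
    · intro m x hx
      obtain ⟨δ, hδ, C, hC⟩ := hb (m + 1) x hx
      refine ⟨δ, hδ, C, fun y hy => ?_⟩
      have : f' =ᶠ[𝓝 y] fderiv ℝ f :=
        heq.eventuallyEq_of_mem (isOpen_interior.mem_nhds hy.1)
      rw [(this.iteratedFDeriv ℝ m).self_of_nhds, norm_iteratedFDeriv_fderiv]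
      exact hC y hy
    · intro x hx
      obtain ⟨δ, hδ, hδU⟩ := Metric.isOpen_iff.1 hU x (hKUZ ▸ hx : x ∈ U ∩ Z).1
      -- Half the radius keeps the closure of the ball inside `U`; together with the closedness of
      -- `Z` this keeps the closure of `s` inside `K`.
      set s := interior K ∩ Metric.ball x (δ / 2) with hsdef
      have hsK : closure s ⊆ K := by
        intro y hy
        rw [hKUZ]
        refine ⟨hδU ?_, ?_⟩
        · have : y ∈ closure (Metric.ball x (δ / 2)) := closure_mono inter_subset_right hy
          have := Metric.closure_ball_subset_closedBall this
          rw [Metric.mem_closedBall] at this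
          rw [Metric.mem_ball]; linarith
        · have h1 : s ⊆ Z := fun z hz => (hKUZ ▸ interior_subset hz.1 : z ∈ U ∩ Z).2
          exact closure_minimal h1 hZ hy
      have h := hasFDerivWithinAt_closure_of_tendsto_fderiv (f := f) (s := s) (x := x)
        (f' := f' x) ((hs.differentiableOn (by simp)).mono inter_subset_left)
        (hK.interior.inter (convex_ball _ _)) (isOpen_interior.inter Metric.isOpen_ball)
        (fun y hy => (hf y (hsK hy)).mono (inter_subset_left.trans interior_subset)) ?_
      · refine h.mono_of_mem_nhdsWithin ?_
        have : K ∩ Metric.ball x (δ / 2) ⊆ closure s := by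
          rintro y ⟨hyK, hyb⟩
          have := hcl hyK
          rw [mem_closure_iff_nhdsWithin_neBot] at this ⊢
          rwa [hsdef, inter_comm, nhdsWithin_inter_of_mem
            (mem_nhdsWithin_of_mem_nhds (Metric.isOpen_ball.mem_nhds hyb))]
        exact mem_of_superset (inter_mem self_mem_nhdsWithin
          (mem_nhdsWithin_of_mem_nhds (Metric.ball_mem_nhds x (by linarith)))) this
      · have h1 : Tendsto (fderiv ℝ f) (𝓝[interior K] x) (𝓝 (f' x)) :=
          tendsto_extendFrom (hlim x hx)
        exact h1.mono_left (nhdsWithin_mono x inter_subset_left)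

/-- A function on a locally closed convex set that is smooth in the interior, with locally bounded
derivatives of all orders, and continuous, is smooth. -/
theorem contDiffOn_of_bounded_iteratedFDeriv {E F : Type} [NormedAddCommGroup E]
    [NormedSpace ℝ E] [NormedAddCommGroup F] [NormedSpace ℝ F] [CompleteSpace F]
    {K U Z : Set E} (hK : Convex ℝ K) (hKi : (interior K).Nonempty)
    (hU : IsOpen U) (hZ : IsClosed Z) (hKUZ : K = U ∩ Z) {f : E → F}
    (hf : ContinuousOn f K) (hs : ContDiffOn ℝ (⊤ : ℕ∞) f (interior K))
    (hb : ∀ m : ℕ, ∀ x ∈ K, ∃ δ > 0, ∃ C, ∀ y ∈ interior K ∩ Metric.ball x δ,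
        ‖iteratedFDeriv ℝ m f y‖ ≤ C) : ContDiffOn ℝ (⊤ : ℕ∞) f K :=
  contDiffOn_infty.2 fun n =>
    contDiffOn_nat_of_bounded_iteratedFDeriv hK hKi hU hZ hKUZ n hf hs hb

/-! ### Families of functions closed under differentiation -/

/-- The differential of each member is a combination, with constant covectors, of members of the
same family, so once differentiability bootstraps to every order. This is the mechanism behind the
smoothness of all Fourier series below. -/
theorem contDiffOn_of_closed_family {ι κ : Type*} [Fintype κ] {E F : Type} [NormedAddCommGroup E]
    [NormedSpace ℝ E] [NormedAddCommGroup F] [NormedSpace ℝ F] {s : Set E} (hs : IsOpen s)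
    {Φ : ι → E → F} {c : κ → ι → ι} {v : κ → E →L[ℝ] ℝ}
    (h : ∀ i, ∀ q ∈ s, HasFDerivAt (Φ i) (∑ j, (v j).smulRight (Φ (c j i) q)) q) (i : ι) :
    ContDiffOn ℝ (⊤ : ℕ∞) (Φ i) s := by
  refine contDiffOn_infty.2 fun n => ?_
  induction n generalizing i with
  | zero =>
    exact contDiffOn_zero.2 fun q hq => (h i q hq).continuousAt.continuousWithinAt
  | succ n ih =>
    refine contDiffOn_succ_of_hasFDerivWithinAt hs.uniqueDiffOn (f' := fun q =>
      ∑ j, (v j).smulRight (Φ (c j i) q)) ?_ fun q hq => (h i q hq).hasFDerivWithinAt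
    refine ContDiffOn.sum fun j _ => ?_
    exact (ContinuousLinearMap.smulRightL ℝ E F (v j)).contDiff.comp_contDiffOn (ih (c j i))

/-- The quantitative form of the same bootstrap. The parameter `x` and the weight `w` serve to
obtain constants uniform in a variable that is not differentiated. -/
theorem norm_iteratedFDeriv_le_of_closed_family {ι κ X : Type*} [Fintype κ] {E F : Type}
    [NormedAddCommGroup E] [NormedSpace ℝ E] [NormedAddCommGroup F] [NormedSpace ℝ F]
    {s : X → Set E} (hs : ∀ x, IsOpen (s x)) {Φ : ι → X → E → F} {c : κ → ι → ι}
    {v : κ → E →L[ℝ] ℝ}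
    (h : ∀ i x, ∀ q ∈ s x, HasFDerivAt (Φ i x) (∑ j, (v j).smulRight (Φ (c j i) x q)) q)
    {t : X → Set E} (ht : ∀ x, t x ⊆ s x) {w : X → ℝ}
    (hb : ∀ i, ∃ C, ∀ x, ∀ q ∈ t x, ‖Φ i x q‖ ≤ C * w x) (n : ℕ) (i : ι) :
    ∃ C, ∀ x, ∀ q ∈ t x, ‖iteratedFDeriv ℝ n (Φ i x) q‖ ≤ C * w x := by
  have hsm : ∀ i x, ContDiffOn ℝ (⊤ : ℕ∞) (Φ i x) (s x) := by
    intro i x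
    exact contDiffOn_of_closed_family (hs x) (Φ := fun i => Φ i x) (c := c) (v := v)
      (fun i q hq => h i x q hq) i
  induction n generalizing i with
  | zero => simpa only [norm_iteratedFDeriv_zero] using hb i
  | succ n ih =>
    choose C hC using fun j => ih (c j i)
    refine ⟨∑ j, ‖ContinuousLinearMap.smulRightL ℝ E F (v j)‖ * C j, fun x q hq => ?_⟩
    have hq' := (hs x).mem_nhds (ht x hq)
    have e : fderiv ℝ (Φ i x) =ᶠ[𝓝 q] fun p =>
        ∑ j, (ContinuousLinearMap.smulRightL ℝ E F (v j) ∘ Φ (c j i) x) p := by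
      filter_upwards [hq'] with p hp
      exact (h i x p hp).fderiv
    have hA : ∀ j, ContDiffAt ℝ n (Φ (c j i) x) q := fun j =>
      ((hsm (c j i) x).contDiffAt hq').of_le (by exact_mod_cast le_top)
    rw [← norm_iteratedFDeriv_fderiv, (e.iteratedFDeriv ℝ n).self_of_nhds,
      iteratedFDeriv_fun_sum_apply fun j _ =>
        (ContinuousLinearMap.contDiff _).contDiffAt.comp q (hA j), Finset.sum_mul]
    refine (norm_sum_le _ _).trans (Finset.sum_le_sum fun j _ => ?_)
    refine (ContinuousLinearMap.norm_iteratedFDeriv_comp_left _ (hA j) le_rfl).trans ?_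
    rw [mul_assoc]
    exact mul_le_mul_of_nonneg_left (hC j x q hq) (norm_nonneg _)

end HypCyl

/-! ### Calculus of families of Fourier modes: derivatives, classes, products -/

noncomputable section

namespace HypCyl
open Set Filter Topology

/-! ### Families of Fourier modes -/

/-- The nonzero Fourier modes. -/
abbrev Mode := {k : ℤ // k ≠ 0}

/-- The size of a mode. -/
def Mode.w (k : Mode) : ℝ := |((k : ℤ) : ℝ)|

theorem Mode.one_le_w (k : Mode) : 1 ≤ k.w := by
  have : (1 : ℤ) ≤ |(k : ℤ)| := Int.one_le_abs k.2
  unfold Mode.w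
  exact_mod_cast this

theorem Mode.w_pos (k : Mode) : 0 < k.w := zero_lt_one.trans_le k.one_le_w

/-- Families of functions of `(ℓ, τ)`, indexed by the nonzero modes. -/
abbrev Fam := Mode → ℝ → ℝ → ℂ

/-- The derivative `ℓ ^ σ ∂_ℓ`. -/
def pl (σ : ℕ) (f : Fam) : Fam := fun k l t => (l : ℂ) ^ σ * deriv (fun l' => f k l' t) l

/-- The derivative `∂_τ`. -/
def pt (f : Fam) : Fam := fun k l t => deriv (f k l) t

/-- Smoothness of all members of a family. -/
def Sm (S : Set (ℝ × ℝ)) (f : Fam) : Prop :=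
  ∀ k, ContDiffOn ℝ (⊤ : ℕ∞) (fun p : ℝ × ℝ => f k p.1 p.2) S

/-- Equality of families on a set. -/
def EqF (S : Set (ℝ × ℝ)) (f g : Fam) : Prop := ∀ k l t, (l, t) ∈ S → f k l t = g k l t

section Derivatives

variable {S : Set (ℝ × ℝ)} {f g : Fam} {σ : ℕ}

theorem EqF.symm (h : EqF S f g) : EqF S g f := fun k l t hp => (h k l t hp).symm

theorem eventually_left (hS : IsOpen S) {l t : ℝ} (hp : (l, t) ∈ S) : ∀ᶠ l' in 𝓝 l, (l', t) ∈ S :=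
  (continuous_id.prodMk continuous_const).continuousAt.preimage_mem_nhds (hS.mem_nhds hp)

theorem eventually_right (hS : IsOpen S) {l t : ℝ} (hp : (l, t) ∈ S) :
    ∀ᶠ t' in 𝓝 t, (l, t') ∈ S :=
  (continuous_const.prodMk continuous_id).continuousAt.preimage_mem_nhds (hS.mem_nhds hp)

theorem EqF.pl (hS : IsOpen S) (h : EqF S f g) : EqF S (pl σ f) (pl σ g) := fun k l t hp => by
  have : (fun l' => f k l' t) =ᶠ[𝓝 l] fun l' => g k l' t :=
    (eventually_left hS hp).mono fun l' hl' => h k l' t hl'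
  simp only [HypCyl.pl, this.deriv_eq]

theorem EqF.pt (hS : IsOpen S) (h : EqF S f g) : EqF S (pt f) (pt g) := fun k l t hp => by
  have : f k l =ᶠ[𝓝 t] g k l :=
    (eventually_right hS hp).mono fun t' ht' => h k l t' ht'
  simp only [HypCyl.pt, this.deriv_eq]

theorem Sm.mono {S' : Set (ℝ × ℝ)} (hf : Sm S f) (h : S' ⊆ S) : Sm S' f := fun k => (hf k).mono h

theorem Sm.congr (hf : Sm S f) (h : EqF S f g) : Sm S g :=
  fun k => (hf k).congr fun p hp => (h k p.1 p.2 hp).symm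

theorem Sm.add (hf : Sm S f) (hg : Sm S g) : Sm S (f + g) := fun k => (hf k).add (hg k)

theorem Sm.mul (hf : Sm S f) (hg : Sm S g) : Sm S (f * g) := fun k => (hf k).mul (hg k)

theorem Sm.differentiableAt (hS : IsOpen S) (hf : Sm S f) (k : Mode) {l t : ℝ}
    (hp : (l, t) ∈ S) : DifferentiableAt ℝ (fun p : ℝ × ℝ => f k p.1 p.2) (l, t) :=
  ((hf k).contDiffAt (hS.mem_nhds hp)).differentiableAt (by simp)

theorem Sm.hasDerivAt_left' (hS : IsOpen S) (hf : Sm S f) (k : Mode) {l t : ℝ} (hp : (l, t) ∈ S) :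
    HasDerivAt (fun l' => f k l' t) (fderiv ℝ (fun p : ℝ × ℝ => f k p.1 p.2) (l, t) (1, 0)) l := by
  have h1 : HasDerivAt (fun l' : ℝ => (l', t)) (1, 0) l :=
    (hasDerivAt_id l).prodMk (hasDerivAt_const l t)
  exact (hf.differentiableAt hS k hp).hasFDerivAt.comp_hasDerivAt (f := fun l' : ℝ => (l', t)) l h1

theorem Sm.hasDerivAt_right' (hS : IsOpen S) (hf : Sm S f) (k : Mode) {l t : ℝ}
    (hp : (l, t) ∈ S) :
    HasDerivAt (f k l) (fderiv ℝ (fun p : ℝ × ℝ => f k p.1 p.2) (l, t) (0, 1)) t := by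
  have h1 : HasDerivAt (fun t' : ℝ => (l, t')) (0, 1) t :=
    (hasDerivAt_const t l).prodMk (hasDerivAt_id t)
  exact (hf.differentiableAt hS k hp).hasFDerivAt.comp_hasDerivAt (f := fun t' : ℝ => (l, t')) t h1

theorem Sm.differentiableAt_left (hS : IsOpen S) (hf : Sm S f) (k : Mode) {l t : ℝ}
    (hp : (l, t) ∈ S) : DifferentiableAt ℝ (fun l' => f k l' t) l :=
  (hf.hasDerivAt_left' hS k hp).differentiableAt

theorem Sm.differentiableAt_right (hS : IsOpen S) (hf : Sm S f) (k : Mode) {l t : ℝ}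
    (hp : (l, t) ∈ S) : DifferentiableAt ℝ (f k l) t :=
  (hf.hasDerivAt_right' hS k hp).differentiableAt

theorem Sm.hasDerivAt_pt (hS : IsOpen S) (hf : Sm S f) (k : Mode) {l t : ℝ}
    (hp : (l, t) ∈ S) : HasDerivAt (f k l) (pt f k l t) t :=
  (hf.differentiableAt_right hS k hp).hasDerivAt

theorem Sm.pl_eq (hS : IsOpen S) (hf : Sm S f) (k : Mode) {l t : ℝ} (hp : (l, t) ∈ S) :
    pl σ f k l t = (l : ℂ) ^ σ * fderiv ℝ (fun p : ℝ × ℝ => f k p.1 p.2) (l, t) (1, 0) := by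
  simp only [HypCyl.pl, (hf.hasDerivAt_left' hS k hp).deriv]

theorem Sm.pt_eq (hS : IsOpen S) (hf : Sm S f) (k : Mode) {l t : ℝ} (hp : (l, t) ∈ S) :
    pt f k l t = fderiv ℝ (fun p : ℝ × ℝ => f k p.1 p.2) (l, t) (0, 1) := by
  simp only [HypCyl.pt, (hf.hasDerivAt_right' hS k hp).deriv]

theorem Sm.contDiffOn_fderiv (hS : IsOpen S) (hf : Sm S f) (k : Mode) :
    ContDiffOn ℝ (⊤ : ℕ∞) (fderiv ℝ (fun p : ℝ × ℝ => f k p.1 p.2)) S :=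
  (hf k).fderiv_of_isOpen hS (by norm_cast)

theorem contDiff_ofReal_fst_pow (σ : ℕ) :
    ContDiff ℝ (⊤ : ℕ∞) fun p : ℝ × ℝ => ((p.1 : ℂ)) ^ σ :=
  (Complex.ofRealCLM.contDiff.comp contDiff_fst).pow σ

theorem Sm.pl (hS : IsOpen S) (hf : Sm S f) : Sm S (pl σ f) := fun k => by
  refine ContDiffOn.congr ?_ fun p hp => hf.pl_eq hS k hp
  exact (contDiff_ofReal_fst_pow σ).contDiffOn.mul
    ((hf.contDiffOn_fderiv hS k).clm_apply contDiffOn_const)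

theorem Sm.pt (hS : IsOpen S) (hf : Sm S f) : Sm S (pt f) := fun k =>
  ((hf.contDiffOn_fderiv hS k).clm_apply contDiffOn_const).congr fun _ hp => hf.pt_eq hS k hp

theorem pl_add (hS : IsOpen S) (hf : Sm S f) (hg : Sm S g) :
    EqF S (pl σ (f + g)) (pl σ f + pl σ g) := fun k l t hp => by
  have : deriv (fun l' => (f + g) k l' t) l = _ :=
    deriv_add (hf.differentiableAt_left hS k hp) (hg.differentiableAt_left hS k hp)
  change (l : ℂ) ^ σ * deriv (fun l' => (f + g) k l' t) l = (l : ℂ) ^ σ * _ + (l : ℂ) ^ σ * _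
  rw [this, mul_add]

theorem pt_add (hS : IsOpen S) (hf : Sm S f) (hg : Sm S g) :
    EqF S (pt (f + g)) (pt f + pt g) := fun k l t hp => by
  have : deriv ((f + g) k l) t = _ :=
    deriv_add (hf.differentiableAt_right hS k hp) (hg.differentiableAt_right hS k hp)
  exact this

theorem pl_mul (hS : IsOpen S) (hf : Sm S f) (hg : Sm S g) :
    EqF S (pl σ (f * g)) (pl σ f * g + f * pl σ g) := fun k l t hp => by
  have : deriv (fun l' => (f * g) k l' t) l = _ :=
    deriv_mul (hf.differentiableAt_left hS k hp) (hg.differentiableAt_left hS k hp)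
  change (l : ℂ) ^ σ * deriv (fun l' => (f * g) k l' t) l =
    (l : ℂ) ^ σ * deriv (fun l' => f k l' t) l * g k l t
      + f k l t * ((l : ℂ) ^ σ * deriv (fun l' => g k l' t) l)
  rw [this]; ring

theorem pt_mul (hS : IsOpen S) (hf : Sm S f) (hg : Sm S g) :
    EqF S (pt (f * g)) (pt f * g + f * pt g) := fun k l t hp => by
  have : deriv ((f * g) k l) t = _ :=
    deriv_mul (hf.differentiableAt_right hS k hp) (hg.differentiableAt_right hS k hp)
  exact this

theorem pl_pt_comm (hS : IsOpen S) (hf : Sm S f) : EqF S (pl σ (pt f)) (pt (pl σ f)) := by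
  intro k l t hp
  have hd : DifferentiableAt ℝ (fderiv ℝ fun p : ℝ × ℝ => f k p.1 p.2) (l, t) :=
    ((hf.contDiffOn_fderiv hS k).contDiffAt (hS.mem_nhds hp)).differentiableAt (by simp)
  have h1 : HasDerivAt (fun l' => HypCyl.pt f k l' t)
      (fderiv ℝ (fderiv ℝ fun p : ℝ × ℝ => f k p.1 p.2) (l, t) (1, 0) (0, 1)) l := by
    have : HasDerivAt (fun l' : ℝ => (l', t)) (1, 0) l :=
      (hasDerivAt_id l).prodMk (hasDerivAt_const l t)
    have := hd.hasFDerivAt.comp_hasDerivAt (f := fun l' : ℝ => (l', t)) l this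
    have := this.clm_apply (hasDerivAt_const l ((0, 1) : ℝ × ℝ))
    simp only [map_zero, add_zero] at this
    refine this.congr_of_eventuallyEq ?_
    exact (eventually_left hS hp).mono fun l' hl' => hf.pt_eq hS k hl'
  have h2 : HasDerivAt (HypCyl.pl σ f k l)
      ((l : ℂ) ^ σ * fderiv ℝ (fderiv ℝ fun p : ℝ × ℝ => f k p.1 p.2) (l, t) (0, 1) (1, 0)) t := by
    have : HasDerivAt (fun t' : ℝ => (l, t')) (0, 1) t :=
      (hasDerivAt_const t l).prodMk (hasDerivAt_id t)
    have := hd.hasFDerivAt.comp_hasDerivAt (f := fun t' : ℝ => (l, t')) t this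
    have := this.clm_apply (hasDerivAt_const t ((1, 0) : ℝ × ℝ))
    simp only [map_zero, add_zero] at this
    refine (this.const_mul ((l : ℂ) ^ σ)).congr_of_eventuallyEq ?_
    exact (eventually_right hS hp).mono fun t' ht' => hf.pl_eq hS k ht'
  have hsym : IsSymmSndFDerivAt ℝ (fun p : ℝ × ℝ => f k p.1 p.2) (l, t) :=
    ((hf k).contDiffAt (hS.mem_nhds hp)).isSymmSndFDerivAt
      (by simp only [minSmoothness_of_isRCLikeNormedField]; exact WithTop.coe_le_coe.2 le_top)
  change (l : ℂ) ^ σ * deriv (fun l' => HypCyl.pt f k l' t) l = deriv (HypCyl.pl σ f k l) t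
  rw [h1.deriv, h2.deriv, hsym.eq]

end Derivatives

/-! ### Classes of families defined by bounds on all derivatives -/

/-- `∂_τ ^ j f` satisfies `P` for `j ≤ J`. -/
def Tc (P : Fam → Prop) : ℕ → Fam → Prop
  | 0, f => P f
  | J + 1, f => P f ∧ Tc P J (pt f)

/-- `∂_τ ^ j (ℓ ^ σ ∂_ℓ) ^ i f` satisfies `P` for `i ≤ I`, `j ≤ J`. -/
def Cc (σ : ℕ) (P : Fam → Prop) : ℕ → ℕ → Fam → Prop
  | 0, J, f => Tc P J f
  | I + 1, J, f => Tc P J f ∧ Cc σ P I J (pl σ f)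

/-- The class of smooth families all of whose derivatives satisfy `P`. -/
def Cl (S : Set (ℝ × ℝ)) (σ : ℕ) (P : Fam → Prop) (f : Fam) : Prop :=
  Sm S f ∧ ∀ I J, Cc σ P I J f

/-- A predicate on families that only depends on the values on `S`, and is additive. -/
structure IsAdditivePred (S : Set (ℝ × ℝ)) (P : Fam → Prop) : Prop where
  congr : ∀ {f g}, EqF S f g → P f → P g
  add : ∀ {f g}, P f → P g → P (f + g)

section Classes

variable {S : Set (ℝ × ℝ)} {P P₁ P₂ : Fam → Prop} {f g : Fam} {σ : ℕ}

theorem Tc.congr (hS : IsOpen S) (hP : IsAdditivePred S P) {J : ℕ} (h : EqF S f g)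
    (hf : Tc P J f) : Tc P J g := by
  induction J generalizing f g with
  | zero => exact hP.congr h hf
  | succ J ih => exact ⟨hP.congr h hf.1, ih (h.pt hS) hf.2⟩

theorem Cc.congr (hS : IsOpen S) (hP : IsAdditivePred S P) {I J : ℕ} (h : EqF S f g)
    (hf : Cc σ P I J f) : Cc σ P I J g := by
  induction I generalizing f g with
  | zero => exact Tc.congr hS hP h hf
  | succ I ih => exact ⟨Tc.congr hS hP h hf.1, ih (h.pl hS) hf.2⟩

theorem Tc.base {J : ℕ} (hf : Tc P J f) : P f := by
  cases J with
  | zero => exact hf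
  | succ J => exact hf.1

theorem Tc.of_succ {J : ℕ} (hf : Tc P (J + 1) f) : Tc P J f := by
  induction J generalizing f with
  | zero => exact hf.1
  | succ J ih => exact ⟨hf.1, ih hf.2⟩

theorem Cc.tc {I J : ℕ} (hf : Cc σ P I J f) : Tc P J f := by
  cases I with
  | zero => exact hf
  | succ I => exact hf.1

theorem Cc.of_succ {I J : ℕ} (hf : Cc σ P (I + 1) J f) : Cc σ P I J f := by
  induction I generalizing f with
  | zero => exact hf.1
  | succ I ih => exact ⟨hf.1, ih hf.2⟩

theorem Tc.add (hS : IsOpen S) (hP : IsAdditivePred S P) {J : ℕ} (sf : Sm S f) (sg : Sm S g)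
    (hf : Tc P J f) (hg : Tc P J g) : Tc P J (f + g) := by
  induction J generalizing f g with
  | zero => exact hP.add hf hg
  | succ J ih =>
    exact ⟨hP.add hf.1 hg.1,
      (ih (sf.pt hS) (sg.pt hS) hf.2 hg.2).congr hS hP (pt_add hS sf sg).symm⟩

theorem Cc.add (hS : IsOpen S) (hP : IsAdditivePred S P) {I J : ℕ} (sf : Sm S f) (sg : Sm S g)
    (hf : Cc σ P I J f) (hg : Cc σ P I J g) : Cc σ P I J (f + g) := by
  induction I generalizing f g with
  | zero => exact Tc.add hS hP sf sg hf hg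
  | succ I ih =>
    exact ⟨hf.1.add hS hP sf sg hg.1,
      (ih (sf.pl hS) (sg.pl hS) hf.2 hg.2).congr hS hP (pl_add hS sf sg).symm⟩

/-- Leibniz rule by induction: when one factor is differentiated the other is needed only to one
order less, which `of_succ` supplies. The same pattern serves the ℓ-derivatives. -/
theorem Tc.mul (hS : IsOpen S) (hP : IsAdditivePred S P)
    (hm : ∀ {f g}, P₁ f → P₂ g → P (f * g)) {J : ℕ} (sf : Sm S f) (sg : Sm S g)
    (hf : Tc P₁ J f) (hg : Tc P₂ J g) : Tc P J (f * g) := by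
  induction J generalizing f g with
  | zero => exact hm hf hg
  | succ J ih =>
    refine ⟨hm hf.1 hg.1, Tc.congr hS hP (pt_mul hS sf sg).symm ?_⟩
    exact (ih (sf.pt hS) sg hf.2 hg.of_succ).add hS hP ((sf.pt hS).mul sg) (sf.mul (sg.pt hS))
      (ih sf (sg.pt hS) hf.of_succ hg.2)

theorem Cc.mul (hS : IsOpen S) (hP : IsAdditivePred S P)
    (hm : ∀ {f g}, P₁ f → P₂ g → P (f * g)) {I J : ℕ} (sf : Sm S f) (sg : Sm S g)
    (hf : Cc σ P₁ I J f) (hg : Cc σ P₂ I J g) : Cc σ P I J (f * g) := by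
  induction I generalizing f g with
  | zero => exact Tc.mul hS hP hm sf sg hf hg
  | succ I ih =>
    refine ⟨Tc.mul hS hP hm sf sg hf.1 hg.1, Cc.congr hS hP (pl_mul hS sf sg).symm ?_⟩
    exact (ih (sf.pl hS) sg hf.2 hg.of_succ).add hS hP ((sf.pl hS).mul sg) (sf.mul (sg.pl hS))
      (ih sf (sg.pl hS) hf.of_succ hg.2)

/-- The fixed order of the derivatives in `Cc` is harmless, because ∂_τ commutes with ℓ^σ ∂_ℓ. -/
theorem Cc.pt (hS : IsOpen S) (hP : IsAdditivePred S P) {I J : ℕ} (sf : Sm S f)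
    (hf : Cc σ P I (J + 1) f) : Cc σ P I J (pt f) := by
  induction I generalizing f with
  | zero => exact hf.2
  | succ I ih =>
    exact ⟨hf.1.2, (ih (sf.pl hS) hf.2).congr hS hP (pl_pt_comm hS sf).symm⟩

theorem Tc.imp {P' : Fam → Prop} (h : ∀ f, P f → P' f) {J : ℕ} (hf : Tc P J f) : Tc P' J f := by
  induction J generalizing f with
  | zero => exact h _ hf
  | succ J ih => exact ⟨h _ hf.1, ih hf.2⟩

theorem Cc.imp {P' : Fam → Prop} (h : ∀ f, P f → P' f) {I J : ℕ} (hf : Cc σ P I J f) :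
    Cc σ P' I J f := by
  induction I generalizing f with
  | zero => exact Tc.imp h hf
  | succ I ih => exact ⟨hf.1.imp h, ih hf.2⟩

theorem Tc.and {J : ℕ} (hf : Tc P₁ J f) (hg : Tc P₂ J f) : Tc (fun f => P₁ f ∧ P₂ f) J f := by
  induction J generalizing f with
  | zero => exact ⟨hf, hg⟩
  | succ J ih => exact ⟨⟨hf.1, hg.1⟩, ih hf.2 hg.2⟩

theorem Cc.and {I J : ℕ} (hf : Cc σ P₁ I J f) (hg : Cc σ P₂ I J f) :
    Cc σ (fun f => P₁ f ∧ P₂ f) I J f := by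
  induction I generalizing f with
  | zero => exact Tc.and hf hg
  | succ I ih => exact ⟨hf.1.and hg.1, ih hf.2 hg.2⟩

theorem Cl.base (hf : Cl S σ P f) : P f := (hf.2 0 0).tc.base

theorem Cl.congr (hS : IsOpen S) (hP : IsAdditivePred S P) (hf : Cl S σ P f) (h : EqF S f g) :
    Cl S σ P g := ⟨hf.1.congr h, fun I J => (hf.2 I J).congr hS hP h⟩

theorem Cl.add (hS : IsOpen S) (hP : IsAdditivePred S P) (hf : Cl S σ P f) (hg : Cl S σ P g) :
    Cl S σ P (f + g) := ⟨hf.1.add hg.1, fun I J => (hf.2 I J).add hS hP hf.1 hg.1 (hg.2 I J)⟩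

theorem Cl.mul (hS : IsOpen S) (hP : IsAdditivePred S P)
    (hm : ∀ {f g}, P₁ f → P₂ g → P (f * g)) (hf : Cl S σ P₁ f) (hg : Cl S σ P₂ g) :
    Cl S σ P (f * g) := ⟨hf.1.mul hg.1, fun I J => (hf.2 I J).mul hS hP hm hf.1 hg.1 (hg.2 I J)⟩

theorem Cl.pt (hS : IsOpen S) (hP : IsAdditivePred S P) (hf : Cl S σ P f) : Cl S σ P (pt f) :=
  ⟨hf.1.pt hS, fun I J => (hf.2 I (J + 1)).pt hS hP hf.1⟩

theorem Cl.pl (hS : IsOpen S) (hf : Cl S σ P f) : Cl S σ P (pl σ f) :=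
  ⟨hf.1.pl hS, fun I J => (hf.2 (I + 1) J).2⟩

theorem Cl.imp {S' : Set (ℝ × ℝ)} {P' : Fam → Prop} (hSS : S' ⊆ S) (h : ∀ f, P f → P' f)
    (hf : Cl S σ P f) : Cl S' σ P' f := ⟨hf.1.mono hSS, fun I J => (hf.2 I J).imp h⟩

theorem Cl.union {S₁ S₂ : Set (ℝ × ℝ)} (h₁ : IsOpen S₁) (h₂ : IsOpen S₂)
    (h : ∀ f, P₁ f → P₂ f → P f) (hf₁ : Cl S₁ σ P₁ f) (hf₂ : Cl S₂ σ P₂ f) :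
    Cl (S₁ ∪ S₂) σ P f :=
  ⟨fun k => (hf₁.1 k).union_of_isOpen (hf₂.1 k) h₁ h₂,
    fun I J => ((hf₁.2 I J).and (hf₂.2 I J)).imp fun f hf => h f hf.1 hf.2⟩

/-- A set of families that is closed under differentiation. -/
theorem Cl.of_closed {Q : Fam → Prop} (hs : ∀ f, Q f → Sm S f) (hQP : ∀ f, Q f → P f)
    (hpt : ∀ f, Q f → Q (HypCyl.pt f)) (hpl : ∀ f, Q f → Q (HypCyl.pl σ f)) (hf : Q f) :
    Cl S σ P f := by
  have hT : ∀ J f, Q f → Tc P J f := fun J => by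
    induction J with
    | zero => exact hQP
    | succ J ih => exact fun f hf => ⟨hQP f hf, ih _ (hpt f hf)⟩
  refine ⟨hs f hf, fun I => ?_⟩
  induction I generalizing f with
  | zero => exact fun J => hT J f hf
  | succ I ih => exact fun J => ⟨hT J f hf, ih (hpl f hf) J⟩

end Classes

end HypCyl

end

noncomputable section

namespace HypCyl
open Set Filter Topology

/-! ### Rapidly decreasing and moderate families -/

/-- Bounded open subsets of the half plane `ℓ > 0`. -/
structure IsDom (S : Set (ℝ × ℝ)) : Prop where
  isOpen : IsOpen S
  pos : ∀ {l t}, (l, t) ∈ S → 0 < l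
  bdd : ∃ R, ∀ {l t}, (l, t) ∈ S → t ^ 2 + l ^ 2 ≤ R

/-- Families of order `ℓ ^ s` that are rapidly decreasing in the mode and at `τ = ℓ = 0`. -/
def Rap (S : Set (ℝ × ℝ)) (s : ℤ) (f : Fam) : Prop :=
  ∀ m : ℕ, ∃ C, ∀ k l t, (l, t) ∈ S → k.w ^ m * ‖f k l t‖ ≤ C * (t ^ 2 + l ^ 2) ^ m * l ^ s

/-- Families of order `ℓ ^ s` that grow moderately in the mode and at `τ = ℓ = 0`. -/
def Mod (S : Set (ℝ × ℝ)) (s : ℤ) (f : Fam) : Prop :=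
  ∃ (n : ℕ) (C : ℝ), ∀ k l t, (l, t) ∈ S →
    ‖f k l t‖ ≤ C * (k.w * (1 + (t ^ 2 + l ^ 2)⁻¹)) ^ n * l ^ s

section

variable {S S' : Set (ℝ × ℝ)} {s s' : ℤ} {f g : Fam} {σ : ℕ}

theorem Rap.exists_nonneg (hS : IsDom S) (hf : Rap S s f) (m : ℕ) : ∃ C, 0 ≤ C ∧
    ∀ k l t, (l, t) ∈ S → k.w ^ m * ‖f k l t‖ ≤ C * (t ^ 2 + l ^ 2) ^ m * l ^ s := by
  obtain ⟨C, hC⟩ := hf m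
  refine ⟨|C|, abs_nonneg C, fun k l t hp => (hC k l t hp).trans ?_⟩
  have := hS.pos hp
  gcongr
  exact le_abs_self C

theorem Mod.exists_nonneg (hS : IsDom S) (hf : Mod S s f) : ∃ (n : ℕ) (C : ℝ), 0 ≤ C ∧
    ∀ k l t, (l, t) ∈ S → ‖f k l t‖ ≤ C * (k.w * (1 + (t ^ 2 + l ^ 2)⁻¹)) ^ n * l ^ s := by
  obtain ⟨n, C, hC⟩ := hf
  refine ⟨n, |C|, abs_nonneg C, fun k l t hp => (hC k l t hp).trans ?_⟩
  have := hS.pos hp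
  have := k.w_pos
  gcongr
  exact le_abs_self C

theorem isAdditivePred_rap : IsAdditivePred S (Rap S s) where
  congr h hf m := by
    obtain ⟨C, hC⟩ := hf m
    exact ⟨C, fun k l t hp => h k l t hp ▸ hC k l t hp⟩
  add {f g} hf hg m := by
    obtain ⟨C, hC⟩ := hf m
    obtain ⟨D, hD⟩ := hg m
    refine ⟨C + D, fun k l t hp => ?_⟩
    have h1 := hC k l t hp
    have h2 := hD k l t hp
    have h3 : ‖(f + g) k l t‖ ≤ ‖f k l t‖ + ‖g k l t‖ := norm_add_le _ _
    have := pow_nonneg k.w_pos.le m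
    calc k.w ^ m * ‖(f + g) k l t‖ ≤ k.w ^ m * (‖f k l t‖ + ‖g k l t‖) := by gcongr
      _ ≤ _ := by rw [mul_add, add_mul, add_mul]; exact add_le_add h1 h2

theorem Mode.one_le_weight (k : Mode) (r : ℝ) (hr : 0 ≤ r) : 1 ≤ k.w * (1 + r⁻¹) :=
  one_le_mul_of_one_le_of_one_le k.one_le_w (by have := inv_nonneg.2 hr; linarith)

theorem isAdditivePred_mod (hS : IsDom S) : IsAdditivePred S (Mod S s) where
  congr h hf := by
    obtain ⟨n, C, hC⟩ := hf
    exact ⟨n, C, fun k l t hp => h k l t hp ▸ hC k l t hp⟩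
  add {f g} hf hg := by
    obtain ⟨n, C, hC0, hC⟩ := hf.exists_nonneg hS
    obtain ⟨n', D, hD0, hD⟩ := hg.exists_nonneg hS
    refine ⟨n + n', C + D, fun k l t hp => ?_⟩
    have hl := hS.pos hp
    have h1 := hC k l t hp
    have h2 := hD k l t hp
    have h3 : ‖(f + g) k l t‖ ≤ ‖f k l t‖ + ‖g k l t‖ := norm_add_le _ _
    have hw := k.one_le_weight (t ^ 2 + l ^ 2) (by positivity)
    refine h3.trans ?_
    rw [add_mul, add_mul]
    refine add_le_add (h1.trans ?_) (h2.trans ?_) <;> gcongr <;> first | assumption | omega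

/-- A moderate factor costs a power n of k.w (1 + r⁻¹). Using the rapid bound with m + n in place of
m pays for it, since r (1 + r⁻¹) = r + 1 is bounded on `S`. This is why the same exponent governs
the decay in k and in r. -/
theorem Mod.mul_rap (hS : IsDom S) (hf : Mod S s f) (hg : Rap S s' g) : Rap S (s + s') (f * g) := by
  intro m
  obtain ⟨n, C, hC0, hC⟩ := hf.exists_nonneg hS
  obtain ⟨D, hD0, hD⟩ := hg.exists_nonneg hS (m + n)
  obtain ⟨R, hR⟩ := hS.bdd
  refine ⟨C * D * (R + 1) ^ n, fun k l t hp => ?_⟩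
  have hl := hS.pos hp
  have h1 := hC k l t hp
  have h2 := hD k l t hp
  have hw := k.w_pos
  have hr : 0 < t ^ 2 + l ^ 2 := by positivity
  set r := t ^ 2 + l ^ 2
  have hrR : r * (1 + r⁻¹) ≤ R + 1 := by
    rw [mul_add, mul_inv_cancel₀ hr.ne']; linarith [hR hp]
  have e : ‖(f * g) k l t‖ = ‖f k l t‖ * ‖g k l t‖ := norm_mul _ _
  rw [e, zpow_add₀ hl.ne']
  calc k.w ^ m * (‖f k l t‖ * ‖g k l t‖)
      ≤ k.w ^ m * ((C * (k.w * (1 + r⁻¹)) ^ n * l ^ s) * ‖g k l t‖) := by gcongr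
    _ = C * (1 + r⁻¹) ^ n * l ^ s * (k.w ^ (m + n) * ‖g k l t‖) := by rw [mul_pow]; ring
    _ ≤ C * (1 + r⁻¹) ^ n * l ^ s * (D * r ^ (m + n) * l ^ s') := by gcongr
    _ = C * D * (r * (1 + r⁻¹)) ^ n * r ^ m * (l ^ s * l ^ s') := by rw [mul_pow]; ring
    _ ≤ _ := by gcongr

theorem Mod.mul (hS : IsDom S) (hf : Mod S s f) (hg : Mod S s' g) : Mod S (s + s') (f * g) := by
  obtain ⟨n, C, hC0, hC⟩ := hf.exists_nonneg hS
  obtain ⟨n', D, hD0, hD⟩ := hg.exists_nonneg hS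
  refine ⟨n + n', C * D, fun k l t hp => ?_⟩
  have hl := hS.pos hp
  have hw := k.w_pos
  have e : ‖(f * g) k l t‖ = ‖f k l t‖ * ‖g k l t‖ := norm_mul _ _
  rw [e, zpow_add₀ hl.ne', pow_add]
  refine (mul_le_mul (hC k l t hp) (hD k l t hp) (norm_nonneg _) (by positivity)).trans ?_
  exact le_of_eq (by ring)

theorem Rap.mono (h : S' ⊆ S) (hf : Rap S s f) : Rap S' s f := fun m =>
  (hf m).imp fun _ hC k l t hp => hC k l t (h hp)

theorem Mod.mono (h : S' ⊆ S) (hf : Mod S s f) : Mod S' s f :=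
  let ⟨n, C, hC⟩ := hf; ⟨n, C, fun k l t hp => hC k l t (h hp)⟩

theorem zpow_le_const_mul_zpow {R l : ℝ} (hl : 0 < l) (hlR : l ≤ R) {s s' : ℤ} (h : s' ≤ s) :
    l ^ s ≤ R ^ (s - s') * l ^ s' := by
  have e : l ^ s = l ^ (s - s') * l ^ s' := by rw [← zpow_add₀ hl.ne']; congr 1; ring
  rw [e]
  have : l ^ (s - s') ≤ R ^ (s - s') := zpow_le_zpow_left₀ (by omega) hl.le hlR
  gcongr

theorem IsDom.exists_le (hS : IsDom S) : ∃ R, 0 < R ∧ ∀ {l t}, (l, t) ∈ S → l ≤ R ∧ |t| ≤ R := by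
  obtain ⟨R, hR⟩ := hS.bdd
  refine ⟨|R| + 1, by positivity, fun {l t} hp => ⟨?_, ?_⟩⟩
  · nlinarith [hR hp, le_abs_self R, abs_nonneg R, sq_nonneg t]
  · nlinarith [hR hp, le_abs_self R, abs_nonneg R, sq_nonneg l, sq_abs t]

theorem Rap.mono_exp (hS : IsDom S) (h : s' ≤ s) (hf : Rap S s f) : Rap S s' f := fun m => by
  obtain ⟨C, hC0, hC⟩ := hf.exists_nonneg hS m
  obtain ⟨R, hR0, hR⟩ := hS.exists_le
  refine ⟨C * R ^ (s - s'), fun k l t hp => (hC k l t hp).trans ?_⟩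
  have := zpow_le_const_mul_zpow (hS.pos hp) (hR hp).1 h
  calc C * (t ^ 2 + l ^ 2) ^ m * l ^ s ≤ C * (t ^ 2 + l ^ 2) ^ m * (R ^ (s - s') * l ^ s') := by
        gcongr
    _ = _ := by ring

/-! ### Multipliers -/

/-- Rapidly decreasing classes. -/
abbrev ClR (S : Set (ℝ × ℝ)) (σ : ℕ) (s : ℤ) (f : Fam) : Prop := Cl S σ (Rap S s) f

/-- Moderate classes. -/
abbrev ClM (S : Set (ℝ × ℝ)) (σ : ℕ) (s : ℤ) (f : Fam) : Prop := Cl S σ (Mod S s) f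

theorem ClR.add (hS : IsDom S) (hf : ClR S σ s f) (hg : ClR S σ s g) : ClR S σ s (f + g) :=
  Cl.add hS.isOpen isAdditivePred_rap hf hg

theorem ClR.mono (h : S' ⊆ S) (hf : ClR S σ s f) : ClR S' σ s f := hf.imp h fun _ => Rap.mono h

theorem ClR.mono_exp (hS : IsDom S) (h : s' ≤ s) (hf : ClR S σ s f) : ClR S σ s' f :=
  hf.imp subset_rfl fun _ => Rap.mono_exp hS h

theorem ClR.congr (hS : IsDom S) (hf : ClR S σ s f) (h : EqF S f g) : ClR S σ s g :=
  Cl.congr hS.isOpen isAdditivePred_rap hf h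

theorem ClM.mul_rap (hS : IsDom S) (hf : ClM S σ s f) (hg : ClR S σ s' g) :
    ClR S σ (s + s') (f * g) :=
  Cl.mul hS.isOpen isAdditivePred_rap (fun h h' => Mod.mul_rap hS h h') hf hg

theorem ClM.mul_rap_zero (hS : IsDom S) (hf : ClM S σ 0 f) (hg : ClR S σ s' g) :
    ClR S σ s' (f * g) := by
  simpa using hf.mul_rap hS hg

theorem ClM.mul (hS : IsDom S) (hf : ClM S σ s f) (hg : ClM S σ s' g) :
    ClM S σ (s + s') (f * g) :=
  Cl.mul hS.isOpen (isAdditivePred_mod hS) (fun h h' => Mod.mul hS h h') hf hg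

theorem ClM.mul_zero (hS : IsDom S) (hf : ClM S σ 0 f) (hg : ClM S σ 0 g) :
    ClM S σ 0 (f * g) := by
  simpa using ClM.mul hS hf hg

theorem ClM.add (hS : IsDom S) (hf : ClM S σ s f) (hg : ClM S σ s g) : ClM S σ s (f + g) :=
  Cl.add hS.isOpen (isAdditivePred_mod hS) hf hg

theorem ClR.union {S₁ S₂ : Set (ℝ × ℝ)} (h₁ : IsDom S₁) (h₂ : IsDom S₂)
    (hf₁ : ClR S₁ σ s f) (hf₂ : ClR S₂ σ s f) : ClR (S₁ ∪ S₂) σ s f :=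
  Cl.union h₁.isOpen h₂.isOpen (fun f hf hg m => by
    obtain ⟨C, hC0, hC⟩ := hf.exists_nonneg h₁ m
    obtain ⟨D, hD0, hD⟩ := hg.exists_nonneg h₂ m
    refine ⟨C + D, fun k l t hp => ?_⟩
    rw [add_mul, add_mul]
    rcases hp with hp | hp
    · have := h₁.pos hp
      have : 0 ≤ D * (t ^ 2 + l ^ 2) ^ m * l ^ s := by positivity
      linarith [hC k l t hp]
    · have := h₂.pos hp
      have : 0 ≤ C * (t ^ 2 + l ^ 2) ^ m * l ^ s := by positivity
      linarith [hD k l t hp]) hf₁ hf₂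

/-- Families of constants. -/
def cst (c : Mode → ℂ) : Fam := fun k _ _ => c k

/-- Multiplication by a function of `τ`. -/
def tfun (φ : ℝ → ℂ) : Fam := fun _ _ t => φ t

/-- Multiplication by a function of `ℓ`. -/
def lfun (φ : ℝ → ℂ) : Fam := fun _ l _ => φ l

/-- Multiplication by `1 / (τ² + ℓ²)`. -/
def rinv : Fam := fun _ l t => (((t ^ 2 + l ^ 2)⁻¹ : ℝ) : ℂ)

/-- Multiplication by `√(τ² + ℓ²)`. -/
def rsqrt : Fam := fun _ l t => ((Real.sqrt (t ^ 2 + l ^ 2) : ℝ) : ℂ)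

theorem clR_zero : ClR S σ s 0 := by
  refine Cl.of_closed (Q := fun f => f = 0) (fun f hf k => ?_) (fun f hf m => ⟨0, ?_⟩)
    (fun f hf => ?_) (fun f hf => ?_) rfl
  · subst hf; exact contDiffOn_const
  · subst hf; simp
  · subst hf; ext k l t; exact deriv_const t (0 : ℂ)
  · subst hf; ext k l t
    change (l : ℂ) ^ σ * deriv (fun _ => (0 : ℂ)) l = 0
    simp

theorem clM_cst (hS : IsDom S) {c : Mode → ℂ} {n : ℕ} {C : ℝ} (hc : ∀ k, ‖c k‖ ≤ C * k.w ^ n) :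
    ClM S σ 0 (cst c) := by
  refine Cl.of_closed (Q := fun f => f = cst c ∨ f = 0) (fun f hf k => ?_) (fun f hf => ?_)
    (fun f hf => Or.inr ?_) (fun f hf => Or.inr ?_) (Or.inl rfl)
  · rcases hf with rfl | rfl <;> exact contDiffOn_const
  · refine ⟨n, |C|, fun k l t hp => ?_⟩
    have hl := hS.pos hp
    rw [zpow_zero, mul_one]
    have hw := k.w_pos
    rcases hf with rfl | rfl
    · refine (hc k).trans ?_
      have : 0 ≤ (t ^ 2 + l ^ 2)⁻¹ := by positivity
      gcongr
      · exact le_abs_self C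
      · nlinarith
    · simp only [Pi.zero_apply, norm_zero]; positivity
  · rcases hf with rfl | rfl <;> (ext k l t; exact deriv_const t _)
  · rcases hf with rfl | rfl <;>
    · ext k l t
      refine (congrArg ((l : ℂ) ^ σ * ·) (deriv_const l _)).trans (mul_zero _)

theorem clM_const (hS : IsDom S) (c : ℂ) : ClM S σ 0 (cst fun _ => c) :=
  clM_cst hS (n := 0) (C := ‖c‖) fun k => by simp

theorem clM_tfun (hS : IsDom S) {φ : ℝ → ℂ} (hφ : ContDiff ℝ (⊤ : ℕ∞) φ) :
    ClM S σ 0 (tfun φ) := by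
  obtain ⟨R, hR0, hR⟩ := hS.exists_le
  refine Cl.of_closed (Q := fun f => ∃ φ : ℝ → ℂ, ContDiff ℝ (⊤ : ℕ∞) φ ∧ f = tfun φ)
    (fun f hf k => ?_) (fun f hf => ?_) (fun f hf => ?_) (fun f hf => ?_) ⟨φ, hφ, rfl⟩
  · obtain ⟨φ, hφ, rfl⟩ := hf
    exact (hφ.comp contDiff_snd).contDiffOn
  · obtain ⟨φ, hφ, rfl⟩ := hf
    obtain ⟨C, hC⟩ := (isCompact_Icc (a := -R) (b := R)).exists_bound_of_continuousOn
      hφ.continuous.continuousOn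
    refine ⟨0, C, fun k l t hp => ?_⟩
    simpa [tfun] using hC t (abs_le.1 (hR hp).2)
  · obtain ⟨φ, hφ, rfl⟩ := hf
    exact ⟨deriv φ, (contDiff_infty_iff_deriv.1 hφ).2, rfl⟩
  · obtain ⟨φ, hφ, rfl⟩ := hf
    refine ⟨fun _ => 0, contDiff_const, ?_⟩
    ext k l t
    exact (congrArg ((l : ℂ) ^ σ * ·) (deriv_const l _)).trans (mul_zero _)

theorem clM_t (hS : IsDom S) : ClM S σ 0 (tfun fun t => (t : ℂ)) :=
  clM_tfun hS Complex.ofRealCLM.contDiff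

theorem clM_lpoly (hS : IsDom S) (p : Polynomial ℂ) :
    ClM S σ 0 (lfun fun l => p.eval (l : ℂ)) := by
  obtain ⟨R, hR0, hR⟩ := hS.exists_le
  have hd : ∀ (p : Polynomial ℂ) (l : ℝ),
      HasDerivAt (fun l : ℝ => p.eval (l : ℂ)) (p.derivative.eval (l : ℂ)) l := fun p l =>
    (p.hasDerivAt (l : ℂ)).comp_ofReal
  refine Cl.of_closed (Q := fun f => ∃ p : Polynomial ℂ, f = lfun fun l => p.eval (l : ℂ))
    (fun f hf k => ?_) (fun f hf => ?_) (fun f hf => ?_) (fun f hf => ?_) ⟨p, rfl⟩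
  · obtain ⟨p, rfl⟩ := hf
    have : ContDiff ℝ (⊤ : ℕ∞) fun l : ℝ => p.eval (l : ℂ) := by
      simp_rw [Polynomial.eval_eq_sum_range]
      exact ContDiff.sum fun i _ => contDiff_const.mul (Complex.ofRealCLM.contDiff.pow i)
    exact (this.comp contDiff_fst).contDiffOn
  · obtain ⟨p, rfl⟩ := hf
    obtain ⟨C, hC⟩ := (isCompact_Icc (a := 0) (b := R)).exists_bound_of_continuousOn
      (f := fun l : ℝ => p.eval (l : ℂ)) (fun l _ => (hd p l).continuousAt.continuousWithinAt)
    refine ⟨0, C, fun k l t hp => ?_⟩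
    simpa [lfun] using hC l ⟨(hS.pos hp).le, (hR hp).1⟩
  · obtain ⟨p, rfl⟩ := hf
    refine ⟨0, ?_⟩
    ext k l t
    exact (deriv_const t (p.eval (l : ℂ))).trans (by simp [lfun])
  · obtain ⟨p, rfl⟩ := hf
    refine ⟨Polynomial.X ^ σ * p.derivative, ?_⟩
    ext k l t
    change (l : ℂ) ^ σ * deriv (fun l : ℝ => p.eval (l : ℂ)) l = _
    simp [(hd p l).deriv, lfun]

theorem clM_lpow (hS : IsDom S) (n : ℕ) : ClM S σ 0 (lfun fun l => (l : ℂ) ^ n) := by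
  have := clM_lpoly (σ := σ) hS (Polynomial.X ^ n)
  simpa using this

/-- A moderate family whose derivatives are products of moderate families with the family itself. -/
theorem clM_of_deriv_eq_mul (hS : IsDom S) {a b : Fam} (sf : Sm S f) (hf : Mod S 0 f)
    (sa : Sm S a) (sb : Sm S b)
    (ha : ∀ I J, Cc σ (Mod S 0) I J f → Cc σ (Mod S 0) I J a)
    (hb : ∀ I J, Cc σ (Mod S 0) I J f → Cc σ (Mod S 0) I J b)
    (hpt : EqF S (pt f) (a * f)) (hpl : EqF S (pl σ f) (b * f)) : ClM S σ 0 f := by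
  have hP := isAdditivePred_mod (s := 0) hS
  have hm : ∀ {f g}, Mod S 0 f → Mod S 0 g → Mod S 0 (f * g) := fun h h' => by
    simpa using Mod.mul hS h h'
  -- To control J + 1 derivatives of f, the product needs only J derivatives of the coefficient;
  -- hence a coefficient that itself contains f is admissible.
  have hT : ∀ J, Tc (Mod S 0) J f := fun J => by
    induction J with
    | zero => exact hf
    | succ J ih =>
      exact ⟨hf, (Tc.mul hS.isOpen hP hm sa sf (ha 0 J ih) ih).congr hS.isOpen hP hpt.symm⟩
  refine ⟨sf, fun I => ?_⟩
  induction I with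
  | zero => exact hT
  | succ I ih =>
    exact fun J => ⟨hT J,
      (Cc.mul hS.isOpen hP hm sb sf (hb I J (ih J)) (ih J)).congr hS.isOpen hP hpl.symm⟩

theorem contDiffOn_r (hS : IsDom S) {e : ℝ → ℝ} (he : ∀ x, 0 < x → ContDiffAt ℝ (⊤ : ℕ∞) e x) :
    ContDiffOn ℝ (⊤ : ℕ∞) (fun p : ℝ × ℝ => ((e (p.2 ^ 2 + p.1 ^ 2) : ℝ) : ℂ)) S := fun p hp => by
  have hp0 := hS.pos (l := p.1) (t := p.2) hp
  refine (Complex.ofRealCLM.contDiff.contDiffAt.comp p ?_).contDiffWithinAt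
  exact (he _ (by positivity)).comp p (f := fun p : ℝ × ℝ => p.2 ^ 2 + p.1 ^ 2) (by fun_prop)

theorem sm_rinv (hS : IsDom S) : Sm S rinv := fun _ =>
  contDiffOn_r hS (e := fun x => x⁻¹) fun _ hx => contDiffAt_inv ℝ hx.ne'

theorem sm_rsqrt (hS : IsDom S) : Sm S rsqrt := fun _ =>
  contDiffOn_r hS (e := Real.sqrt) fun _ hx => Real.contDiffAt_sqrt hx.ne'

theorem mod_rinv : Mod S 0 rinv := by
  refine ⟨1, 1, fun k l t hp => ?_⟩
  have h : 0 ≤ (t ^ 2 + l ^ 2)⁻¹ := by positivity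
  simp only [rinv, Complex.norm_real, Real.norm_eq_abs, abs_of_nonneg h, pow_one, one_mul,
    zpow_zero, mul_one]
  nlinarith [k.one_le_w]

theorem hasDerivAt_sq_add_inv {t c : ℝ} (h : t ^ 2 + c ≠ 0) :
    HasDerivAt (fun t : ℝ => (t ^ 2 + c)⁻¹) (-2 * t * (t ^ 2 + c)⁻¹ * (t ^ 2 + c)⁻¹) t := by
  refine (((hasDerivAt_pow 2 t).add_const c).fun_inv h).congr_deriv ?_
  simp only [pow_one, Nat.cast_ofNat, Nat.add_one_sub_one]
  field_simp

theorem hasDerivAt_sqrt_sq_add {t c : ℝ} (h : 0 < t ^ 2 + c) :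
    HasDerivAt (fun t : ℝ => Real.sqrt (t ^ 2 + c))
      (t * (t ^ 2 + c)⁻¹ * Real.sqrt (t ^ 2 + c)) t := by
  convert ((hasDerivAt_pow 2 t).add_const c).sqrt h.ne' using 1
  have h0 := Real.sqrt_pos.2 h
  have h1 := Real.sq_sqrt h.le
  rw [eq_div_iff (by positivity)]
  field_simp
  rw [h1]; simp; ring

/-- ∂_τ r⁻¹ = (-2τ r⁻¹) r⁻¹, and similarly in ℓ: the logarithmic derivative again contains r⁻¹, so
the self-referential form of `clM_of_deriv_eq_mul` is needed. -/
theorem clM_rinv (hS : IsDom S) : ClM S σ 0 rinv := by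
  have hP := isAdditivePred_mod (s := 0) hS
  have hm : ∀ {f g}, Mod S 0 f → Mod S 0 g → Mod S 0 (f * g) := fun h h' => by
    simpa using Mod.mul hS h h'
  have c2 := clM_const (σ := σ) hS (-2)
  have h1 := c2.mul_zero hS (clM_t (σ := σ) hS)
  have h2 := c2.mul_zero hS (clM_lpow (σ := σ) hS (σ + 1))
  have hsr := sm_rinv hS
  refine clM_of_deriv_eq_mul hS hsr mod_rinv (h1.1.mul hsr) (h2.1.mul hsr)
    (fun I J h => (h1.2 I J).mul hS.isOpen hP hm h1.1 hsr h)
    (fun I J h => (h2.2 I J).mul hS.isOpen hP hm h2.1 hsr h) ?_ ?_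
  · intro k l t hp
    have hl := hS.pos hp
    have hr : t ^ 2 + l ^ 2 ≠ 0 := by positivity
    change deriv (fun t : ℝ => (((t ^ 2 + l ^ 2)⁻¹ : ℝ) : ℂ)) t =
      -2 * (t : ℂ) * rinv k l t * rinv k l t
    rw [(hasDerivAt_sq_add_inv hr).ofReal_comp.deriv]
    simp only [rinv]; push_cast; rfl
  · intro k l t hp
    have hl := hS.pos hp
    have hr : l ^ 2 + t ^ 2 ≠ 0 := by positivity
    change (l : ℂ) ^ σ * deriv (fun l : ℝ => (((t ^ 2 + l ^ 2)⁻¹ : ℝ) : ℂ)) l =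
      -2 * (l : ℂ) ^ (σ + 1) * rinv k l t * rinv k l t
    simp only [rinv, add_comm (t ^ 2)]
    rw [(hasDerivAt_sq_add_inv hr).ofReal_comp.deriv]
    push_cast; ring

theorem clM_rsqrt (hS : IsDom S) : ClM S σ 0 rsqrt := by
  have hP := isAdditivePred_mod (s := 0) hS
  have hm : ∀ {f g}, Mod S 0 f → Mod S 0 g → Mod S 0 (f * g) := fun h h' => by
    simpa using Mod.mul hS h h'
  have h1 := (clM_t (σ := σ) hS).mul_zero hS (clM_rinv hS)
  have h2 := (clM_lpow (σ := σ) hS (σ + 1)).mul_zero hS (clM_rinv hS)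
  have hsr := sm_rsqrt hS
  refine clM_of_deriv_eq_mul hS hsr ?_ h1.1 h2.1 (fun I J _ => h1.2 I J) (fun I J _ => h2.2 I J)
    ?_ ?_
  · obtain ⟨R, hR⟩ := hS.bdd
    refine ⟨0, Real.sqrt R, fun k l t hp => ?_⟩
    simp only [rsqrt, Complex.norm_real, Real.norm_eq_abs, abs_of_nonneg (Real.sqrt_nonneg _)]
    simpa using Real.sqrt_le_sqrt (hR hp)
  · intro k l t hp
    have hl := hS.pos hp
    have hr : 0 < t ^ 2 + l ^ 2 := by positivity
    change deriv (fun t : ℝ => ((Real.sqrt (t ^ 2 + l ^ 2) : ℝ) : ℂ)) t =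
      t * rinv k l t * rsqrt k l t
    rw [(hasDerivAt_sqrt_sq_add hr).ofReal_comp.deriv]
    simp only [rinv, rsqrt]; push_cast; rfl
  · intro k l t hp
    have hl := hS.pos hp
    have hr : 0 < l ^ 2 + t ^ 2 := by positivity
    change (l : ℂ) ^ σ * deriv (fun l : ℝ => ((Real.sqrt (t ^ 2 + l ^ 2) : ℝ) : ℂ)) l =
      (l : ℂ) ^ (σ + 1) * rinv k l t * rsqrt k l t
    simp only [rinv, rsqrt, add_comm (t ^ 2)]
    rw [(hasDerivAt_sqrt_sq_add hr).ofReal_comp.deriv]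
    push_cast; ring

/-- The family `ℓ ^ z (log ℓ) ^ p`. -/
def lterm (e : ℂ × ℕ) : Fam := lfun (phgTerm e)

/-- For `e.2 = 0` the truncated `e.2 - 1` is harmless, as the coefficient `e.2` vanishes. -/
theorem hasDerivAt_phgTerm (e : ℂ × ℕ) {x : ℝ} (hx : 0 < x) :
    HasDerivAt (phgTerm e)
      ((e.1 * phgTerm e x + e.2 * phgTerm (e.1, e.2 - 1) x) / (x : ℂ)) x := by
  have hx' : (x : ℂ) ≠ 0 := by exact_mod_cast hx.ne'
  have h1 : HasDerivAt (fun x : ℝ => (x : ℂ) ^ e.1) (e.1 * (x : ℂ) ^ (e.1 - 1) * 1) x :=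
    ((hasDerivAt_id (x : ℂ)).cpow_const (Complex.ofReal_mem_slitPlane.2 hx)).comp_ofReal
  have h2 := (Real.hasDerivAt_log hx.ne').ofReal_comp.pow e.2
  refine (h1.mul h2).congr_deriv ?_
  rw [Complex.cpow_sub _ _ hx', Complex.cpow_one]
  simp only [phgTerm, Pi.pow_apply]
  push_cast
  field_simp

theorem contDiffOn_phgTerm (e : ℂ × ℕ) : ContDiffOn ℝ (⊤ : ℕ∞) (phgTerm e) (Ioi 0) := by
  intro x hx
  have hx : 0 < x := hx
  have h1 : ContDiffAt ℝ (⊤ : ℕ∞) (fun x : ℝ => (x : ℂ) ^ e.1) x := by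
    have h : ContDiffAt ℝ (⊤ : ℕ∞)
        (fun x : ℝ => Complex.exp (((Real.log x : ℝ) : ℂ) * e.1)) x :=
      ((Complex.ofRealCLM.contDiff.contDiffAt.comp x (Real.contDiffAt_log.2 hx.ne')).mul
        contDiffAt_const).cexp
    refine h.congr_of_eventuallyEq ?_
    filter_upwards [lt_mem_nhds hx] with y hy
    rw [Complex.cpow_def_of_ne_zero (by exact_mod_cast hy.ne'), Complex.ofReal_log hy.le]
  exact (h1.mul ((Complex.ofRealCLM.contDiff.contDiffAt.comp x
    (Real.contDiffAt_log.2 hx.ne')).pow e.2)).contDiffWithinAt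

/-- The strict inequality leaves a positive power of x to absorb the logarithms as x ↘ 0; away from
0 continuity on a compact interval suffices. -/
theorem exists_norm_phgTerm_le (e : ℂ × ℕ) {s : ℤ} (hs : (s : ℝ) < e.1.re) (R : ℝ) :
    ∃ C, 0 ≤ C ∧ ∀ x, 0 < x → x ≤ R → ‖phgTerm e x‖ ≤ C * x ^ s := by
  have hδ : 0 < e.1.re - s := sub_pos.2 hs
  have hc : ContinuousOn (fun x : ℝ => x ^ (e.1.re - s) * |Real.log x| ^ e.2) (Ioi 0) := by
    intro x hx
    have hx : 0 < x := hx
    exact ((Real.continuousAt_rpow_const x _ (Or.inl hx.ne')).mul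
      ((Real.continuousAt_log hx.ne').abs.pow e.2)).continuousWithinAt
  have ht : Tendsto (fun x : ℝ => x ^ (e.1.re - s) * |Real.log x| ^ e.2) (𝓝[>] 0) (𝓝 0) := by
    -- The spare power x^(Re z - s) is divided into p + 1 equal parts, one for each of the p
    -- logarithms and one more, so that the product tends to 0 also for p = 0.
    have h1 := (tendsto_log_mul_rpow_nhdsGT_zero (r := (e.1.re - s) / (e.2 + 1)) (by positivity))
    have h2 := (h1.abs.pow e.2)
    have h3 : Tendsto (fun x : ℝ => x ^ ((e.1.re - s) / (e.2 + 1))) (𝓝[>] 0) (𝓝 0) := by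
      have := (Real.continuousAt_rpow_const (0 : ℝ) ((e.1.re - s) / (e.2 + 1))
        (Or.inr (by positivity))).tendsto
      rw [Real.zero_rpow (by positivity)] at this
      exact this.mono_left nhdsWithin_le_nhds
    have h4 := h2.mul h3
    rw [mul_zero] at h4
    refine h4.congr' ?_
    filter_upwards [self_mem_nhdsWithin] with x hx
    have hx : 0 < x := hx
    rw [abs_mul, mul_pow, abs_of_pos (Real.rpow_pos_of_pos hx _), mul_assoc, ← Real.rpow_natCast
      (x ^ ((e.1.re - s) / (e.2 + 1))), ← Real.rpow_mul hx.le, ← Real.rpow_add hx, mul_comm]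
    congr 2
    field_simp
  obtain ⟨δ, hδ0, hδ1⟩ : ∃ δ > 0, ∀ x ∈ Ioo 0 δ, x ^ (e.1.re - s) * |Real.log x| ^ e.2 ≤ 1 := by
    have := ht.eventually (gt_mem_nhds zero_lt_one)
    rw [eventually_nhdsWithin_iff, Metric.eventually_nhds_iff] at this
    obtain ⟨δ, h0, h1⟩ := this
    exact ⟨δ, h0, fun x hx => (h1 (by simpa [abs_of_pos hx.1] using hx.2) hx.1).le⟩
  obtain ⟨C, hC⟩ := (isCompact_Icc (a := δ) (b := R)).exists_bound_of_continuousOn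
    (hc.mono fun x hx => hδ0.trans_le hx.1)
  refine ⟨max C 1, by positivity, fun x hx hxR => ?_⟩
  have e1 : ‖phgTerm e x‖ = x ^ (e.1.re - s) * |Real.log x| ^ e.2 * x ^ s := by
    rw [phgTerm, norm_mul, norm_pow, Complex.norm_real, Real.norm_eq_abs,
      Complex.norm_cpow_eq_rpow_re_of_pos hx, ← Real.rpow_intCast, mul_right_comm,
      ← Real.rpow_add hx]
    ring_nf
  rw [e1]
  have := zpow_nonneg hx.le s
  gcongr
  rcases lt_or_ge x δ with h | h
  · exact (hδ1 x ⟨hx, h⟩).trans (le_max_right _ _)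
  · exact ((le_abs_self _).trans (hC x ⟨h, hxR⟩)).trans (le_max_left _ _)

theorem clM_lterm (hS : IsDom S) (e : ℂ × ℕ) (hs : (s : ℝ) < e.1.re) :
    ClM S 1 s (lterm e) := by
  obtain ⟨R, hR0, hR⟩ := hS.exists_le
  have hsm : ∀ e, Sm S (lterm e) := fun e _ =>
    (contDiffOn_phgTerm e).comp contDiffOn_fst fun p hp => hS.pos (l := p.1) (t := p.2) hp
  have hP := isAdditivePred_mod (s := s) hS
  have hm : ∀ {f g}, Mod S 0 f → Mod S s g → Mod S s (f * g) := fun h h' => by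
    simpa using Mod.mul hS h h'
  have hpt : ∀ e, pt (lterm e) = 0 := fun e => by
    ext k l t; exact deriv_const t _
  have hmod : ∀ p, Mod S s (lterm (e.1, p)) := fun p => by
    obtain ⟨C, -, hC⟩ := exists_norm_phgTerm_le (e.1, p) hs R
    exact ⟨0, C, fun k l t hp => by
      simpa [lterm, lfun] using hC l (hS.pos hp) (hR hp).1⟩
  have hz : ∀ J, Tc (Mod S s) J 0 := fun J => by
    have h0 : Mod S s 0 := ⟨0, 0, by simp⟩
    have hpt0 : pt (0 : Fam) = 0 := by ext k l t; exact deriv_const t _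
    induction J with
    | zero => exact h0
    | succ J ih => exact ⟨h0, by rwa [hpt0]⟩
  have hT : ∀ J p, Tc (Mod S s) J (lterm (e.1, p)) := fun J p => by
    cases J with
    | zero => exact hmod p
    | succ J => exact ⟨hmod p, (hpt (e.1, p)).symm ▸ hz J⟩
  refine ⟨hsm e, fun I J => ?_⟩
  -- ℓ ∂_ℓ keeps the exponent z and may lower the logarithmic power, so the induction treats all p
  -- at once. This is where σ = 1 is needed: ∂_ℓ itself would lower z.
  suffices h : ∀ p, Cc 1 (Mod S s) I J (lterm (e.1, p)) from h e.2
  induction I with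
  | zero => exact hT J
  | succ I ih =>
    intro p
    refine ⟨hT J p, ?_⟩
    have c1 := clM_const (σ := 1) hS e.1
    have c2 := clM_const (σ := 1) hS (p : ℂ)
    refine Cc.congr hS.isOpen hP (f := (cst fun _ => e.1) * lterm (e.1, p)
      + (cst fun _ => (p : ℂ)) * lterm (e.1, p - 1)) ?_ ?_
    · intro k l t hp
      have hl := hS.pos hp
      have hl' : (l : ℂ) ≠ 0 := by exact_mod_cast hl.ne'
      change _ = (l : ℂ) ^ 1 * deriv (phgTerm (e.1, p)) l
      rw [(hasDerivAt_phgTerm (e.1, p) hl).deriv, pow_one, mul_div_cancel₀ _ hl']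
      rfl
    · exact ((c1.2 I J).mul hS.isOpen hP hm c1.1 (hsm _) (ih p)).add hS.isOpen hP
        (c1.1.mul (hsm _)) (c2.1.mul (hsm _))
        ((c2.2 I J).mul hS.isOpen hP hm c2.1 (hsm _) (ih (p - 1)))

/-- A power of `ℓ` improves the order. -/
theorem clM_lpow_order (hS : IsDom S) (n : ℕ) : ClM S 1 n (lfun fun l => (l : ℂ) ^ n) := by
  refine Cl.of_closed (Q := fun f => ∃ c : ℂ, f = lfun fun l => c * (l : ℂ) ^ n)
    (fun f hf k => ?_) (fun f hf => ?_) (fun f hf => ?_) (fun f hf => ?_) ⟨1, by simp⟩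
  · obtain ⟨c, rfl⟩ := hf
    exact (contDiff_const.mul (contDiff_ofReal_fst_pow n)).contDiffOn
  · obtain ⟨c, rfl⟩ := hf
    refine ⟨0, ‖c‖, fun k l t hp => ?_⟩
    simp [lfun, abs_of_pos (hS.pos hp)]
  · obtain ⟨c, rfl⟩ := hf
    refine ⟨0, ?_⟩
    ext k l t
    exact (deriv_const t _).trans (by simp [lfun])
  · obtain ⟨c, rfl⟩ := hf
    refine ⟨c * n, ?_⟩
    ext k l t
    have h : HasDerivAt (fun l : ℝ => c * (l : ℂ) ^ n) (c * (n * (l : ℂ) ^ (n - 1))) l :=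
      ((hasDerivAt_pow n (l : ℂ)).const_mul c).comp_ofReal
    change (l : ℂ) ^ 1 * deriv (fun l : ℝ => c * (l : ℂ) ^ n) l = c * n * (l : ℂ) ^ n
    rw [h.deriv]
    rcases n with _ | n
    · simp
    · simp only [Nat.add_one_sub_one]; ring

/-- A family that is smooth in `ℓ` is smooth in `log ℓ`. -/
theorem ClR.of_zero (hS : IsDom S) (hf : ClR S 0 s f) : ClR S 1 s f := by
  refine ⟨hf.1, fun I J => ?_⟩
  have hP : IsAdditivePred S (Rap S s) := isAdditivePred_rap
  have hm : ∀ {f g}, Mod S 0 f → Rap S s g → Rap S s (f * g) := fun h h' => by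
    simpa using Mod.mul_rap hS h h'
  have c := clM_lpow (σ := 0) hS 1
  have h := hf.2 I J
  have sf := hf.1
  clear hf
  induction I generalizing f with
  | zero => exact h
  | succ I ih =>
    refine ⟨h.1, ?_⟩
    have h1 : Cc 0 (Rap S s) I J ((lfun fun l => (l : ℂ) ^ 1) * HypCyl.pl 0 f) :=
      (c.2 I J).mul hS.isOpen hP hm c.1 (sf.pl hS.isOpen) h.2
    have h2 := ih h1 (c.1.mul (sf.pl hS.isOpen))
    refine h2.congr hS.isOpen hP fun k l t _ => ?_
    simp [lfun, HypCyl.pl]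

end

end HypCyl

end

/-! ### A priori estimates for the model equation, uniform in the mode and in ℓ -/

noncomputable section

namespace HypCyl
open Set Filter Topology

/-! ### The maximum principle -/

/-- A positive second derivative would make the point a local minimum as well, hence the function
locally constant, with second derivative zero. -/
theorem second_deriv_nonpos_of_isLocalMax {g g' : ℝ → ℝ} {g'' t : ℝ} (hm : IsLocalMax g t)
    (h1 : ∀ᶠ s in 𝓝 t, HasDerivAt g (g' s) s) (h2 : HasDerivAt g' g'' t) : g'' ≤ 0 := by
  by_contra! hpos
  have e1 : deriv g =ᶠ[𝓝 t] g' := h1.mono fun s hs => hs.deriv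
  have e2 : deriv (deriv g) t = g'' := by rw [e1.deriv_eq, h2.deriv]
  have hmin : IsLocalMin g t := isLocalMin_of_deriv_deriv_pos (by rwa [e2]) hm.deriv_eq_zero
    h1.self_of_nhds.continuousAt
  have hc : g =ᶠ[𝓝 t] fun _ => g t := by
    filter_upwards [hm, hmin] with s hs hs'
    exact le_antisymm hs hs'
  have e3 : deriv g =ᶠ[𝓝 t] fun _ => 0 := by
    refine hc.deriv.trans (Eventually.of_forall fun s => ?_)
    simp
  have : deriv (deriv g) t = 0 := by rw [e3.deriv_eq]; simp
  linarith

/-- A comparison principle for `A f'' - V f = G` with `A, V > 0`. -/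
theorem norm_le_of_barrier {a b : ℝ} (hab : a ≤ b) {f f' f'' G : ℝ → ℂ} {A V ψ ψ' ψ'' : ℝ → ℝ}
    (hc : ContinuousOn f (Icc a b)) (h1 : ∀ t ∈ Ioo a b, HasDerivAt f (f' t) t)
    (h2 : ∀ t ∈ Ioo a b, HasDerivAt f' (f'' t) t)
    (hψ1 : ∀ t, HasDerivAt ψ (ψ' t) t) (hψ2 : ∀ t, HasDerivAt ψ' (ψ'' t) t)
    (hA : ∀ t ∈ Ioo a b, 0 < A t) (hV : ∀ t ∈ Ioo a b, 0 < V t)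
    (heq : ∀ t ∈ Ioo a b, (A t : ℂ) * f'' t - V t * f t = G t)
    (ha : ‖f a‖ ≤ ψ a) (hb : ‖f b‖ ≤ ψ b)
    (hb' : ∀ t ∈ Ioo a b, ‖f t‖ ≤ ψ t ∨ ‖G t‖ ≤ V t * ψ t - A t * ψ'' t) :
    ∀ t ∈ Icc a b, ‖f t‖ ≤ ψ t := by
  by_contra! hcon
  obtain ⟨t₀, ht₀, hlt⟩ := hcon
  have hψc : Continuous ψ := continuous_iff_continuousAt.2 fun t => (hψ1 t).continuousAt
  -- A rotation by a unit number reduces the complex case to the real function Re(ζ f) - ψ, which is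
  -- positive at t₀ and therefore has a positive interior maximum.
  obtain ⟨ζ, hζ1, hζ⟩ : ∃ ζ : ℂ, ‖ζ‖ = 1 ∧ ζ * f t₀ = ‖f t₀‖ := by
    by_cases h0 : f t₀ = 0
    · exact ⟨1, by simp, by simp [h0]⟩
    · refine ⟨‖f t₀‖ / f t₀, ?_, ?_⟩
      · rw [norm_div, Complex.norm_real, norm_norm, div_self (norm_ne_zero_iff.2 h0)]
      · rw [div_mul_cancel₀ _ h0]
  have hre : ∀ z : ℂ, |(ζ * z).re| ≤ ‖z‖ := fun z =>
    (Complex.abs_re_le_norm _).trans (by rw [norm_mul, hζ1, one_mul])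
  set g : ℝ → ℝ := fun t => (ζ * f t).re - ψ t with hg
  have hgc : ContinuousOn g (Icc a b) :=
    (Complex.continuous_re.comp_continuousOn (continuousOn_const.mul hc)).sub hψc.continuousOn
  obtain ⟨t₁, ht₁, hmax⟩ := isCompact_Icc.exists_isMaxOn (nonempty_Icc.2 hab) hgc
  have hg0 : 0 < g t₁ := by
    refine lt_of_lt_of_le ?_ (hmax ht₀)
    simp only [hg, hζ, Complex.ofReal_re]; linarith
  have hgle : ∀ t, ‖f t‖ ≤ ψ t → g t ≤ 0 := fun t ht => by
    have := (le_abs_self _).trans (hre (f t)); simp only [hg]; linarith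
  have hne : t₁ ∈ Ioo a b := by
    refine ⟨lt_of_le_of_ne ht₁.1 ?_, lt_of_le_of_ne ht₁.2 ?_⟩
    · rintro rfl; exact absurd (hgle _ ha) (not_le.2 hg0)
    · rintro rfl; exact absurd (hgle _ hb) (not_le.2 hg0)
  have hloc : IsLocalMax g t₁ := by
    filter_upwards [Icc_mem_nhds hne.1 hne.2] with t ht using hmax ht
  have hd : ∀ (φ φ' : ℝ → ℂ) t, HasDerivAt φ (φ' t) t →
      HasDerivAt (fun t => (ζ * φ t).re) ((ζ * φ' t).re) t := fun φ φ' t h =>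
    Complex.reCLM.hasFDerivAt.comp_hasDerivAt t (h.const_mul ζ)
  have hsec : (ζ * f'' t₁).re - ψ'' t₁ ≤ 0 :=
    second_deriv_nonpos_of_isLocalMax hloc (g' := fun t => (ζ * f' t).re - ψ' t)
      (by filter_upwards [Ioo_mem_nhds hne.1 hne.2] with t ht using (hd f f' t (h1 t ht)).sub (hψ1 t))
      ((hd f' f'' t₁ (h2 t₁ hne)).sub (hψ2 t₁))
  have hG : A t₁ * (ζ * f'' t₁).re - V t₁ * (ζ * f t₁).re = (ζ * G t₁).re := by
    rw [← heq t₁ hne]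
    simp only [Complex.mul_re, Complex.sub_re, Complex.sub_im, Complex.mul_im, Complex.ofReal_re,
      Complex.ofReal_im]
    ring
  rcases hb' t₁ hne with h | h
  · exact absurd (hgle _ h) (not_le.2 hg0)
  · have h3 := neg_le_of_abs_le (hre (G t₁))
    have h4 := mul_nonpos_of_nonneg_of_nonpos (hA t₁ hne).le hsec
    have h5 := mul_pos (hV t₁ hne) hg0
    simp only [hg] at h5
    nlinarith

/-! ### Estimates for the model equation -/

theorem hasDerivAt_sq_add_pow (l : ℝ) (m : ℕ) (t : ℝ) :
    HasDerivAt (fun t : ℝ => (t ^ 2 + l ^ 2) ^ m) (m * (t ^ 2 + l ^ 2) ^ (m - 1) * (2 * t)) t := by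
  have := ((hasDerivAt_pow 2 t).add_const (l ^ 2)).fun_pow m
  simpa using this

/-- The weighted a priori estimate for `r² f'' - ((τ + κ)² + τ² + 2 ℓ²) f = G`. -/
theorem norm_le_weight_of_eq {a l κ K R : ℝ} (m : ℕ) (ha : a ≤ 1) (hl : 0 < l) (hκ : 1 ≤ |κ|)
    (hK : 0 ≤ K) {f f' f'' G : ℝ → ℂ}
    (hc : ContinuousOn f (Icc a 1)) (h1 : ∀ t ∈ Ioo a 1, HasDerivAt f (f' t) t)
    (h2 : ∀ t ∈ Ioo a 1, HasDerivAt f' (f'' t) t)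
    (heq : ∀ t ∈ Ioo a 1, (((t ^ 2 + l ^ 2) ^ 2 : ℝ) : ℂ) * f'' t
      - (((t + κ) ^ 2 + t ^ 2 + 2 * l ^ 2 : ℝ) : ℂ) * f t = G t)
    (hR1 : 1 ≤ R) (hR : ∀ t ∈ Icc a 1, t ^ 2 + l ^ 2 ≤ R)
    (hb : ∀ t, t = a ∨ t = 1 → ‖f t‖ ≤ K * (t ^ 2 + l ^ 2) ^ (m + 2))
    (hG : ∀ t ∈ Ioo a 1, ‖G t‖ ≤ K * (t ^ 2 + l ^ 2) ^ (m + 3)) :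
    ∀ t ∈ Icc a 1, ‖f t‖ ≤
      K * R ^ (m + 2) * (4 * (2 * (m + 2) + 4 * (m + 2) ^ 2) : ℝ) ^ (m + 2)
        * (t ^ 2 + l ^ 2) ^ (m + 2) := by
  have hr : ∀ t : ℝ, 0 < t ^ 2 + l ^ 2 := fun t => by positivity
  have hV : ∀ t : ℝ, t ^ 2 + l ^ 2 ≤ (t + κ) ^ 2 + t ^ 2 + 2 * l ^ 2 := fun t => by
    nlinarith [sq_nonneg (t + κ), sq_nonneg l]
  -- First barrier, a constant: since V ≥ r, one factor r of the bound on G is absorbed by V.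
  have step1 : ∀ t ∈ Icc a 1, ‖f t‖ ≤ K * R ^ (m + 2) := by
    refine norm_le_of_barrier ha hc h1 h2 (ψ := fun _ => K * R ^ (m + 2)) (ψ' := fun _ => 0)
      (ψ'' := fun _ => 0) (A := fun t => (t ^ 2 + l ^ 2) ^ 2)
      (V := fun t => (t + κ) ^ 2 + t ^ 2 + 2 * l ^ 2)
      (fun t => hasDerivAt_const t _) (fun t => hasDerivAt_const t _)
      (fun t _ => by have := hr t; positivity) (fun t _ => (hr t).trans_le (hV t)) heq ?_ ?_ ?_
    · refine (hb a (Or.inl rfl)).trans ?_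
      have := hR a ⟨le_rfl, ha⟩; have := hr a
      gcongr
    · refine (hb 1 (Or.inr rfl)).trans ?_
      have := hR 1 ⟨ha, le_rfl⟩; have := hr 1
      gcongr
    · intro t ht
      refine Or.inr ((hG t ht).trans ?_)
      have h3 := hR t ⟨ht.1.le, ht.2.le⟩
      have h4 := hr t
      have h5 : (t ^ 2 + l ^ 2) ^ (m + 2) ≤ R ^ (m + 2) := by gcongr
      calc K * (t ^ 2 + l ^ 2) ^ (m + 3) = (t ^ 2 + l ^ 2) * (K * (t ^ 2 + l ^ 2) ^ (m + 2)) := by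
            ring
        _ ≤ ((t + κ) ^ 2 + t ^ 2 + 2 * l ^ 2) * (K * R ^ (m + 2)) := by
            exact mul_le_mul (hV t) (mul_le_mul_of_nonneg_left h5 hK) (by positivity)
              ((hr t).le.trans (hV t))
        _ = _ := by ring
  -- c is chosen so that r² (r^(m+2))'' ≤ c r^(m+3); the second barrier is D r^(m+2).
  set c : ℝ := 2 * (m + 2) + 4 * (m + 2) ^ 2 with hcdef
  have hc1 : 1 ≤ c := by
    have : (0 : ℝ) ≤ m := Nat.cast_nonneg m
    nlinarith
  have hRm : 1 ≤ R ^ (m + 2) := one_le_pow₀ hR1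
  set D : ℝ := K * R ^ (m + 2) * (4 * c) ^ (m + 2) with hD
  have hKD : K ≤ D := by
    have : 1 ≤ (4 * c) ^ (m + 2) := one_le_pow₀ (by linarith)
    have h6 : K ≤ K * R ^ (m + 2) := le_mul_of_one_le_right hK hRm
    exact h6.trans (le_mul_of_one_le_right (by positivity) this)
  refine norm_le_of_barrier ha hc h1 h2 (ψ := fun t => D * (t ^ 2 + l ^ 2) ^ (m + 2))
    (ψ' := fun t => D * ((m + 2 : ℕ) * (t ^ 2 + l ^ 2) ^ (m + 1) * (2 * t)))
    (ψ'' := fun t => D * ((m + 2 : ℕ) * ((m + 1 : ℕ) * (t ^ 2 + l ^ 2) ^ m * (2 * t)) * (2 * t)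
      + (m + 2 : ℕ) * (t ^ 2 + l ^ 2) ^ (m + 1) * 2))
    (A := fun t => (t ^ 2 + l ^ 2) ^ 2) (V := fun t => (t + κ) ^ 2 + t ^ 2 + 2 * l ^ 2)
    (fun t => (hasDerivAt_sq_add_pow l (m + 2) t).const_mul D) (fun t => ?_)
    (fun t _ => by have := hr t; positivity) (fun t _ => (hr t).trans_le (hV t)) heq ?_ ?_ ?_
  · have h3 := ((hasDerivAt_sq_add_pow l (m + 1) t).const_mul ((m + 2 : ℕ) : ℝ)).mul
      ((hasDerivAt_id t).const_mul 2)
    refine (h3.const_mul D).congr_deriv ?_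
    simp
  · refine (hb a (Or.inl rfl)).trans ?_
    have := hr a
    gcongr
  · refine (hb 1 (Or.inr rfl)).trans ?_
    have := hr 1
    gcongr
  · intro t ht
    have hrt := hr t
    set r := t ^ 2 + l ^ 2 with hrdef
    -- Where 4cr ≥ 1, the factor (4c)^(m+2) in D makes the constant bound sufficient. Where 4cr < 1,
    -- one has |t| ≤ 1/2, and |κ| ≥ 1 forces V ≥ 1/4 + r: the 1/4 absorbs the second derivative of
    -- the barrier and the r absorbs G.
    rcases le_or_gt 1 (4 * c * r) with hbig | hsmall
    · left
      refine (step1 t ⟨ht.1.le, ht.2.le⟩).trans ?_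
      rw [hD, mul_assoc _ ((4 * c) ^ (m + 2)), ← mul_pow]
      exact le_mul_of_one_le_right (by positivity) (one_le_pow₀ hbig)
    · right
      have hr4 : r < 1 / 4 := by nlinarith
      have ht2 : |t| ≤ 1 / 2 := abs_le_of_sq_le_sq (by nlinarith [sq_nonneg l]) (by norm_num)
      have hk4 : 1 / 4 ≤ (t + κ) ^ 2 := by
        have : 1 / 2 ≤ |t + κ| := by
          have := abs_sub_abs_le_abs_sub κ (-t)
          rw [abs_neg, sub_neg_eq_add, add_comm κ] at this
          linarith
        rw [← sq_abs]; nlinarith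
      have htr : t ^ 2 ≤ r := by rw [hrdef]; nlinarith [sq_nonneg l]
      have hD0 : 0 ≤ D := hK.trans hKD
      have e : r ^ 2 * (D * ((m + 2 : ℕ) * ((m + 1 : ℕ) * r ^ m * (2 * t)) * (2 * t)
          + (m + 2 : ℕ) * r ^ (m + 1) * 2)) ≤ D * r ^ (m + 2) * (c * r) := by
        have h3 : ((m + 2 : ℕ) : ℝ) * (m + 1 : ℕ) * 4 * t ^ 2 + (m + 2 : ℕ) * 2 * r ≤ c * r := by
          push_cast
          have h4 : ((m : ℝ) + 2) * (m + 1) * 4 * t ^ 2 ≤ (m + 2) * (m + 1) * 4 * r := by gcongr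
          have h5 : ((m : ℝ) + 2) * (m + 1) * 4 * r ≤ 4 * (m + 2) ^ 2 * r := by
            have : (0 : ℝ) ≤ m := Nat.cast_nonneg m
            nlinarith [mul_nonneg (by positivity : (0 : ℝ) ≤ 4 * (m + 2)) hrt.le]
          rw [hcdef]; nlinarith
        calc _ = D * r ^ (m + 2) * (((m + 2 : ℕ) : ℝ) * (m + 1 : ℕ) * 4 * t ^ 2
              + (m + 2 : ℕ) * 2 * r) := by ring
          _ ≤ _ := by gcongr
      have e2 : D * r ^ (m + 2) * (1 / 4 + r) ≤
          ((t + κ) ^ 2 + t ^ 2 + 2 * l ^ 2) * (D * r ^ (m + 2)) := by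
        rw [mul_comm]
        refine mul_le_mul_of_nonneg_right ?_ (by positivity)
        nlinarith [sq_nonneg l, hk4, hrdef]
      have e3 : K * r ^ (m + 3) ≤ D * r ^ (m + 2) * r := by
        rw [mul_assoc, ← pow_succ]; gcongr
      have e4 : D * r ^ (m + 2) * (c * r) ≤ D * r ^ (m + 2) * (1 / 4) := by gcongr; linarith
      refine (hG t ht).trans (e3.trans ?_)
      have := mul_add (D * r ^ (m + 2)) (1 / 4) r
      linarith

/-- Interpolation: `f'` is controlled by `f` and `f''`. -/
theorem norm_deriv_le_of_norm_second_deriv_le {a b d B : ℝ} (hd : 0 < d) {f f' f'' : ℝ → ℂ}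
    (h1 : ∀ t ∈ Icc a b, HasDerivAt f (f' t) t) (h2 : ∀ t ∈ Icc a b, HasDerivAt f' (f'' t) t)
    (hf : ∀ t ∈ Icc a b, ‖f t‖ ≤ B) (hf2 : ∀ t ∈ Icc a b, ‖f'' t‖ ≤ B) (hab : b = a + d) {t : ℝ}
    (ht : t = a ∨ t = b) : ‖f' t‖ ≤ 2 * B / d + B * d := by
  have hle : a ≤ b := by linarith
  have htm : t ∈ Icc a b := by rcases ht with rfl | rfl; exacts [⟨le_rfl, hle⟩, ⟨hle, le_rfl⟩]
  have hB : 0 ≤ B := (norm_nonneg _).trans (hf t htm)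
  have hder : ∀ s ∈ Icc a b, ‖f' s - f' t‖ ≤ B * d := fun s hs => by
    have h3 := (convex_Icc a b).norm_image_sub_le_of_norm_hasDerivWithin_le
      (fun x hx => (h2 x hx).hasDerivWithinAt) hf2 htm hs
    refine h3.trans ?_
    gcongr
    rw [Real.norm_eq_abs, abs_le]
    constructor <;> linarith [hs.1, hs.2, htm.1, htm.2]
  have h4 := (convex_Icc a b).norm_image_sub_le_of_norm_hasDerivWithin_le
    (f := fun s => f s - (s : ℂ) * f' t) (f' := fun s => f' s - f' t)
    (fun x hx => by
      have := (h1 x hx).fun_sub (((hasDerivAt_id x).ofReal_comp).mul_const (f' t))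
      simpa using this.hasDerivWithinAt) hder (left_mem_Icc.2 hle) (right_mem_Icc.2 hle)
  have e : (d : ℂ) * f' t = (f b - f a) - ((f b - (b : ℂ) * f' t) - (f a - (a : ℂ) * f' t)) := by
    rw [hab]; push_cast; ring
  have h5 : d * ‖f' t‖ ≤ 2 * B + B * d * d := by
    have h6 : ‖(d : ℂ) * f' t‖ = d * ‖f' t‖ := by
      rw [norm_mul, Complex.norm_real, Real.norm_eq_abs, abs_of_pos hd]
    rw [← h6, e]
    refine (norm_sub_le _ _).trans (add_le_add ?_ ?_)
    · refine (norm_sub_le _ _).trans ?_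
      linarith [hf a (left_mem_Icc.2 hle), hf b (right_mem_Icc.2 hle)]
    · refine h4.trans (le_of_eq ?_)
      rw [hab, Real.norm_eq_abs, abs_of_pos (by linarith)]; ring
  rw [div_add' _ _ _ hd.ne', le_div_iff₀ hd]
  linarith

/-- Interpolation on an interval of length d = r / (4R). On it r grows by at most a factor 4, and
the division by d costs a single power of r, which explains the exponent m in the conclusion against
m + 1 in the hypotheses. -/
theorem norm_deriv_le_weight {a l R B : ℝ} (m : ℕ) (ha : a = -1 ∨ a = 0) (hl : 0 < l)
    (hR1 : 1 ≤ R) {f f' f'' : ℝ → ℂ} (h1 : ∀ t ∈ Ioo a 1, HasDerivAt f (f' t) t)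
    (h2 : ∀ t ∈ Ioo a 1, HasDerivAt f' (f'' t) t) (hB : 0 ≤ B)
    (hR : ∀ t ∈ Icc a 1, t ^ 2 + l ^ 2 ≤ R)
    (hf : ∀ t ∈ Ioo a 1, ‖f t‖ ≤ B * (t ^ 2 + l ^ 2) ^ (m + 1))
    (hf2 : ∀ t ∈ Ioo a 1, ‖f'' t‖ ≤ B * (t ^ 2 + l ^ 2) ^ (m + 1)) :
    ∀ t ∈ Ioo a 1, ‖f' t‖ ≤ B * 4 ^ (m + 1) * (8 * R + R) * (t ^ 2 + l ^ 2) ^ m := by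
  intro t ht
  have ha1 : -1 ≤ a := by rcases ha with rfl | rfl <;> norm_num
  have ha0 : a ≤ 0 := by rcases ha with rfl | rfl <;> norm_num
  have htR := hR t ⟨ht.1.le, ht.2.le⟩
  set r := t ^ 2 + l ^ 2 with hrdef
  have hr : 0 < r := by positivity
  set d := r / (4 * R) with hd
  have hd0 : 0 < d := by positivity
  have hd4 : d ≤ 1 / 4 := by rw [hd, div_le_iff₀ (by positivity)]; linarith
  have hdr : d ≤ r / 4 := by
    rw [hd]; exact div_le_div_of_nonneg_left hr.le (by norm_num) (by linarith)
  have hr4 : ∀ s, |s - t| ≤ d → s ^ 2 + l ^ 2 ≤ 4 * r := fun s hs => by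
    have h3 : s ^ 2 = t ^ 2 + 2 * t * (s - t) + (s - t) ^ 2 := by ring
    have h4 : (s - t) ^ 2 ≤ d ^ 2 := by rw [← sq_abs]; gcongr
    have h5 : 2 * t * (s - t) ≤ 2 * d := by
      have ht1 : |t| ≤ 1 := abs_le.2 ⟨by linarith [ht.1], ht.2.le⟩
      have := (le_abs_self (t * (s - t))).trans_eq (abs_mul t (s - t))
      have := mul_le_mul ht1 hs (abs_nonneg _) zero_le_one
      linarith
    nlinarith
  have hbd : ∀ s, s ∈ Ioo a 1 → |s - t| ≤ d → ∀ φ : ℝ → ℂ,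
      (∀ t ∈ Ioo a 1, ‖φ t‖ ≤ B * (t ^ 2 + l ^ 2) ^ (m + 1)) →
      ‖φ s‖ ≤ B * (4 * r) ^ (m + 1) := fun s hs hsd φ hφ => by
    refine (hφ s hs).trans ?_
    have := hr4 s hsd
    gcongr
  have key : ‖f' t‖ ≤ 2 * (B * (4 * r) ^ (m + 1)) / d + B * (4 * r) ^ (m + 1) * d := by
    -- The interval is laid to the right or to the left of t so as to stay in (a, 1); d ≤ 1/4 and a
    -- ≤ 0 make this possible.
    rcases lt_or_ge t (1 / 2) with hlt | hge
    · have hsub : ∀ s ∈ Icc t (t + d), s ∈ Ioo a 1 ∧ |s - t| ≤ d := fun s hs =>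
        ⟨⟨ht.1.trans_le hs.1, by linarith [hs.2]⟩, by
          rw [abs_of_nonneg (by linarith [hs.1])]; linarith [hs.2]⟩
      exact norm_deriv_le_of_norm_second_deriv_le hd0 (a := t) (b := t + d)
        (fun s hs => h1 s (hsub s hs).1) (fun s hs => h2 s (hsub s hs).1)
        (fun s hs => hbd s (hsub s hs).1 (hsub s hs).2 f hf)
        (fun s hs => hbd s (hsub s hs).1 (hsub s hs).2 f'' hf2) rfl (Or.inl rfl)
    · have hsub : ∀ s ∈ Icc (t - d) t, s ∈ Ioo a 1 ∧ |s - t| ≤ d := fun s hs =>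
        ⟨⟨by linarith [hs.1], hs.2.trans_lt ht.2⟩, by
          rw [abs_of_nonpos (by linarith [hs.2])]; linarith [hs.1]⟩
      exact norm_deriv_le_of_norm_second_deriv_le hd0 (a := t - d) (b := t)
        (fun s hs => h1 s (hsub s hs).1) (fun s hs => h2 s (hsub s hs).1)
        (fun s hs => hbd s (hsub s hs).1 (hsub s hs).2 f hf)
        (fun s hs => hbd s (hsub s hs).1 (hsub s hs).2 f'' hf2) (by ring) (Or.inr rfl)
  refine key.trans ?_
  have e1 : 2 * (B * (4 * r) ^ (m + 1)) / d = B * 4 ^ (m + 1) * (8 * R) * r ^ m := by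
    rw [hd, mul_pow]; field_simp; ring
  have e2 : B * (4 * r) ^ (m + 1) * d ≤ B * 4 ^ (m + 1) * R * r ^ m := by
    calc B * (4 * r) ^ (m + 1) * d = B * 4 ^ (m + 1) * (r * d) * r ^ m := by rw [mul_pow]; ring
      _ ≤ _ := by
        gcongr
        calc r * d ≤ R * 1 := by gcongr; linarith
          _ = R := mul_one R
  exact (add_le_add e1.le e2).trans (le_of_eq (by ring))

end HypCyl

end

noncomputable section

namespace HypCyl
open Set Filter Topology

/-! ### Regularity for the model equation -/

/-- Multiplication by `τ² + ℓ²`. -/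
def rr : Fam := fun _ l t => ((t ^ 2 + l ^ 2 : ℝ) : ℂ)

/-- The potential of the model equation. -/
def pot (ε : ℝ) : Fam := fun k l t => (((t + ε * (k : ℤ)) ^ 2 + t ^ 2 + 2 * l ^ 2 : ℝ) : ℂ)

/-- The model operator. -/
def Qop (ε : ℝ) (f : Fam) : Fam := fun k l t =>
  (((t ^ 2 + l ^ 2) ^ 2 : ℝ) : ℂ) * pt (pt f) k l t
    - (((t + ε * (k : ℤ)) ^ 2 + t ^ 2 + 2 * l ^ 2 : ℝ) : ℂ) * f k l t

section

variable {S : Set (ℝ × ℝ)} {σ : ℕ} {s : ℤ} {f g G : Fam} {ε a : ℝ}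

theorem ClM.congr (hS : IsDom S) (hf : ClM S σ s f) (h : EqF S f g) : ClM S σ s g :=
  Cl.congr hS.isOpen (isAdditivePred_mod hS) hf h

theorem clM_mode (hS : IsDom S) (c : ℂ) : ClM S σ 0 (cst fun k => c * ((k : ℤ) : ℂ)) :=
  clM_cst hS (n := 1) (C := ‖c‖) fun k => by
    rw [norm_mul, pow_one, Complex.norm_intCast]; rfl

theorem clM_rr (hS : IsDom S) : ClM S σ 0 rr := by
  refine (((clM_t hS).mul_zero hS (clM_t hS)).add hS (clM_lpow hS 2)).congr hS fun k l t _ => ?_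
  simp only [rr, tfun, lfun, Pi.add_apply, Pi.mul_apply]
  push_cast; ring

theorem clM_pot (hS : IsDom S) (ε : ℝ) : ClM S σ 0 (pot ε) := by
  have h1 := (clM_t (σ := σ) hS).add hS (clM_mode hS ε)
  refine (((h1.mul_zero hS h1).add hS ((clM_t hS).mul_zero hS (clM_t hS))).add hS
    ((clM_const hS 2).mul_zero hS (clM_lpow hS 2))).congr hS fun k l t _ => ?_
  simp only [pot, tfun, lfun, cst, Pi.add_apply, Pi.mul_apply]
  push_cast; ring

theorem Qop_eq (ε : ℝ) (f : Fam) : Qop ε f = rr * rr * pt (pt f) + cst (fun _ => -1) * pot ε * f := by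
  ext k l t
  simp only [Qop, rr, pot, cst, Pi.add_apply, Pi.mul_apply]
  push_cast; ring

theorem EqF.Qop (hS : IsOpen S) (h : EqF S f g) : EqF S (Qop ε f) (Qop ε g) := fun k l t hp => by
  have := (h.pt hS).pt hS k l t hp
  simp only [HypCyl.Qop, this, h k l t hp]

theorem Qop_add (hS : IsOpen S) (hf : Sm S f) (hg : Sm S g) :
    EqF S (Qop ε (f + g)) (Qop ε f + Qop ε g) := fun k l t hp => by
  have h1 := ((pt_add hS hf hg).pt hS k l t hp).trans (pt_add hS (hf.pt hS) (hg.pt hS) k l t hp)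
  simp only [HypCyl.Qop, h1, Pi.add_apply]; ring

theorem pt_lfun_mul (c : ℝ → ℂ) (f : Fam) : pt (lfun c * f) = lfun c * pt f := by
  ext k l t
  change deriv (fun t => c l * f k l t) t = c l * deriv (f k l) t
  rw [deriv_const_mul_field]

theorem Qop_lfun_mul (c : ℝ → ℂ) (f : Fam) : Qop ε (lfun c * f) = lfun c * Qop ε f := by
  ext k l t
  simp only [HypCyl.Qop, pt_lfun_mul]
  simp only [lfun, Pi.mul_apply, HypCyl.Qop]; ring

theorem pl_rr (k : Mode) (l t : ℝ) : pl σ rr k l t = (l : ℂ) ^ σ * (2 * l) := by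
  have : HasDerivAt (fun l' : ℝ => ((t ^ 2 + l' ^ 2 : ℝ) : ℂ)) ((2 * l : ℝ) : ℂ) l := by
    refine HasDerivAt.ofReal_comp ?_
    simpa using (hasDerivAt_pow 2 l).const_add (t ^ 2)
  change (l : ℂ) ^ σ * deriv (fun l' : ℝ => ((t ^ 2 + l' ^ 2 : ℝ) : ℂ)) l = _
  rw [this.deriv]; push_cast; rfl

theorem pl_pot (k : Mode) (l t : ℝ) : pl σ (pot ε) k l t = (l : ℂ) ^ σ * (4 * l) := by
  have : HasDerivAt (fun l' : ℝ => (((t + ε * (k : ℤ)) ^ 2 + t ^ 2 + 2 * l' ^ 2 : ℝ) : ℂ))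
      ((4 * l : ℝ) : ℂ) l := by
    refine HasDerivAt.ofReal_comp ?_
    refine (((hasDerivAt_pow 2 l).const_mul 2).const_add _).congr_deriv ?_
    simp; ring
  change (l : ℂ) ^ σ * deriv
    (fun l' : ℝ => (((t + ε * (k : ℤ)) ^ 2 + t ^ 2 + 2 * l' ^ 2 : ℝ) : ℂ)) l = _
  rw [this.deriv]; push_cast; rfl

/-- The commutator of the model operator with `ℓ ^ σ ∂_ℓ`. -/
theorem Qop_pl (hS : IsDom S) (hf : Sm S f) : EqF S (Qop ε (pl σ f))
    (pl σ (Qop ε f) + cst (fun _ => -4) * lfun (fun l => (l : ℂ) ^ (σ + 1)) * (rr * pt (pt f))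
      + cst (fun _ => 4) * lfun (fun l => (l : ℂ) ^ (σ + 1)) * f) := fun k l t hp => by
  have ho := hS.isOpen
  have h2 := (hf.pt ho).pt ho
  have c1 := (pl_pt_comm (σ := σ) ho (hf.pt ho) k l t hp).trans
    ((pl_pt_comm (σ := σ) ho hf).pt ho k l t hp)
  have sr := (clM_rr (σ := 0) hS).1
  have sp := (clM_pot (σ := 0) hS ε).1
  have sc := (clM_const (σ := 0) hS (-1)).1
  rw [Qop_eq ε f]
  have e1 := pl_add (σ := σ) ho ((sr.mul sr).mul h2) ((sc.mul sp).mul hf) k l t hp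
  have e2 := pl_mul (σ := σ) ho (sr.mul sr) h2 k l t hp
  have e3 := pl_mul (σ := σ) ho sr sr k l t hp
  have e4 := pl_mul (σ := σ) ho (sc.mul sp) hf k l t hp
  have e5 := pl_mul (σ := σ) ho sc sp k l t hp
  have e6 : pl σ (cst fun _ => -1) k l t = 0 := by
    simp [HypCyl.pl, cst]
  simp only [Pi.add_apply, Pi.mul_apply] at e1 e2 e3 e4 e5 ⊢
  rw [e1, e2, e3, e4, e5, e6, pl_rr, pl_pot, c1]
  simp only [HypCyl.Qop, rr, pot, cst, lfun]
  push_cast; ring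

/-- As k.w ≥ 1 and r is bounded, large exponents imply small ones, so finitely many exponents may be
skipped. -/
theorem Rap.of_le (hS : IsDom S) (c : ℕ) (h : ∀ m : ℕ, ∃ C, ∀ k l t, (l, t) ∈ S →
    k.w ^ (m + c) * ‖f k l t‖ ≤ C * (t ^ 2 + l ^ 2) ^ (m + c) * l ^ s) : Rap S s f := fun m => by
  obtain ⟨C, hC⟩ := h m
  obtain ⟨R, hR⟩ := hS.bdd
  refine ⟨|C| * R ^ c, fun k l t hp => ?_⟩
  have hl := hS.pos hp
  have hr : 0 ≤ t ^ 2 + l ^ 2 := by positivity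
  have h1 : k.w ^ m ≤ k.w ^ (m + c) := pow_le_pow_right₀ k.one_le_w (by omega)
  calc k.w ^ m * ‖f k l t‖ ≤ k.w ^ (m + c) * ‖f k l t‖ := by gcongr
    _ ≤ C * (t ^ 2 + l ^ 2) ^ (m + c) * l ^ s := hC k l t hp
    _ ≤ |C| * ((t ^ 2 + l ^ 2) ^ m * R ^ c) * l ^ s := by
      rw [pow_add]; gcongr
      · exact le_abs_self C
      · exact hR hp
    _ = _ := by ring

variable {Λ : Set ℝ}

/-- The weighted maximum principle for each mode and each ℓ separately, with κ = εk. All dependence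
on k and ℓ sits in K = const · ℓ^s / k.w^(m+2), and the remaining constants are uniform. -/
theorem rap_of_Qop (hS : IsDom (Λ ×ˢ Ioo a 1)) (ha : a = -1 ∨ a = 0) (hε : |ε| = 1)
    (hf : Sm (Λ ×ˢ Ioo a 1) f) (h : EqF (Λ ×ˢ Ioo a 1) (Qop ε f) G)
    (hG : Rap (Λ ×ˢ Ioo a 1) s G)
    (hc : ∀ k, ∀ l ∈ Λ, ContinuousOn (f k l) (Icc a 1))
    (hb : ∀ m : ℕ, ∃ C, ∀ k, ∀ l ∈ Λ, ∀ t, t = a ∨ t = 1 →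
      k.w ^ m * ‖f k l t‖ ≤ C * (t ^ 2 + l ^ 2) ^ m * l ^ s) : Rap (Λ ×ˢ Ioo a 1) s f := by
  have ha1 : a < 1 := by rcases ha with rfl | rfl <;> norm_num
  have ha0 : a ≤ 0 := by rcases ha with rfl | rfl <;> norm_num
  have ha2 : -1 ≤ a := by rcases ha with rfl | rfl <;> norm_num
  obtain ⟨R, hR0, hR⟩ := hS.exists_le
  refine Rap.of_le hS 2 fun m => ?_
  obtain ⟨C, hC0, hC⟩ := hG.exists_nonneg hS (m + 3)
  obtain ⟨D, hD⟩ := hb (m + 2)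
  refine ⟨(C + |D|) * (1 + R ^ 2) ^ (m + 2) * (4 * (2 * (m + 2) + 4 * (m + 2) ^ 2) : ℝ) ^ (m + 2),
    fun k l t hp => ?_⟩
  have hl := hS.pos hp
  have hw := k.w_pos
  have hmem : ∀ {t}, t ∈ Ioo a 1 → (l, t) ∈ Λ ×ˢ Ioo a 1 := fun ht => ⟨hp.1, ht⟩
  have ho := hS.isOpen
  have hκ : |ε * (k : ℤ)| = k.w := by rw [abs_mul, hε, one_mul]; rfl
  have hls : 0 < l ^ s := zpow_pos hl s
  have hrn : ∀ t : ℝ, 0 ≤ t ^ 2 + l ^ 2 := fun t => by positivity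
  have key := norm_le_weight_of_eq (κ := ε * (k : ℤ)) (K := (C + |D|) * l ^ s / k.w ^ (m + 2))
    (R := 1 + R ^ 2) (f := f k l) (f' := pt f k l) (f'' := pt (pt f) k l) (G := G k l) m ha1.le hl
    (by rw [hκ]; exact k.one_le_w) (by positivity) (hc k l hp.1)
    (fun t ht => hf.hasDerivAt_pt ho k (hmem ht))
    (fun t ht => (hf.pt ho).hasDerivAt_pt ho k (hmem ht)) (fun t ht => h k l t (hmem ht))
    (by nlinarith) (fun t ht => by nlinarith [(hR hp).1, ht.1, ht.2]) (fun t ht => ?_)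
    (fun t ht => ?_) t ⟨hp.2.1.le, hp.2.2.le⟩
  · refine (mul_le_mul_of_nonneg_left key (pow_nonneg hw.le (m + 2))).trans (le_of_eq ?_)
    field_simp
  · rw [div_mul_eq_mul_div, le_div_iff₀ (by positivity), mul_comm]
    refine (hD k l hp.1 t ht).trans ?_
    have : D ≤ C + |D| := by linarith [le_abs_self D]
    calc D * (t ^ 2 + l ^ 2) ^ (m + 2) * l ^ s
        ≤ (C + |D|) * (t ^ 2 + l ^ 2) ^ (m + 2) * l ^ s := by
          have := hrn t
          gcongr
      _ = _ := by ring
  · rw [div_mul_eq_mul_div, le_div_iff₀ (by positivity), mul_comm]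
    have h1 : k.w ^ (m + 2) ≤ k.w ^ (m + 3) := pow_le_pow_right₀ k.one_le_w (by omega)
    calc k.w ^ (m + 2) * ‖G k l t‖ ≤ k.w ^ (m + 3) * ‖G k l t‖ := by gcongr
      _ ≤ C * (t ^ 2 + l ^ 2) ^ (m + 3) * l ^ s := hC k l t (hmem ht)
      _ ≤ (C + |D|) * (t ^ 2 + l ^ 2) ^ (m + 3) * l ^ s := by
          have := hrn t
          gcongr
          linarith [abs_nonneg D]
      _ = _ := by ring

theorem Rap.pt_of_pt_pt (hS : IsDom (Λ ×ˢ Ioo a 1)) (ha : a = -1 ∨ a = 0)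
    (hf : Sm (Λ ×ˢ Ioo a 1) f) (h0 : Rap (Λ ×ˢ Ioo a 1) s f)
    (h2 : Rap (Λ ×ˢ Ioo a 1) s (pt (pt f))) : Rap (Λ ×ˢ Ioo a 1) s (pt f) := fun m => by
  obtain ⟨R, hR0, hR⟩ := hS.exists_le
  obtain ⟨C, hC0, hC⟩ := h0.exists_nonneg hS (m + 1)
  obtain ⟨D, hD0, hD⟩ := h2.exists_nonneg hS (m + 1)
  have ha2 : -1 ≤ a := by rcases ha with rfl | rfl <;> norm_num
  refine ⟨(C + D) * 4 ^ (m + 1) * (8 * (1 + R ^ 2) + (1 + R ^ 2)), fun k l t hp => ?_⟩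
  have hl := hS.pos hp
  have hw := k.w_pos
  have ho := hS.isOpen
  have hmem : ∀ {t}, t ∈ Ioo a 1 → (l, t) ∈ Λ ×ˢ Ioo a 1 := fun ht => ⟨hp.1, ht⟩
  have hls : 0 < l ^ s := zpow_pos hl s
  have hb : ∀ (g : Fam) (E : ℝ), E ≤ C + D → (∀ k l t, (l, t) ∈ Λ ×ˢ Ioo a 1 →
      k.w ^ (m + 1) * ‖g k l t‖ ≤ E * (t ^ 2 + l ^ 2) ^ (m + 1) * l ^ s) → ∀ t ∈ Ioo a 1,
      ‖g k l t‖ ≤ (C + D) * l ^ s / k.w ^ (m + 1) * (t ^ 2 + l ^ 2) ^ (m + 1) :=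
    fun g E hE hg t ht => by
      rw [div_mul_eq_mul_div, le_div_iff₀ (by positivity), mul_comm]
      calc k.w ^ (m + 1) * ‖g k l t‖ ≤ E * (t ^ 2 + l ^ 2) ^ (m + 1) * l ^ s := hg k l t (hmem ht)
        _ ≤ (C + D) * (t ^ 2 + l ^ 2) ^ (m + 1) * l ^ s := by gcongr
        _ = _ := by ring
  have key := norm_deriv_le_weight (R := 1 + R ^ 2) (B := (C + D) * l ^ s / k.w ^ (m + 1)) m ha hl
    (by nlinarith) (fun t ht => hf.hasDerivAt_pt ho k (hmem ht))
    (fun t ht => (hf.pt ho).hasDerivAt_pt ho k (hmem ht)) (by positivity)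
    (fun t ht => by nlinarith [(hR hp).1, ht.1, ht.2]) (hb f C (by linarith) hC)
    (hb (pt (pt f)) D (by linarith) hD) t hp.2
  have h1 : k.w ^ m ≤ k.w ^ (m + 1) := pow_le_pow_right₀ k.one_le_w (by omega)
  calc k.w ^ m * ‖pt f k l t‖ ≤ k.w ^ (m + 1) * ‖pt f k l t‖ := by gcongr
    _ ≤ _ := mul_le_mul_of_nonneg_left key (by positivity)
    _ = _ := by field_simp

theorem pt_pt_eq_of_Qop (hS : IsDom S) (h : EqF S (Qop ε f) G) :
    EqF S (rinv * rinv * (G + pot ε * f)) (pt (pt f)) := fun k l t hp => by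
  have h1 := h k l t hp
  have hl := hS.pos hp
  have hr : ((t ^ 2 + l ^ 2 : ℝ) : ℂ) ≠ 0 := by
    have : 0 < t ^ 2 + l ^ 2 := by positivity
    exact_mod_cast this.ne'
  simp only [rinv, pot, Pi.add_apply, Pi.mul_apply, ← h1, HypCyl.Qop, Complex.ofReal_inv,
    Complex.ofReal_pow _ 2]
  push_cast at hr ⊢
  field_simp
  ring

/-- f is bounded by the maximum principle, ∂_τ² f = r⁻² (G + V f) by the equation, and ∂_τ f by
interpolation. After that the equation gains two derivatives at a time, so f and ∂_τ f are carried
together through the induction; r⁻² is only moderate and does no harm to rapid decrease. -/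
theorem tc_of_Qop (hS : IsDom (Λ ×ˢ Ioo a 1)) (ha : a = -1 ∨ a = 0) (hε : |ε| = 1)
    (hf : Sm (Λ ×ˢ Ioo a 1) f) (sG : Sm (Λ ×ˢ Ioo a 1) G)
    (h : EqF (Λ ×ˢ Ioo a 1) (Qop ε f) G)
    (hG : ∀ J, Tc (Rap (Λ ×ˢ Ioo a 1) s) J G)
    (hc : ∀ k, ∀ l ∈ Λ, ContinuousOn (f k l) (Icc a 1))
    (hb : ∀ m : ℕ, ∃ C, ∀ k, ∀ l ∈ Λ, ∀ t, t = a ∨ t = 1 →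
      k.w ^ m * ‖f k l t‖ ≤ C * (t ^ 2 + l ^ 2) ^ m * l ^ s) (J : ℕ) :
    Tc (Rap (Λ ×ˢ Ioo a 1) s) J f := by
  have ho := hS.isOpen
  have hP := isAdditivePred_rap (S := Λ ×ˢ Ioo a 1) (s := s)
  have hm : ∀ {f g}, Mod (Λ ×ˢ Ioo a 1) 0 f → Rap (Λ ×ˢ Ioo a 1) s g →
      Rap (Λ ×ˢ Ioo a 1) s (f * g) := fun h h' => by simpa using Mod.mul_rap hS h h'
  have hri := (clM_rinv (σ := 0) hS).mul_zero hS (clM_rinv hS)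
  have hpo := clM_pot (σ := 0) hS ε
  have e := pt_pt_eq_of_Qop hS h
  have h0 := rap_of_Qop hS ha hε hf h (hG 0) hc hb
  have hstep : ∀ J, Tc (Rap (Λ ×ˢ Ioo a 1) s) J f →
      Tc (Rap (Λ ×ˢ Ioo a 1) s) J (pt (pt f)) := fun J hJ => by
    refine Tc.congr ho hP e ?_
    refine Tc.mul ho hP hm hri.1 (sG.add (hpo.1.mul hf)) (hri.2 0 J).tc ?_
    exact (hG J).add ho hP sG (hpo.1.mul hf) (Tc.mul ho hP hm hpo.1 hf (hpo.2 0 J).tc hJ)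
  have h1 := h0.pt_of_pt_pt hS ha hf (hstep 0 h0)
  suffices Tc (Rap (Λ ×ˢ Ioo a 1) s) J f ∧ Tc (Rap (Λ ×ˢ Ioo a 1) s) J (pt f) from this.1
  induction J with
  | zero => exact ⟨h0, h1⟩
  | succ J ih => exact ⟨⟨h0, ih.2⟩, h1, hstep J ih.1⟩

/-- ℓ^σ ∂_ℓ f solves the same equation with the source changed by the commutator of Q with ℓ^σ ∂_ℓ.
The commutator contains ∂_τ² f but no further ℓ-derivative, so it is controlled once n ℓ-derivatives
are known together with all τ-derivatives. -/
theorem cc_of_Qop (hS : IsDom (Λ ×ˢ Ioo a 1)) (ha : a = -1 ∨ a = 0) (hε : |ε| = 1) (n : ℕ)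
    (hf : Sm (Λ ×ˢ Ioo a 1) f) (sG : Sm (Λ ×ˢ Ioo a 1) G)
    (h : EqF (Λ ×ˢ Ioo a 1) (Qop ε f) G)
    (hG : ∀ J, Cc σ (Rap (Λ ×ˢ Ioo a 1) s) n J G)
    (hc : ∀ i k, ∀ l ∈ Λ, ContinuousOn ((pl σ)^[i] f k l) (Icc a 1))
    (hb : ∀ i, ∀ m : ℕ, ∃ C, ∀ k, ∀ l ∈ Λ, ∀ t, t = a ∨ t = 1 →
      k.w ^ m * ‖(pl σ)^[i] f k l t‖ ≤ C * (t ^ 2 + l ^ 2) ^ m * l ^ s) (J : ℕ) :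
    Cc σ (Rap (Λ ×ˢ Ioo a 1) s) n J f := by
  induction n generalizing f G J with
  | zero => exact tc_of_Qop hS ha hε hf sG h hG (hc 0) (hb 0) J
  | succ n ih =>
    have ho := hS.isOpen
    have hP := isAdditivePred_rap (S := Λ ×ˢ Ioo a 1) (s := s)
    have hm : ∀ {f g}, Mod (Λ ×ˢ Ioo a 1) 0 f → Rap (Λ ×ˢ Ioo a 1) s g →
        Rap (Λ ×ˢ Ioo a 1) s (f * g) := fun h h' => by simpa using Mod.mul_rap hS h h'
    refine ⟨tc_of_Qop hS ha hε hf sG h (fun J => (hG J).1) (hc 0) (hb 0) J, ?_⟩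
    have hn : ∀ J, Cc σ (Rap (Λ ×ˢ Ioo a 1) s) n J f :=
      ih hf sG h (fun J => (hG J).of_succ) hc hb
    have h2 := fun J => ((hn (J + 2)).pt ho hP hf).pt ho hP (hf.pt ho)
    have s2 := (hf.pt ho).pt ho
    have c1 := ((clM_const (σ := σ) hS (-4)).mul_zero hS (clM_lpow hS (σ + 1))).mul_zero hS
      (clM_rr hS)
    have c2 := (clM_const (σ := σ) hS 4).mul_zero hS (clM_lpow hS (σ + 1))
    refine ih (G := pl σ G
        + cst (fun _ => -4) * lfun (fun l => (l : ℂ) ^ (σ + 1)) * rr * pt (pt f)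
        + cst (fun _ => 4) * lfun (fun l => (l : ℂ) ^ (σ + 1)) * f) (hf.pl ho)
      (((sG.pl ho).add (c1.1.mul s2)).add (c2.1.mul hf)) (fun k l t hp => ?_) (fun J => ?_)
      (fun i => hc (i + 1)) (fun i => hb (i + 1)) J
    · rw [Qop_pl hS hf k l t hp]
      have := h.pl (σ := σ) ho k l t hp
      simp only [Pi.add_apply, Pi.mul_apply, this]; ring
    · exact (((hG J).2).add ho hP (sG.pl ho) (c1.1.mul s2)
        (Cc.mul ho hP hm c1.1 s2 (c1.2 n J) (h2 J))).add ho hP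
        ((sG.pl ho).add (c1.1.mul s2)) (c2.1.mul hf) (Cc.mul ho hP hm c2.1 hf (c2.2 n J) (hn J))

/-- Solutions of the model equation with right hand side in a class belong to the class, if their
boundary values do. -/
theorem clR_of_Qop (hS : IsDom (Λ ×ˢ Ioo a 1)) (ha : a = -1 ∨ a = 0) (hε : |ε| = 1)
    (hf : Sm (Λ ×ˢ Ioo a 1) f) (h : EqF (Λ ×ˢ Ioo a 1) (Qop ε f) G)
    (hG : ClR (Λ ×ˢ Ioo a 1) σ s G)
    (hc : ∀ i k, ∀ l ∈ Λ, ContinuousOn ((pl σ)^[i] f k l) (Icc a 1))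
    (hb : ∀ i, ∀ m : ℕ, ∃ C, ∀ k, ∀ l ∈ Λ, ∀ t, t = a ∨ t = 1 →
      k.w ^ m * ‖(pl σ)^[i] f k l t‖ ≤ C * (t ^ 2 + l ^ 2) ^ m * l ^ s) :
    ClR (Λ ×ˢ Ioo a 1) σ s f :=
  ⟨hf, fun I J => cc_of_Qop hS ha hε I hf hG.1 h (hG.2 I) hc hb J⟩

end

end HypCyl

end

/-! ### Explicit solution of the model equation by reduction of order -/

noncomputable section

namespace HypCyl
open Set Filter Topology

/-! ### Families that are smooth up to the lateral boundary -/

/-- The open strip `(0, R) × (-1, 1)`. -/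
abbrev strip (R : ℝ) : Set (ℝ × ℝ) := Ioo 0 R ×ˢ Ioo (-1) 1

/-- The strip `(0, R) × [-1, 1]`. -/
abbrev cstrip (R : ℝ) : Set (ℝ × ℝ) := Ioo 0 R ×ˢ Icc (-1) 1

section

variable {R : ℝ} {σ : ℕ} {f g G : Fam} {ε : ℝ}

theorem strip_subset_cstrip : strip R ⊆ cstrip R := prod_mono_right Ioo_subset_Icc_self

theorem isDom_prod {R a b : ℝ} : IsDom (Ioo 0 R ×ˢ Ioo a b) where
  isOpen := isOpen_Ioo.prod isOpen_Ioo
  pos h := h.1.1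
  bdd := ⟨(|a| + |b|) ^ 2 + R ^ 2, fun {l t} h => by
    have h1 : |t| ≤ |a| + |b| := abs_le.2
      ⟨by linarith [h.2.1, neg_abs_le a, abs_nonneg b], by linarith [h.2.2, le_abs_self b, abs_nonneg a]⟩
    have h2 : t ^ 2 ≤ (|a| + |b|) ^ 2 := by rw [← sq_abs t]; gcongr
    nlinarith [h.1.1, h.1.2]⟩

theorem convex_cstrip : Convex ℝ (cstrip R) := (convex_Ioo 0 R).prod (convex_Icc (-1) 1)

theorem interior_cstrip : interior (cstrip R) = strip R := by
  rw [interior_prod_eq, interior_Icc, isOpen_Ioo.interior_eq]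

theorem uniqueDiffOn_cstrip : UniqueDiffOn ℝ (cstrip R) :=
  isOpen_Ioo.uniqueDiffOn.prod (uniqueDiffOn_Icc (by norm_num))

theorem Sm.neg {S : Set (ℝ × ℝ)} (hf : Sm S f) : Sm S (-f) := fun k => (hf k).neg

theorem sm_cst {S : Set (ℝ × ℝ)} (c : Mode → ℂ) : Sm S (cst c) := fun _ => contDiffOn_const

theorem sm_of_left {S : Set (ℝ × ℝ)} {c : Mode → ℝ → ℂ}
    (hc : ∀ k, ContDiffOn ℝ (⊤ : ℕ∞) (c k) (Ioo 0 R)) (hS : ∀ p ∈ S, p.1 ∈ Ioo 0 R) :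
    Sm S (fun k l _ => c k l) :=
  fun k => (hc k).comp contDiffOn_fst hS

theorem Sm.left (hf : Sm (cstrip R) f) {t : ℝ} (ht : t ∈ Icc (-1 : ℝ) 1) (k : Mode) :
    ContDiffOn ℝ (⊤ : ℕ∞) (fun l => f k l t) (Ioo 0 R) :=
  (hf k).comp (f := fun l : ℝ => (l, t)) (by fun_prop) fun _ hl => ⟨hl, ht⟩

theorem Sm.continuousOn_right (hf : Sm (cstrip R) f) (k : Mode) {l : ℝ} (hl : l ∈ Ioo 0 R) :
    ContinuousOn (f k l) (Icc (-1) 1) :=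
  (hf k).continuousOn.comp (f := fun t : ℝ => (l, t)) (by fun_prop) fun _ ht => ⟨hl, ht⟩

theorem Sm.pl_eq_fderivWithin (hf : Sm (cstrip R) f) (k : Mode) {l t : ℝ}
    (hl : l ∈ Ioo 0 R) (ht : t ∈ Icc (-1 : ℝ) 1) : HypCyl.pl σ f k l t =
      (l : ℂ) ^ σ * fderivWithin ℝ (fun p : ℝ × ℝ => f k p.1 p.2) (cstrip R) (l, t) (1, 0) := by
  have h1 : HasDerivWithinAt (fun l' : ℝ => (l', t)) (1, 0) (Ioo 0 R) l :=
    ((hasDerivAt_id l).prodMk (hasDerivAt_const l t)).hasDerivWithinAt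
  have h2 := ((((hf k).differentiableOn (by simp)) (l, t) ⟨hl, ht⟩).hasFDerivWithinAt).comp_hasDerivWithinAt
    (f := fun l' : ℝ => (l', t)) (s := Ioo 0 R) l h1 fun l' hl' => ⟨hl', ht⟩
  have h3 := (h2.hasDerivAt (isOpen_Ioo.mem_nhds hl)).deriv
  simp only [HypCyl.pl]
  rw [← h3]; rfl

theorem Sm.pl_closed (hf : Sm (cstrip R) f) : Sm (cstrip R) (HypCyl.pl σ f) := fun k => by
  refine ContDiffOn.congr ?_ fun p hp => hf.pl_eq_fderivWithin k hp.1 hp.2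
  exact (contDiff_ofReal_fst_pow σ).contDiffOn.mul
    (((hf k).fderivWithin uniqueDiffOn_cstrip (by norm_cast)).clm_apply contDiffOn_const)

theorem Sm.pl_iterate (hf : Sm (cstrip R) f) (i : ℕ) : Sm (cstrip R) ((HypCyl.pl σ)^[i] f) := by
  induction i generalizing f with
  | zero => exact hf
  | succ i ih => exact ih hf.pl_closed

theorem pl_iterate_congr_left {t : ℝ} (h : ∀ k, ∀ l ∈ Ioo 0 R, f k l t = g k l t) (i : ℕ) :
    ∀ k, ∀ l ∈ Ioo 0 R, (pl σ)^[i] f k l t = (pl σ)^[i] g k l t := by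
  induction i generalizing f g with
  | zero => exact h
  | succ i ih =>
    refine ih fun k l hl => ?_
    have : (fun l' => f k l' t) =ᶠ[𝓝 l] fun l' => g k l' t := by
      filter_upwards [isOpen_Ioo.mem_nhds hl] with l' hl' using h k l' hl'
    simp only [pl, this.deriv_eq]

theorem pl_iterate_zero (i : ℕ) : (pl σ)^[i] 0 = 0 := by
  induction i with
  | zero => rfl
  | succ i ih =>
    have : pl σ 0 = 0 := by
      ext k l t
      change (l : ℂ) ^ σ * deriv (fun _ => (0 : ℂ)) l = 0
      simp
    rw [Function.iterate_succ_apply, this, ih]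

/-! ### Solving the model equation -/

/-- The primitive in `τ` that vanishes at `τ = 0`. -/
def prim (f : Fam) : Fam := fun k l t => ∫ x in (0 : ℝ)..t, f k l x

theorem Sm.prim (hR : 0 < R) (hf : Sm (cstrip R) f) : Sm (cstrip R) (prim f) := fun k => by
  -- The primitive equals τ ∫₀¹ f(ℓ, xτ) dx. With fixed limits, smoothness up to τ = ±1 follows from
  -- that of parameter integrals.
  have h : ContDiffOn ℝ (⊤ : ℕ∞) (fun p : ℝ × ℝ => ∫ x in (0 : ℝ)..1, f k p.1 (x * p.2))
      (cstrip R) := by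
    refine contDiffOn_intervalIntegral convex_cstrip ?_ zero_lt_one
      (G := fun (p : ℝ × ℝ) x => f k p.1 (x * p.2)) ?_
    · rw [interior_cstrip]
      exact ⟨(R / 2, 0), ⟨by linarith, by linarith⟩, by norm_num, by norm_num⟩
    · refine (hf k).comp (f := fun q : (ℝ × ℝ) × ℝ => (q.1.1, q.2 * q.1.2)) (by fun_prop) ?_
      rintro ⟨⟨l, t⟩, x⟩ ⟨⟨hl, ht⟩, hx⟩
      refine ⟨hl, abs_le.1 ?_⟩
      simp only [abs_mul]
      exact mul_le_one₀ (abs_le.2 ⟨by linarith [hx.1], hx.2⟩) (abs_nonneg _) (abs_le.2 ht)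
  have h2 : ContDiffOn ℝ (⊤ : ℕ∞) (fun p : ℝ × ℝ => (p.2 : ℂ)) (cstrip R) :=
    (Complex.ofRealCLM.contDiff.comp contDiff_snd).contDiffOn
  refine (h2.mul h).congr fun p _ => ?_
  have := intervalIntegral.smul_integral_comp_mul_right (a := 0) (b := 1) (f k p.1) p.2
  simp only [zero_mul, one_mul, Complex.real_smul] at this
  exact this.symm

theorem hasDerivAt_prim (hf : Sm (cstrip R) f) (k : Mode) {l t : ℝ} (hl : l ∈ Ioo 0 R)
    (ht : t ∈ Ioo (-1 : ℝ) 1) : HasDerivAt (prim f k l) (f k l t) t := by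
  have hc := hf.continuousOn_right k hl
  have hsub : uIcc 0 t ⊆ Icc (-1) 1 := by
    rw [← uIcc_of_le (by norm_num : (-1 : ℝ) ≤ 1)]
    refine uIcc_subset_uIcc ?_ ?_ <;> rw [uIcc_of_le (by norm_num)]
    · norm_num
    · exact Ioo_subset_Icc_self ht
  have hcd := hc.mono (Ioo_subset_Icc_self (a := (-1 : ℝ)) (b := 1))
  refine intervalIntegral.integral_hasDerivAt_right ((hc.mono hsub).intervalIntegrable) ?_
    (hcd.continuousAt (isOpen_Ioo.mem_nhds ht))
  exact hcd.stronglyMeasurableAtFilter isOpen_Ioo t ht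

/-- A positive solution of the homogeneous model equation. -/
def homSol (ε : ℝ) : Fam := fun k l t =>
  (((t ^ 2 + l ^ 2) * Real.exp (ε * (k : ℤ) * (Real.arctan (t / l) / l)) : ℝ) : ℂ)

theorem homSol_pos {k : Mode} {l : ℝ} (hl : 0 < l) (t : ℝ) :
    0 < (t ^ 2 + l ^ 2) * Real.exp (ε * (k : ℤ) * (Real.arctan (t / l) / l)) := by positivity

theorem homSol_ne_zero {k : Mode} {l : ℝ} (hl : 0 < l) (t : ℝ) : homSol ε k l t ≠ 0 := by
  simpa only [homSol, ne_eq, Complex.ofReal_eq_zero] using (homSol_pos hl t).ne'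

theorem sm_homSol : Sm (cstrip R) (homSol ε) := fun k => by
  refine Complex.ofRealCLM.contDiff.comp_contDiffOn ?_
  have h1 : ContDiffOn ℝ (⊤ : ℕ∞) (fun p : ℝ × ℝ => p.2 / p.1) (cstrip R) :=
    contDiffOn_snd.div contDiffOn_fst fun p hp => hp.1.1.ne'
  have h2 : ContDiffOn ℝ (⊤ : ℕ∞) (fun p : ℝ × ℝ => Real.arctan (p.2 / p.1) / p.1) (cstrip R) :=
    (Real.contDiff_arctan.comp_contDiffOn h1).div contDiffOn_fst fun p hp => hp.1.1.ne'
  exact (((contDiff_snd.pow 2).add (contDiff_fst.pow 2)).contDiffOn).mul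
    (Real.contDiff_exp.comp_contDiffOn (contDiffOn_const.mul h2))

/-- The derivative of `homSol`. -/
def homSol' (ε : ℝ) : Fam := fun k l t =>
  (((2 * t + ε * (k : ℤ)) * Real.exp (ε * (k : ℤ) * (Real.arctan (t / l) / l)) : ℝ) : ℂ)

/-- The second derivative of `homSol`. -/
def homSol'' (ε : ℝ) : Fam := fun k l t =>
  (((((t + ε * (k : ℤ)) ^ 2 + t ^ 2 + 2 * l ^ 2) / (t ^ 2 + l ^ 2)) *
    Real.exp (ε * (k : ℤ) * (Real.arctan (t / l) / l)) : ℝ) : ℂ)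

theorem hasDerivAt_exp_arctan (κ : ℝ) {l : ℝ} (hl : 0 < l) (t : ℝ) :
    HasDerivAt (fun t => Real.exp (κ * (Real.arctan (t / l) / l)))
      (Real.exp (κ * (Real.arctan (t / l) / l)) * (κ / (t ^ 2 + l ^ 2))) t := by
  refine ((((hasDerivAt_id t).div_const l).arctan.div_const l).const_mul κ).exp.congr_deriv ?_
  have : t ^ 2 + l ^ 2 ≠ 0 := by positivity
  simp only [id]
  field_simp
  ring

theorem hasDerivAt_homSol (k : Mode) {l : ℝ} (hl : 0 < l) (t : ℝ) :
    HasDerivAt (homSol ε k l) (homSol' ε k l t) t := by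
  refine HasDerivAt.ofReal_comp ?_
  refine (((hasDerivAt_pow 2 t).add_const (l ^ 2)).mul
    (hasDerivAt_exp_arctan (ε * (k : ℤ)) hl t)).congr_deriv ?_
  have : t ^ 2 + l ^ 2 ≠ 0 := by positivity
  field_simp
  simp; ring

theorem hasDerivAt_homSol' (k : Mode) {l : ℝ} (hl : 0 < l) (t : ℝ) :
    HasDerivAt (homSol' ε k l) (homSol'' ε k l t) t := by
  refine HasDerivAt.ofReal_comp ?_
  refine ((((hasDerivAt_id t).const_mul 2).add_const (ε * (k : ℤ))).mul
    (hasDerivAt_exp_arctan (ε * (k : ℤ)) hl t)).congr_deriv ?_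
  have : t ^ 2 + l ^ 2 ≠ 0 := by positivity
  field_simp
  simp; ring

/-- `1 / F ^ 2`. -/
def homSolInvSq (ε : ℝ) : Fam := fun k l t => (homSol ε k l t ^ 2)⁻¹

/-- `∫ 1 / F ^ 2`. -/
def solJ (ε : ℝ) : Fam := prim (homSolInvSq ε)

/-- `∫ F G / r ^ 2`. -/
def solI (ε : ℝ) (G : Fam) : Fam := prim (homSol ε * G * (rinv * rinv))

/-- A particular solution, divided by `F`. -/
def solK (ε : ℝ) (G : Fam) : Fam := prim (homSolInvSq ε * solI ε G)

/-- The coefficient adjusting the boundary value at `τ = -1`. -/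
def solB (ε : ℝ) (G : Fam) : Fam := fun k l _ =>
  -(solK ε G k l 1 - solK ε G k l (-1)) / (solJ ε k l 1 - solJ ε k l (-1))

/-- The coefficient adjusting the boundary value at `τ = 1`. -/
def solA (ε : ℝ) (G : Fam) : Fam := fun k l t =>
  -(solB ε G k l t * solJ ε k l 1) - solK ε G k l 1

/-- The solution of the model equation with vanishing boundary values. -/
def solve (ε : ℝ) (G : Fam) : Fam := homSol ε * (solA ε G + solB ε G * solJ ε + solK ε G)

theorem sm_homSolInvSq : Sm (cstrip R) (homSolInvSq ε) := fun k =>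
  ((sm_homSol k).pow 2).inv fun _ hp => pow_ne_zero 2 (homSol_ne_zero hp.1.1 _)

theorem sm_solJ (hR : 0 < R) : Sm (cstrip R) (solJ ε) := sm_homSolInvSq.prim hR

theorem sm_rinv_closed : Sm (cstrip R) rinv := fun _ => by
  refine Complex.ofRealCLM.contDiff.comp_contDiffOn ?_
  refine ((contDiff_snd.pow 2).add (contDiff_fst.pow 2)).contDiffOn.inv fun p hp => ?_
  have := hp.1.1
  positivity

theorem sm_solI (hR : 0 < R) (hG : Sm (cstrip R) G) : Sm (cstrip R) (solI ε G) :=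
  ((sm_homSol.mul hG).mul (sm_rinv_closed.mul sm_rinv_closed)).prim hR

theorem sm_solK (hR : 0 < R) (hG : Sm (cstrip R) G) : Sm (cstrip R) (solK ε G) :=
  (sm_homSolInvSq.mul (sm_solI hR hG)).prim hR

/-- F is real and nowhere zero, so the integral of F⁻² over [-1, 1] is positive. This is the
solvability condition: the difference is the denominator in `solB`. -/
theorem solJ_ne (k : Mode) {l : ℝ} (hl : 0 < l) : solJ ε k l 1 - solJ ε k l (-1) ≠ 0 := by
  have hc : ContinuousOn (homSolInvSq ε k l) (Icc (-1) 1) :=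
    (sm_homSolInvSq (R := l + 1)).continuousOn_right k ⟨hl, by linarith⟩
  have hii : ∀ a b : ℝ, a ∈ Icc (-1 : ℝ) 1 → b ∈ Icc (-1 : ℝ) 1 →
      IntervalIntegrable (homSolInvSq ε k l) MeasureTheory.volume a b := fun a b ha hb => by
    refine (hc.mono ?_).intervalIntegrable
    rw [← uIcc_of_le (by norm_num : (-1 : ℝ) ≤ 1)] at ha hb ⊢
    exact uIcc_subset_uIcc ha hb
  have e : solJ ε k l 1 - solJ ε k l (-1) = ∫ x in (-1 : ℝ)..1, homSolInvSq ε k l x :=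
    intervalIntegral.integral_interval_sub_left (hii 0 1 (by norm_num) (by norm_num))
      (hii 0 (-1) (by norm_num) (by norm_num))
  set φ : ℝ → ℝ := fun t =>
    (((t ^ 2 + l ^ 2) * Real.exp (ε * (k : ℤ) * (Real.arctan (t / l) / l))) ^ 2)⁻¹ with hφ
  have e2 : ∀ x, homSolInvSq ε k l x = ((φ x : ℝ) : ℂ) := fun x => by
    simp only [homSolInvSq, homSol, hφ, Complex.ofReal_inv, Complex.ofReal_pow]
  have hφc : ContinuousOn φ (Icc (-1) 1) := by
    refine (Complex.continuous_re.comp_continuousOn hc).congr fun x _ => ?_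
    simp only [Function.comp, e2, Complex.ofReal_re]
  rw [e, intervalIntegral.integral_congr (g := fun x => ((φ x : ℝ) : ℂ)) fun x _ => e2 x,
    intervalIntegral.integral_ofReal]
  have hpos : 0 < ∫ x in (-1 : ℝ)..1, φ x := by
    refine intervalIntegral.intervalIntegral_pos_of_pos_on ?_ (fun x _ => ?_) (by norm_num)
    · refine ContinuousOn.intervalIntegrable ?_
      rwa [uIcc_of_le (by norm_num)]
    · have := homSol_pos (ε := ε) (k := k) hl x
      positivity
  exact_mod_cast hpos.ne'

theorem contDiffOn_solB (hR : 0 < R) (hG : Sm (cstrip R) G) (k : Mode) (t : ℝ) :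
    ContDiffOn ℝ (⊤ : ℕ∞) (fun l => solB ε G k l t) (Ioo 0 R) := by
  have h1 : (1 : ℝ) ∈ Icc (-1 : ℝ) 1 := by norm_num
  have h2 : (-1 : ℝ) ∈ Icc (-1 : ℝ) 1 := by norm_num
  have hK := sm_solK (ε := ε) hR hG
  have hJ := sm_solJ (ε := ε) hR
  simp only [solB, div_eq_mul_inv]
  exact ((hK.left h1 k).sub (hK.left h2 k)).neg.mul
    (((hJ.left h1 k).sub (hJ.left h2 k)).inv fun l hl => solJ_ne k hl.1)

theorem sm_solB (hR : 0 < R) (hG : Sm (cstrip R) G) : Sm (cstrip R) (solB ε G) :=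
  sm_of_left (c := fun k l => solB ε G k l 0) (fun k => contDiffOn_solB hR hG k 0) fun _ hp => hp.1

theorem sm_solA (hR : 0 < R) (hG : Sm (cstrip R) G) : Sm (cstrip R) (solA ε G) := by
  have h1 : (1 : ℝ) ∈ Icc (-1 : ℝ) 1 := by norm_num
  exact sm_of_left (c := fun k l => solA ε G k l 0) (fun k => ((contDiffOn_solB hR hG k 0).mul
    ((sm_solJ hR).left h1 k)).neg.sub ((sm_solK hR hG).left h1 k)) fun _ hp => hp.1

theorem sm_solve (hR : 0 < R) (hG : Sm (cstrip R) G) : Sm (cstrip R) (solve ε G) :=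
  sm_homSol.mul (((sm_solA hR hG).add ((sm_solB hR hG).mul (sm_solJ hR))).add (sm_solK hR hG))

theorem solve_one (k : Mode) (l : ℝ) : solve ε G k l 1 = 0 := by
  simp only [solve, solA, Pi.mul_apply, Pi.add_apply]
  ring

theorem solve_neg_one (k : Mode) {l : ℝ} (hl : 0 < l) : solve ε G k l (-1) = 0 := by
  have h := solJ_ne (ε := ε) k hl
  simp only [solve, solA, solB, Pi.mul_apply, Pi.add_apply]
  field_simp
  ring

/-- Reduction of order: for f = F g with Q F = 0, the equation Q f = G becomes (F² g')' = F G / r²,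
that is, g' = F⁻² (b + ∫ F G / r²) with a constant b. -/
theorem Qop_solve (hR : 0 < R) (hG : Sm (cstrip R) G) : EqF (strip R) (Qop ε (solve ε G)) G := by
  intro k l t hp
  have hl := hp.1
  have hr0 : ∀ t : ℝ, ((t ^ 2 + l ^ 2 : ℝ) : ℂ) ≠ 0 := fun t => by
    have : 0 < t ^ 2 + l ^ 2 := by have := hl.1; positivity
    exact_mod_cast this.ne'
  have hF0 : ∀ t, homSol ε k l t ≠ 0 := homSol_ne_zero hl.1
  set g : ℝ → ℂ := fun t => solA ε G k l t + solB ε G k l t * solJ ε k l t + solK ε G k l t with hg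
  set b := solB ε G k l 0
  have hdg : ∀ t ∈ Ioo (-1 : ℝ) 1, HasDerivAt g
      (homSolInvSq ε k l t * (b + solI ε G k l t)) t := fun t ht => by
    have h1 : HasDerivAt (solJ ε k l) (homSolInvSq ε k l t) t :=
      hasDerivAt_prim (R := R) sm_homSolInvSq k hl ht
    have h2 : HasDerivAt (solK ε G k l) (homSolInvSq ε k l t * solI ε G k l t) t :=
      hasDerivAt_prim (sm_homSolInvSq.mul (sm_solI hR hG)) k hl ht
    have h3 := ((h1.const_mul b).const_add (solA ε G k l 0)).add h2
    exact h3.congr_deriv (by ring)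
  have hd1 : ∀ t ∈ Ioo (-1 : ℝ) 1, HasDerivAt (solve ε G k l)
      (homSol' ε k l t * g t + (homSol ε k l t)⁻¹ * (b + solI ε G k l t)) t := fun t ht => by
    refine ((hasDerivAt_homSol k hl.1 t).mul (hdg t ht)).congr_deriv ?_
    have := hF0 t
    simp only [homSolInvSq]
    field_simp
  have hI : ∀ t ∈ Ioo (-1 : ℝ) 1, HasDerivAt (solI ε G k l)
      (homSol ε k l t * G k l t * (rinv k l t * rinv k l t)) t := fun t ht =>
    hasDerivAt_prim ((sm_homSol.mul hG).mul (sm_rinv_closed.mul sm_rinv_closed)) k hl ht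
  have hd2 : HasDerivAt (pt (solve ε G) k l)
      (homSol'' ε k l t * g t + G k l t * (rinv k l t * rinv k l t)) t := by
    have h1 := ((hasDerivAt_homSol' (ε := ε) k hl.1 t).mul (hdg t hp.2)).add
      (((hasDerivAt_homSol (ε := ε) k hl.1 t).inv (hF0 t)).mul ((hI t hp.2).const_add b))
    refine (h1.congr_deriv ?_).congr_of_eventuallyEq ?_
    · have := hF0 t
      simp only [homSolInvSq, Pi.inv_apply]
      field_simp
      ring
    · filter_upwards [isOpen_Ioo.mem_nhds hp.2] with t ht using (hd1 t ht).deriv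
  have e1 : pt (pt (solve ε G)) k l t = _ := hd2.deriv
  have e2 : solve ε G k l t = homSol ε k l t * g t := rfl
  have e3 : (((t ^ 2 + l ^ 2) ^ 2 : ℝ) : ℂ) * homSol'' ε k l t
      = (((t + ε * (k : ℤ)) ^ 2 + t ^ 2 + 2 * l ^ 2 : ℝ) : ℂ) * homSol ε k l t := by
    simp only [homSol'', homSol]
    rw [← Complex.ofReal_mul, ← Complex.ofReal_mul]
    congr 1
    have : t ^ 2 + l ^ 2 ≠ 0 := by have := hl.1; positivity
    field_simp
  have e4 : (((t ^ 2 + l ^ 2) ^ 2 : ℝ) : ℂ) * (rinv k l t * rinv k l t) = 1 := by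
    simp only [rinv]
    rw [← Complex.ofReal_mul, ← Complex.ofReal_mul]
    have : t ^ 2 + l ^ 2 ≠ 0 := by have := hl.1; positivity
    rw [← Complex.ofReal_one]; congr 1; field_simp
  simp only [HypCyl.Qop]
  rw [e1, e2]
  linear_combination g t * e3 + G k l t * e4

end

end HypCyl

end

/-! ### Expansions of modes in ℓ on one side of the neck, and their propagation by the model
equation -/

noncomputable section

namespace HypCyl
open Set Filter Topology

/-! ### Expansions at one of the side faces -/

/-- The half strip `(0, R) × (0, 1)`. -/
abbrev half (R : ℝ) : Set (ℝ × ℝ) := Ioo 0 R ×ˢ Ioo 0 1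

/-- A family that decreases rapidly at the front face and in the mode, and has an expansion in
powers and logarithms of `ℓ` for `τ > 0`. -/
structure Phg (ℓ₀ : ℝ) (E : IndexSet) (f : Fam) : Prop where
  sm : Sm (cstrip ℓ₀) f
  bdd : ∃ s : ℤ, ∀ q < ℓ₀, ClR (strip q) 1 s f
  expansion : ∃ u : ℂ × ℕ → Fam,
    (∀ e ∈ E.carrier, Sm (cstrip 1) (u e) ∧ ClR (strip 1) 0 0 (u e)) ∧
    ∀ N : ℕ, ∃ ε > 0, ClR (half ε) 1 N (f - ∑ e ∈ E.upTo N, u e * lterm e)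

theorem IndexSet.mem_upTo {E : IndexSet} {N : ℝ} {e : ℂ × ℕ} :
    e ∈ E.upTo N ↔ e ∈ E.carrier ∧ e.1.re ≤ N := by simp [IndexSet.upTo]

section

variable {S : Set (ℝ × ℝ)} {R ℓ₀ : ℝ} {σ : ℕ} {s : ℤ} {f g G : Fam} {ε : ℝ} {E E' : IndexSet}

theorem strip_mono {R R' : ℝ} (h : R ≤ R') : strip R ⊆ strip R' :=
  prod_mono_left (Ioo_subset_Ioo_right h)

theorem cstrip_mono {R R' : ℝ} (h : R ≤ R') : cstrip R ⊆ cstrip R' :=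
  prod_mono_left (Ioo_subset_Ioo_right h)

theorem half_mono {R R' : ℝ} (h : R ≤ R') : half R ⊆ half R' :=
  prod_mono_left (Ioo_subset_Ioo_right h)

theorem half_subset_strip : half R ⊆ strip R :=
  prod_mono_right (Ioo_subset_Ioo_left (by norm_num))

theorem isDom_strip : IsDom (strip R) := isDom_prod

theorem isDom_half : IsDom (half R) := isDom_prod

theorem ClR.const_mul (hS : IsDom S) (c : ℂ) (hf : ClR S σ s f) : ClR S σ s (cst (fun _ => c) * f) :=
  (clM_const hS c).mul_rap_zero hS hf

theorem ClR.neg (hS : IsDom S) (hf : ClR S σ s f) : ClR S σ s (-f) :=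
  (hf.const_mul hS (-1)).congr hS fun k l t _ => by simp [cst]

theorem ClR.sub (hS : IsDom S) (hf : ClR S σ s f) (hg : ClR S σ s g) : ClR S σ s (f - g) := by
  rw [sub_eq_add_neg]; exact hf.add hS (hg.neg hS)

theorem ClR.sum (hS : IsDom S) {ι : Type*} (T : Finset ι) {F : ι → Fam}
    (h : ∀ i ∈ T, ClR S σ s (F i)) : ClR S σ s (∑ i ∈ T, F i) := by
  classical
  induction T using Finset.induction_on with
  | empty => simpa using clR_zero
  | insert a T ha ih =>
    rw [Finset.sum_insert ha]
    exact (h a (Finset.mem_insert_self a T)).add hS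
      (ih fun i hi => h i (Finset.mem_insert_of_mem hi))

theorem exists_clR_sum (hS : IsDom S) {ι : Type*} (T : Finset ι) {F : ι → Fam}
    (h : ∀ i ∈ T, ∃ s, ClR S σ s (F i)) : ∃ s, ClR S σ s (∑ i ∈ T, F i) := by
  classical
  induction T using Finset.induction_on with
  | empty => exact ⟨0, by simpa using clR_zero⟩
  | insert a T ha ih =>
    rw [Finset.sum_insert ha]
    obtain ⟨s₁, h₁⟩ := h a (Finset.mem_insert_self a T)
    obtain ⟨s₂, h₂⟩ := ih fun i hi => h i (Finset.mem_insert_of_mem hi)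
    exact ⟨min s₁ s₂, (h₁.mono_exp hS (min_le_left _ _)).add hS (h₂.mono_exp hS (min_le_right _ _))⟩

theorem Sm.sub (hf : Sm S f) (hg : Sm S g) : Sm S (f - g) := fun k => (hf k).sub (hg k)

theorem Sm.zero : Sm S 0 := fun _ => contDiffOn_const

theorem Sm.sum {ι : Type*} (T : Finset ι) {F : ι → Fam} (h : ∀ i ∈ T, Sm S (F i)) :
    Sm S (∑ i ∈ T, F i) := by
  classical
  induction T using Finset.induction_on with
  | empty => simpa using Sm.zero
  | insert a T ha ih =>
    rw [Finset.sum_insert ha]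
    exact (h a (Finset.mem_insert_self a T)).add
      (ih fun i hi => h i (Finset.mem_insert_of_mem hi))

theorem sm_lterm (hS : ∀ p ∈ S, 0 < p.1) (e : ℂ × ℕ) : Sm S (lterm e) := fun _ =>
  (contDiffOn_phgTerm e).comp contDiffOn_fst hS

theorem ClR.mul_lterm (hS : IsDom S) (hf : ClR S 1 0 f) (e : ℂ × ℕ) (h : (s : ℝ) < e.1.re) :
    ClR S 1 s (f * lterm e) := by
  have := (clM_lterm hS e h).mul_rap hS hf
  rwa [mul_comm, add_zero] at this

theorem ClR.exists_mul_lterm (hS : IsDom S) (hf : ClR S 1 0 f) (e : ℂ × ℕ) :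
    ∃ s, ClR S 1 s (f * lterm e) :=
  (exists_int_lt e.1.re).imp fun _ h => hf.mul_lterm hS e h

theorem Qop_sum (hS : IsOpen S) {ι : Type*} (T : Finset ι) {F : ι → Fam}
    (h : ∀ i ∈ T, Sm S (F i)) : EqF S (Qop ε (∑ i ∈ T, F i)) (∑ i ∈ T, Qop ε (F i)) := by
  classical
  induction T using Finset.induction_on with
  | empty =>
    intro k l t _
    have : pt 0 = 0 := by ext k l t; exact deriv_const t (0 : ℂ)
    simp [Qop, this]
  | insert a T ha ih =>
    rw [Finset.sum_insert ha, Finset.sum_insert ha]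
    intro k l t hp
    have h1 := fun i hi => h i (Finset.mem_insert_of_mem hi)
    have := Qop_add hS (ε := ε) (h a (Finset.mem_insert_self a T)) (Sm.sum T h1) k l t hp
    rw [this]
    simp only [Pi.add_apply, ih h1 k l t hp]

theorem Qop_neg (f : Fam) : Qop ε (-f) = -Qop ε f := by
  have h : ∀ f : Fam, pt (-f) = -pt f := fun f => by
    ext k l t; exact deriv.neg
  ext k l t
  simp only [Qop, h, Pi.neg_apply]; ring

theorem Qop_sub (hS : IsOpen S) (hf : Sm S f) (hg : Sm S g) :
    EqF S (Qop ε (f - g)) (Qop ε f - Qop ε g) := by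
  rw [sub_eq_add_neg, sub_eq_add_neg, ← Qop_neg]
  exact Qop_add hS hf hg.neg

/-- Rapid decrease at the front face gives arbitrary powers of `ℓ` at `τ = 0`. -/
theorem ClR.bound_at_zero (hR1 : R ≤ 1) (hf : ClR (strip R) 1 s f) (N : ℤ) (i m : ℕ) :
    ∃ C, ∀ k, ∀ l ∈ Ioo 0 R, k.w ^ m * ‖(pl 1)^[i] f k l 0‖ ≤ C * (0 ^ 2 + l ^ 2) ^ m * l ^ N := by
  have h : ClR (strip R) 1 s ((pl 1)^[i] f) := by
    induction i generalizing f with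
    | zero => exact hf
    | succ i ih => exact ih (Cl.pl isDom_strip.isOpen hf)
  obtain ⟨C, hC0, hC⟩ := h.base.exists_nonneg isDom_strip (m + (N - s).toNat)
  refine ⟨C, fun k l hl => ?_⟩
  have hl0 := hl.1
  have h1 : k.w ^ m ≤ k.w ^ (m + (N - s).toNat) := pow_le_pow_right₀ k.one_le_w (by omega)
  -- At τ = 0 one has r = ℓ², so (N - s)⁺ additional powers of r raise the order from s to at least
  -- N; for N ≤ s the truncation to 0 is right, since ℓ < 1.
  have h2 : (l ^ 2) ^ (N - s).toNat * l ^ s ≤ l ^ N := by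
    have e : (l ^ 2) ^ (N - s).toNat * l ^ s = l ^ (2 * ((N - s).toNat : ℤ) + s) := by
      rw [zpow_add₀ hl0.ne', zpow_mul]; norm_cast
    rw [e]
    refine zpow_le_zpow_right_of_le_one₀ hl0 (hl.2.le.trans hR1) ?_
    have := Int.self_le_toNat (N - s)
    omega
  calc k.w ^ m * ‖(pl 1)^[i] f k l 0‖ ≤ k.w ^ (m + (N - s).toNat) * ‖(pl 1)^[i] f k l 0‖ := by gcongr
    _ ≤ C * (0 ^ 2 + l ^ 2) ^ (m + (N - s).toNat) * l ^ s := hC k l 0 ⟨hl, by norm_num⟩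
    _ = C * (0 ^ 2 + l ^ 2) ^ m * ((l ^ 2) ^ (N - s).toNat * l ^ s) := by rw [pow_add]; ring
    _ ≤ _ := by gcongr

/-- Solutions of the Dirichlet problem on the whole strip. -/
theorem clR_strip_of_Qop (hε : |ε| = 1) (hf : Sm (cstrip R) f) (h : EqF (strip R) (Qop ε f) G)
    (hG : ClR (strip R) σ s G) (h1 : ∀ k, ∀ l ∈ Ioo 0 R, f k l 1 = 0)
    (h2 : ∀ k, ∀ l ∈ Ioo 0 R, f k l (-1) = 0) : ClR (strip R) σ s f := by
  refine clR_of_Qop isDom_strip (Or.inl rfl) hε (hf.mono strip_subset_cstrip) h hG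
    (fun i k l hl => (hf.pl_iterate i).continuousOn_right k hl) fun i m => ⟨0, fun k l hl t ht => ?_⟩
  have : (pl σ)^[i] f k l t = 0 := by
    rcases ht with rfl | rfl
    · exact (pl_iterate_congr_left (g := 0) h2 i k l hl).trans (by rw [pl_iterate_zero]; rfl)
    · exact (pl_iterate_congr_left (g := 0) h1 i k l hl).trans (by rw [pl_iterate_zero]; rfl)
  simp [this]

/-- Q involves no ℓ-derivative, so ℓ^z (log ℓ)^p passes through it and the solutions of the
Dirichlet problems for the coefficients of G serve as coefficients of f. The remainder has a source
of order N on the half strip τ > 0 only. There its boundary values vanish at τ = 1, and at τ = 0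
they are smaller than any power of ℓ because f and all the coefficients decrease rapidly at τ = ℓ =
0. The estimate on the half strip then gives order N. -/
theorem Phg.of_Qop (hℓ₀ : 0 < ℓ₀) (hε : |ε| = 1) (hG : Phg ℓ₀ E G) (hf : Sm (cstrip ℓ₀) f)
    (h : EqF (strip ℓ₀) (Qop ε f) G) (h1 : ∀ k, ∀ l ∈ Ioo 0 ℓ₀, f k l 1 = 0)
    (h2 : ∀ k, ∀ l ∈ Ioo 0 ℓ₀, f k l (-1) = 0) : Phg ℓ₀ E f := by
  have hb : ∀ s : ℤ, (∀ q < ℓ₀, ClR (strip q) 1 s G) → ∀ q < ℓ₀, ClR (strip q) 1 s f :=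
    fun s hs q hq => clR_strip_of_Qop hε (hf.mono (cstrip_mono hq.le))
      (fun k l t hp => h k l t (strip_mono hq.le hp)) (hs q hq)
      (fun k l hl => h1 k l ⟨hl.1, hl.2.trans hq⟩) (fun k l hl => h2 k l ⟨hl.1, hl.2.trans hq⟩)
  obtain ⟨s, hs⟩ := hG.bdd
  obtain ⟨u, hu, hexp⟩ := hG.expansion
  have hbs := hb s hs
  have hU : ∀ e ∈ E.carrier, Sm (cstrip 1) (solve ε (u e)) ∧ ClR (strip 1) 0 0 (solve ε (u e)) :=
    fun e he => ⟨sm_solve zero_lt_one (hu e he).1,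
      clR_strip_of_Qop hε (sm_solve zero_lt_one (hu e he).1) (Qop_solve zero_lt_one (hu e he).1)
        (hu e he).2 (fun k l _ => solve_one k l) (fun k l hl => solve_neg_one k hl.1)⟩
  refine ⟨hf, ⟨s, hbs⟩, fun e => solve ε (u e), hU, fun N => ?_⟩
  obtain ⟨δ, hδ, hrem⟩ := hexp N
  -- The remainder of G is controlled for ℓ < δ, the coefficients for ℓ < 1, and f itself only on
  -- strips strictly shorter than ℓ₀.
  set q := min δ (min 1 (ℓ₀ / 2)) with hq
  have hq0 : 0 < q := by positivity
  have hqδ : q ≤ δ := min_le_left _ _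
  have hq1 : q ≤ 1 := (min_le_right _ _).trans (min_le_left _ _)
  have hqℓ : q < ℓ₀ := ((min_le_right _ _).trans (min_le_right _ _)).trans_lt (by linarith)
  have hT : ∀ e ∈ E.upTo N, e ∈ E.carrier := fun e he => (IndexSet.mem_upTo.1 he).1
  have hpos : ∀ p ∈ cstrip q, 0 < p.1 := fun p hp => hp.1.1
  set W := ∑ e ∈ E.upTo N, solve ε (u e) * lterm e with hW
  have sW : Sm (cstrip q) W := Sm.sum _ fun e he =>
    ((hU e (hT e he)).1.mono (cstrip_mono hq1)).mul (sm_lterm hpos e)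
  have sf := hf.mono (cstrip_mono hqℓ.le)
  have srem := sf.sub sW
  obtain ⟨s', hs'⟩ := exists_clR_sum (σ := 1) (isDom_strip (R := q)) (E.upTo N)
    (F := fun e => solve ε (u e) * lterm e) fun e he =>
    (((hU e (hT e he)).2.of_zero isDom_strip).mono (strip_mono hq1)).exists_mul_lterm isDom_strip e
  have cW : ClR (strip q) 1 (min s s') (f - W) :=
    ((hbs q hqℓ).mono_exp isDom_strip (min_le_left _ _)).sub isDom_strip
      (hs'.mono_exp isDom_strip (min_le_right _ _))
  have hsub : half q ⊆ cstrip q := half_subset_strip.trans strip_subset_cstrip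
  refine ⟨q, hq0, clR_of_Qop isDom_half (Or.inr rfl) hε (srem.mono hsub) ?_
    (hrem.mono (half_mono hqδ))
    (fun i k l hl => ((srem.pl_iterate i).continuousOn_right k hl).mono
      (Icc_subset_Icc_left (by norm_num))) fun i m => ?_⟩
  · intro k l t hp
    have ho := isDom_half (R := q).isOpen
    rw [Qop_sub ho (sf.mono hsub) (sW.mono hsub) k l t hp]
    have e1 := h k l t (strip_mono hqℓ.le (half_subset_strip hp))
    have e2 := Qop_sum (ε := ε) ho (E.upTo N) (F := fun e => solve ε (u e) * lterm e) (fun e he =>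
      (((hU e (hT e he)).1.mono (cstrip_mono hq1)).mul (sm_lterm hpos e)).mono hsub) k l t hp
    simp only [Pi.sub_apply, e1]
    rw [e2]
    simp only [Finset.sum_apply]
    congr 1
    refine Finset.sum_congr rfl fun e he => ?_
    have e3 := Qop_solve (ε := ε) zero_lt_one (hu e (hT e he)).1 k l t
      (strip_mono hq1 (half_subset_strip hp))
    rw [mul_comm, lterm, Qop_lfun_mul, mul_comm]
    simp only [Pi.mul_apply, e3]
  · obtain ⟨C, hC⟩ := cW.bound_at_zero hq1 N i m
    refine ⟨|C|, fun k l hl t ht => ?_⟩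
    have hl0 := hl.1
    rcases ht with rfl | rfl
    · refine (hC k l hl).trans ?_
      gcongr
      exact le_abs_self C
    · have hz : ∀ k, ∀ l ∈ Ioo 0 q, (f - W) k l 1 = (0 : Fam) k l 1 := fun k l hl => by
        have := h1 k l ⟨hl.1, hl.2.trans hqℓ⟩
        simp only [Pi.sub_apply, hW, Finset.sum_apply, Pi.mul_apply, this, solve_one]
        simp
      rw [pl_iterate_congr_left hz i k l hl, pl_iterate_zero]
      simp only [Pi.zero_apply, norm_zero, mul_zero]
      positivity

/-! ### Closure properties -/

theorem Phg.add (hf : Phg ℓ₀ E f) (hg : Phg ℓ₀ E g) : Phg ℓ₀ E (f + g) := by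
  obtain ⟨s, hs⟩ := hf.bdd
  obtain ⟨s', hs'⟩ := hg.bdd
  obtain ⟨u, hu, hue⟩ := hf.expansion
  obtain ⟨v, hv, hve⟩ := hg.expansion
  refine ⟨hf.sm.add hg.sm, ⟨min s s', fun q hq =>
    ((hs q hq).mono_exp isDom_strip (min_le_left _ _)).add isDom_strip
      ((hs' q hq).mono_exp isDom_strip (min_le_right _ _))⟩, u + v, fun e he =>
    ⟨(hu e he).1.add (hv e he).1, (hu e he).2.add isDom_strip (hv e he).2⟩, fun N => ?_⟩
  obtain ⟨δ, hδ, h1⟩ := hue N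
  obtain ⟨δ', hδ', h2⟩ := hve N
  refine ⟨min δ δ', lt_min hδ hδ', ((h1.mono (half_mono (min_le_left _ _))).add isDom_half
    (h2.mono (half_mono (min_le_right _ _)))).congr isDom_half fun k l t _ => ?_⟩
  simp only [Pi.add_apply, Pi.sub_apply, add_mul, Finset.sum_add_distrib]
  ring

/-- Smooth multipliers. -/
structure IsMult (m : Fam) : Prop where
  sm : Sm (Ioi 0 ×ˢ univ) m
  cl : ∀ R σ, ClM (strip R) σ 0 m

theorem Phg.mul {m : Fam} (hm : IsMult m) (hf : Phg ℓ₀ E f) : Phg ℓ₀ E (m * f) := by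
  obtain ⟨s, hs⟩ := hf.bdd
  obtain ⟨u, hu, hue⟩ := hf.expansion
  have hsm : ∀ R, Sm (cstrip R) m := fun R => hm.sm.mono (prod_mono Ioo_subset_Ioi_self (subset_univ _))
  refine ⟨(hsm _).mul hf.sm, ⟨s, fun q hq => (hm.cl q 1).mul_rap_zero isDom_strip (hs q hq)⟩,
    fun e => m * u e, fun e he => ⟨(hsm _).mul (hu e he).1,
      (hm.cl 1 0).mul_rap_zero isDom_strip (hu e he).2⟩, fun N => ?_⟩
  obtain ⟨δ, hδ, h1⟩ := hue N
  have hm' : ClM (half δ) 1 0 m :=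
    (hm.cl δ 1).imp half_subset_strip fun _ => Mod.mono half_subset_strip
  refine ⟨δ, hδ, (hm'.mul_rap_zero isDom_half h1).congr isDom_half fun k l t _ => ?_⟩
  simp only [Pi.sub_apply, Pi.mul_apply, Finset.sum_apply, mul_sub, Finset.mul_sum, mul_assoc]

theorem Phg.congr (hf : Phg ℓ₀ E f) (h : ∀ k, ∀ l ∈ Ioo 0 ℓ₀, ∀ t ∈ Icc (-1 : ℝ) 1, f k l t = g k l t)
    (hℓ₀ : 0 < ℓ₀) : Phg ℓ₀ E g := by
  obtain ⟨s, hs⟩ := hf.bdd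
  obtain ⟨u, hu, hue⟩ := hf.expansion
  refine ⟨hf.sm.congr fun k l t hp => h k l hp.1 t hp.2, ⟨s, fun q hq =>
    (hs q hq).congr isDom_strip fun k l t hp => h k l ⟨hp.1.1, hp.1.2.trans hq⟩ t
      (Ioo_subset_Icc_self hp.2)⟩, u, hu, fun N => ?_⟩
  obtain ⟨δ, hδ, h1⟩ := hue N
  refine ⟨min δ ℓ₀, lt_min hδ hℓ₀, (h1.mono (half_mono (min_le_left _ _))).congr isDom_half
    fun k l t hp => ?_⟩
  simp only [Pi.sub_apply]
  rw [h k l ⟨hp.1.1, hp.1.2.trans_le (min_le_right _ _)⟩ t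
    ⟨by linarith [hp.2.1], hp.2.2.le⟩]

theorem Phg.mono (h : E.carrier ⊆ E'.carrier) (hf : Phg ℓ₀ E f) : Phg ℓ₀ E' f := by
  classical
  obtain ⟨u, hu, hue⟩ := hf.expansion
  refine ⟨hf.sm, hf.bdd, fun e => if e ∈ E.carrier then u e else 0, fun e _ => ?_, fun N => ?_⟩
  · by_cases he : e ∈ E.carrier
    · simpa [he] using hu e he
    · simpa [he] using ⟨Sm.zero, clR_zero⟩
  · obtain ⟨δ, hδ, h1⟩ := hue N
    refine ⟨δ, hδ, ?_⟩
    convert h1 using 2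
    symm
    refine Finset.sum_subset_zero_on_sdiff (fun e he => ?_) (fun e he => ?_) (fun e he => ?_)
    · rw [IndexSet.mem_upTo] at he ⊢
      exact ⟨h he.1, he.2⟩
    · rw [Finset.mem_sdiff, IndexSet.mem_upTo, IndexSet.mem_upTo] at he
      have : e ∉ E.carrier := fun hE => he.2 ⟨hE, he.1.2⟩
      simp [this]
    · simp [(IndexSet.mem_upTo.1 he).1]

/-- The union of two index sets. -/
def IndexSet.union (E F : IndexSet) : IndexSet where
  carrier := E.carrier ∪ F.carrier
  finite_re_le N := by
    refine ((E.finite_re_le N).union (F.finite_re_le N)).subset ?_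
    rintro e ⟨he | he, h⟩
    exacts [Or.inl ⟨he, h⟩, Or.inr ⟨he, h⟩]
  log_closed z p q h hq := h.imp (fun h => E.log_closed z p q h hq) fun h => F.log_closed z p q h hq
  shift_closed z p h := h.imp (E.shift_closed z p) (F.shift_closed z p)

/-! ### Reflection -/

/-- The reflection `τ ↦ -τ`. -/
def reflect (f : Fam) : Fam := fun k l t => f k l (-t)

theorem pt_reflect (f : Fam) : pt (reflect f) = -reflect (pt f) := by
  ext k l t
  exact deriv_comp_neg (f k l) t

/-- In V only the cross term 2ετk is odd in τ, so the reflection exchanges the two signs ε.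
Statements about τ < 0 thereby reduce to τ > 0. -/
theorem Qop_reflect (f : Fam) : Qop (-ε) (reflect f) = reflect (Qop ε f) := by
  have h : ∀ f : Fam, pt (-f) = -pt f := fun f => by
    ext k l t; exact deriv.neg
  ext k l t
  simp only [Qop, pt_reflect, h, neg_neg]
  simp only [reflect]
  congr 2
  · ring_nf
  · ring_nf

theorem Sm.reflect (hf : Sm (cstrip R) f) : Sm (cstrip R) (reflect f) := fun k =>
  (hf k).comp (f := fun p : ℝ × ℝ => (p.1, -p.2)) (by fun_prop) fun p hp =>
    ⟨hp.1, by linarith [hp.2.2], by linarith [hp.2.1]⟩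

/-- The solution of the Dirichlet problem with right hand sides that have expansions on both sides. -/
theorem phg_solve {E' : IndexSet} (hℓ₀ : 0 < ℓ₀) (hε : |ε| = 1) (h₁ : Phg ℓ₀ E G)
    (h₂ : Phg ℓ₀ E' (reflect G)) :
    Phg ℓ₀ E (solve ε G) ∧ Phg ℓ₀ E' (reflect (solve ε G)) := by
  have hs := sm_solve (ε := ε) hℓ₀ h₁.sm
  refine ⟨h₁.of_Qop hℓ₀ hε hs (Qop_solve hℓ₀ h₁.sm) (fun k l _ => solve_one k l)
    (fun k l hl => solve_neg_one k hl.1), h₂.of_Qop (ε := -ε) hℓ₀ (by rwa [abs_neg]) hs.reflect ?_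
    (fun k l hl => solve_neg_one k hl.1) fun k l hl => ?_⟩
  · rw [Qop_reflect]
    intro k l t hp
    exact Qop_solve hℓ₀ h₁.sm k l (-t) ⟨hp.1, by linarith [hp.2.2], by linarith [hp.2.1]⟩
  · simp [reflect, solve_one]

end

end HypCyl

end

/-! ### From modes to functions: Fourier series and their expansions on the blowup -/

noncomputable section

namespace HypCyl
open Set Filter Topology

/-! ### Fourier series of families -/

/-- The function with the given Fourier coefficients. -/
def synth (f : Fam) (l t θ : ℝ) : ℂ :=
  ∑' k : Mode, f k l t * Complex.exp (Complex.I * (k : ℤ) * θ)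

theorem norm_exp_mode (k : ℤ) (θ : ℝ) : ‖Complex.exp (Complex.I * k * θ)‖ = 1 := by
  have : Complex.I * k * θ = ((k * θ : ℝ) : ℂ) * Complex.I := by push_cast; ring
  rw [this, Complex.norm_exp_ofReal_mul_I]

theorem summable_mode : Summable fun k : Mode => (k.w ^ 2)⁻¹ := by
  have h : Summable fun k : ℤ => 1 / (k : ℝ) ^ 2 :=
    Real.summable_one_div_int_pow.2 one_lt_two
  refine (h.comp_injective (i := fun k : Mode => (k : ℤ)) Subtype.val_injective).congr fun k => ?_
  simp [Mode.w, sq_abs]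

/-- Families of some order. -/
def RapF (S : Set (ℝ × ℝ)) (f : Fam) : Prop := ∃ s : ℤ, ClR S 1 s f

/-- Multiplication by `i k`. -/
def dθ (f : Fam) : Fam := cst (fun k => Complex.I * ((k : ℤ) : ℂ)) * f

/-- The derivation `ℓ ∂_ℓ + τ ∂_τ`. -/
def Bop (f : Fam) : Fam := pl 1 f + tfun (fun t => (t : ℂ)) * pt f

section

variable {S : Set (ℝ × ℝ)} {s : ℤ} {f g : Fam} {R : ℝ}

theorem ClR.dθ (hS : IsDom S) (hf : ClR S 1 s f) : ClR S 1 s (dθ f) :=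
  (clM_mode hS Complex.I).mul_rap_zero hS hf

theorem ClR.pt (hS : IsDom S) (hf : ClR S 1 s f) : ClR S 1 s (pt f) :=
  Cl.pt hS.isOpen isAdditivePred_rap hf

theorem ClR.pl (hS : IsDom S) (hf : ClR S 1 s f) : ClR S 1 s (pl 1 f) := Cl.pl hS.isOpen hf

theorem ClR.Bop (hS : IsDom S) (hf : ClR S 1 s f) : ClR S 1 s (Bop f) :=
  (hf.pl hS).add hS ((clM_t hS).mul_rap_zero hS (hf.pt hS))

theorem ClR.lmul (hS : IsDom S) (hf : ClR S 1 s f) : ClR S 1 s (lfun (fun l => (l : ℂ)) * f) := by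
  have := (clM_lpow (σ := 1) hS 1).mul_rap_zero hS hf
  simpa using this

theorem RapF.dθ (hS : IsDom S) (hf : RapF S f) : RapF S (dθ f) := hf.imp fun _ h => h.dθ hS

theorem RapF.pt (hS : IsDom S) (hf : RapF S f) : RapF S (pt f) := hf.imp fun _ h => h.pt hS

/-- ∂_ℓ = ℓ⁻¹ (ℓ ∂_ℓ). The order drops, here by two because `clM_lterm` asks for a strict
inequality; it is left existential in `RapF` so that the class is closed under all coordinate
derivatives. -/
theorem RapF.pl (hS : IsDom S) (hf : RapF S f) : RapF S (pl 0 f) := by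
  obtain ⟨s, h⟩ := hf
  refine ⟨-2 + s, ((clM_lterm (s := -2) hS (-1, 0) (by norm_num)).mul_rap hS (h.pl hS)).congr hS
    fun k l t hp => ?_⟩
  have : (l : ℂ) ≠ 0 := by exact_mod_cast (hS.pos hp).ne'
  simp only [Pi.mul_apply, lterm, lfun, phgTerm, HypCyl.pl, Complex.cpow_neg_one]
  field_simp

theorem RapF.add (hS : IsDom S) (hf : RapF S f) (hg : RapF S g) : RapF S (f + g) := by
  obtain ⟨s, h⟩ := hf
  obtain ⟨s', h'⟩ := hg
  exact ⟨min s s', (h.mono_exp hS (min_le_left _ _)).add hS (h'.mono_exp hS (min_le_right _ _))⟩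

theorem RapF.sm (hf : RapF S f) : Sm S f := by
  obtain ⟨s, h⟩ := hf; exact h.1

theorem RapF.exists_bound (hS : IsDom S) (hf : RapF S f) (m : ℕ) {p : ℝ × ℝ} (hp : p ∈ S) :
    ∃ C, ∀ᶠ q in 𝓝 p, ∀ k, k.w ^ m * ‖f k q.1 q.2‖ ≤ C := by
  obtain ⟨s, h⟩ := hf
  obtain ⟨C, hC0, hC⟩ := h.base.exists_nonneg hS m
  have hp0 := hS.pos (l := p.1) (t := p.2) hp
  have hc : ContinuousAt (fun q : ℝ × ℝ => C * (q.2 ^ 2 + q.1 ^ 2) ^ m * q.1 ^ s) p :=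
    (ContinuousAt.mul (by fun_prop) (by fun_prop)).mul
      (continuousAt_fst.zpow₀ s (Or.inl hp0.ne'))
  refine ⟨C * (p.2 ^ 2 + p.1 ^ 2) ^ m * p.1 ^ s + 1, ?_⟩
  filter_upwards [hc.eventually_lt_const (lt_add_one _), hS.isOpen.mem_nhds hp] with q hq hqS k
  exact (hC k q.1 q.2 hqS).trans hq.le

theorem summable_of_bound {a : Mode → ℂ} {C : ℝ} (h : ∀ k, k.w ^ 2 * ‖a k‖ ≤ C) :
    Summable fun k => ‖a k‖ := by
  refine Summable.of_nonneg_of_le (fun k => norm_nonneg _) (fun k => ?_) (summable_mode.mul_left C)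
  rw [← div_eq_mul_inv, le_div_iff₀ (pow_pos k.w_pos 2), mul_comm]
  exact h k

theorem RapF.summable (hS : IsDom S) (hf : RapF S f) {l t : ℝ} (hp : (l, t) ∈ S) (θ : ℝ) :
    Summable fun k : Mode => f k l t * Complex.exp (Complex.I * (k : ℤ) * θ) := by
  obtain ⟨C, hC⟩ := hf.exists_bound hS 2 hp
  refine Summable.of_norm ?_
  simpa only [norm_mul, norm_exp_mode, mul_one] using summable_of_bound hC.self_of_nhds

theorem synth_add (hS : IsDom S) (hf : RapF S f) (hg : RapF S g) {l t : ℝ} (hp : (l, t) ∈ S)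
    (θ : ℝ) : synth (f + g) l t θ = synth f l t θ + synth g l t θ := by
  simp only [synth]
  rw [← (hf.summable hS hp θ).tsum_add (hg.summable hS hp θ)]
  simp only [Pi.add_apply, add_mul]

theorem synth_lfun_mul (c : ℝ → ℂ) (f : Fam) (l t θ : ℝ) :
    synth (lfun c * f) l t θ = c l * synth f l t θ := by
  simp only [synth]
  rw [← tsum_mul_left]
  simp only [Pi.mul_apply, lfun, mul_assoc]

theorem synth_tfun_mul (c : ℝ → ℂ) (f : Fam) (l t θ : ℝ) :
    synth (tfun c * f) l t θ = c t * synth f l t θ := by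
  simp only [synth]
  rw [← tsum_mul_left]
  simp only [Pi.mul_apply, tfun, mul_assoc]

theorem synth_pl_one (f : Fam) (l t θ : ℝ) : synth (pl 1 f) l t θ = l * synth (pl 0 f) l t θ := by
  simp only [synth]
  rw [← tsum_mul_left]
  simp only [pl, pow_one, pow_zero, one_mul, mul_assoc]

theorem synth_congr (h : EqF S f g) {l t : ℝ} (hp : (l, t) ∈ S) (θ : ℝ) :
    synth f l t θ = synth g l t θ := tsum_congr fun k => by rw [h k l t hp]

/-- The three coordinate derivatives of a family. -/
def dop (j : Fin 3) : Fam → Fam := ![pl 0, pt, dθ] j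

/-- The three coordinate functionals. -/
def coord3 (j : Fin 3) : ℝ × ℝ × ℝ →L[ℝ] ℝ :=
  ![ContinuousLinearMap.fst ℝ ℝ (ℝ × ℝ),
    (ContinuousLinearMap.fst ℝ ℝ ℝ).comp (ContinuousLinearMap.snd ℝ ℝ (ℝ × ℝ)),
    (ContinuousLinearMap.snd ℝ ℝ ℝ).comp (ContinuousLinearMap.snd ℝ ℝ (ℝ × ℝ))] j

theorem RapF.dop (hS : IsDom S) (hf : RapF S f) (j : Fin 3) : RapF S (dop j f) := by
  fin_cases j
  exacts [hf.pl hS, hf.pt hS, hf.dθ hS]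

theorem norm_coord3_le (j : Fin 3) : ‖coord3 j‖ ≤ 1 := by
  refine ContinuousLinearMap.opNorm_le_bound _ zero_le_one fun v => ?_
  rw [one_mul]
  fin_cases j
  · exact norm_fst_le v
  · exact (norm_fst_le v.2).trans (norm_snd_le v)
  · exact (norm_snd_le v.2).trans (norm_snd_le v)

theorem hasFDerivAt_term (hS : IsDom S) (hf : Sm S f) (k : Mode) {q : ℝ × ℝ × ℝ}
    (hq : (q.1, q.2.1) ∈ S) :
    HasFDerivAt (fun q : ℝ × ℝ × ℝ => f k q.1 q.2.1 * Complex.exp (Complex.I * (k : ℤ) * q.2.2))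
      (∑ j, (coord3 j).smulRight
        (dop j f k q.1 q.2.1 * Complex.exp (Complex.I * (k : ℤ) * q.2.2))) q := by
  have h1 : HasFDerivAt (fun q : ℝ × ℝ × ℝ => (q.1, q.2.1))
      ((ContinuousLinearMap.fst ℝ ℝ (ℝ × ℝ)).prod
        ((ContinuousLinearMap.fst ℝ ℝ ℝ).comp (ContinuousLinearMap.snd ℝ ℝ (ℝ × ℝ)))) q :=
    ((ContinuousLinearMap.fst ℝ ℝ (ℝ × ℝ)).prod
        ((ContinuousLinearMap.fst ℝ ℝ ℝ).comp
          (ContinuousLinearMap.snd ℝ ℝ (ℝ × ℝ)))).hasFDerivAt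
  have h2 := (hf.differentiableAt hS.isOpen k hq).hasFDerivAt.comp q h1
  have h3 : HasDerivAt (fun θ : ℝ => Complex.exp (Complex.I * (k : ℤ) * θ))
      (Complex.exp (Complex.I * (k : ℤ) * q.2.2) * (Complex.I * (k : ℤ))) q.2.2 := by
    have := ((hasDerivAt_id q.2.2).ofReal_comp.const_mul (Complex.I * (k : ℤ))).cexp
    simpa using this
  have h4 : HasFDerivAt (fun q : ℝ × ℝ × ℝ => q.2.2) (coord3 2) q := (coord3 2).hasFDerivAt
  have h5 := h3.hasFDerivAt.comp q h4
  refine (h2.mul h5).congr_fderiv ?_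
  refine ContinuousLinearMap.ext fun v => ?_
  have e0 := hf.pl_eq (σ := 0) hS.isOpen k hq
  have e1 := hf.pt_eq hS.isOpen k hq
  simp only [pow_zero, one_mul] at e0
  have e2 : fderiv ℝ (fun p : ℝ × ℝ => f k p.1 p.2) (q.1, q.2.1) (v.1, v.2.1)
      = v.1 * pl 0 f k q.1 q.2.1 + v.2.1 * pt f k q.1 q.2.1 := by
    rw [e0, e1, ← Complex.real_smul, ← Complex.real_smul, ← map_smul, ← map_smul, ← map_add]
    simp
  simp only [Fin.sum_univ_three, dop, coord3, Matrix.cons_val_zero, Matrix.cons_val_one,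
    Matrix.cons_val_two, Matrix.head_cons, Matrix.tail_cons, add_apply, smul_apply, ContinuousLinearMap.toSpanSingleton_apply,
    ContinuousLinearMap.smulRight_apply,
    ContinuousLinearMap.coe_comp, Function.comp_apply, ContinuousLinearMap.prod_apply,
    ContinuousLinearMap.coe_fst', ContinuousLinearMap.coe_snd', dθ, cst, Pi.mul_apply, smul_eq_mul,
    Complex.real_smul]
  rw [e2]
  ring

/-- Termwise differentiation. -/
theorem hasFDerivAt_synth (hS : IsDom S) (hf : RapF S f) {q : ℝ × ℝ × ℝ} (hq : (q.1, q.2.1) ∈ S) :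
    HasFDerivAt (fun q : ℝ × ℝ × ℝ => synth f q.1 q.2.1 q.2.2)
      (∑ j, (coord3 j).smulRight (synth (dop j f) q.1 q.2.1 q.2.2)) q := by
  choose C hC using fun j => (hf.dop hS j).exists_bound hS 2 hq
  obtain ⟨δ, hδ, hball⟩ := Metric.eventually_nhds_iff_ball.1
    (((hC 0).and ((hC 1).and (hC 2))).and (hS.isOpen.mem_nhds hq))
  have hsm := hf.sm
  set V : Set (ℝ × ℝ × ℝ) := (fun q : ℝ × ℝ × ℝ => (q.1, q.2.1)) ⁻¹' Metric.ball (q.1, q.2.1) δ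
  have hVc : Convex ℝ V := by
    have : V = ((LinearMap.fst ℝ ℝ (ℝ × ℝ)).prod
      ((LinearMap.fst ℝ ℝ ℝ).comp (LinearMap.snd ℝ ℝ (ℝ × ℝ)))) ⁻¹'
        Metric.ball (q.1, q.2.1) δ := rfl
    rw [this]
    exact (convex_ball _ _).linear_preimage _
  have hV : IsOpen V := Metric.isOpen_ball.preimage (by fun_prop)
  have hqV : q ∈ V := Metric.mem_ball_self hδ
  have hbd : ∀ (k : Mode) (x : ℝ × ℝ × ℝ), x ∈ V → ‖∑ j, (coord3 j).smulRight
      (dop j f k x.1 x.2.1 * Complex.exp (Complex.I * (k : ℤ) * x.2.2))‖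
      ≤ (C 0 + C 1 + C 2) * (k.w ^ 2)⁻¹ := fun k x hx => by
    obtain ⟨⟨h0, h1, h2⟩, -⟩ := hball _ hx
    rw [← div_eq_mul_inv, le_div_iff₀ (pow_pos k.w_pos 2)]
    have hj : ∀ j, ‖(coord3 j).smulRight
        (dop j f k x.1 x.2.1 * Complex.exp (Complex.I * (k : ℤ) * x.2.2))‖ * k.w ^ 2
        ≤ k.w ^ 2 * ‖dop j f k x.1 x.2.1‖ := fun j => by
      rw [ContinuousLinearMap.norm_smulRight_apply, norm_mul, norm_exp_mode, mul_one, mul_comm]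
      have := norm_coord3_le j
      have hw := pow_pos k.w_pos 2
      gcongr
      exact mul_le_of_le_one_left (norm_nonneg _) this
    refine (mul_le_mul_of_nonneg_right (norm_sum_le _ _) (pow_pos k.w_pos 2).le).trans ?_
    rw [Fin.sum_univ_three, add_mul, add_mul]
    exact add_le_add (add_le_add ((hj 0).trans (h0 k)) ((hj 1).trans (h1 k))) ((hj 2).trans (h2 k))
  have key := hasFDerivAt_tsum_of_isPreconnected (summable_mode.mul_left (C 0 + C 1 + C 2)) hV
    hVc.isPreconnected
    (f := fun (k : Mode) (q : ℝ × ℝ × ℝ) =>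
      f k q.1 q.2.1 * Complex.exp (Complex.I * (k : ℤ) * q.2.2))
    (fun k x hx => hasFDerivAt_term hS hsm k (hball _ hx).2) hbd hqV (hf.summable hS hq q.2.2) hqV
  refine key.congr_fderiv ?_
  rw [Summable.tsum_finsetSum fun j _ => ?_]
  · refine Finset.sum_congr rfl fun j _ => ?_
    have := (((hf.dop hS j).summable hS hq q.2.2).hasSum.mapL
      (ContinuousLinearMap.smulRightL ℝ (ℝ × ℝ × ℝ) ℂ (coord3 j))).tsum_eq
    simpa [synth] using this
  · exact (((hf.dop hS j).summable hS hq q.2.2).hasSum.mapL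
      (ContinuousLinearMap.smulRightL ℝ (ℝ × ℝ × ℝ) ℂ (coord3 j))).summable

/-- Differentiation along a curve. -/
theorem hasDerivAt_synth_comp (hS : IsDom S) (hf : RapF S f) {γ₁ γ₂ γ₃ : ℝ → ℝ} {a b c x : ℝ}
    (h₁ : HasDerivAt γ₁ a x) (h₂ : HasDerivAt γ₂ b x) (h₃ : HasDerivAt γ₃ c x)
    (hq : (γ₁ x, γ₂ x) ∈ S) : HasDerivAt (fun x => synth f (γ₁ x) (γ₂ x) (γ₃ x))
      (a * synth (pl 0 f) (γ₁ x) (γ₂ x) (γ₃ x) + b * synth (pt f) (γ₁ x) (γ₂ x) (γ₃ x)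
        + c * synth (dθ f) (γ₁ x) (γ₂ x) (γ₃ x)) x := by
  have h := (hasFDerivAt_synth hS hf (q := (γ₁ x, γ₂ x, γ₃ x)) hq).comp_hasDerivAt
    (f := fun x => (γ₁ x, γ₂ x, γ₃ x)) x (h₁.prodMk (h₂.prodMk h₃))
  refine h.congr_deriv ?_
  simp [Fin.sum_univ_three, dop, coord3]

/-- Two additional powers of k.w make the series converge; the two powers of r that come with them
are bounded. -/
theorem norm_synth_le (hS : IsDom S) (hf : ClR S 1 s f) (m : ℕ) :
    ∃ C, 0 ≤ C ∧ ∀ l t, (l, t) ∈ S → ∀ θ, ‖synth f l t θ‖ ≤ C * (t ^ 2 + l ^ 2) ^ m * l ^ s := by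
  obtain ⟨C, hC0, hC⟩ := hf.base.exists_nonneg hS (m + 2)
  obtain ⟨R, hR⟩ := hS.bdd
  refine ⟨C * R ^ 2 * ∑' k : Mode, (k.w ^ 2)⁻¹, ?_, fun l t hp θ => ?_⟩
  · exact mul_nonneg (by positivity) (tsum_nonneg fun k => by positivity)
  have hl := hS.pos hp
  have hr : 0 ≤ t ^ 2 + l ^ 2 := by positivity
  have hb : ∀ k : Mode, ‖f k l t * Complex.exp (Complex.I * (k : ℤ) * θ)‖
      ≤ C * R ^ 2 * (t ^ 2 + l ^ 2) ^ m * l ^ s * (k.w ^ 2)⁻¹ := fun k => by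
    rw [norm_mul, norm_exp_mode, mul_one, ← div_eq_mul_inv, le_div_iff₀ (pow_pos k.w_pos 2)]
    have h1 : k.w ^ 2 ≤ k.w ^ (m + 2) := pow_le_pow_right₀ k.one_le_w (by omega)
    calc ‖f k l t‖ * k.w ^ 2 ≤ k.w ^ (m + 2) * ‖f k l t‖ := by rw [mul_comm]; gcongr
      _ ≤ C * (t ^ 2 + l ^ 2) ^ (m + 2) * l ^ s := hC k l t hp
      _ ≤ C * ((t ^ 2 + l ^ 2) ^ m * R ^ 2) * l ^ s := by
        rw [pow_add]
        have := hR hp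
        gcongr
      _ = _ := by ring
  have hs := summable_mode.mul_left (C * R ^ 2 * (t ^ 2 + l ^ 2) ^ m * l ^ s)
  refine (tsum_of_norm_bounded hs.hasSum hb).trans (le_of_eq ?_)
  rw [tsum_mul_left]; ring

end

end HypCyl

end

/-! ### Removing the dependence of the coefficients on ℓ -/

noncomputable section

namespace HypCyl
open Set Filter Topology

/-! ### Taylor expansion at `ℓ = 0` -/

/-- The limit as `ℓ ↘ 0`. -/
def lim0 (u : Fam) : Fam := fun k _ t => limUnder (𝓝[>] (0 : ℝ)) fun l' => u k l' t

/-- The remainder of the Taylor expansion at `ℓ = 0`. -/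
def taylorRem (L : ℕ) (u : Fam) : Fam := fun k l t =>
  u k l t - ∑ n ∈ Finset.range L, (n.factorial : ℂ)⁻¹ * (l : ℂ) ^ n * lim0 ((pl 0)^[n] u) k l t

section

variable {u v : Fam}

theorem ClR.pl_zero_iterate {S : Set (ℝ × ℝ)} {s : ℤ} (hS : IsOpen S) (hu : ClR S 0 s u) (n : ℕ) :
    ClR S 0 s ((HypCyl.pl 0)^[n] u) := by
  induction n generalizing u with
  | zero => exact hu
  | succ n ih => exact ih (Cl.pl hS hu)

theorem lipschitz_left (hu : ClR (half 1) 0 0 u) : ∃ C, 0 ≤ C ∧ ∀ k, ∀ l ∈ Ioo (0 : ℝ) 1,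
    ∀ l' ∈ Ioo (0 : ℝ) 1, ∀ t ∈ Ioo (0 : ℝ) 1, ‖u k l t - u k l' t‖ ≤ C * |l - l'| := by
  have ho := (isDom_half (R := 1)).isOpen
  obtain ⟨C, hC0, hC⟩ := (Cl.base (Cl.pl ho hu)).exists_nonneg isDom_half 0
  refine ⟨C, hC0, fun k l hl l' hl' t ht => ?_⟩
  refine (convex_Ioo (0 : ℝ) 1).norm_image_sub_le_of_norm_hasDerivWithin_le
    (f := fun l => u k l t) (f' := fun l => pl 0 u k l t) (fun x hx => ?_) (fun x hx => ?_) hl' hl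
  · have := (hu.1.differentiableAt_left ho k (l := x) (t := t) ⟨hx, ht⟩).hasDerivAt
    simpa [pl] using this.hasDerivWithinAt
  · simpa using hC k x t ⟨hx, ht⟩

/-- In the class with σ = 0 the derivative ∂_ℓ u is bounded up to ℓ = 0, so the limit exists; the
class with σ = 1 would not suffice. -/
theorem tendsto_lim0 (hu : ClR (half 1) 0 0 u) (k : Mode) (l : ℝ) {t : ℝ} (ht : t ∈ Ioo (0 : ℝ) 1) :
    Tendsto (fun l' => u k l' t) (𝓝[>] 0) (𝓝 (lim0 u k l t)) := by
  have ho := (isDom_half (R := 1)).isOpen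
  obtain ⟨C, hC0, hC⟩ := (Cl.base (Cl.pl ho hu)).exists_nonneg isDom_half 0
  have hd : ∀ x ∈ Ioo (0 : ℝ) 1, DifferentiableAt ℝ (fun l => u k l t) x := fun x hx =>
    hu.1.differentiableAt_left ho k (l := x) (t := t) ⟨hx, ht⟩
  obtain ⟨y, hy⟩ := exists_tendsto_of_bounded_fderiv isOpen_Ioo (convex_Ioo (0 : ℝ) 1)
    (f := fun l => u k l t) (x := 0) (C := C) (fun x hx => (hd x hx).differentiableWithinAt)
    (by rw [closure_Ioo (by norm_num)]; norm_num) zero_lt_one fun x hx => by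
      have := hC k x t ⟨hx.1, ht⟩
      rw [← norm_deriv_eq_norm_fderiv]
      simpa [pl] using this
  rw [nhdsWithin_Ioo_eq_nhdsGT zero_lt_one] at hy
  have e := hy.limUnder_eq
  rwa [lim0, e]

theorem eventually_Ioo : ∀ᶠ l in 𝓝[>] (0 : ℝ), l ∈ Ioo (0 : ℝ) 1 := Ioo_mem_nhdsGT zero_lt_one

theorem lim0_congr (h : EqF (half 1) u v) (k : Mode) (l : ℝ) {t : ℝ} (ht : t ∈ Ioo (0 : ℝ) 1) :
    lim0 u k l t = lim0 v k l t := by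
  have : (fun l' => u k l' t) =ᶠ[𝓝[>] 0] fun l' => v k l' t :=
    eventually_Ioo.mono fun l' hl' => h k l' t ⟨hl', ht⟩
  simp only [lim0, limUnder, Filter.map_congr this]

theorem exists_lim0_sub_le (hu : ClR (half 1) 0 0 u) : ∃ C, 0 ≤ C ∧ ∀ k, ∀ l ∈ Ioo (0 : ℝ) 1,
    ∀ t ∈ Ioo (0 : ℝ) 1, ‖u k l t - lim0 u k l t‖ ≤ C * l := by
  obtain ⟨C, hC0, hC⟩ := lipschitz_left hu
  refine ⟨C, hC0, fun k l hl t ht => ?_⟩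
  refine le_of_tendsto (((tendsto_lim0 hu k l ht).const_sub (u k l t)).norm) ?_
  filter_upwards [eventually_Ioo, Ioo_mem_nhdsGT hl.1] with l' hl' hl2
  refine (hC k l hl l' hl' t ht).trans ?_
  rw [abs_of_pos (by linarith [hl2.2])]
  have := hl'.1
  gcongr
  linarith

/-- The bound on ∂_ℓ ∂_τ u makes ∂_τ u converge uniformly in τ, which allows the limit and ∂_τ to be
exchanged. -/
theorem hasDerivAt_lim0 (hu : ClR (half 1) 0 0 u) (k : Mode) (l : ℝ) {t : ℝ}
    (ht : t ∈ Ioo (0 : ℝ) 1) : HasDerivAt (lim0 u k l) (lim0 (pt u) k l t) t := by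
  have ho := (isDom_half (R := 1)).isOpen
  have hpt : ClR (half 1) 0 0 (pt u) := Cl.pt ho isAdditivePred_rap hu
  obtain ⟨C, hC0, hC⟩ := exists_lim0_sub_le hpt
  refine hasDerivAt_of_tendstoUniformlyOn (l := 𝓝[>] (0 : ℝ)) (s := Ioo 0 1) isOpen_Ioo
    (f := fun l' t => u k l' t) (f' := fun l' t => pt u k l' t) ?_ ?_
    (fun t ht => tendsto_lim0 hu k l ht) ht
  · rw [Metric.tendstoUniformlyOn_iff]
    intro ε hε
    have h1 : Tendsto (fun l' : ℝ => C * l') (𝓝[>] 0) (𝓝 0) := by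
      have : Tendsto (fun l' : ℝ => C * l') (𝓝 0) (𝓝 (C * 0)) := tendsto_id.const_mul C
      rw [mul_zero] at this
      exact this.mono_left nhdsWithin_le_nhds
    filter_upwards [eventually_Ioo, h1.eventually_lt_const hε] with l' hl' hlt t ht
    rw [dist_comm, dist_eq_norm]
    exact (hC k l' hl' t ht).trans_lt hlt
  · filter_upwards [eventually_Ioo] with l' hl' t ht
    exact hu.1.hasDerivAt_pt ho k ⟨hl', ht⟩

theorem pt_lim0 (hu : ClR (half 1) 0 0 u) : EqF (half 1) (pt (lim0 u)) (lim0 (pt u)) :=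
  fun k l _ hp => (hasDerivAt_lim0 hu k l hp.2).deriv

theorem sm_lim0 (hu : ClR (half 1) 0 0 u) : Sm (half 1) (lim0 u) := fun k => by
  have ho := (isDom_half (R := 1)).isOpen
  refine contDiffOn_of_closed_family (ι := {u // ClR (half 1) 0 0 u}) (κ := Unit) ho
    (Φ := fun i p => lim0 i.1 k p.1 p.2) (c := fun _ i => ⟨pt i.1, Cl.pt ho isAdditivePred_rap i.2⟩)
    (v := fun _ => ContinuousLinearMap.snd ℝ ℝ ℝ) (fun i p hp => ?_) ⟨u, hu⟩
  have h := (hasDerivAt_lim0 i.2 k p.1 hp.2).hasFDerivAt.comp p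
    (ContinuousLinearMap.snd ℝ ℝ ℝ).hasFDerivAt
  refine h.congr_fderiv ?_
  ext <;> simp

theorem rap_lim0 (hu : ClR (half 1) 0 0 u) : Rap (half 1) 0 (lim0 u) := fun m => by
  obtain ⟨C, hC0, hC⟩ := hu.base.exists_nonneg isDom_half m
  refine ⟨C, fun k l t hp => ?_⟩
  refine le_of_tendsto (((tendsto_lim0 hu k l hp.2).norm).const_mul _) ?_
  filter_upwards [eventually_Ioo, Ioo_mem_nhdsGT hp.1.1] with l' hl' hl2
  refine (hC k l' t ⟨hl', hp.2⟩).trans ?_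
  have := hl'.1
  rw [zpow_zero, zpow_zero]
  gcongr
  exact hl2.2.le

/-- The limits of class members form a set closed under differentiation: ∂_τ passes to the limit of
∂_τ u, while ℓ^σ ∂_ℓ gives 0, the limit of the zero family. Hence σ is arbitrary here. -/
theorem clR_lim0 {σ : ℕ} (hu : ClR (half 1) 0 0 u) : ClR (half 1) σ 0 (lim0 u) := by
  have ho := (isDom_half (R := 1)).isOpen
  have hz : EqF (half 1) 0 (lim0 0) := fun k l t hp => by
    refine (tendsto_nhds_unique (tendsto_lim0 clR_zero k l hp.2) ?_).symm
    exact tendsto_const_nhds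
  refine Cl.of_closed (Q := fun f => ∃ u, ClR (half 1) 0 0 u ∧ EqF (half 1) f (lim0 u))
    (fun f hf => ?_) (fun f hf => ?_) (fun f hf => ?_) (fun f hf => ?_) ⟨u, hu, fun _ _ _ _ => rfl⟩
  · obtain ⟨u, hu, h⟩ := hf
    exact (sm_lim0 hu).congr h.symm
  · obtain ⟨u, hu, h⟩ := hf
    exact isAdditivePred_rap.congr h.symm (rap_lim0 hu)
  · obtain ⟨u, hu, h⟩ := hf
    refine ⟨pt u, Cl.pt ho isAdditivePred_rap hu, fun k l t hp => ?_⟩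
    rw [h.pt ho k l t hp, pt_lim0 hu k l t hp]
  · obtain ⟨u, hu, h⟩ := hf
    refine ⟨0, clR_zero, fun k l t hp => ?_⟩
    rw [h.pl ho k l t hp, ← hz k l t hp]
    change (l : ℂ) ^ σ * deriv (fun _ => lim0 u k l t) l = 0
    simp

theorem pl_zero_iterate_pt (hu : ClR (half 1) 0 0 u) (n : ℕ) :
    EqF (half 1) (pt ((pl 0)^[n] u)) ((pl 0)^[n] (pt u)) := by
  have ho := (isDom_half (R := 1)).isOpen
  induction n generalizing u with
  | zero => exact fun _ _ _ _ => rfl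
  | succ n ih =>
    intro k l t hp
    rw [Function.iterate_succ_apply, Function.iterate_succ_apply, ih (Cl.pl ho hu) k l t hp]
    have : ∀ n (f g : Fam), EqF (half 1) f g → EqF (half 1) ((pl 0)^[n] f) ((pl 0)^[n] g) := by
      intro n
      induction n with
      | zero => exact fun f g h => h
      | succ n ih => exact fun f g h => ih _ _ (h.pl ho)
    exact this n _ _ (pl_pt_comm ho hu.1).symm k l t hp

theorem pt_taylorRem (hu : ClR (half 1) 0 0 u) (L : ℕ) :
    EqF (half 1) (pt (taylorRem L u)) (taylorRem L (pt u)) := fun k l t hp => by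
  have ho := (isDom_half (R := 1)).isOpen
  have h1 : HasDerivAt (taylorRem L u k l) (pt u k l t - ∑ n ∈ Finset.range L,
      (n.factorial : ℂ)⁻¹ * (l : ℂ) ^ n * lim0 (pt ((pl 0)^[n] u)) k l t) t :=
    (hu.1.hasDerivAt_pt ho k hp).sub (HasDerivAt.fun_sum fun n _ =>
      (hasDerivAt_lim0 (hu.pl_zero_iterate ho n) k l hp.2).const_mul _)
  rw [show pt (taylorRem L u) k l t = _ from h1.deriv, taylorRem]
  congr 1
  exact Finset.sum_congr rfl fun n _ => by rw [lim0_congr (pl_zero_iterate_pt hu n) k l hp.2]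

/-- Differentiation in ℓ shifts the Taylor polynomial by one index. Every bound on the remainder
below is an induction on L through this identity. -/
theorem hasDerivAt_taylorRem (hu : ClR (half 1) 0 0 u) (L : ℕ) (k : Mode) {l t : ℝ}
    (hp : (l, t) ∈ half 1) : HasDerivAt (fun l => taylorRem (L + 1) u k l t)
      (taylorRem L (pl 0 u) k l t) l := by
  have ho := (isDom_half (R := 1)).isOpen
  have hd : HasDerivAt (fun l => u k l t) (pl 0 u k l t) l := by
    simpa [pl] using (hu.1.differentiableAt_left ho k hp).hasDerivAt
  have h1 := hd.sub (HasDerivAt.fun_sum (u := Finset.range (L + 1))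
    (A := fun n (l : ℝ) => (n.factorial : ℂ)⁻¹ * (l : ℂ) ^ n * lim0 ((pl 0)^[n] u) k l t)
    (A' := fun n => (n.factorial : ℂ)⁻¹ * (n * (l : ℂ) ^ (n - 1)) * lim0 ((pl 0)^[n] u) k l t)
    fun n _ => by
      have h2 := ((hasDerivAt_pow n (l : ℂ)).comp_ofReal.const_mul (n.factorial : ℂ)⁻¹).mul_const
        (lim0 ((pl 0)^[n] u) k l t)
      exact h2)
  refine h1.congr_deriv ?_
  rw [taylorRem, Finset.sum_range_succ']
  simp only [Nat.cast_zero, zero_mul, mul_zero, add_zero, Nat.add_sub_cancel]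
  congr 1
  refine Finset.sum_congr rfl fun n _ => ?_
  rw [Function.iterate_succ_apply, Nat.factorial_succ]
  have h3 : (n.factorial : ℂ) ≠ 0 := by exact_mod_cast n.factorial_ne_zero
  have h4 : ((n + 1 : ℕ) : ℂ) ≠ 0 := by exact_mod_cast n.succ_ne_zero
  push_cast at h4 ⊢
  field_simp

theorem sm_taylorRem (hu : ClR (half 1) 0 0 u) (L : ℕ) : Sm (half 1) (taylorRem L u) := fun k => by
  have ho := (isDom_half (R := 1)).isOpen
  refine (hu.1 k).sub (ContDiffOn.sum fun n _ => ?_)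
  exact (contDiff_const.mul (contDiff_ofReal_fst_pow n)).contDiffOn.mul
    (sm_lim0 (hu.pl_zero_iterate ho n) k)

theorem tendsto_taylorRem (hu : ClR (half 1) 0 0 u) (L : ℕ) (k : Mode) {t : ℝ}
    (ht : t ∈ Ioo (0 : ℝ) 1) : Tendsto (fun l => taylorRem (L + 1) u k l t) (𝓝[>] 0) (𝓝 0) := by
  have h1 := tendsto_lim0 hu k 0 ht
  have h2 : Tendsto (fun l : ℝ => ∑ n ∈ Finset.range (L + 1), (n.factorial : ℂ)⁻¹ * (l : ℂ) ^ n *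
      lim0 ((pl 0)^[n] u) k 0 t) (𝓝[>] 0) (𝓝 (∑ n ∈ Finset.range (L + 1),
        (n.factorial : ℂ)⁻¹ * ((0 : ℝ) : ℂ) ^ n * lim0 ((pl 0)^[n] u) k 0 t)) := by
    have hc : Continuous fun l : ℝ => ∑ n ∈ Finset.range (L + 1),
        (n.factorial : ℂ)⁻¹ * (l : ℂ) ^ n * lim0 ((pl 0)^[n] u) k 0 t := by fun_prop
    exact hc.continuousAt.tendsto.mono_left nhdsWithin_le_nhds
  have h3 := h1.sub h2
  rw [Finset.sum_range_succ'] at h3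
  have h4 : Tendsto (fun l : ℝ => u k l t - ∑ n ∈ Finset.range (L + 1), (n.factorial : ℂ)⁻¹ *
      (l : ℂ) ^ n * lim0 ((pl 0)^[n] u) k 0 t) (𝓝[>] 0) (𝓝 0) := by simpa using h3
  exact h4

/-- The bound of order L for the remainder of ∂_ℓ u is integrated from ℓ = 0, where the remainder of
u vanishes. Both r^m and ℓ^L increase with ℓ, so the bound at the upper end serves on the whole
interval. -/
theorem rap_taylorRem (hu : ClR (half 1) 0 0 u) (L : ℕ) : Rap (half 1) L (taylorRem L u) := by
  have ho := (isDom_half (R := 1)).isOpen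
  induction L generalizing u with
  | zero =>
    refine isAdditivePred_rap.congr (fun k l t _ => ?_) hu.base
    simp [taylorRem]
  | succ L ih =>
    intro m
    obtain ⟨C, hC0, hC⟩ := (ih (Cl.pl ho hu)).exists_nonneg isDom_half m
    refine ⟨C, fun k l t hp => ?_⟩
    have hl := hp.1.1
    have hw := pow_pos k.w_pos m
    have hb : ∀ l' ∈ Ioo 0 l, ‖taylorRem (L + 1) u k l t - taylorRem (L + 1) u k l' t‖ ≤
        C * (t ^ 2 + l ^ 2) ^ m * l ^ L / k.w ^ m * l := fun l' hl' => by
      have h1 := (convex_Icc l' l).norm_image_sub_le_of_norm_hasDerivWithin_le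
        (f := fun l => taylorRem (L + 1) u k l t) (f' := fun l => taylorRem L (pl 0 u) k l t)
        (C := C * (t ^ 2 + l ^ 2) ^ m * l ^ L / k.w ^ m)
        (fun x hx => (hasDerivAt_taylorRem hu L k (l := x) (t := t)
          ⟨⟨hl'.1.trans_le hx.1, hx.2.trans_lt hp.1.2⟩, hp.2⟩).hasDerivWithinAt)
        (fun x hx => ?_) (left_mem_Icc.2 hl'.2.le) (right_mem_Icc.2 hl'.2.le)
      · refine h1.trans ?_
        rw [Real.norm_eq_abs, abs_of_pos (by linarith [hl'.2])]
        gcongr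
        linarith [hl'.1]
      · have hx0 := hl'.1.trans_le hx.1
        rw [le_div_iff₀ hw, mul_comm]
        refine (hC k x t ⟨⟨hx0, hx.2.trans_lt hp.1.2⟩, hp.2⟩).trans ?_
        rw [zpow_natCast]
        gcongr <;> exact hx.2
    have h2 : ‖taylorRem (L + 1) u k l t - 0‖ ≤ C * (t ^ 2 + l ^ 2) ^ m * l ^ L / k.w ^ m * l := by
      refine le_of_tendsto (((tendsto_taylorRem hu L k hp.2).const_sub _).norm) ?_
      filter_upwards [Ioo_mem_nhdsGT hl] with l' hl' using hb l' hl'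
    rw [sub_zero] at h2
    refine (mul_le_mul_of_nonneg_left h2 hw.le).trans (le_of_eq ?_)
    rw [zpow_natCast, pow_succ]
    field_simp
    ring

theorem tc_taylorRem (hu : ClR (half 1) 0 0 u) (L J : ℕ) :
    Tc (Rap (half 1) L) J (taylorRem L u) := by
  have ho := (isDom_half (R := 1)).isOpen
  induction J generalizing u with
  | zero => exact rap_taylorRem hu L
  | succ J ih =>
    exact ⟨rap_taylorRem hu L, Tc.congr ho isAdditivePred_rap (pt_taylorRem hu L).symm
      (ih (Cl.pt ho isAdditivePred_rap hu))⟩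

/-- ℓ ∂_ℓ of the remainder of order L + 1 is ℓ times the remainder of order L of ∂_ℓ u, again of
order L + 1. For L = 0 the remainder is u itself. -/
theorem clR_taylorRem (hu : ClR (half 1) 0 0 u) (L : ℕ) : ClR (half 1) 1 L (taylorRem L u) := by
  have ho := (isDom_half (R := 1)).isOpen
  refine ⟨sm_taylorRem hu L, fun I J => ?_⟩
  induction I generalizing u L with
  | zero => exact tc_taylorRem hu L J
  | succ I ih =>
    cases L with
    | zero =>
      have e : EqF (half 1) u (taylorRem 0 u) := fun k l t _ => by simp [taylorRem]
      exact ((hu.of_zero isDom_half).congr isDom_half e).2 (I + 1) J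
    | succ L =>
      refine ⟨tc_taylorRem hu (L + 1) J, ?_⟩
      have hu' : ClR (half 1) 0 0 (pl 0 u) := Cl.pl ho hu
      have hl := clM_lpow_order (isDom_half (R := 1)) 1
      have h := Cc.mul ho (isAdditivePred_rap (S := half 1) (s := (1 : ℕ) + (L : ℤ)))
        (fun h h' => Mod.mul_rap isDom_half h h') hl.1 (sm_taylorRem hu' L) (hl.2 I J) (ih hu' L)
      have e : ((L + 1 : ℕ) : ℤ) = (1 : ℕ) + (L : ℤ) := by push_cast; ring
      rw [e]
      refine Cc.congr ho isAdditivePred_rap (fun k l t hp => ?_) h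
      change (l : ℂ) ^ 1 * _ = (l : ℂ) ^ 1 * _
      rw [(hasDerivAt_taylorRem hu L k hp).deriv]

end

/-! ### Expansions with coefficients that do not depend on `ℓ` -/

/-- The expansion of a family in powers and logarithms of `ℓ` for `τ > 0`, with coefficients that
do not depend on `ℓ`. -/
def HasExpansion (E : IndexSet) (f : Fam) : Prop :=
  ∃ v : ℂ × ℕ → Fam, (∀ e k l l' t, v e k l t = v e k l' t) ∧
    (∀ e ∈ E.carrier, ClR (half 1) 1 0 (v e)) ∧
    ∀ N : ℕ, ∃ ε > 0, ClR (half ε) 1 N (f - ∑ e ∈ E.upTo N, v e * lterm e)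

theorem IndexSet.add_nat_mem (E : IndexSet) {e : ℂ × ℕ} (he : e ∈ E.carrier) (n : ℕ) :
    (e.1 + n, e.2) ∈ E.carrier := by
  induction n with
  | zero => simpa using he
  | succ n ih =>
    have := E.shift_closed _ _ ih
    rwa [add_assoc, ← Nat.cast_succ] at this

theorem phgTerm_add_nat (e : ℂ × ℕ) (n : ℕ) {x : ℝ} (hx : 0 < x) :
    phgTerm (e.1 + n, e.2) x = (x : ℂ) ^ n * phgTerm e x := by
  have : (x : ℂ) ≠ 0 := by exact_mod_cast hx.ne'
  simp only [phgTerm, Complex.cpow_add _ _ this, Complex.cpow_natCast]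
  ring

/-- A pair (z, p) that reaches e' by adding n has Re z ≤ Re e', which leaves finitely many, and it
determines n. -/
theorem IndexSet.finite_sources (E : IndexSet) (e' : ℂ × ℕ) :
    {q : (ℂ × ℕ) × ℕ | q.1 ∈ E.carrier ∧ (q.1.1 + q.2, q.1.2) = e'}.Finite := by
  refine Set.Finite.of_finite_image (f := Prod.fst) ((E.finite_re_le e'.1.re).subset ?_) ?_
  · rintro _ ⟨⟨e, n⟩, ⟨he, rfl⟩, rfl⟩
    refine ⟨he, ?_⟩
    simp
  · rintro ⟨e, n⟩ ⟨-, h⟩ ⟨e₂, n₂⟩ ⟨-, h₂⟩ rfl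
    have := h.trans h₂.symm
    simp only [Prod.mk.injEq, add_right_inj, Nat.cast_inj, and_true] at this
    rw [this]

/-- Each coefficient is Taylor expanded at ℓ = 0 and the terms ℓ^(z+n) (log ℓ)^p are regrouped by
exponent, which stays in E because an index set is closed under shifts. What is left over has three
sources: the old remainder, the Taylor remainders, and the terms with exponent of real part above N.
-/
theorem Phg.hasExpansion {ℓ₀ : ℝ} {E : IndexSet} {f : Fam} (hf : Phg ℓ₀ E f) :
    HasExpansion E f := by
  classical
  obtain ⟨u, hu, hexp⟩ := hf.expansion
  have ho := (isDom_half (R := 1)).isOpen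
  have hu' : ∀ e ∈ E.carrier, ClR (half 1) 0 0 (u e) := fun e he =>
    (hu e he).2.mono half_subset_strip
  set V : (ℂ × ℕ) × ℕ → Fam := fun q =>
    cst (fun _ => (q.2.factorial : ℂ)⁻¹) * lim0 ((pl 0)^[q.2] (u q.1)) with hV
  have cV : ∀ q : (ℂ × ℕ) × ℕ, q.1 ∈ E.carrier → ClR (half 1) 1 0 (V q) := fun q hq =>
    (clR_lim0 ((hu' q.1 hq).pl_zero_iterate ho q.2)).const_mul isDom_half _
  set g : (ℂ × ℕ) × ℕ → ℂ × ℕ := fun q => (q.1.1 + q.2, q.1.2) with hg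
  refine ⟨fun e' => ∑ q ∈ (E.finite_sources e').toFinset, V q, fun e' k l l' t => ?_,
    fun e' _ => ClR.sum isDom_half _ fun q hq => cV q ?_, fun N => ?_⟩
  · simp only [Finset.sum_apply]; rfl
  · exact ((E.finite_sources e').mem_toFinset.1 hq).1
  obtain ⟨δ, hδ, hrem⟩ := hexp N
  obtain ⟨b, hb⟩ : ∃ b : ℤ, ∀ e ∈ E.upTo N, (b : ℝ) < e.1.re := by
    obtain ⟨b, hb⟩ := ((E.upTo N).image fun e => e.1.re).bddBelow
    obtain ⟨b', hb'⟩ := exists_int_lt b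
    exact ⟨b', fun e he => hb'.trans_le (hb (by exact_mod_cast Finset.mem_image_of_mem _ he))⟩
  -- b lies below every real part that occurs, so b + L ≥ N makes the Taylor remainders negligible;
  -- moreover a term with n ≥ L has exponent beyond N, so truncation at L loses nothing.
  set L : ℕ := ((N : ℤ) - b).toNat + 1 with hL
  have hLN : (N : ℤ) - b < L := by have := Int.self_le_toNat ((N : ℤ) - b); omega
  have hLN' : (N : ℝ) - b < L := by exact_mod_cast hLN
  set q₀ := min δ 1 with hq₀
  have hq1 : q₀ ≤ 1 := min_le_right _ _
  have hT : ∀ e ∈ E.upTo N, e ∈ E.carrier := fun e he => (IndexSet.mem_upTo.1 he).1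
  set P := (E.upTo N) ×ˢ Finset.range L with hP
  have key : ClR (half q₀) 1 N ((f - ∑ e ∈ E.upTo N, u e * lterm e)
      + ∑ e ∈ E.upTo N, taylorRem L (u e) * lterm e
      + ∑ q ∈ P.filter (fun q => ¬ (g q).1.re ≤ N), V q * lterm (g q)) := by
    refine ((hrem.mono (half_mono (min_le_left _ _))).add isDom_half
      (ClR.sum isDom_half _ fun e he => ?_)).add isDom_half
      (ClR.sum isDom_half _ fun q hq => ?_)
    · have h1 := ((clM_lterm isDom_half e (hb e he)).mul_rap isDom_half
        ((clR_taylorRem (hu' e (hT e he)) L).mono (half_mono hq1)))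
      rw [mul_comm]
      exact h1.mono_exp isDom_half (by omega)
    · rw [Finset.mem_filter, hP, Finset.mem_product] at hq
      exact ((cV q (hT _ hq.1.1)).mono (half_mono hq1)).mul_lterm isDom_half _
        (by exact_mod_cast not_le.1 hq.2)
  refine ⟨q₀, by positivity, key.congr isDom_half fun k l t hp => ?_⟩
  have hl := hp.1.1
  have e1 : ∑ e' ∈ E.upTo N, (∑ q ∈ (E.finite_sources e').toFinset, V q) * lterm e'
      = ∑ q ∈ P.filter (fun q => (g q).1.re ≤ N), V q * lterm (g q) := by
    rw [← Finset.sum_fiberwise_of_maps_to (s := P.filter (fun q => (g q).1.re ≤ N)) (t := E.upTo N)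
      (g := g)]
    · refine Finset.sum_congr rfl fun e' he' => ?_
      rw [Finset.sum_mul]
      have he'2 := IndexSet.mem_upTo.1 he'
      have hs : (E.finite_sources e').toFinset
          = (P.filter (fun q => (g q).1.re ≤ N)).filter (fun q => g q = e') := by
        ext q
        simp only [Set.Finite.mem_toFinset, Set.mem_ofPred_eq, Finset.mem_filter, hP,
          Finset.mem_product, Finset.mem_range, IndexSet.mem_upTo]
        constructor
        · rintro ⟨h1, h2⟩
          have h3 : q.1.1.re + q.2 = e'.1.re := by rw [← h2]; simp
          have h4 : (0 : ℝ) ≤ q.2 := Nat.cast_nonneg _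
          have h5 : q.1 ∈ E.upTo N := IndexSet.mem_upTo.2 ⟨h1, by linarith [he'2.2]⟩
          refine ⟨⟨⟨⟨h1, by linarith [he'2.2]⟩, ?_⟩, ?_⟩, h2⟩
          · have := hb _ h5
            have : (q.2 : ℝ) < L := by linarith [he'2.2]
            exact_mod_cast this
          · rw [show g q = e' from h2]; exact he'2.2
        · rintro ⟨⟨⟨⟨h1, -⟩, -⟩, -⟩, h2⟩
          exact ⟨h1, h2⟩
      rw [hs]
      refine Finset.sum_congr rfl fun q hq => ?_
      rw [(Finset.mem_filter.1 hq).2]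
    · intro q hq
      rw [Finset.mem_filter, hP, Finset.mem_product] at hq
      exact IndexSet.mem_upTo.2 ⟨E.add_nat_mem (hT _ hq.1.1) _, hq.2⟩
  have e2 := Finset.sum_filter_add_sum_filter_not P (fun q => (g q).1.re ≤ N)
    fun q => V q * lterm (g q)
  have e3 : (∑ q ∈ P, V q * lterm (g q)) k l t
      = ∑ e ∈ E.upTo N, (u e k l t - taylorRem L (u e) k l t) * lterm e k l t := by
    rw [hP, Finset.sum_product]
    simp only [Finset.sum_apply]
    refine Finset.sum_congr rfl fun e _ => ?_
    simp only [taylorRem, sub_sub_cancel, Finset.sum_mul]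
    refine Finset.sum_congr rfl fun n _ => ?_
    simp only [hV, hg, Pi.mul_apply, lterm, lfun, cst, phgTerm_add_nat e n hl]
    ring
  rw [e1]
  have e4 := congrFun (congrFun (congrFun e2 k) l) t
  rw [e3] at e4
  simp only [Pi.add_apply, Pi.sub_apply, Finset.sum_apply, Pi.mul_apply, sub_mul,
    Finset.sum_sub_distrib] at e4 ⊢
  linear_combination e4

end HypCyl

end

/-! ### Change of variables in expansions, and Euler derivatives on the blowup -/

noncomputable section

namespace HypCyl
open Set Filter Topology

/-! ### Changing the variable in an expansion -/

/-- The coefficients of an expansion after multiplying the variable by a constant. -/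
def shiftCoef {A : Type} [CommSemiring A] (E : IndexSet) (c a : ℂ × ℕ → A) (e : ℂ × ℕ) : A :=
  ∑ e' ∈ (E.upTo e.1.re).filter (fun e' => e'.1 = e.1 ∧ e.2 ≤ e'.2),
    (e'.2.choose e.2 : A) * c (e.1, e'.2 - e.2) * a e'

/-- The hypothesis is the binomial formula for powers of log x + log y. Closure of E under lowering
the logarithmic power keeps all new terms in the index set, and the claim is an exchange of two
finite sums. -/
theorem sum_shiftCoef {A : Type} [CommSemiring A] {E : IndexSet} {c a φ φ' : ℂ × ℕ → A}
    (h : ∀ e, φ e = ∑ q ∈ Finset.range (e.2 + 1),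
      (e.2.choose q : A) * φ' (e.1, q) * c (e.1, e.2 - q)) (N : ℝ) :
    ∑ e ∈ E.upTo N, a e * φ e = ∑ e ∈ E.upTo N, shiftCoef E c a e * φ' e := by
  have h1 : ∀ e ∈ E.upTo N, a e * φ e = ∑ e' ∈ (E.upTo N).filter
      (fun e' => e.1 = e'.1 ∧ e'.2 ≤ e.2),
        (e.2.choose e'.2 : A) * c (e'.1, e.2 - e'.2) * a e * φ' e' := fun e he => by
    rw [h, Finset.mul_sum]
    refine Finset.sum_nbij' (i := fun q => (e.1, q)) (j := Prod.snd) (fun q hq => ?_)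
      (fun e' he' => ?_) (fun q _ => rfl) (fun e' he' => ?_) fun q _ => by ring
    · rw [IndexSet.mem_upTo] at he
      have hq' : q ≤ e.2 := Nat.lt_succ_iff.1 (Finset.mem_range.1 hq)
      exact Finset.mem_filter.2 ⟨IndexSet.mem_upTo.2 ⟨E.log_closed _ _ _ he.1 hq', he.2⟩, rfl, hq'⟩
    · exact Finset.mem_range.2 (Nat.lt_succ_iff.2 (Finset.mem_filter.1 he').2.2)
    · exact Prod.ext (Finset.mem_filter.1 he').2.1 rfl
  have h2 : ∀ e ∈ E.upTo N, shiftCoef E c a e * φ' e = ∑ e' ∈ (E.upTo N).filter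
      (fun e' => e'.1 = e.1 ∧ e.2 ≤ e'.2),
        (e'.2.choose e.2 : A) * c (e.1, e'.2 - e.2) * a e' * φ' e := fun e he => by
    rw [shiftCoef, Finset.sum_mul]
    refine Finset.sum_congr ?_ fun _ _ => rfl
    ext e'
    simp only [Finset.mem_filter, IndexSet.mem_upTo]
    refine and_congr_left fun h => and_congr_right fun _ => ?_
    rw [h.1]
    exact ⟨fun _ => (IndexSet.mem_upTo.1 he).2, fun _ => le_rfl⟩
  rw [Finset.sum_congr rfl h1, Finset.sum_congr rfl h2]
  refine Finset.sum_comm' fun e e' => ?_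
  simp only [Finset.mem_filter]
  tauto

theorem phgTerm_mul (e : ℂ × ℕ) {x y : ℝ} (hx : 0 < x) (hy : 0 < y) :
    phgTerm e (x * y) = ∑ q ∈ Finset.range (e.2 + 1),
      (e.2.choose q : ℂ) * phgTerm (e.1, q) x * phgTerm (e.1, e.2 - q) y := by
  simp only [phgTerm]
  rw [Complex.ofReal_mul, Complex.mul_cpow_ofReal_nonneg hx.le hy.le, Real.log_mul hx.ne' hy.ne',
    Complex.ofReal_add, add_pow, Finset.mul_sum]
  exact Finset.sum_congr rfl fun q _ => by ring

/-! ### Derivatives of Fourier series in the coordinates of the blowup -/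

/-- Transfers iterated Euler derivatives along any curve family in the blowup to iterates of one
operator on families; the class `P` carries the differentiability needed at each stage. -/
theorem eulerD_iterate_eqOn {P : Fam → Prop} {B : Fam → Fam} {Ψ : Fam → ℝ → ℂ} {U : Set ℝ}
    (hU : IsOpen U) (hB : ∀ g, P g → P (B g))
    (h : ∀ g, P g → ∀ x ∈ U, (x : ℂ) * deriv (Ψ g) x = Ψ (B g) x) (j : ℕ) {g : Fam} (hg : P g)
    {F : ℝ → ℂ} (hF : EqOn F (Ψ g) U) : EqOn (eulerD^[j] F) (Ψ (B^[j] g)) U := by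
  induction j generalizing g F with
  | zero => exact hF
  | succ j ih =>
    refine ih (hB g hg) fun x hx => ?_
    have : F =ᶠ[𝓝 x] Ψ g := hF.eventuallyEq_of_mem (hU.mem_nhds hx)
    rw [eulerD, this.deriv_eq, h g hg x hx]

section

variable {S : Set (ℝ × ℝ)} {s : ℤ} {f g : Fam} {E : IndexSet} {ℓ₀ q : ℝ}

theorem clR_iterate {D : Fam → Fam} (hD : ∀ g, ClR S 1 s g → ClR S 1 s (D g)) (hg : ClR S 1 s g)
    (n : ℕ) : ClR S 1 s (D^[n] g) := by
  induction n generalizing g with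
  | zero => exact hg
  | succ n ih => exact ih (hD g hg)

theorem iteratedDeriv_synth (hS : IsDom S) (hg : RapF S g) {l t : ℝ} (hp : (l, t) ∈ S) (n : ℕ)
    (θ : ℝ) : iteratedDeriv n (fun θ => synth g l t θ) θ = synth (dθ^[n] g) l t θ := by
  induction n generalizing g with
  | zero => simp
  | succ n ih =>
    rw [iteratedDeriv_succ', Function.iterate_succ_apply, ← ih (hg.dθ hS)]
    congr 1
    ext θ
    have := hasDerivAt_synth_comp hS hg (hasDerivAt_const θ l) (hasDerivAt_const θ t)
      (hasDerivAt_id θ) hp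
    simpa using this.deriv

/-- With ℓ = xy and τ = y, the field x ∂_x becomes ℓ ∂_ℓ and y ∂_y becomes ℓ ∂_ℓ + τ ∂_τ, which is
`Bop`. Both preserve the rapidly decreasing classes without loss of order. -/
theorem bDeriv_synth (hS : IsDom S) (hg : ClR S 1 s g) {Ix Iy : Set ℝ} (hIx : IsOpen Ix)
    (hIy : IsOpen Iy) (hI : ∀ x ∈ Ix, ∀ y ∈ Iy, (x * y, y) ∈ S) {Φ : ℝ → ℝ → ℝ → ℂ}
    (h : ∀ x ∈ Ix, ∀ y ∈ Iy, ∀ θ, Φ x y θ = synth g (x * y) y θ) (i j n : ℕ) {x y : ℝ}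
    (hx : x ∈ Ix) (hy : y ∈ Iy) (θ : ℝ) :
    bDeriv i j n Φ x y θ = synth ((pl 1)^[i] (Bop^[j] (dθ^[n] g))) (x * y) y θ := by
  have h1 := clR_iterate (fun g hg => ClR.dθ hS hg) hg n
  have h2 := clR_iterate (fun g hg => ClR.Bop hS hg) h1 j
  refine eulerD_iterate_eqOn (P := ClR S 1 s) (B := pl 1)
    (Ψ := fun g x => synth g (x * y) y θ) hIx (fun g hg => hg.pl hS) (fun g hg x hx => ?_) i h2
    (fun x hx => ?_) hx
  · have := (hasDerivAt_synth_comp hS ⟨s, hg⟩ ((hasDerivAt_id x).mul_const y)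
      (hasDerivAt_const x y) (hasDerivAt_const x θ) (hI x hx y hy)).deriv
    simp only [id] at this
    rw [this, synth_pl_one]
    push_cast; ring
  · refine eulerD_iterate_eqOn (P := ClR S 1 s) (B := Bop)
      (Ψ := fun g y => synth g (x * y) y θ) hIy (fun g hg => hg.Bop hS) (fun g hg y hy => ?_) j h1
      (fun y hy => ?_) hy
    · have := (hasDerivAt_synth_comp hS ⟨s, hg⟩ ((hasDerivAt_id y).const_mul x)
        (hasDerivAt_id y) (hasDerivAt_const y θ) (hI x hx y hy)).deriv
      simp only [id] at this
      have hc := clM_t (σ := 1) hS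
      rw [this, Bop, synth_add hS ⟨s, hg.pl hS⟩ ⟨s, hc.mul_rap_zero hS (hg.pt hS)⟩ (hI x hx y hy),
        synth_pl_one, synth_tfun_mul]
      push_cast; ring
    · have : (fun θ' => Φ x y θ') = fun θ' => synth g (x * y) y θ' := funext fun θ' => h x hx y hy θ'
      simp only [this]
      exact iteratedDeriv_synth hS ⟨s, hg⟩ (hI x hx y hy) n θ

/-! ### Smoothness up to the boundary -/

theorem exists_contDiffOn_extension {E F : Type} [NormedAddCommGroup E]
    [NormedSpace ℝ E] [NormedAddCommGroup F] [NormedSpace ℝ F] [CompleteSpace F]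
    {K U Z : Set E} (hK : Convex ℝ K) (hKi : (interior K).Nonempty)
    (hU : IsOpen U) (hZ : IsClosed Z) (hKUZ : K = U ∩ Z) {f : E → F}
    (hs : ContDiffOn ℝ (⊤ : ℕ∞) f (interior K))
    (hb : ∀ m : ℕ, ∀ x ∈ K, ∃ δ > 0, ∃ C, ∀ y ∈ interior K ∩ Metric.ball x δ,
        ‖iteratedFDeriv ℝ m f y‖ ≤ C) :
    ∃ g, ContDiffOn ℝ (⊤ : ℕ∞) g K ∧ EqOn g f (interior K) := by
  have hcl : K ⊆ closure (interior K) := by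
    rw [hK.closure_interior_eq_closure_of_nonempty_interior hKi]; exact subset_closure
  have heq : EqOn (extendFrom (interior K) f) f (interior K) := fun x hx =>
    extendFrom_eq (subset_closure hx) (hs.continuousOn x hx)
  refine ⟨extendFrom (interior K) f, ?_, heq⟩
  refine contDiffOn_of_bounded_iteratedFDeriv hK hKi hU hZ hKUZ ?_ (hs.congr heq)
    fun m x hx => ?_
  · refine continuousOn_extendFrom hcl fun x hx => ?_
    obtain ⟨δ, hδ, C, hC⟩ := hb 1 x hx
    refine exists_tendsto_of_bounded_fderiv isOpen_interior hK.interior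
      (hs.differentiableOn (by simp)) (hcl hx) hδ (C := C) fun y hy => ?_
    rw [← norm_iteratedFDeriv_one]
    exact hC y hy
  · obtain ⟨δ, hδ, C, hC⟩ := hb m x hx
    refine ⟨δ, hδ, C, fun y hy => ?_⟩
    have : extendFrom (interior K) f =ᶠ[𝓝 y] f :=
      heq.eventuallyEq_of_mem (isOpen_interior.mem_nhds hy.1)
    rw [(this.iteratedFDeriv ℝ m).eq_of_nhds]
    exact hC y hy

theorem zpow_le_add {a b l : ℝ} (ha : 0 < a) (hal : a ≤ l) (hlb : l ≤ b) (s : ℤ) :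
    l ^ s ≤ a ^ s + b ^ s := by
  have hl : 0 < l := ha.trans_le hal
  have hb : 0 < b := hl.trans_le hlb
  rcases le_or_gt 0 s with hs | hs
  · have := zpow_le_zpow_left₀ hs hl.le hlb
    have := zpow_pos ha s
    linarith
  · have : l ^ s ≤ a ^ s := by
      obtain ⟨n, rfl⟩ : ∃ n : ℕ, s = -n := ⟨s.natAbs, by omega⟩
      rw [zpow_neg, zpow_neg, zpow_natCast, zpow_natCast]
      gcongr
    have := zpow_pos hb s
    linarith

theorem isOpen_lift (hS : IsOpen S) : IsOpen {q : ℝ × ℝ × ℝ | (q.1, q.2.1) ∈ S} :=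
  hS.preimage (by fun_prop)

theorem contDiffOn_synth (hS : IsDom S) (hf : RapF S f) :
    ContDiffOn ℝ (⊤ : ℕ∞) (fun q : ℝ × ℝ × ℝ => synth f q.1 q.2.1 q.2.2)
      {q | (q.1, q.2.1) ∈ S} :=
  contDiffOn_of_closed_family (ι := {f // RapF S f}) (isOpen_lift hS.isOpen)
    (Φ := fun i q => synth i.1 q.1 q.2.1 q.2.2) (c := fun j i => ⟨dop j i.1, i.2.dop hS j⟩)
    (v := coord3) (fun i _ hq => hasFDerivAt_synth hS i.2 hq) ⟨f, hf⟩

theorem exists_norm_iteratedFDeriv_synth_le (hS : IsDom S) (hf : RapF S f) {a : ℝ} (ha : 0 < a)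
    (m : ℕ) : ∃ C, ∀ q : ℝ × ℝ × ℝ, (q.1, q.2.1) ∈ S → a ≤ q.1 →
      ‖iteratedFDeriv ℝ m (fun q : ℝ × ℝ × ℝ => synth f q.1 q.2.1 q.2.2) q‖ ≤ C := by
  obtain ⟨R, hR0, hR⟩ := hS.exists_le
  have hbd : ∀ i : {f // RapF S f}, ∃ C, ∀ _ : Unit, ∀ q ∈ {q : ℝ × ℝ × ℝ | (q.1, q.2.1) ∈ S ∧ a ≤ q.1},
      ‖synth i.1 q.1 q.2.1 q.2.2‖ ≤ C * 1 := fun i => by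
    obtain ⟨s, hs⟩ := i.2
    obtain ⟨C, hC0, hC⟩ := norm_synth_le hS hs 0
    refine ⟨C * (a ^ s + R ^ s), fun _ q hq => ?_⟩
    refine (hC _ _ hq.1 _).trans ?_
    rw [pow_zero, mul_one, mul_one]
    exact mul_le_mul_of_nonneg_left (zpow_le_add ha hq.2 (hR hq.1).1 s) hC0
  obtain ⟨C, hC⟩ := norm_iteratedFDeriv_le_of_closed_family (ι := {f // RapF S f}) (X := Unit)
    (fun _ => isOpen_lift hS.isOpen)
    (Φ := fun i _ q => synth i.1 q.1 q.2.1 q.2.2) (c := fun j i => ⟨dop j i.1, i.2.dop hS j⟩)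
    (v := coord3) (fun i _ _ hq => hasFDerivAt_synth hS i.2 hq)
    (t := fun _ => {q | (q.1, q.2.1) ∈ S ∧ a ≤ q.1}) (fun _ q hq => hq.1) (w := fun _ => 1)
    hbd m ⟨f, hf⟩
  exact ⟨C, fun q hq hq' => by simpa using hC () q ⟨hq, hq'⟩⟩

/-- The class bounds hold on the open strip only; for each mode they extend to τ = ±1 by continuity,
after which the series converges uniformly near any point. -/
theorem continuousOn_synth (hf : Sm (cstrip ℓ₀) f)
    (hb : ∃ s : ℤ, ∀ q < ℓ₀, ClR (strip q) 1 s f) :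
    ContinuousOn (fun q : ℝ × ℝ × ℝ => synth f q.1 q.2.1 q.2.2)
      (Ioo 0 ℓ₀ ×ˢ (Icc (-1) 1 ×ˢ univ)) := by
  obtain ⟨s, hs⟩ := hb
  rintro ⟨l₀, t₀, θ₀⟩ ⟨hl₀, ht₀, -⟩
  obtain ⟨b, hb1, hb2⟩ := exists_between hl₀.2
  have ha : 0 < l₀ / 2 := by have := hl₀.1; simp only at this; linarith
  obtain ⟨C, hC0, hC⟩ := (hs b hb2).base.exists_nonneg isDom_strip 2
  set D := C * (1 + b ^ 2) ^ 2 * ((l₀ / 2) ^ s + b ^ s)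
  have hbd : ∀ k, ∀ l ∈ Ioo (l₀ / 2) b, ∀ t ∈ Icc (-1 : ℝ) 1, k.w ^ 2 * ‖f k l t‖ ≤ D := by
    intro k l hl t ht
    have hl0 : 0 < l := ha.trans hl.1
    have hcont := hf.continuousOn_right k (l := l) ⟨hl0, hl.2.trans hb2⟩
    have hsub : Icc (-1 : ℝ) 1 ⊆ closure (Ioo (-1) 1) := by rw [closure_Ioo (by norm_num)]
    refine ContinuousWithinAt.closure_le (s := Ioo (-1) 1) (hsub ht)
      (((hcont.norm.const_smul (k.w ^ 2)) t ht).mono Ioo_subset_Icc_self) continuousWithinAt_const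
      fun t' ht' => ?_
    refine (hC k l t' ⟨⟨hl0, hl.2⟩, ht'⟩).trans ?_
    have h1 : t' ^ 2 + l ^ 2 ≤ 1 + b ^ 2 := by nlinarith [ht'.1, ht'.2, hl.2]
    have := zpow_le_add ha hl.1.le hl.2.le s
    have := zpow_pos hl0 s
    change _ ≤ C * (1 + b ^ 2) ^ 2 * ((l₀ / 2) ^ s + b ^ s)
    gcongr
  set V : Set (ℝ × ℝ × ℝ) := Ioo (l₀ / 2) b ×ˢ (Icc (-1) 1 ×ˢ univ)
  have hcV : ContinuousOn (fun q : ℝ × ℝ × ℝ => synth f q.1 q.2.1 q.2.2) V := by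
    refine continuousOn_tsum (fun k => ?_) (summable_mode.mul_left D) fun k q hq => ?_
    · refine ContinuousOn.mul ((hf k).continuousOn.comp (f := fun q : ℝ × ℝ × ℝ => (q.1, q.2.1))
        (by fun_prop) fun q hq => ⟨⟨ha.trans hq.1.1, hq.1.2.trans hb2⟩, hq.2.1⟩) (by fun_prop)
    · rw [norm_mul, norm_exp_mode, mul_one, ← div_eq_mul_inv, le_div_iff₀ (pow_pos k.w_pos 2),
        mul_comm]
      exact hbd k q.1 hq.1 q.2.1 hq.2.1
  refine (hcV _ ⟨⟨by have := hl₀.1; simp only at this ⊢; linarith, hb1⟩, ht₀, mem_univ _⟩).mono_of_mem_nhdsWithin ?_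
  refine mem_nhdsWithin.2 ⟨Ioo (l₀ / 2) b ×ˢ univ, isOpen_Ioo.prod isOpen_univ,
    ⟨⟨by have := hl₀.1; simp only at this ⊢; linarith, hb1⟩, mem_univ _⟩, ?_⟩
  rintro q ⟨hq1, hq2⟩
  exact ⟨hq1.1, hq2.2⟩

theorem contDiffOn_synth_closed (hf : Sm (cstrip ℓ₀) f)
    (hb : ∃ s : ℤ, ∀ q < ℓ₀, ClR (strip q) 1 s f) (hℓ₀ : 0 < ℓ₀) :
    ContDiffOn ℝ (⊤ : ℕ∞) (fun q : ℝ × ℝ × ℝ => synth f q.1 q.2.1 q.2.2)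
      (Ioo 0 ℓ₀ ×ˢ (Icc (-1) 1 ×ˢ univ)) := by
  have hint : interior (Ioo 0 ℓ₀ ×ˢ (Icc (-1 : ℝ) 1 ×ˢ (univ : Set ℝ)))
      = Ioo 0 ℓ₀ ×ˢ (Ioo (-1) 1 ×ˢ univ) := by
    rw [interior_prod_eq, interior_prod_eq, isOpen_Ioo.interior_eq, interior_Icc, interior_univ]
  refine contDiffOn_of_bounded_iteratedFDeriv (U := Ioo 0 ℓ₀ ×ˢ univ)
    (Z := univ ×ˢ (Icc (-1) 1 ×ˢ univ)) ((convex_Ioo _ _).prod ((convex_Icc _ _).prod convex_univ))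
    ?_ (isOpen_Ioo.prod isOpen_univ) (isClosed_univ.prod (isClosed_Icc.prod isClosed_univ)) ?_
    (continuousOn_synth hf hb) ?_ fun m p hp => ?_
  · rw [hint]
    exact ⟨(ℓ₀ / 2, 0, 0), ⟨by linarith, by linarith⟩, ⟨by norm_num, by norm_num⟩, mem_univ _⟩
  · rw [prod_inter_prod, inter_univ, univ_inter]
  · rw [hint]
    obtain ⟨s, hs⟩ := hb
    intro p hp
    obtain ⟨b, hb1, hb2⟩ := exists_between hp.1.2
    refine ((contDiffOn_synth isDom_strip ⟨s, hs b hb2⟩).contDiffAt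
      ((isOpen_lift isDom_strip.isOpen).mem_nhds ?_)).contDiffWithinAt
    exact ⟨⟨hp.1.1, hb1⟩, hp.2.1⟩
  · obtain ⟨s, hs⟩ := hb
    obtain ⟨b, hb1, hb2⟩ := exists_between hp.1.2
    have hp0 := hp.1.1
    obtain ⟨C, hC⟩ := exists_norm_iteratedFDeriv_synth_le isDom_strip ⟨s, hs b hb2⟩ (half_pos hp0) m
    -- Near p the variable ℓ stays between p.1 / 2 and b, away from 0 and from ℓ₀, so negative
    -- powers of ℓ are bounded.
    refine ⟨min (p.1 / 2) (b - p.1), lt_min (half_pos hp0) (by linarith), C, fun y hy => ?_⟩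
    rw [hint] at hy
    have h1 : dist y.1 p.1 < min (p.1 / 2) (b - p.1) :=
      (le_max_left _ _).trans_lt (Metric.mem_ball.1 hy.2)
    rw [Real.dist_eq, lt_min_iff, abs_lt, abs_lt] at h1
    exact hC y ⟨⟨hy.1.1.1, by linarith⟩, hy.1.2.1⟩ (by linarith)

end

end HypCyl

end

noncomputable section

namespace HypCyl
open Set Filter Topology

/-! ### Polyhomogeneity of Fourier series on the blowup -/

/-- The empty index set. -/
def emptyIndex : IndexSet where
  carrier := ∅
  finite_re_le _ := by simp
  log_closed _ _ _ h := h.elim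
  shift_closed _ _ h := h.elim

theorem upTo_eq_empty {F : IndexSet} (hF : F.carrier = ∅) (N : ℝ) : F.upTo N = ∅ := by
  ext e; simp [IndexSet.mem_upTo, hF]

section

variable {S : Set (ℝ × ℝ)} {s : ℤ} {f g v : Fam} {E F : IndexSet} {ℓ₀ q : ℝ}

theorem synth_sum (hS : IsDom S) {ι : Type*} (T : Finset ι) {G : ι → Fam}
    (h : ∀ i ∈ T, RapF S (G i)) {l t : ℝ} (hp : (l, t) ∈ S) (θ : ℝ) :
    RapF S (∑ i ∈ T, G i) ∧ synth (∑ i ∈ T, G i) l t θ = ∑ i ∈ T, synth (G i) l t θ := by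
  classical
  induction T using Finset.induction_on with
  | empty => exact ⟨⟨0, by simpa using clR_zero⟩, by simp [synth]⟩
  | insert a T ha ih =>
    obtain ⟨h1, h2⟩ := ih fun i hi => h i (Finset.mem_insert_of_mem hi)
    have h3 := h a (Finset.mem_insert_self a T)
    rw [Finset.sum_insert ha, Finset.sum_insert ha, synth_add hS h3 h1 hp, h2]
    exact ⟨h3.add hS h1, rfl⟩

theorem diag_mem {y : ℝ} (hy : y ∈ Ioo (0 : ℝ) 1) : (y, y) ∈ half 1 := ⟨hy, hy⟩

theorem hasFDerivAt_synth_diag (hv : RapF (half 1) v) {p : ℝ × ℝ} (hp : p.1 ∈ Ioo (0 : ℝ) 1) :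
    HasFDerivAt (fun p : ℝ × ℝ => synth v p.1 p.1 p.2)
      (∑ j : Fin 2, ((![ContinuousLinearMap.fst ℝ ℝ ℝ, ContinuousLinearMap.snd ℝ ℝ ℝ] :
        Fin 2 → ℝ × ℝ →L[ℝ] ℝ) j).smulRight
          (synth ((![pl 0 v + pt v, dθ v] : Fin 2 → Fam) j) p.1 p.1 p.2)) p := by
  have hS := isDom_half (R := 1)
  have h1 : HasFDerivAt (fun p : ℝ × ℝ => (p.1, p.1, p.2)) _ p :=
    ((ContinuousLinearMap.fst ℝ ℝ ℝ).prod
      ((ContinuousLinearMap.fst ℝ ℝ ℝ).prod (ContinuousLinearMap.snd ℝ ℝ ℝ))).hasFDerivAt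
  refine ((hasFDerivAt_synth hS hv (q := (p.1, p.1, p.2)) (diag_mem hp)).comp
    (f := fun p : ℝ × ℝ => (p.1, p.1, p.2)) p h1).congr_fderiv ?_
  refine ContinuousLinearMap.ext fun w => ?_
  simp [Fin.sum_univ_three, dop, coord3, synth_add hS (hv.pl hS) (hv.pt hS) (diag_mem hp)]

theorem rapF_diag (hv : RapF (half 1) v) (j : Fin 2) :
    RapF (half 1) ((![pl 0 v + pt v, dθ v] : Fin 2 → Fam) j) := by
  have hS := isDom_half (R := 1)
  fin_cases j
  exacts [(hv.pl hS).add hS (hv.pt hS), hv.dθ hS]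

theorem hasFDerivAt_synth_angle (hS : IsDom S) (hg : RapF S g) {l t : ℝ} (hp : (l, t) ∈ S) (θ : ℝ) :
    HasFDerivAt (fun θ : ℝ => synth g l t θ)
      (∑ _j : Unit, (ContinuousLinearMap.id ℝ ℝ).smulRight (synth (dθ g) l t θ)) θ := by
  have := hasDerivAt_synth_comp hS hg (hasDerivAt_const θ l) (hasDerivAt_const θ t)
      (hasDerivAt_id θ) hp
  refine this.hasFDerivAt.congr_fderiv ?_
  ext
  simp

theorem zpow_mul_pow_le {y : ℝ} (hy : 0 < y) (hy1 : y ≤ 1) (s : ℤ) (N : ℕ) :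
    y ^ s * (y ^ 2) ^ (N + s.natAbs) ≤ y ^ N := by
  have e : y ^ s * (y ^ 2) ^ (N + s.natAbs) = y ^ (s + 2 * ((N + s.natAbs : ℕ) : ℤ)) := by
    rw [zpow_add₀ hy.ne', zpow_mul]; norm_cast
  rw [e, ← zpow_natCast]
  refine zpow_le_zpow_right_of_le_one₀ hy hy1 ?_
  omega

/-- The functions on the side face given by Fourier series. -/
theorem exists_sideCoef (hv : RapF (half 1) v) (hF : F.carrier = ∅) : ∃ a : ℝ → ℝ → ℂ,
    (∀ y ∈ Ioo (0 : ℝ) 1, ∀ θ, a y θ = synth v y y θ) ∧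
    ContDiffOn ℝ (⊤ : ℕ∞) (fun q : ℝ × ℝ => a q.1 q.2) (Ioc 0 1 ×ˢ univ) ∧
    HasPhgExpansion F a := by
  have hS := isDom_half (R := 1)
  have hint : interior (Ioc (0 : ℝ) 1 ×ˢ (univ : Set ℝ)) = Ioo 0 1 ×ˢ univ := by
    rw [interior_prod_eq, interior_Ioc, interior_univ]
  have ho : IsOpen (Ioo (0 : ℝ) 1 ×ˢ (univ : Set ℝ)) := isOpen_Ioo.prod isOpen_univ
  have hder := fun (i : {v // RapF (half 1) v}) (p : ℝ × ℝ)
    (hp : p ∈ Ioo (0 : ℝ) 1 ×ˢ (univ : Set ℝ)) => hasFDerivAt_synth_diag i.2 hp.1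
  have hbd : ∀ (b : ℝ), 0 < b → ∀ i : {v // RapF (half 1) v}, ∃ C, ∀ _ : Unit,
      ∀ p ∈ Ioo b 1 ×ˢ (univ : Set ℝ), ‖synth i.1 p.1 p.1 p.2‖ ≤ C * 1 := fun b hb i => by
    obtain ⟨s, hs⟩ := i.2
    obtain ⟨C, hC0, hC⟩ := norm_synth_le hS hs 0
    refine ⟨C * (b ^ s + 1 ^ s), fun _ p hp => ?_⟩
    refine (hC _ _ (diag_mem ⟨hb.trans hp.1.1, hp.1.2⟩) _).trans ?_
    rw [pow_zero, mul_one, mul_one]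
    exact mul_le_mul_of_nonneg_left (zpow_le_add hb hp.1.1.le hp.1.2.le s) hC0
  -- The series is controlled only for y < 1. Locally bounded derivatives give a smooth extension to
  -- y = 1, as the definition of a corner expansion requires.
  obtain ⟨A, hA, hAe⟩ := exists_contDiffOn_extension (K := Ioc (0 : ℝ) 1 ×ˢ (univ : Set ℝ))
    (U := Ioi 0 ×ˢ univ) (Z := Iic 1 ×ˢ univ) ((convex_Ioc _ _).prod convex_univ)
    (by rw [hint]; exact ⟨(1 / 2, 0), ⟨by norm_num, by norm_num⟩, mem_univ _⟩)
    (isOpen_Ioi.prod isOpen_univ) (isClosed_Iic.prod isClosed_univ)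
    (by rw [prod_inter_prod, univ_inter, Ioi_inter_Iic])
    (f := fun p : ℝ × ℝ => synth v p.1 p.1 p.2)
    (by
      rw [hint]
      exact contDiffOn_of_closed_family (ι := {v // RapF (half 1) v}) ho
        (Φ := fun i p => synth i.1 p.1 p.1 p.2) (c := fun j i => ⟨_, rapF_diag i.2 j⟩) hder ⟨v, hv⟩)
    (fun m p hp => by
      have hp0 := hp.1.1
      obtain ⟨C, hC⟩ := norm_iteratedFDeriv_le_of_closed_family (ι := {v // RapF (half 1) v})
        (X := Unit) (fun _ => ho) (Φ := fun i _ p => synth i.1 p.1 p.1 p.2)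
        (c := fun j i => ⟨_, rapF_diag i.2 j⟩) (fun i _ => hder i)
        (t := fun _ => Ioo (p.1 / 2) 1 ×ˢ univ)
        (fun _ => prod_mono_left (Ioo_subset_Ioo_left (half_pos hp0).le)) (w := fun _ => 1)
        (hbd _ (half_pos hp0)) m ⟨v, hv⟩
      refine ⟨p.1 / 2, half_pos hp0, C, fun y hy => ?_⟩
      rw [hint] at hy
      have h1 : dist y.1 p.1 < p.1 / 2 := (le_max_left _ _).trans_lt (Metric.mem_ball.1 hy.2)
      rw [Real.dist_eq, abs_lt] at h1
      simpa using hC () y ⟨⟨by linarith, hy.1.1.2⟩, mem_univ _⟩)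
  rw [hint] at hAe
  have ha : ∀ y ∈ Ioo (0 : ℝ) 1, ∀ θ, A (y, θ) = synth v y y θ := fun y hy θ =>
    hAe (x := (y, θ)) ⟨hy, mem_univ _⟩
  refine ⟨fun y θ => A (y, θ), ha, hA, 0, fun e he => by rw [hF] at he; exact he.elim,
    fun N j n K _ => ?_⟩
  obtain ⟨s, hs⟩ := hv
  have h1 : ∀ i : {v // ClR (half 1) 1 s v}, ∃ C, ∀ x : Ioo (0 : ℝ) 1, ∀ θ ∈ (univ : Set ℝ),
      ‖synth i.1 x x θ‖ ≤ C * (x : ℝ) ^ N := fun i => by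
    obtain ⟨C, hC0, hC⟩ := norm_synth_le hS i.2 (N + s.natAbs)
    refine ⟨C * 2 ^ (N + s.natAbs), fun x θ _ => ?_⟩
    have hx0 := x.2.1
    refine (hC _ _ (diag_mem x.2) _).trans ?_
    calc C * ((x : ℝ) ^ 2 + (x : ℝ) ^ 2) ^ (N + s.natAbs) * (x : ℝ) ^ s
        = C * 2 ^ (N + s.natAbs) * ((x : ℝ) ^ s * ((x : ℝ) ^ 2) ^ (N + s.natAbs)) := by
          rw [← two_mul, mul_pow]; ring
      _ ≤ _ := by
          have := zpow_mul_pow_le hx0 x.2.2.le s N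
          gcongr
  have hB := clR_iterate (fun g hg => ClR.Bop hS hg) hs j
  obtain ⟨C, hC⟩ := norm_iteratedFDeriv_le_of_closed_family (ι := {v // ClR (half 1) 1 s v})
    (X := Ioo (0 : ℝ) 1) (fun _ => isOpen_univ) (Φ := fun i x θ => synth i.1 x x θ)
    (c := fun _ i => ⟨dθ i.1, i.2.dθ hS⟩) (v := fun _ : Unit => ContinuousLinearMap.id ℝ ℝ)
    (fun i x θ _ => hasFDerivAt_synth_angle hS ⟨s, i.2⟩ (diag_mem x.2) θ)
    (t := fun _ => univ) (fun _ => subset_rfl) h1 n ⟨_, hB⟩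
  refine ⟨C, 1, one_pos, fun x hx θ _ => ?_⟩
  have e : (fun θ => (eulerD^[j] fun x' => A (x', θ) - ∑ e ∈ F.upTo N,
      (0 : ℂ × ℕ → ℝ → ℂ) e θ * phgTerm e x') x) = fun θ => synth (Bop^[j] v) x x θ := by
    funext θ
    refine eulerD_iterate_eqOn (P := ClR (half 1) 1 s) (B := Bop)
      (Ψ := fun g x => synth g x x θ) (isOpen_Ioo (a := (0 : ℝ)) (b := 1))
      (fun g hg => hg.Bop hS) (fun g hg x hx => ?_) j hs (fun x hx => ?_) hx
    · have := (hasDerivAt_synth_comp hS ⟨s, hg⟩ (hasDerivAt_id x) (hasDerivAt_id x)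
        (hasDerivAt_const x θ) (diag_mem hx)).deriv
      simp only [id] at this
      have hc := clM_t (σ := 1) hS
      rw [this, Bop, synth_add hS ⟨s, hg.pl hS⟩ ⟨s, hc.mul_rap_zero hS (hg.pt hS)⟩ (diag_mem hx),
        synth_pl_one, synth_tfun_mul]
      push_cast; ring
    · simp [upTo_eq_empty hF, ha x hx]
  rw [e]
  exact hC ⟨x, hx⟩ θ (mem_univ _)

/-- At the side face, a remainder of order ℓ^N = (xy)^N is at most x^N. At the front face no term is
needed, since r ≤ 2y² and any power of r is available. The factor ℓ^s = x^s y^s may be singular in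
x, which costs the fixed loss |s| at the other face. -/
theorem hasCornerExpansion_synth (hF : F.carrier = ∅) (hf : HasExpansion E f) (hq : 0 < q)
    (hb : ClR (half q) 1 s f) :
    HasCornerExpansion E F (fun x y θ => synth f (x * y) y θ) := by
  obtain ⟨V, hV0, hV, hexp⟩ := hf
  have hS := isDom_half (R := 1)
  -- The coefficient at x^z (log x)^q contains powers and logarithms of y. They are encoded by
  -- `lterm` evaluated on the diagonal ℓ = τ = y, which is possible because the families `V e` do
  -- not depend on ℓ.
  have hvR : ∀ e ∈ E.carrier, RapF (half 1) (shiftCoef E lterm V e) := fun e _ => by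
    refine exists_clR_sum hS _ fun e' he' => ?_
    have he'' := (IndexSet.mem_upTo.1 (Finset.mem_filter.1 he').1).1
    obtain ⟨s, hs⟩ := (hV e' he'').exists_mul_lterm hS (e.1, e'.2 - e.2)
    refine ⟨s, (hs.const_mul hS (e'.2.choose e.2 : ℂ)).congr hS fun k l t _ => ?_⟩
    simp only [Pi.mul_apply, cst, Pi.natCast_apply]
    ring
  choose! a ha1 ha2 ha3 using fun e he => exists_sideCoef (F := F) (hvR e he) hF
  refine ⟨a, 0, s.natAbs, fun e he => ⟨ha2 e he, ha3 e he⟩,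
    fun e he => by rw [hF] at he; exact he.elim, fun N i j n => ?_, fun N i j n => ?_⟩
  · obtain ⟨δ, hδ, hrem⟩ := hexp N
    set ρ := min δ 1
    have hρ1 : ρ ≤ 1 := min_le_right _ _
    have hSρ := isDom_half (R := ρ)
    set W := ∑ e ∈ E.upTo N, V e * lterm e with hW
    have cg : ClR (half ρ) 1 N (f - W) := hrem.mono (half_mono (min_le_left _ _))
    have hI : ∀ x ∈ Ioo 0 ρ, ∀ y ∈ Ioo (0 : ℝ) 1, (x * y, y) ∈ half ρ := fun x hx y hy =>
      ⟨⟨mul_pos hx.1 hy.1, (mul_lt_of_lt_one_right hx.1 hy.2).trans hx.2⟩, hy⟩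
    have hT : ∀ e ∈ E.upTo N, e ∈ E.carrier := fun e he => (IndexSet.mem_upTo.1 he).1
    have hΦ : ∀ x ∈ Ioo 0 ρ, ∀ y ∈ Ioo (0 : ℝ) 1, ∀ θ, synth f (x * y) y θ
        - ∑ e ∈ E.upTo N, a e y θ * phgTerm e x = synth (f - W) (x * y) y θ := by
      intro x hx y hy θ
      obtain ⟨rW, eW⟩ := synth_sum hSρ (E.upTo N) (G := fun e => V e * lterm e) (fun e he =>
        ((hV e (hT e he)).mono (half_mono hρ1)).exists_mul_lterm hSρ e) (hI x hx y hy) θ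
      have e1 : synth f (x * y) y θ = synth (f - W) (x * y) y θ + synth W (x * y) y θ := by
        rw [← synth_add hSρ ⟨N, cg⟩ rW (hI x hx y hy), sub_add_cancel]
      rw [e1, add_sub_assoc, hW, eW, add_eq_left, sub_eq_zero]
      have e2 := sum_shiftCoef (E := E) (c := fun e => phgTerm e y)
        (a := fun e => synth (V e) y y θ) (φ := fun e => phgTerm e (x * y))
        (φ' := fun e => phgTerm e x) (fun e => phgTerm_mul e hx.1 hy.1) N
      have e3 : ∀ e ∈ E.upTo N, a e y θ = shiftCoef E (fun e => phgTerm e y)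
          (fun e => synth (V e) y y θ) e := fun e he => by
        rw [ha1 e (hT e he) y hy θ, shiftCoef]
        have hterm : ∀ e', (e'.2.choose e.2 : Fam) * lterm (e.1, e'.2 - e.2) * V e' =
            lfun (fun l => (e'.2.choose e.2 : ℂ) * phgTerm (e.1, e'.2 - e.2) l) * V e' :=
          fun e' => rfl
        rw [(synth_sum hS _ (fun e' he' => ?_) (diag_mem hy) θ).2]
        · refine Finset.sum_congr rfl fun e' _ => ?_
          rw [hterm, synth_lfun_mul]
        · have he'' := (IndexSet.mem_upTo.1 (Finset.mem_filter.1 he').1).1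
          obtain ⟨s, hs⟩ := (hV e' he'').exists_mul_lterm hS (e.1, e'.2 - e.2)
          refine ⟨s, (hs.const_mul hS (e'.2.choose e.2 : ℂ)).congr hS fun k l t _ => ?_⟩
          simp only [Pi.mul_apply, cst, Pi.natCast_apply]
          ring
      have e4 : ∀ e ∈ E.upTo N, synth (V e * lterm e) (x * y) y θ
          = synth (V e) y y θ * phgTerm e (x * y) := fun e _ => by
        rw [mul_comm, lterm, synth_lfun_mul, mul_comm]
        congr 1
        exact tsum_congr fun k => by rw [hV0 e k (x * y) y y]
      rw [Finset.sum_congr rfl e4, e2]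
      exact Finset.sum_congr rfl fun e he => by rw [e3 e he]
    have hB := clR_iterate (fun g hg => hg.pl hSρ) (clR_iterate (fun g hg => ClR.Bop hSρ hg)
      (clR_iterate (fun g hg => ClR.dθ hSρ hg) cg n) j) i
    obtain ⟨C, hC0, hC⟩ := norm_synth_le hSρ hB 0
    refine ⟨C, ρ, by positivity, fun x hx y hy θ => ?_⟩
    rw [bDeriv_synth hSρ cg isOpen_Ioo isOpen_Ioo hI hΦ i j n hx hy θ]
    refine (hC _ _ (hI x hx y hy) θ).trans ?_
    have hx0 := hx.1
    have hy0 := hy.1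
    rw [pow_zero, mul_one, zpow_natCast, mul_pow, le_div_iff₀ (by positivity)]
    have h1 : y ^ N ≤ 1 := pow_le_one₀ hy0.le hy.2.le
    have h2 : y ^ s.natAbs ≤ 1 := pow_le_one₀ hy0.le hy.2.le
    calc C * (x ^ N * y ^ N) * y ^ s.natAbs ≤ C * (x ^ N * 1) * 1 := by gcongr
      _ = _ := by ring
  · set ρ := min q 1
    have hρ1 : ρ ≤ 1 := min_le_right _ _
    have hSρ := isDom_half (R := ρ)
    have cf : ClR (half ρ) 1 s f := hb.mono (half_mono (min_le_left _ _))
    have hI : ∀ x ∈ Ioo (0 : ℝ) 1, ∀ y ∈ Ioo 0 ρ, (x * y, y) ∈ half ρ := fun x hx y hy =>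
      ⟨⟨mul_pos hx.1 hy.1, (mul_lt_of_lt_one_left hy.1 hx.2).trans hy.2⟩,
        hy.1, hy.2.trans_le hρ1⟩
    have hB := clR_iterate (fun g hg => hg.pl hSρ) (clR_iterate (fun g hg => ClR.Bop hSρ hg)
      (clR_iterate (fun g hg => ClR.dθ hSρ hg) cf n) j) i
    obtain ⟨C, hC0, hC⟩ := norm_synth_le hSρ hB (N + s.natAbs)
    refine ⟨C * 2 ^ (N + s.natAbs), ρ, by positivity, fun x hx y hy θ => ?_⟩
    rw [bDeriv_synth hSρ cf isOpen_Ioo isOpen_Ioo hI (fun x _ y _ θ => by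
      simp [upTo_eq_empty hF]) i j n hx hy θ]
    refine (hC _ _ (hI x hx y hy) θ).trans ?_
    have hx0 := hx.1
    have hy0 := hy.1
    have h1 : y ^ 2 + (x * y) ^ 2 ≤ 2 * y ^ 2 := by
      have : (x * y) ^ 2 ≤ y ^ 2 := by
        gcongr
        exact mul_le_of_le_one_left hy0.le hx.2.le
      linarith
    have h2 := zpow_mul_pow_le hy0 (hy.2.le.trans hρ1) s N
    have h3 : x ^ s * x ^ s.natAbs ≤ 1 := by
      rw [← zpow_natCast, ← zpow_add₀ hx0.ne']
      exact (zpow_le_zpow_right_of_le_one₀ hx0 hx.2.le (by omega : 0 ≤ s + (s.natAbs : ℤ))).trans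
        (by simp)
    rw [mul_zpow, le_div_iff₀ (by positivity)]
    have hxs := zpow_pos hx0 s
    have hys := zpow_pos hy0 s
    calc C * (y ^ 2 + (x * y) ^ 2) ^ (N + s.natAbs) * (x ^ s * y ^ s) * x ^ s.natAbs
        ≤ C * (2 * y ^ 2) ^ (N + s.natAbs) * (x ^ s * y ^ s) * x ^ s.natAbs := by gcongr
      _ = C * 2 ^ (N + s.natAbs) * (y ^ s * (y ^ 2) ^ (N + s.natAbs)) * (x ^ s * x ^ s.natAbs) := by
        rw [mul_pow]; ring
      _ ≤ C * 2 ^ (N + s.natAbs) * y ^ N * 1 := by gcongr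
      _ = _ := mul_one _

theorem hasFDerivAt_synth_front (hg : RapF (strip q) g) {x : ℝ} (hx : x ∈ Ioo 0 q) {w : ℝ × ℝ}
    (hw : x * w.1 ∈ Ioo (-1 : ℝ) 1) :
    HasFDerivAt (fun w : ℝ × ℝ => synth g x (x * w.1) w.2)
      (∑ j : Fin 2, ((![ContinuousLinearMap.fst ℝ ℝ ℝ, ContinuousLinearMap.snd ℝ ℝ ℝ] :
        Fin 2 → ℝ × ℝ →L[ℝ] ℝ) j).smulRight
          (synth ((![lfun (fun l => (l : ℂ)) * pt g, dθ g] : Fin 2 → Fam) j) x (x * w.1) w.2)) w := by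
  have h1 : HasFDerivAt (fun w : ℝ × ℝ => (x, x * w.1, w.2)) _ w :=
    (hasFDerivAt_const x w).prodMk (((ContinuousLinearMap.fst ℝ ℝ ℝ).hasFDerivAt.const_mul x).prodMk
      (ContinuousLinearMap.snd ℝ ℝ ℝ).hasFDerivAt)
  refine ((hasFDerivAt_synth isDom_strip hg (q := (x, x * w.1, w.2)) ⟨hx, hw⟩).comp
    (f := fun w : ℝ × ℝ => (x, x * w.1, w.2)) w h1).congr_fderiv ?_
  refine ContinuousLinearMap.ext fun w => ?_
  simp [Fin.sum_univ_three, dop, coord3, synth_lfun_mul]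
  ring

/-- For T = τ/ℓ in a bounded set r ≤ (M² + 1) ℓ², so rapid decrease in r is rapid decrease in ℓ.
Taking ε ≤ M⁻¹ keeps τ = ℓT inside (-1, 1). -/
theorem hasPhgExpansion_front (hF : F.carrier = ∅) (hq : 0 < q) (hb : ClR (strip q) 1 s f) :
    HasPhgExpansion F (fun (ℓ : ℝ) (w : ℝ × ℝ) => synth f ℓ (ℓ * w.1) w.2) := by
  have hS := isDom_strip (R := q)
  refine ⟨0, fun e he => by rw [hF] at he; exact he.elim, fun N j n K hK => ?_⟩
  obtain ⟨ρ, hρ⟩ := hK.isBounded.exists_norm_le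
  set M := |ρ| + 1 with hM
  have hM0 : 0 < M := by positivity
  set ε := min q (min 1 M⁻¹) with hε
  have hε0 : 0 < ε := by positivity
  have hεq : ε ≤ q := min_le_left _ _
  have hε1 : ε ≤ 1 := (min_le_right _ _).trans (min_le_left _ _)
  have hεM : ε ≤ M⁻¹ := (min_le_right _ _).trans (min_le_right _ _)
  have hmem : ∀ x ∈ Ioo 0 ε, ∀ w ∈ Metric.ball (0 : ℝ × ℝ) M, |w.1| ≤ M ∧
      x * w.1 ∈ Ioo (-1 : ℝ) 1 := fun x hx w hw => by
    have h1 : |w.1| < M := (norm_fst_le w).trans_lt (mem_ball_zero_iff.1 hw)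
    refine ⟨h1.le, abs_lt.1 ?_⟩
    rw [abs_mul, abs_of_pos hx.1]
    calc x * |w.1| < M⁻¹ * M := mul_lt_mul'' (hx.2.trans_le hεM) h1 hx.1.le (abs_nonneg _)
      _ = 1 := inv_mul_cancel₀ hM0.ne'
  have h1 : ∀ i : {v // ClR (strip q) 1 s v}, ∃ C, ∀ x : Ioo 0 ε,
      ∀ w ∈ Metric.ball (0 : ℝ × ℝ) M, ‖synth i.1 x (x * w.1) w.2‖ ≤ C * (x : ℝ) ^ N := fun i => by
    obtain ⟨C, hC0, hC⟩ := norm_synth_le hS i.2 (N + s.natAbs)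
    refine ⟨C * (M ^ 2 + 1) ^ (N + s.natAbs), fun x w hw => ?_⟩
    have hx0 := x.2.1
    obtain ⟨hw1, hw2⟩ := hmem x x.2 w hw
    refine (hC _ _ ⟨⟨hx0, x.2.2.trans_le hεq⟩, hw2⟩ _).trans ?_
    have h2 : ((x : ℝ) * w.1) ^ 2 + (x : ℝ) ^ 2 ≤ (M ^ 2 + 1) * (x : ℝ) ^ 2 := by
      have : w.1 ^ 2 ≤ M ^ 2 := by rw [← sq_abs]; gcongr
      nlinarith [sq_nonneg (x : ℝ)]
    have := zpow_pos hx0 s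
    calc C * (((x : ℝ) * w.1) ^ 2 + (x : ℝ) ^ 2) ^ (N + s.natAbs) * (x : ℝ) ^ s
        ≤ C * ((M ^ 2 + 1) * (x : ℝ) ^ 2) ^ (N + s.natAbs) * (x : ℝ) ^ s := by gcongr
      _ = C * (M ^ 2 + 1) ^ (N + s.natAbs) * ((x : ℝ) ^ s * ((x : ℝ) ^ 2) ^ (N + s.natAbs)) := by
          rw [mul_pow]; ring
      _ ≤ _ := by
          have := zpow_mul_pow_le hx0 (x.2.2.le.trans hε1) s N
          gcongr
  have hc : ∀ (j : Fin 2) (i : {v // ClR (strip q) 1 s v}), ClR (strip q) 1 s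
      ((![lfun (fun l => (l : ℂ)) * pt i.1, dθ i.1] : Fin 2 → Fam) j) := fun j i => by
    fin_cases j
    exacts [(i.2.pt hS).lmul hS, i.2.dθ hS]
  have hB := clR_iterate (fun g hg => ClR.Bop hS hg) hb j
  obtain ⟨C, hC⟩ := norm_iteratedFDeriv_le_of_closed_family (ι := {v // ClR (strip q) 1 s v})
    (X := Ioo 0 ε) (s := fun _ => Metric.ball (0 : ℝ × ℝ) M) (fun _ => Metric.isOpen_ball)
    (Φ := fun i x w => synth i.1 x (x * w.1) w.2) (c := fun j i => ⟨_, hc j i⟩)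
    (fun i x w hw => hasFDerivAt_synth_front ⟨s, i.2⟩ ⟨x.2.1, x.2.2.trans_le hεq⟩
      (hmem x x.2 w hw).2) (t := fun _ => Metric.ball 0 M) (fun _ => subset_rfl) h1 n ⟨_, hB⟩
  refine ⟨C, ε, hε0, fun x hx w hw => ?_⟩
  have hwM : w ∈ Metric.ball (0 : ℝ × ℝ) M := by
    rw [mem_ball_zero_iff]
    exact (hρ w hw).trans_lt ((le_abs_self ρ).trans_lt (lt_add_one _))
  have e : (fun w => (eulerD^[j] fun x' => synth f x' (x' * w.1) w.2 - ∑ e ∈ F.upTo N,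
      (0 : ℂ × ℕ → ℝ × ℝ → ℂ) e w * phgTerm e x') x)
      =ᶠ[𝓝 w] fun w => synth (Bop^[j] f) x (x * w.1) w.2 := by
    filter_upwards [Metric.isOpen_ball.mem_nhds hwM] with w hw
    refine eulerD_iterate_eqOn (P := ClR (strip q) 1 s) (B := Bop)
      (Ψ := fun g x => synth g x (x * w.1) w.2) (isOpen_Ioo (a := (0 : ℝ)) (b := ε))
      (fun g hg => hg.Bop hS) (fun g hg x hx => ?_) j hb (fun x hx => ?_) hx
    · have hm : (x, x * w.1) ∈ strip q := ⟨⟨hx.1, hx.2.trans_le hεq⟩, (hmem x hx w hw).2⟩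
      have := (hasDerivAt_synth_comp hS ⟨s, hg⟩ (hasDerivAt_id x) ((hasDerivAt_id x).mul_const w.1)
        (hasDerivAt_const x w.2) hm).deriv
      simp only [id] at this
      have hc := clM_t (σ := 1) hS
      rw [this, Bop, synth_add hS ⟨s, hg.pl hS⟩ ⟨s, hc.mul_rap_zero hS (hg.pt hS)⟩ hm,
        synth_pl_one, synth_tfun_mul]
      push_cast; ring
    · simp [upTo_eq_empty hF]
  rw [(e.iteratedFDeriv ℝ n).eq_of_nhds]
  exact hC ⟨x, hx⟩ w hwM

theorem synth_periodic (f : Fam) (l t θ : ℝ) :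
    synth f l t (θ + 2 * Real.pi) = synth f l t θ := by
  refine tsum_congr fun k => ?_
  congr 1
  have : Complex.I * (k : ℤ) * ((θ + 2 * Real.pi : ℝ) : ℂ)
      = Complex.I * (k : ℤ) * θ + (k : ℤ) * (2 * Real.pi * Complex.I) := by push_cast; ring
  rw [this, Complex.exp_add, Complex.exp_int_mul_two_pi_mul_I, mul_one]

theorem isPhgOnBlowup_synth {E' : IndexSet} (hℓ₀ : 0 < ℓ₀) (h₁ : Phg ℓ₀ E f)
    (h₂ : Phg ℓ₀ E' (reflect f)) :
    IsPhgOnBlowup ℓ₀ ⟨emptyIndex, E, E'⟩ (fun ℓ τ θ => synth f ℓ τ θ) := by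
  obtain ⟨s, hs⟩ := h₁.bdd
  obtain ⟨s', hs'⟩ := h₂.bdd
  have hq : ℓ₀ / 2 < ℓ₀ := by linarith
  have hq0 : 0 < ℓ₀ / 2 := by linarith
  have h0 : emptyIndex.carrier = ∅ := rfl
  have e1 := hasPhgExpansion_front h0 hq0 (hs _ hq)
  have e2 := hasCornerExpansion_synth h0 h₁.hasExpansion hq0 ((hs _ hq).mono half_subset_strip)
  have e3 := hasCornerExpansion_synth h0 h₂.hasExpansion hq0 ((hs' _ hq).mono half_subset_strip)
  have e4 : (fun x y θ => synth f (x * y) (-y) θ) = fun x y θ => synth (reflect f) (x * y) y θ :=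
    rfl
  have e5 := contDiffOn_synth_closed h₁.sm h₁.bdd hℓ₀
  refine ⟨fun ℓ _ τ _ θ => synth_periodic f ℓ τ θ, e5, e1, e2, ?_⟩
  rw [e4]
  exact e3

end

end HypCyl

end

/-! ### From functions to modes: Fourier coefficients of sources and boundary values -/

noncomputable section

namespace HypCyl
open Set Filter Topology

/-! ### Fourier coefficients with a smooth window -/

/-- A smooth window whose translates by `2π` sum to one. -/
def win (θ : ℝ) : ℝ := Real.smoothTransition θ - Real.smoothTransition (θ - 2 * Real.pi)

theorem contDiff_win : ContDiff ℝ (⊤ : ℕ∞) fun θ => ((win θ : ℝ) : ℂ) :=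
  Complex.ofRealCLM.contDiff.comp (Real.smoothTransition.contDiff.sub
    (Real.smoothTransition.contDiff.comp (contDiff_id.sub contDiff_const)))

theorem win_eq_zero {θ : ℝ} (h : θ ≤ 0 ∨ 2 * Real.pi + 1 ≤ θ) : win θ = 0 := by
  have hpi := Real.pi_pos
  rcases h with h | h
  · rw [win, Real.smoothTransition.zero_of_nonpos h, Real.smoothTransition.zero_of_nonpos (by linarith),
      sub_zero]
  · rw [win, Real.smoothTransition.one_of_one_le (by linarith),
      Real.smoothTransition.one_of_one_le (by linarith), sub_self]

/-- The windowed Fourier coefficient of a function. -/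
def fcoef (k : ℤ) (g : ℝ → ℂ) : ℂ :=
  (1 / (2 * Real.pi)) * ∫ θ in (-1 : ℝ)..(2 * Real.pi + 2), Complex.exp (-Complex.I * k * θ) * g θ

/-- The windowed Fourier coefficients of a function of `(ℓ, τ, θ)`. -/
def fhat (g : ℝ → ℝ → ℝ → ℂ) : Fam := fun k l t => fcoef k fun θ => win θ * g l t θ

theorem angle_lt : (-1 : ℝ) < 2 * Real.pi + 2 := by linarith [Real.pi_pos]

theorem norm_exp_neg_mode (k : ℤ) (θ : ℝ) : ‖Complex.exp (-Complex.I * k * θ)‖ = 1 := by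
  have := norm_exp_mode (-k) θ
  push_cast at this
  rwa [mul_neg, ← neg_mul] at this

/-- A function supported in [0, 2π + 1] vanishes at the ends of the interval of integration, so no
boundary terms appear and periodicity is not needed. This matters because the coefficient functions
in the given expansions are not assumed to be periodic. -/
theorem fcoef_deriv {g : ℝ → ℂ} (hg : ContDiff ℝ (⊤ : ℕ∞) g)
    (h0 : ∀ θ, θ < 0 ∨ 2 * Real.pi + 1 < θ → g θ = 0) (k : ℤ) :
    Complex.I * k * fcoef k g = fcoef k (deriv g) := by
  have hd : ∀ θ : ℝ, HasDerivAt (fun θ : ℝ => Complex.exp (-Complex.I * k * θ))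
      (Complex.exp (-Complex.I * k * θ) * (-Complex.I * k)) θ := fun θ => by
    have := ((hasDerivAt_id θ).ofReal_comp.const_mul (-Complex.I * (k : ℂ))).cexp
    simpa using this
  have hg' : Continuous (deriv g) := hg.continuous_deriv (by simp)
  have h := intervalIntegral.integral_mul_deriv_eq_deriv_mul (a := -1) (b := 2 * Real.pi + 2)
    (u := fun θ : ℝ => Complex.exp (-Complex.I * k * θ)) (v := g) (fun θ _ => hd θ)
    (fun θ _ => (hg.differentiable (by simp) θ).hasDerivAt)
    (Continuous.intervalIntegrable (by fun_prop) _ _) (hg'.intervalIntegrable _ _)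
  rw [h0 (-1) (Or.inl (by norm_num)), h0 (2 * Real.pi + 2) (Or.inr (by linarith)), mul_zero, mul_zero,
    sub_zero, zero_sub] at h
  simp only [fcoef]
  rw [h, ← intervalIntegral.integral_neg, mul_left_comm, ← intervalIntegral.integral_const_mul]
  congr 1
  exact intervalIntegral.integral_congr fun θ _ => by ring

theorem support_deriv {g : ℝ → ℂ} (h0 : ∀ θ, θ < 0 ∨ 2 * Real.pi + 1 < θ → g θ = 0) (θ : ℝ)
    (hθ : θ < 0 ∨ 2 * Real.pi + 1 < θ) : deriv g θ = 0 := by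
  have : g =ᶠ[𝓝 θ] fun _ => 0 := by
    have ho : IsOpen {θ : ℝ | θ < 0 ∨ 2 * Real.pi + 1 < θ} :=
      (isOpen_gt' 0).union (isOpen_lt' (2 * Real.pi + 1))
    filter_upwards [ho.mem_nhds hθ] with θ' h using h0 θ' h
  rw [this.deriv_eq, deriv_const]

/-- Each integration by parts gains a factor |k|. The constant 3 bounds (2π + 3) / (2π), the length
of the interval over the normalization. -/
theorem norm_fcoef_le {g : ℝ → ℂ} (hg : ContDiff ℝ (⊤ : ℕ∞) g)
    (h0 : ∀ θ, θ < 0 ∨ 2 * Real.pi + 1 < θ → g θ = 0) (m : ℕ) {C : ℝ}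
    (hC : ∀ θ ∈ Icc (-1 : ℝ) (2 * Real.pi + 2), ‖iteratedDeriv m g θ‖ ≤ C) (k : ℤ) :
    |(k : ℝ)| ^ m * ‖fcoef k g‖ ≤ 3 * C := by
  induction m generalizing g with
  | zero =>
    have hpi := Real.pi_gt_three
    have h1 : ‖∫ θ in (-1 : ℝ)..(2 * Real.pi + 2), Complex.exp (-Complex.I * k * θ) * g θ‖
        ≤ C * |2 * Real.pi + 2 - (-1)| := by
      refine intervalIntegral.norm_integral_le_of_norm_le_const fun θ hθ => ?_
      rw [uIoc_of_le angle_lt.le] at hθ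
      rw [norm_mul, norm_exp_neg_mode, one_mul]
      simpa using hC θ (Ioc_subset_Icc_self hθ)
    have hC0 : 0 ≤ C := (norm_nonneg _).trans (hC (-1) (left_mem_Icc.2 angle_lt.le))
    rw [abs_of_pos (by linarith)] at h1
    have h2 : ‖(1 / (2 * Real.pi) : ℂ)‖ = 1 / (2 * Real.pi) := by
      have : (1 / (2 * Real.pi) : ℂ) = ((1 / (2 * Real.pi) : ℝ) : ℂ) := by push_cast; ring
      rw [this, Complex.norm_real, Real.norm_of_nonneg (by positivity)]
    rw [pow_zero, one_mul, fcoef, norm_mul, h2, one_div, inv_mul_le_iff₀ (by positivity)]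
    refine h1.trans ?_
    nlinarith
  | succ m ih =>
    have h1 := ih (g := deriv g) ((contDiff_succ_iff_deriv (n := (⊤ : ℕ∞))).1 hg).2.2
      (support_deriv h0) fun θ hθ => by rw [← iteratedDeriv_succ']; exact hC θ hθ
    rw [← fcoef_deriv hg h0, norm_mul, norm_mul, Complex.norm_I, one_mul, Complex.norm_intCast] at h1
    rw [pow_succ, mul_assoc]
    exact h1

/-! ### Smooth functions of three variables -/

/-- Smoothness in all three variables. -/
def Smooth3 (S : Set (ℝ × ℝ)) (g : ℝ → ℝ → ℝ → ℂ) : Prop :=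
  ContDiffOn ℝ (⊤ : ℕ∞) (fun q : ℝ × ℝ × ℝ => g q.1 q.2.1 q.2.2) {q | (q.1, q.2.1) ∈ S}

/-- `x ∂_x`. -/
def eul1 (g : ℝ → ℝ → ℝ → ℂ) : ℝ → ℝ → ℝ → ℂ := fun x y θ => x * deriv (fun x' => g x' y θ) x

/-- `y ∂_y`. -/
def eul2 (g : ℝ → ℝ → ℝ → ℂ) : ℝ → ℝ → ℝ → ℂ := fun x y θ => y * deriv (fun y' => g x y' θ) y

/-- `∂_θ`. -/
def dang (g : ℝ → ℝ → ℝ → ℂ) : ℝ → ℝ → ℝ → ℂ := fun x y θ => deriv (g x y) θ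

theorem eul1_iterate (i : ℕ) (g : ℝ → ℝ → ℝ → ℂ) (x y θ : ℝ) :
    eul1^[i] g x y θ = (eulerD^[i] fun x' => g x' y θ) x := by
  induction i generalizing g with
  | zero => rfl
  | succ i ih => rw [Function.iterate_succ_apply, Function.iterate_succ_apply, ih]; rfl

theorem eul2_iterate (j : ℕ) (g : ℝ → ℝ → ℝ → ℂ) (x y θ : ℝ) :
    eul2^[j] g x y θ = (eulerD^[j] fun y' => g x y' θ) y := by
  induction j generalizing g with
  | zero => rfl
  | succ j ih => rw [Function.iterate_succ_apply, Function.iterate_succ_apply, ih]; rfl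

theorem dang_iterate (n : ℕ) (g : ℝ → ℝ → ℝ → ℂ) (x y θ : ℝ) :
    dang^[n] g x y θ = iteratedDeriv n (g x y) θ := by
  induction n generalizing g with
  | zero => simp
  | succ n ih => rw [Function.iterate_succ_apply, ih, iteratedDeriv_succ']; rfl

theorem bDeriv_eq (i j n : ℕ) (g : ℝ → ℝ → ℝ → ℂ) (x y θ : ℝ) :
    bDeriv i j n g x y θ = eul1^[i] (eul2^[j] (dang^[n] g)) x y θ := by
  rw [eul1_iterate]
  simp only [eul2_iterate, dang_iterate]
  rfl

theorem fderiv_mul_fderiv_apply {E : Type} [NormedAddCommGroup E] [NormedSpace ℝ E] {G a : E → ℂ}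
    {a' : E →L[ℝ] ℂ} {q u v : E} (hG : ContDiffAt ℝ (⊤ : ℕ∞) G q) (ha : HasFDerivAt a a' q)
    (hav : a' v = 0) : fderiv ℝ (fun p => a p * fderiv ℝ G p u) q v
      = a q * fderiv ℝ (fderiv ℝ G) q v u := by
  have h1 : DifferentiableAt ℝ (fderiv ℝ G) q :=
    (hG.fderiv_right (m := (⊤ : ℕ∞)) (by norm_cast)).differentiableAt (by simp)
  have h2 := h1.hasFDerivAt.clm_apply (hasFDerivAt_const u q)
  rw [(ha.fun_mul h2).fderiv]
  simp [hav]

section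

variable {S : Set (ℝ × ℝ)} {g h : ℝ → ℝ → ℝ → ℂ}

/-- Equality on a set of parameters. -/
def Eq3 (S : Set (ℝ × ℝ)) (g h : ℝ → ℝ → ℝ → ℂ) : Prop :=
  ∀ x y, (x, y) ∈ S → ∀ θ, g x y θ = h x y θ

theorem Eq3.eul1 (hS : IsOpen S) (e : Eq3 S g h) : Eq3 S (eul1 g) (eul1 h) := fun x y hp θ => by
  have : (fun x' => g x' y θ) =ᶠ[𝓝 x] fun x' => h x' y θ :=
    (eventually_left hS hp).mono fun x' hx' => e x' y hx' θ
  simp only [HypCyl.eul1, this.deriv_eq]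

theorem Eq3.eul2 (hS : IsOpen S) (e : Eq3 S g h) : Eq3 S (eul2 g) (eul2 h) := fun x y hp θ => by
  have : (fun y' => g x y' θ) =ᶠ[𝓝 y] fun y' => h x y' θ :=
    (eventually_right hS hp).mono fun y' hy' => e x y' hy' θ
  simp only [HypCyl.eul2, this.deriv_eq]

theorem Eq3.dang (e : Eq3 S g h) : Eq3 S (dang g) (dang h) := fun x y hp θ => by
  have : g x y = h x y := funext (e x y hp)
  simp only [HypCyl.dang, this]

theorem Eq3.iterate {D : (ℝ → ℝ → ℝ → ℂ) → ℝ → ℝ → ℝ → ℂ}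
    (hD : ∀ g h, Eq3 S g h → Eq3 S (D g) (D h)) (e : Eq3 S g h) (n : ℕ) :
    Eq3 S (D^[n] g) (D^[n] h) := by
  induction n generalizing g h with
  | zero => exact e
  | succ n ih => exact ih (hD _ _ e)

theorem Smooth3.congr (hg : Smooth3 S g) (e : Eq3 S g h) : Smooth3 S h :=
  ContDiffOn.congr hg fun q hq => (e q.1 q.2.1 hq q.2.2).symm

theorem Smooth3.contDiffAt (hS : IsOpen S) (hg : Smooth3 S g) {q : ℝ × ℝ × ℝ}
    (hq : (q.1, q.2.1) ∈ S) :
    ContDiffAt ℝ (⊤ : ℕ∞) (fun q : ℝ × ℝ × ℝ => g q.1 q.2.1 q.2.2) q :=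
  ContDiffOn.contDiffAt hg ((isOpen_lift hS).mem_nhds hq)

theorem Smooth3.hasDerivAt_comp (hS : IsOpen S) (hg : Smooth3 S g) {γ₁ γ₂ γ₃ : ℝ → ℝ}
    {a b c x : ℝ} (h₁ : HasDerivAt γ₁ a x) (h₂ : HasDerivAt γ₂ b x) (h₃ : HasDerivAt γ₃ c x)
    (hq : (γ₁ x, γ₂ x) ∈ S) : HasDerivAt (fun x => g (γ₁ x) (γ₂ x) (γ₃ x))
      (fderiv ℝ (fun q : ℝ × ℝ × ℝ => g q.1 q.2.1 q.2.2) (γ₁ x, γ₂ x, γ₃ x) (a, b, c)) x :=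
  ((hg.contDiffAt hS (q := (γ₁ x, γ₂ x, γ₃ x)) hq).differentiableAt
    (by simp)).hasFDerivAt.comp_hasDerivAt (f := fun x => (γ₁ x, γ₂ x, γ₃ x)) x
      (h₁.prodMk (h₂.prodMk h₃))

theorem Smooth3.hasDerivAt_1 (hS : IsOpen S) (hg : Smooth3 S g) {x y : ℝ} (hp : (x, y) ∈ S)
    (θ : ℝ) : HasDerivAt (fun x => g x y θ)
      (fderiv ℝ (fun q : ℝ × ℝ × ℝ => g q.1 q.2.1 q.2.2) (x, y, θ) (1, 0, 0)) x :=
  hg.hasDerivAt_comp hS (hasDerivAt_id x) (hasDerivAt_const x y) (hasDerivAt_const x θ) hp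

theorem Smooth3.hasDerivAt_2 (hS : IsOpen S) (hg : Smooth3 S g) {x y : ℝ} (hp : (x, y) ∈ S)
    (θ : ℝ) : HasDerivAt (fun y => g x y θ)
      (fderiv ℝ (fun q : ℝ × ℝ × ℝ => g q.1 q.2.1 q.2.2) (x, y, θ) (0, 1, 0)) y :=
  hg.hasDerivAt_comp hS (hasDerivAt_const y x) (hasDerivAt_id y) (hasDerivAt_const y θ) hp

theorem Smooth3.hasDerivAt_3 (hS : IsOpen S) (hg : Smooth3 S g) {x y : ℝ} (hp : (x, y) ∈ S)
    (θ : ℝ) : HasDerivAt (g x y)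
      (fderiv ℝ (fun q : ℝ × ℝ × ℝ => g q.1 q.2.1 q.2.2) (x, y, θ) (0, 0, 1)) θ :=
  hg.hasDerivAt_comp hS (hasDerivAt_const θ x) (hasDerivAt_const θ y) (hasDerivAt_id θ) hp

theorem Smooth3.contDiffOn_fderiv (hS : IsOpen S) (hg : Smooth3 S g) (v : ℝ × ℝ × ℝ) :
    ContDiffOn ℝ (⊤ : ℕ∞) (fun q => fderiv ℝ (fun q : ℝ × ℝ × ℝ => g q.1 q.2.1 q.2.2) q v)
      {q | (q.1, q.2.1) ∈ S} :=
  (ContDiffOn.fderiv_of_isOpen hg (isOpen_lift hS) (by norm_cast)).clm_apply contDiffOn_const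

theorem contDiff_ofReal_fst3 : ContDiff ℝ (⊤ : ℕ∞) fun q : ℝ × ℝ × ℝ => ((q.1 : ℝ) : ℂ) :=
  Complex.ofRealCLM.contDiff.comp contDiff_fst

theorem contDiff_ofReal_snd3 : ContDiff ℝ (⊤ : ℕ∞) fun q : ℝ × ℝ × ℝ => ((q.2.1 : ℝ) : ℂ) :=
  Complex.ofRealCLM.contDiff.comp (contDiff_fst.comp contDiff_snd)

theorem Smooth3.eul1 (hS : IsOpen S) (hg : Smooth3 S g) : Smooth3 S (eul1 g) :=
  (contDiff_ofReal_fst3.contDiffOn.mul (hg.contDiffOn_fderiv hS (1, 0, 0))).congr fun q hq => by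
    simp only [HypCyl.eul1, (hg.hasDerivAt_1 hS hq q.2.2).deriv]

theorem Smooth3.eul2 (hS : IsOpen S) (hg : Smooth3 S g) : Smooth3 S (eul2 g) :=
  (contDiff_ofReal_snd3.contDiffOn.mul (hg.contDiffOn_fderiv hS (0, 1, 0))).congr fun q hq => by
    simp only [HypCyl.eul2, (hg.hasDerivAt_2 hS hq q.2.2).deriv]

theorem Smooth3.dang (hS : IsOpen S) (hg : Smooth3 S g) : Smooth3 S (dang g) :=
  (hg.contDiffOn_fderiv hS (0, 0, 1)).congr fun q hq => by
    simp only [HypCyl.dang, (hg.hasDerivAt_3 hS hq q.2.2).deriv]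

theorem Smooth3.iterate {D : (ℝ → ℝ → ℝ → ℂ) → ℝ → ℝ → ℝ → ℂ}
    (hD : ∀ g, Smooth3 S g → Smooth3 S (D g)) (hg : Smooth3 S g) (n : ℕ) :
    Smooth3 S (D^[n] g) := by
  induction n generalizing g with
  | zero => exact hg
  | succ n ih => exact ih (hD _ hg)

theorem fderiv_fderiv_comm {E : Type} [NormedAddCommGroup E] [NormedSpace ℝ E] {G : E → ℂ} {q : E}
    (hG : ContDiffAt ℝ (⊤ : ℕ∞) G q) (u v : E) :
    fderiv ℝ (fderiv ℝ G) q u v = fderiv ℝ (fderiv ℝ G) q v u :=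
  (hG.isSymmSndFDerivAt (by
    simp only [minSmoothness_of_isRCLikeNormedField]; exact WithTop.coe_le_coe.2 le_top)).eq u v

theorem eul2_eul1_comm (hS : IsOpen S) (hg : Smooth3 S g) :
    Eq3 S (eul2 (eul1 g)) (eul1 (eul2 g)) := fun x y hp θ => by
  have hG := hg.contDiffAt hS (q := (x, y, θ)) hp
  have ho := (isOpen_lift hS).mem_nhds (x := (x, y, θ)) hp
  have e1 : (fun q : ℝ × ℝ × ℝ => eul1 g q.1 q.2.1 q.2.2) =ᶠ[𝓝 (x, y, θ)] fun q =>
      (q.1 : ℂ) * fderiv ℝ (fun q : ℝ × ℝ × ℝ => g q.1 q.2.1 q.2.2) q (1, 0, 0) := by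
    filter_upwards [ho] with q hq
    simp only [eul1, (hg.hasDerivAt_1 hS hq q.2.2).deriv]
  have e2 : (fun q : ℝ × ℝ × ℝ => eul2 g q.1 q.2.1 q.2.2) =ᶠ[𝓝 (x, y, θ)] fun q =>
      (q.2.1 : ℂ) * fderiv ℝ (fun q : ℝ × ℝ × ℝ => g q.1 q.2.1 q.2.2) q (0, 1, 0) := by
    filter_upwards [ho] with q hq
    simp only [eul2, (hg.hasDerivAt_2 hS hq q.2.2).deriv]
  have h1 := ((hg.eul1 hS).hasDerivAt_2 hS hp θ).deriv
  have h2 := ((hg.eul2 hS).hasDerivAt_1 hS hp θ).deriv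
  rw [eul2, h1, e1.fderiv_eq, fderiv_mul_fderiv_apply hG
    (a := fun q : ℝ × ℝ × ℝ => (q.1 : ℂ))
    (Complex.ofRealCLM.hasFDerivAt.comp (x, y, θ) hasFDerivAt_fst) (by simp), eul1, h2, e2.fderiv_eq,
    fderiv_mul_fderiv_apply hG (a := fun q : ℝ × ℝ × ℝ => (q.2.1 : ℂ))
      (Complex.ofRealCLM.comp ((ContinuousLinearMap.fst ℝ ℝ ℝ).comp
        (ContinuousLinearMap.snd ℝ ℝ (ℝ × ℝ)))).hasFDerivAt (by simp), fderiv_fderiv_comm hG]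
  ring

theorem dang_eul1_comm (hS : IsOpen S) (hg : Smooth3 S g) :
    Eq3 S (dang (eul1 g)) (eul1 (dang g)) := fun x y hp θ => by
  have hG := hg.contDiffAt hS (q := (x, y, θ)) hp
  have ho := (isOpen_lift hS).mem_nhds (x := (x, y, θ)) hp
  have e1 : (fun q : ℝ × ℝ × ℝ => eul1 g q.1 q.2.1 q.2.2) =ᶠ[𝓝 (x, y, θ)] fun q =>
      (q.1 : ℂ) * fderiv ℝ (fun q : ℝ × ℝ × ℝ => g q.1 q.2.1 q.2.2) q (1, 0, 0) := by
    filter_upwards [ho] with q hq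
    simp only [eul1, (hg.hasDerivAt_1 hS hq q.2.2).deriv]
  have e2 : (fun q : ℝ × ℝ × ℝ => dang g q.1 q.2.1 q.2.2) =ᶠ[𝓝 (x, y, θ)] fun q =>
      (1 : ℂ) * fderiv ℝ (fun q : ℝ × ℝ × ℝ => g q.1 q.2.1 q.2.2) q (0, 0, 1) := by
    filter_upwards [ho] with q hq
    simp only [dang, (hg.hasDerivAt_3 hS hq q.2.2).deriv, one_mul]
  have h1 := ((hg.eul1 hS).hasDerivAt_3 hS hp θ).deriv
  have h2 := ((hg.dang hS).hasDerivAt_1 hS hp θ).deriv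
  rw [dang, h1, e1.fderiv_eq, fderiv_mul_fderiv_apply hG
    (a := fun q : ℝ × ℝ × ℝ => (q.1 : ℂ))
    (Complex.ofRealCLM.hasFDerivAt.comp (x, y, θ) hasFDerivAt_fst) (by simp), eul1, h2, e2.fderiv_eq,
    fderiv_mul_fderiv_apply hG (hasFDerivAt_const 1 (x, y, θ)) (by simp), fderiv_fderiv_comm hG]
  ring

theorem dang_eul2_comm (hS : IsOpen S) (hg : Smooth3 S g) :
    Eq3 S (dang (eul2 g)) (eul2 (dang g)) := fun x y hp θ => by
  have hG := hg.contDiffAt hS (q := (x, y, θ)) hp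
  have ho := (isOpen_lift hS).mem_nhds (x := (x, y, θ)) hp
  have e1 : (fun q : ℝ × ℝ × ℝ => eul2 g q.1 q.2.1 q.2.2) =ᶠ[𝓝 (x, y, θ)] fun q =>
      (q.2.1 : ℂ) * fderiv ℝ (fun q : ℝ × ℝ × ℝ => g q.1 q.2.1 q.2.2) q (0, 1, 0) := by
    filter_upwards [ho] with q hq
    simp only [eul2, (hg.hasDerivAt_2 hS hq q.2.2).deriv]
  have e2 : (fun q : ℝ × ℝ × ℝ => dang g q.1 q.2.1 q.2.2) =ᶠ[𝓝 (x, y, θ)] fun q =>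
      (1 : ℂ) * fderiv ℝ (fun q : ℝ × ℝ × ℝ => g q.1 q.2.1 q.2.2) q (0, 0, 1) := by
    filter_upwards [ho] with q hq
    simp only [dang, (hg.hasDerivAt_3 hS hq q.2.2).deriv, one_mul]
  have h1 := ((hg.eul2 hS).hasDerivAt_3 hS hp θ).deriv
  have h2 := ((hg.dang hS).hasDerivAt_2 hS hp θ).deriv
  rw [dang, h1, e1.fderiv_eq, fderiv_mul_fderiv_apply hG (a := fun q : ℝ × ℝ × ℝ => (q.2.1 : ℂ))
      (Complex.ofRealCLM.comp ((ContinuousLinearMap.fst ℝ ℝ ℝ).comp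
        (ContinuousLinearMap.snd ℝ ℝ (ℝ × ℝ)))).hasFDerivAt (by simp), eul2, h2, e2.fderiv_eq,
    fderiv_mul_fderiv_apply hG (hasFDerivAt_const 1 (x, y, θ)) (by simp), fderiv_fderiv_comm hG]
  ring

theorem comm_iterate {A D : (ℝ → ℝ → ℝ → ℂ) → ℝ → ℝ → ℝ → ℂ}
    (hA : ∀ g h, Eq3 S g h → Eq3 S (A g) (A h)) (hAs : ∀ g, Smooth3 S g → Smooth3 S (A g))
    (hc : ∀ g, Smooth3 S g → Eq3 S (D (A g)) (A (D g))) (hg : Smooth3 S g) (i : ℕ) :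
    Eq3 S (D (A^[i] g)) (A^[i] (D g)) := by
  induction i generalizing g with
  | zero => exact fun _ _ _ _ => rfl
  | succ i ih =>
    intro x y hp θ
    rw [Function.iterate_succ_apply, Function.iterate_succ_apply, ih (hAs g hg) x y hp θ]
    exact Eq3.iterate hA (hc g hg) i x y hp θ

end

end HypCyl

end

noncomputable section

namespace HypCyl
open Set Filter Topology

/-! ### Differentiation and bounds for Fourier coefficients -/

section

variable {S K : Set (ℝ × ℝ)} {g h : ℝ → ℝ → ℝ → ℂ} {σ : ℕ} {s : ℤ}

theorem contDiff_angle {f : ℝ → ℂ} (hf : ContDiff ℝ (⊤ : ℕ∞) f) :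
    ContDiff ℝ (⊤ : ℕ∞) fun q : ℝ × ℝ × ℝ => f q.2.2 :=
  hf.comp (contDiff_snd.comp contDiff_snd)

theorem contDiff_exp_neg_mode (k : ℤ) :
    ContDiff ℝ (⊤ : ℕ∞) fun θ : ℝ => Complex.exp (-Complex.I * k * θ) :=
  Complex.contDiff_exp.comp (contDiff_const.mul Complex.ofRealCLM.contDiff)

theorem Smooth3.mono (hg : Smooth3 K g) (h : S ⊆ K) : Smooth3 S g :=
  ContDiffOn.mono hg fun _ hq => h hq

theorem Smooth3.angle_mul {f : ℝ → ℂ} (hf : ContDiff ℝ (⊤ : ℕ∞) f) (hg : Smooth3 K g) :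
    Smooth3 K fun l t θ => f θ * g l t θ :=
  (contDiff_angle hf).contDiffOn.mul hg

theorem Smooth3.sub (hg : Smooth3 K g) (hh : Smooth3 K h) : Smooth3 K fun l t θ => g l t θ - h l t θ :=
  ContDiffOn.sub hg hh

theorem Smooth3.slice (hg : Smooth3 K g) {l t : ℝ} (hp : (l, t) ∈ K) :
    ContDiff ℝ (⊤ : ℕ∞) (g l t) :=
  contDiffOn_univ.1 (ContDiffOn.comp hg (f := fun θ : ℝ => (l, t, θ)) (by fun_prop) fun _ _ => hp)

theorem Smooth3.windowed (hg : Smooth3 K g) (k : ℤ) :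
    Smooth3 K fun l t θ => Complex.exp (-Complex.I * k * θ) * (win θ * g l t θ) :=
  (hg.angle_mul contDiff_win).angle_mul (contDiff_exp_neg_mode k)

theorem sm_fhat (hK : Convex ℝ K) (hKi : (interior K).Nonempty) (hg : Smooth3 K g) :
    Sm K (fhat g) := fun k => by
  refine contDiffOn_const.mul (contDiffOn_intervalIntegral hK hKi angle_lt (G := fun p θ =>
    Complex.exp (-Complex.I * (k : ℤ) * θ) * (win θ * g p.1 p.2 θ)) ?_)
  exact ContDiffOn.comp (hg.windowed k) (f := fun q : (ℝ × ℝ) × ℝ => (q.1.1, q.1.2, q.2))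
    (by fun_prop) fun q hq => hq.1

theorem hasFDerivAt_integral3 (hS : IsOpen S) (hc : Convex ℝ S) (hg : Smooth3 S g) {p : ℝ × ℝ}
    (hp : p ∈ S) : ∃ L : ℝ × ℝ →L[ℝ] ℂ,
      HasFDerivAt (fun p : ℝ × ℝ => ∫ θ in (-1 : ℝ)..(2 * Real.pi + 2), g p.1 p.2 θ) L p ∧
      ∀ v, L v = ∫ θ in (-1 : ℝ)..(2 * Real.pi + 2),
        fderiv ℝ (fun q : ℝ × ℝ × ℝ => g q.1 q.2.1 q.2.2) (p.1, p.2, θ) (v.1, v.2, 0) := by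
  set G := fun q : ℝ × ℝ × ℝ => g q.1 q.2.1 q.2.2 with hG
  set A : ℝ × ℝ →L[ℝ] ℝ × ℝ × ℝ := (ContinuousLinearMap.fst ℝ ℝ ℝ).prod
    ((ContinuousLinearMap.snd ℝ ℝ ℝ).prod 0) with hA
  have hf : ContinuousOn (fderiv ℝ G) {q | (q.1, q.2.1) ∈ S} :=
    (ContDiffOn.fderiv_of_isOpen (m := (⊤ : ℕ∞)) hg (isOpen_lift hS) (by norm_cast)).continuousOn
  have hf' : ContinuousOn (Function.uncurry fun (p : ℝ × ℝ) (θ : ℝ) =>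
      (fderiv ℝ G (p.1, p.2, θ)).comp A) (S ×ˢ Icc (-1) (2 * Real.pi + 2)) :=
    (hf.comp (f := fun q : (ℝ × ℝ) × ℝ => (q.1.1, q.1.2, q.2)) (by fun_prop)
      fun q hq => hq.1).clm_comp continuousOn_const
  have h := norm_intervalIntegral_sub_le_of_hasFDerivWithinAt hc angle_lt
    (G := fun p θ => g p.1 p.2 θ) (G' := fun p θ => (fderiv ℝ G (p.1, p.2, θ)).comp A)
    ((ContDiffOn.continuousOn hg).comp (f := fun q : (ℝ × ℝ) × ℝ => (q.1.1, q.1.2, q.2))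
      (by fun_prop) fun q hq => hq.1) hf' (fun q hq θ _ => ?_) hp
  · refine ⟨_, h.hasFDerivAt (hS.mem_nhds hp), fun v => ?_⟩
    rw [ContinuousLinearMap.intervalIntegral_apply]
    · simp [hA]
    · refine ContinuousOn.intervalIntegrable ?_
      rw [uIcc_of_le angle_lt.le]
      exact hf'.comp (f := fun θ => (p, θ)) (by fun_prop) fun θ hθ => ⟨hp, hθ⟩
  · have h1 := ((hg.contDiffAt hS (q := (q.1, q.2, θ)) hq).differentiableAt (by simp)).hasFDerivAt
    have h2 : HasFDerivAt (fun q : ℝ × ℝ => (q.1, q.2, θ)) A q :=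
      hasFDerivAt_fst.prodMk (hasFDerivAt_snd.prodMk (hasFDerivAt_const θ q))
    exact (h1.comp (f := fun q : ℝ × ℝ => (q.1, q.2, θ)) q h2).hasFDerivWithinAt

/-- `∂_ℓ`. -/
def dl (g : ℝ → ℝ → ℝ → ℂ) : ℝ → ℝ → ℝ → ℂ := fun l t θ => deriv (fun l' => g l' t θ) l

/-- `∂_τ`. -/
def dt (g : ℝ → ℝ → ℝ → ℂ) : ℝ → ℝ → ℝ → ℂ := fun l t θ => deriv (fun t' => g l t' θ) t

theorem deriv_integral_left (hS : IsOpen S) (hc : Convex ℝ S) (hg : Smooth3 S g) {l t : ℝ}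
    (hp : (l, t) ∈ S) : deriv (fun l => ∫ θ in (-1 : ℝ)..(2 * Real.pi + 2), g l t θ) l =
      ∫ θ in (-1 : ℝ)..(2 * Real.pi + 2), dl g l t θ := by
  obtain ⟨L, hL, hLv⟩ := hasFDerivAt_integral3 hS hc hg hp
  refine (hL.comp_hasDerivAt (f := fun l => (l, t)) l
    ((hasDerivAt_id l).prodMk (hasDerivAt_const l t))).deriv.trans ?_
  rw [hLv]
  exact intervalIntegral.integral_congr fun θ _ => ((hg.hasDerivAt_1 hS hp θ).deriv).symm

theorem deriv_integral_right (hS : IsOpen S) (hc : Convex ℝ S) (hg : Smooth3 S g) {l t : ℝ}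
    (hp : (l, t) ∈ S) : deriv (fun t => ∫ θ in (-1 : ℝ)..(2 * Real.pi + 2), g l t θ) t =
      ∫ θ in (-1 : ℝ)..(2 * Real.pi + 2), dt g l t θ := by
  obtain ⟨L, hL, hLv⟩ := hasFDerivAt_integral3 hS hc hg hp
  refine (hL.comp_hasDerivAt (f := fun t => (l, t)) t
    ((hasDerivAt_const t l).prodMk (hasDerivAt_id t))).deriv.trans ?_
  rw [hLv]
  exact intervalIntegral.integral_congr fun θ _ => ((hg.hasDerivAt_2 hS hp θ).deriv).symm

theorem fcoef_const_mul (k : ℤ) (c : ℂ) (f : ℝ → ℂ) : fcoef k (fun θ => c * f θ) = c * fcoef k f := by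
  simp only [fcoef]
  rw [mul_left_comm, ← intervalIntegral.integral_const_mul (r := c)]
  congr 1
  exact intervalIntegral.integral_congr fun θ _ => by ring

theorem fhat_const_mul (c : ℝ → ℝ → ℂ) (g : ℝ → ℝ → ℝ → ℂ) (k : Mode) (l t : ℝ) :
    fhat (fun l t θ => c l t * g l t θ) k l t = c l t * fhat g k l t := by
  rw [fhat, fhat, ← fcoef_const_mul]
  congr 1
  ext θ
  ring

theorem fcoef_add {f f' : ℝ → ℂ} (hf : Continuous f) (hf' : Continuous f') (k : ℤ) :
    fcoef k (fun θ => f θ + f' θ) = fcoef k f + fcoef k f' := by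
  have he := (contDiff_exp_neg_mode k).continuous
  have h1 : ∀ f : ℝ → ℂ, Continuous f → IntervalIntegrable
      (fun θ : ℝ => Complex.exp (-Complex.I * k * θ) * f θ) MeasureTheory.volume (-1)
        (2 * Real.pi + 2) := fun f hf => (he.mul hf).intervalIntegrable _ _
  simp only [fcoef, mul_add]
  rw [intervalIntegral.integral_add (h1 f hf) (h1 f' hf'), mul_add]

theorem fhat_add (hg : Smooth3 K g) (hh : Smooth3 K h) :
    EqF K (fhat fun l t θ => g l t θ + h l t θ) (fhat g + fhat h) := fun k l t hp => by
  have hw := contDiff_win.continuous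
  simp only [Pi.add_apply, fhat]
  refine Eq.trans ?_ (fcoef_add (hw.mul (hg.slice hp).continuous) (hw.mul (hh.slice hp).continuous) k)
  congr 1
  ext θ
  exact mul_add _ _ _

theorem fhat_sub (hg : Smooth3 K g) (hh : Smooth3 K h) :
    EqF K (fhat fun l t θ => g l t θ - h l t θ) (fhat g - fhat h) := fun k l t hp => by
  have h1 := fhat_add (hg.sub hh) hh k l t hp
  simp only [Pi.add_apply, sub_add_cancel] at h1
  exact eq_sub_of_add_eq h1.symm

theorem fhat_sum {ι : Type*} (T : Finset ι) {F : ι → ℝ → ℝ → ℝ → ℂ} (hF : ∀ i ∈ T, Smooth3 K (F i)) :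
    EqF K (fhat fun l t θ => ∑ i ∈ T, F i l t θ) (∑ i ∈ T, fhat (F i)) := by
  classical
  have hs : ∀ T' ⊆ T, Smooth3 K fun l t θ => ∑ i ∈ T', F i l t θ := fun T' hT' =>
    ContDiffOn.sum fun i hi => hF i (hT' hi)
  induction T using Finset.induction_on with
  | empty => intro k l t _; simp [fhat, fcoef]
  | insert a T ha ih =>
    intro k l t hp
    have h1 := ih (fun i hi => hF i (Finset.mem_insert_of_mem hi))
      (fun T' h => hs T' (h.trans (Finset.subset_insert _ _))) k l t hp
    have h2 := fhat_add (hF a (Finset.mem_insert_self a T)) (hs T (Finset.subset_insert _ _)) k l t hp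
    simp only [Finset.sum_insert ha]
    rw [h2]
    simp only [Pi.add_apply, h1]

theorem fhat_congr (e : Eq3 K g h) : EqF K (fhat g) (fhat h) := fun k l t hp => by
  simp only [fhat, e l t hp]

theorem pl_fhat (hS : IsOpen S) (hc : Convex ℝ S) (hg : Smooth3 S g) :
    EqF S (pl σ (fhat g)) (fhat fun l t θ => (l : ℂ) ^ σ * dl g l t θ) := fun k l t hp => by
  rw [fhat_const_mul (fun l _ => (l : ℂ) ^ σ)]
  simp only [pl, fhat, fcoef, deriv_const_mul_field]
  rw [deriv_integral_left hS hc (hg.windowed k) hp]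
  simp only [dl, deriv_const_mul_field]

theorem pt_fhat (hS : IsOpen S) (hc : Convex ℝ S) (hg : Smooth3 S g) :
    EqF S (pt (fhat g)) (fhat (dt g)) := fun k l t hp => by
  simp only [pt]
  unfold fhat fcoef
  rw [deriv_const_mul_field, deriv_integral_right hS hc (hg.windowed k) hp]
  simp only [dt, deriv_const_mul_field]

theorem pl_one_fhat (hS : IsOpen S) (hc : Convex ℝ S) (hg : Smooth3 S g) :
    EqF S (pl 1 (fhat g)) (fhat (eul1 g)) := fun k l t hp => by
  rw [pl_fhat hS hc hg k l t hp]
  simp only [pow_one, dl]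
  rfl

theorem norm_iteratedDeriv_mul_le {f f' : ℝ → ℂ} (hf : ContDiff ℝ (⊤ : ℕ∞) f)
    (hf' : ContDiff ℝ (⊤ : ℕ∞) f') (n : ℕ) (θ : ℝ) :
    ‖iteratedDeriv n (fun θ => f θ * f' θ) θ‖ ≤ ∑ i ∈ Finset.range (n + 1),
      (n.choose i : ℝ) * ‖iteratedDeriv i f θ‖ * ‖iteratedDeriv (n - i) f' θ‖ := by
  simp only [← norm_iteratedFDeriv_eq_norm_iteratedDeriv]
  exact norm_iteratedFDeriv_mul_le hf hf' θ (by exact_mod_cast le_top)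

/-- Away from τ = ℓ = 0 the weight r^m is bounded below, so only decay in k is at stake, and m
derivatives in θ provide it. The condition n ≤ m stands inside the existential so that constants can
be chosen for all n at once. -/
theorem rap_fhat_of_le {r : ℝ} (hr : 0 < r) (hSr : ∀ l t, (l, t) ∈ S → r ≤ t ^ 2 + l ^ 2)
    (hpos : ∀ l t, (l, t) ∈ S → 0 ≤ l)
    (hg : ∀ l t, (l, t) ∈ S → ContDiff ℝ (⊤ : ℕ∞) (g l t)) (m : ℕ)
    (hb : ∀ n, ∃ C, n ≤ m → ∀ l t, (l, t) ∈ S → ∀ θ ∈ Icc (-1 : ℝ) (2 * Real.pi + 2),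
      ‖iteratedDeriv n (g l t) θ‖ ≤ C * l ^ s) :
    ∃ C, ∀ k l t, (l, t) ∈ S → k.w ^ m * ‖fhat g k l t‖ ≤ C * (t ^ 2 + l ^ 2) ^ m * l ^ s := by
  have hw : ∀ n, ∃ C, ∀ θ ∈ Icc (-1 : ℝ) (2 * Real.pi + 2),
      ‖iteratedDeriv n (fun θ => ((win θ : ℝ) : ℂ)) θ‖ ≤ C := fun n =>
    isCompact_Icc.exists_bound_of_continuousOn
      (contDiff_win.continuous_iteratedDeriv n (by exact_mod_cast le_top)).continuousOn
  choose A hA using hw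
  choose B hB using hb
  refine ⟨3 * (∑ i ∈ Finset.range (m + 1), (m.choose i : ℝ) * |A i| * |B (m - i)|) / r ^ m,
    fun k l t hp => ?_⟩
  have hl := hpos l t hp
  have h1 := norm_fcoef_le (g := fun θ => win θ * g l t θ) (contDiff_win.mul (hg l t hp))
    (fun θ hθ => by rw [win_eq_zero (hθ.imp le_of_lt le_of_lt)]; simp) m
    (C := (∑ i ∈ Finset.range (m + 1), (m.choose i : ℝ) * |A i| * |B (m - i)|) * l ^ s)
    (fun θ hθ => ?_) k
  · calc k.w ^ m * ‖fhat g k l t‖ ≤ 3 * ((∑ i ∈ Finset.range (m + 1), (m.choose i : ℝ) * |A i| *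
          |B (m - i)|) * l ^ s) := h1
      _ = 3 * (∑ i ∈ Finset.range (m + 1), (m.choose i : ℝ) * |A i| * |B (m - i)|) / r ^ m * r ^ m *
          l ^ s := by field_simp
      _ ≤ _ := by
        have := hSr l t hp
        gcongr
  · refine (norm_iteratedDeriv_mul_le contDiff_win (hg l t hp) m θ).trans ?_
    rw [Finset.sum_mul]
    refine Finset.sum_le_sum fun i _ => ?_
    have h2 := (hA i θ hθ).trans (le_abs_self _)
    have h3 : ‖iteratedDeriv (m - i) (g l t) θ‖ ≤ |B (m - i)| * l ^ s :=
      (hB (m - i) (Nat.sub_le m i) l t hp θ hθ).trans (by gcongr; exact le_abs_self _)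
    calc _ ≤ (m.choose i : ℝ) * |A i| * (|B (m - i)| * l ^ s) := by gcongr
      _ = _ := by ring

theorem IsDom.subset (hK : IsDom K) (hS : IsOpen S) (h : S ⊆ K) : IsDom S :=
  ⟨hS, fun hp => hK.pos (h hp), hK.bdd.imp fun _ hR _ _ hp => hR (h hp)⟩

/-! ### Sources that are smooth up to the boundary -/

/-- The derivative in the direction `v` on `S × ℝ`. -/
def dir3 (K : Set (ℝ × ℝ)) (v : ℝ × ℝ × ℝ) (g : ℝ → ℝ → ℝ → ℂ) : ℝ → ℝ → ℝ → ℂ := fun l t θ =>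
  fderivWithin ℝ (fun q : ℝ × ℝ × ℝ => g q.1 q.2.1 q.2.2) {q | (q.1, q.2.1) ∈ K} (l, t, θ) v

theorem uniqueDiffOn_lift {I J : Set ℝ} (hI : UniqueDiffOn ℝ I) (hJ : UniqueDiffOn ℝ J) :
    UniqueDiffOn ℝ {q : ℝ × ℝ × ℝ | (q.1, q.2.1) ∈ I ×ˢ J} := by
  have : {q : ℝ × ℝ × ℝ | (q.1, q.2.1) ∈ I ×ˢ J} = I ×ˢ (J ×ˢ univ) := by ext; simp
  rw [this]
  exact hI.prod (hJ.prod uniqueDiffOn_univ)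

theorem Smooth3.dir3 (hK : UniqueDiffOn ℝ {q : ℝ × ℝ × ℝ | (q.1, q.2.1) ∈ K}) (hg : Smooth3 K g)
    (v : ℝ × ℝ × ℝ) : Smooth3 K (dir3 K v g) :=
  (ContDiffOn.fderivWithin hg hK (by norm_cast)).clm_apply contDiffOn_const

theorem dir3_eq (hS : IsOpen S) (h : S ⊆ K) (v : ℝ × ℝ × ℝ) {l t : ℝ} (hp : (l, t) ∈ S) (θ : ℝ) :
    dir3 K v g l t θ = fderiv ℝ (fun q : ℝ × ℝ × ℝ => g q.1 q.2.1 q.2.2) (l, t, θ) v := by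
  rw [dir3, fderivWithin_of_mem_nhds]
  exact mem_of_superset ((isOpen_lift hS).mem_nhds (x := (l, t, θ)) hp) fun q hq => h hq

/-- The transforms of functions smooth on I × J × ℝ form a set closed under ∂_ℓ and ∂_τ, taken as
derivatives within this set, and each such function is bounded with its θ-derivatives over the
compact K. -/
theorem clR_fhat_of_compact {I J : Set ℝ} (hI : UniqueDiffOn ℝ I) (hJ : UniqueDiffOn ℝ J)
    (hg : Smooth3 (I ×ˢ J) g) (hK : IsCompact K) (hKI : K ⊆ I ×ˢ J) (hSK : S ⊆ K)
    (hS : IsDom S) (hc : Convex ℝ S) (hne : S.Nonempty) {r : ℝ} (hr : 0 < r)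
    (hSr : ∀ l t, (l, t) ∈ S → r ≤ t ^ 2 + l ^ 2) : ClR S 0 0 (fhat g) := by
  have hu := uniqueDiffOn_lift hI hJ
  have hSI := hSK.trans hKI
  have ho := hS.isOpen
  refine Cl.of_closed (Q := fun f => ∃ g, Smooth3 (I ×ˢ J) g ∧ EqF S f (fhat g)) ?_ ?_ ?_ ?_
    ⟨g, hg, fun _ _ _ _ => rfl⟩
  · rintro f ⟨g, hg, e⟩
    exact (sm_fhat hc (by rwa [ho.interior_eq]) (hg.mono hSI)).congr e.symm
  · rintro f ⟨g, hg, e⟩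
    refine isAdditivePred_rap.congr e.symm (fun m => rap_fhat_of_le hr hSr (fun l t hp => (hS.pos hp).le)
      (fun l t hp => hg.slice (hSI hp)) m fun n => ?_)
    have h1 : ∀ n g, Smooth3 (I ×ˢ J) g → ∀ l t, (l, t) ∈ S → ∀ θ,
        iteratedDeriv n (g l t) θ = (dir3 (I ×ˢ J) (0, 0, 1))^[n] g l t θ := fun n => by
      induction n with
      | zero => intro g _ l t _ θ; simp
      | succ n ih =>
        intro g hg l t hp θ
        rw [iteratedDeriv_succ', Function.iterate_succ_apply, ← ih _ (hg.dir3 hu _) l t hp]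
        congr 1
        ext θ
        rw [((hg.mono hSI).hasDerivAt_3 ho hp θ).deriv, dir3_eq ho hSI _ hp]
    have h2 : Smooth3 (I ×ˢ J) ((dir3 (I ×ˢ J) (0, 0, 1))^[n] g) :=
      Smooth3.iterate (fun g hg => hg.dir3 hu _) hg n
    obtain ⟨C, hC⟩ := (hK.prod (isCompact_Icc (a := (-1 : ℝ)) (b := 2 * Real.pi + 2))
      ).exists_bound_of_continuousOn ((ContDiffOn.continuousOn h2).comp
        (f := fun q : (ℝ × ℝ) × ℝ => (q.1.1, q.1.2, q.2)) (by fun_prop) fun q hq => hKI hq.1)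
    refine ⟨C, fun _ l t hp θ hθ => ?_⟩
    rw [h1 n g hg l t hp, zpow_zero, mul_one]
    exact hC ((l, t), θ) ⟨hSK hp, hθ⟩
  · rintro f ⟨g, hg, e⟩
    refine ⟨_, hg.dir3 hu (0, 1, 0), fun k l t hp => ?_⟩
    rw [e.pt ho k l t hp, pt_fhat ho hc (hg.mono hSI) k l t hp]
    refine fhat_congr (K := S) (fun l t hp θ => ?_) k l t hp
    rw [dir3_eq ho hSI _ hp, dt, ((hg.mono hSI).hasDerivAt_2 ho hp θ).deriv]
  · rintro f ⟨g, hg, e⟩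
    refine ⟨_, hg.dir3 hu (1, 0, 0), fun k l t hp => ?_⟩
    rw [e.pl ho k l t hp, pl_fhat ho hc (hg.mono hSI) k l t hp]
    refine fhat_congr (K := S) (fun l t hp θ => ?_) k l t hp
    rw [dir3_eq ho hSI _ hp, dl, ((hg.mono hSI).hasDerivAt_1 ho hp θ).deriv, pow_zero, one_mul]

end

end HypCyl

end

noncomputable section

namespace HypCyl
open Set Filter Topology

/-! ### Cutoff functions -/

/-- A smooth function that vanishes for `t ≤ a` and is one for `t ≥ b`. -/
def cut (a b : ℝ) (t : ℝ) : ℂ := ((Real.smoothTransition ((t - a) / (b - a)) : ℝ) : ℂ)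

theorem contDiff_cut (a b : ℝ) : ContDiff ℝ (⊤ : ℕ∞) (cut a b) :=
  Complex.ofRealCLM.contDiff.comp (Real.smoothTransition.contDiff.comp
    ((contDiff_id.sub contDiff_const).div_const _))

theorem cut_eq_zero {a b t : ℝ} (hab : a < b) (ht : t ≤ a) : cut a b t = 0 := by
  rw [cut, Real.smoothTransition.zero_of_nonpos
    (div_nonpos_of_nonpos_of_nonneg (by linarith) (by linarith)), Complex.ofReal_zero]

theorem cut_eq_one {a b t : ℝ} (hab : a < b) (ht : b ≤ t) : cut a b t = 1 := by
  rw [cut, Real.smoothTransition.one_of_one_le ((one_le_div (by linarith)).2 (by linarith)),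
    Complex.ofReal_one]

theorem contDiff_cut_mul {a b : ℝ} (ha : 0 < a) (hab : a < b) {f : ℝ → ℂ}
    (hf : ContDiffOn ℝ (⊤ : ℕ∞) f (Ioi 0)) : ContDiff ℝ (⊤ : ℕ∞) fun t => cut a b t * f t := by
  refine contDiff_iff_contDiffAt.2 fun t => ?_
  rcases lt_or_ge 0 t with h | h
  · exact (contDiff_cut a b).contDiffAt.mul (hf.contDiffAt (Ioi_mem_nhds h))
  · refine (contDiffAt_const (c := 0)).congr_of_eventuallyEq ?_
    filter_upwards [Iio_mem_nhds (h.trans_lt ha)] with t' ht'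
    rw [cut_eq_zero hab (le_of_lt ht'), zero_mul]

section

variable {S : Set (ℝ × ℝ)} {a b b' R ℓ₀ δ c x : ℝ} {κ : ℝ → ℂ} {W f g : Fam} {σ : ℕ} {s : ℤ}
  {E : IndexSet}

theorem isDom_box (hx : 0 ≤ x) : IsDom (Ioo x R ×ˢ Ioo a b) :=
  (isDom_prod (R := R) (a := a) (b := b)).subset (isOpen_Ioo.prod isOpen_Ioo)
    (prod_mono_left (Ioo_subset_Ioo_left hx))

/-- The product is controlled for t > b and vanishes for t < b'; since b < b' these open sets
overlap and the classes glue. -/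
theorem ClR.cut_mul (hx : 0 ≤ x) (hbb : b < b')
    (hκ : ContDiff ℝ (⊤ : ℕ∞) κ) (hκ0 : ∀ t ≤ b', κ t = 0) (hW : ClR (Ioo x R ×ˢ Ioo b 1) σ s W) :
    ClR (Ioo x R ×ˢ Ioo (-1) 1) σ s (tfun κ * W) := by
  have d1 := isDom_box (R := R) (a := b) (b := 1) hx
  have d2 := isDom_box (R := R) (a := -1) (b := b') hx
  have h1 := (clM_tfun (σ := σ) d1 hκ).mul_rap_zero d1 hW
  have h2 : ClR (Ioo x R ×ˢ Ioo (-1) b') σ s (tfun κ * W) := clR_zero.congr d2 fun k l t hp => by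
    simp [tfun, hκ0 t hp.2.2.le]
  refine (h1.union d1 d2 h2).mono fun p hp => ?_
  rcases lt_or_ge b p.2 with h | h
  · exact Or.inl ⟨hp.1, h, hp.2.2⟩
  · exact Or.inr ⟨hp.1, hp.2.1, h.trans_lt hbb⟩

theorem Sm.cut_mul (hb' : 0 < b') (hκ : ContDiff ℝ (⊤ : ℕ∞) κ) (hκ0 : ∀ t ≤ b', κ t = 0)
    (hW : Sm (Ioo 0 R ×ˢ Ioc 0 1) W) : Sm (cstrip R) (tfun κ * W) := fun k p hp => by
  rcases lt_or_ge 0 p.2 with h | h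
  · have h1 : ContDiffWithinAt ℝ (⊤ : ℕ∞) (fun p : ℝ × ℝ => W k p.1 p.2) (cstrip R) p := by
      refine (hW k p ⟨hp.1, h, hp.2.2⟩).mono_of_mem_nhdsWithin ?_
      have : {p : ℝ × ℝ | 0 < p.2} ∈ 𝓝 p := (isOpen_lt continuous_const continuous_snd).mem_nhds h
      filter_upwards [mem_nhdsWithin_of_mem_nhds this, self_mem_nhdsWithin] with q hq hq'
      exact ⟨hq'.1, hq, hq'.2.2⟩
    exact (hκ.comp contDiff_snd).contDiffAt.contDiffWithinAt.mul h1
  · refine (contDiffWithinAt_const (c := 0)).congr_of_eventuallyEq ?_ ?_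
    · have : {p : ℝ × ℝ | p.2 < b'} ∈ 𝓝 p :=
        (isOpen_lt continuous_snd continuous_const).mem_nhds (h.trans_lt hb')
      filter_upwards [mem_nhdsWithin_of_mem_nhds this] with q hq
      simp [tfun, hκ0 q.2 (le_of_lt hq)]
    · simp [tfun, hκ0 p.2 (h.trans hb'.le)]

/-- A cutoff away from τ = 0 turns data known only for τ > b into data on the whole strip. The
global order s comes from the expansion with N = 0 for small ℓ, glued to the bounds on compact
ℓ-intervals. -/
theorem phg_of_side (hb : 0 < b) (hbb : b < b')
    (hκ : ContDiff ℝ (⊤ : ℕ∞) κ) (hκ0 : ∀ t ≤ b', κ t = 0) (hW : Sm (Ioo 0 ℓ₀ ×ˢ Ioc 0 1) W)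
    (hc : ∀ a q, 0 < a → a < q → q < ℓ₀ → ClR (Ioo a q ×ˢ Ioo b 1) 1 0 W) {v : ℂ × ℕ → Fam}
    (hv : ∀ e ∈ E.carrier, Sm (Ioo 0 1 ×ˢ Ioc 0 1) (v e) ∧ ClR (Ioo 0 1 ×ˢ Ioo b 1) 0 0 (v e))
    (hN : ∀ N : ℕ, ∃ ε > 0, ClR (Ioo 0 ε ×ˢ Ioo b 1) 1 N (W - ∑ e ∈ E.upTo N, v e * lterm e)) :
    Phg ℓ₀ E (tfun κ * W) := by
  refine ⟨hW.cut_mul (hb.trans hbb) hκ hκ0, ?_, fun e => tfun κ * v e, fun e he =>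
    ⟨(hv e he).1.cut_mul (hb.trans hbb) hκ hκ0, (hv e he).2.cut_mul le_rfl hbb hκ hκ0⟩,
    fun N => ?_⟩
  · obtain ⟨ε, hε, h0⟩ := hN 0
    set ε' := min ε 1 with hε'
    have hε0 : 0 < ε' := lt_min hε zero_lt_one
    have d : IsDom (Ioo 0 ε' ×ˢ Ioo b 1) := isDom_box le_rfl
    obtain ⟨s, hs⟩ := exists_clR_sum (σ := 1) d (E.upTo (0 : ℕ)) (F := fun e => v e * lterm e)
      fun e he => (((hv e (IndexSet.mem_upTo.1 he).1).2.of_zero (isDom_box le_rfl)).mono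
        (prod_mono_left (Ioo_subset_Ioo_right (min_le_right _ _)))).exists_mul_lterm d e
    have h1 : ClR (Ioo 0 ε' ×ˢ Ioo b 1) 1 (min 0 s) W := by
      have := ((h0.mono (prod_mono_left (Ioo_subset_Ioo_right (min_le_left _ _)))).mono_exp d
        (s' := min 0 s) (by simp)).add d (hs.mono_exp d (min_le_right 0 s))
      exact this.congr d fun k l t _ => by simp
    refine ⟨min 0 s, fun q hq => ?_⟩
    rcases le_or_gt q ε' with h | h
    · exact (h1.mono (prod_mono_left (Ioo_subset_Ioo_right h))).cut_mul le_rfl hbb hκ hκ0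
    · have h2 := (hc (ε' / 2) q (by positivity) (by linarith) hq).mono_exp
        (isDom_box (by positivity)) (min_le_left 0 s)
      refine ((h1.union d (isDom_box (by positivity)) h2).mono ?_).cut_mul le_rfl hbb hκ hκ0
      rintro p ⟨hp1, hp2⟩
      rcases lt_or_ge p.1 ε' with h3 | h3
      · exact Or.inl ⟨⟨hp1.1, h3⟩, hp2⟩
      · exact Or.inr ⟨⟨by linarith, hp1.2⟩, hp2⟩
  · obtain ⟨ε, hε, h⟩ := hN N
    refine ⟨ε, hε, ((h.cut_mul le_rfl hbb hκ hκ0).mono half_subset_strip).congr isDom_half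
      fun k l t _ => ?_⟩
    simp only [Pi.mul_apply, Pi.sub_apply, Finset.sum_apply, mul_sub, Finset.mul_sum, mul_assoc]

/-! ### Remainders -/

/-- `G i j` stands for (ℓ ∂_ℓ)^i (ℓ ∂_ℓ + τ ∂_τ)^j applied to the remainder, the derivatives that a
corner expansion controls. For τ > b these suffice, because ∂_τ is τ⁻¹ times the difference of the
two fields. -/
theorem clR_fhat_of_remainder (hb : 0 < b) (hb1 : b < 1) (hδ : 0 < δ) (N : ℕ)
    {G : ℕ → ℕ → ℝ → ℝ → ℝ → ℂ} (hS : S = Ioo 0 δ ×ˢ Ioo b 1) (hs : ∀ i j, Smooth3 S (G i j))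
    (h1 : ∀ i j, Eq3 S (eul1 (G i j)) (G (i + 1) j))
    (h2 : ∀ i j, Eq3 S (fun l t θ => eul1 (G i j) l t θ + eul2 (G i j) l t θ) (G i (j + 1)))
    (hbd : ∀ i j n, ∃ C, ∃ ε > 0, ∀ l t, (l, t) ∈ S → l < ε →
      ∀ θ ∈ Icc (-1 : ℝ) (2 * Real.pi + 2), ‖iteratedDeriv n (G i j l t) θ‖ ≤ C * l ^ N)
    (hc : ∀ a, 0 < a → a < δ → ClR (Ioo a δ ×ˢ Ioo b 1) 1 0 (fhat (G 0 0))) :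
    ClR S 1 N (fhat (G 0 0)) := by
  have d : IsDom S := by rw [hS]; exact isDom_prod
  have ho := d.isOpen
  have hcv : Convex ℝ S := by rw [hS]; exact (convex_Ioo 0 δ).prod (convex_Ioo b 1)
  have hne : S.Nonempty := by
    rw [hS]; exact ⟨(δ / 2, (b + 1) / 2), ⟨by linarith, by linarith⟩, by linarith, by linarith⟩
  have hsm : ∀ i j, Sm S (fhat (G i j)) := fun i j =>
    sm_fhat hcv (by rwa [ho.interior_eq]) (hs i j)
  have hpl : ∀ i j, EqF S (pl 1 (fhat (G i j))) (fhat (G (i + 1) j)) := fun i j k l t hp => by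
    rw [pl_one_fhat ho hcv (hs i j) k l t hp, fhat_congr (h1 i j) k l t hp]
  have hB : ∀ i j, EqF S (Bop (fhat (G i j))) (fhat (G i (j + 1))) := fun i j k l t hp => by
    rw [← fhat_congr (h2 i j) k l t hp,
      fhat_add ((hs i j).eul1 ho) ((hs i j).eul2 ho) k l t hp]
    simp only [Bop, Pi.add_apply, Pi.mul_apply, tfun]
    rw [pl_one_fhat ho hcv (hs i j) k l t hp, pt_fhat ho hcv (hs i j) k l t hp,
      ← fhat_const_mul (fun _ t => (t : ℂ))]
    rfl
  have hcl : ∀ a, 0 < a → a < δ → ∀ j i, ClR (Ioo a δ ×ˢ Ioo b 1) 1 0 (fhat (G i j)) :=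
    fun a ha haδ => by
    have da : IsDom (Ioo a δ ×ˢ Ioo b 1) := isDom_box ha.le
    have hsub : Ioo a δ ×ˢ Ioo b 1 ⊆ S := by
      rw [hS]; exact prod_mono_left (Ioo_subset_Ioo_left ha.le)
    have h0 : ∀ j, ClR (Ioo a δ ×ˢ Ioo b 1) 1 0 (fhat (G 0 j)) := fun j => by
      induction j with
      | zero => exact hc a ha haδ
      | succ j ih => exact (ih.Bop da).congr da fun k l t hp => hB 0 j k l t (hsub hp)
    intro j i
    induction i with
    | zero => exact h0 j
    | succ i ih => exact (ih.pl da).congr da fun k l t hp => hpl i j k l t (hsub hp)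
  have hr : ∀ l t, (l, t) ∈ S → b ^ 2 ≤ t ^ 2 + l ^ 2 := fun l t hp => by
    rw [hS] at hp
    nlinarith [hp.2.1, sq_nonneg l]
  have hrap : ∀ i j, Rap S N (fhat (G i j)) := fun i j m => by
    have hε : ∀ m, ∃ ε > 0, ∀ n, ∃ C, n ≤ m → ∀ l t, (l, t) ∈ S → l < ε →
        ∀ θ ∈ Icc (-1 : ℝ) (2 * Real.pi + 2), ‖iteratedDeriv n (G i j l t) θ‖ ≤ C * l ^ N :=
      fun m => by
      induction m with
      | zero =>
        obtain ⟨C, ε, hε, h⟩ := hbd i j 0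
        exact ⟨ε, hε, fun n => ⟨C, fun hn => by obtain rfl := Nat.le_zero.1 hn; exact h⟩⟩
      | succ m ih =>
        obtain ⟨C, ε, hε, h⟩ := hbd i j (m + 1)
        obtain ⟨ε', hε', h'⟩ := ih
        refine ⟨min ε ε', lt_min hε hε', fun n => ?_⟩
        rcases eq_or_ne n (m + 1) with rfl | hn
        · exact ⟨C, fun _ l t hp hl => h l t hp (hl.trans_le (min_le_left _ _))⟩
        · obtain ⟨C', hC'⟩ := h' n
          exact ⟨C', fun hn' l t hp hl =>
            hC' (by omega) l t hp (hl.trans_le (min_le_right _ _))⟩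
    obtain ⟨ε, hε, hn⟩ := hε m
    have hsub : S ∩ {p | p.1 < ε} ⊆ S := inter_subset_left
    obtain ⟨C, hC⟩ := rap_fhat_of_le (S := S ∩ {p | p.1 < ε}) (g := G i j) (s := N)
      (pow_pos hb 2) (fun l t hp => hr l t hp.1) (fun l t hp => (d.pos hp.1).le)
      (fun l t hp => (hs i j).slice hp.1) m fun n => by
        obtain ⟨C, hC⟩ := hn n
        exact ⟨C, fun hnm l t hp θ hθ => by
          rw [zpow_natCast]; exact hC hnm l t hp.1 hp.2 θ hθ⟩
    -- The given bounds hold only for ℓ < ε. For ℓ ≥ ε the factor ℓ^N is bounded below by a^N, and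
    -- the family is bounded there by `hc`.
    set a := min ε δ / 2 with ha
    have ha0 : 0 < a := by positivity
    have haδ : a < δ := by have := min_le_right ε δ; linarith
    have haε : a < ε := by have := min_le_left ε δ; linarith
    obtain ⟨D, hD0, hD⟩ := (hcl a ha0 haδ j i).base.exists_nonneg (isDom_box ha0.le) m
    refine ⟨|C| + D / a ^ N, fun k l t hp => ?_⟩
    have hl := d.pos hp
    rcases lt_or_ge l ε with h | h
    · refine (hC k l t ⟨hp, h⟩).trans ?_
      have : C ≤ |C| + D / a ^ N := (le_abs_self C).trans (le_add_of_nonneg_right (by positivity))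
      gcongr
    · have hp' := hp
      rw [hS] at hp'
      have h3 := hD k l t ⟨⟨by linarith, hp'.1.2⟩, hp'.2⟩
      rw [zpow_zero, mul_one] at h3
      refine h3.trans ?_
      have h4 : a ^ N ≤ l ^ N := by gcongr; linarith
      rw [zpow_natCast]
      calc D * (t ^ 2 + l ^ 2) ^ m = D / a ^ N * (t ^ 2 + l ^ 2) ^ m * a ^ N := by field_simp
        _ ≤ (|C| + D / a ^ N) * (t ^ 2 + l ^ 2) ^ m * l ^ N := by
          gcongr
          exact le_add_of_nonneg_left (abs_nonneg C)
  -- The cutoff makes τ⁻¹ smooth on the whole line without changing it for τ > b, so that it becomes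
  -- a moderate multiplier.
  set φ : ℝ → ℂ := fun t => cut (b / 2) b t * ((t⁻¹ : ℝ) : ℂ) with hφ
  have hφd : ContDiff ℝ (⊤ : ℕ∞) φ := contDiff_cut_mul (half_pos hb) (half_lt_self hb)
    (Complex.ofRealCLM.contDiff.comp_contDiffOn (contDiffOn_inv ℝ |>.mono fun t ht => ne_of_gt ht))
  have hpt : ∀ i j, EqF S (pt (fhat (G i j)))
      (tfun φ * fhat (G i (j + 1)) + tfun (fun t => -φ t) * fhat (G (i + 1) j)) :=
    fun i j k l t hp => by
    have hp' := hp
    rw [hS] at hp'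
    have ht : (t : ℂ) ≠ 0 := by
      have : 0 < t := hb.trans hp'.2.1
      exact_mod_cast this.ne'
    simp only [Pi.add_apply, Pi.mul_apply, ← hB i j k l t hp, ← hpl i j k l t hp, Bop, tfun, hφ,
      cut_eq_one (half_lt_self hb) hp'.2.1.le]
    push_cast
    field_simp
    ring
  have hP : IsAdditivePred S (Rap S N) := isAdditivePred_rap
  have hm : ∀ {f g}, Mod S 0 f → Rap S N g → Rap S N (f * g) := fun h h' => by
    simpa using Mod.mul_rap d h h'
  have hT : ∀ J i j, Tc (Rap S N) J (fhat (G i j)) := fun J => by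
    induction J with
    | zero => exact hrap
    | succ J ih =>
      refine fun i j => ⟨hrap i j, Tc.congr ho hP (hpt i j).symm ?_⟩
      have c1 := clM_tfun (σ := 1) d hφd
      have c2 := clM_tfun (σ := 1) d hφd.neg
      exact Tc.add ho hP (c1.1.mul (hsm _ _)) (c2.1.mul (hsm _ _))
        (Tc.mul ho hP hm c1.1 (hsm _ _) (c1.2 0 J) (ih _ _))
        (Tc.mul ho hP hm c2.1 (hsm _ _) (c2.2 0 J) (ih _ _))
  have hC : ∀ J I i j, Cc 1 (Rap S N) I J (fhat (G i j)) := fun J I => by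
    induction I with
    | zero => exact hT J
    | succ I ih => exact fun i j => ⟨hT J i j, (ih (i + 1) j).congr ho hP (hpl i j).symm⟩
  exact ⟨hsm 0 0, fun I J => hC J I 0 0⟩

end

end HypCyl

end

noncomputable section

namespace HypCyl
open Set Filter Topology

section

variable {S : Set (ℝ × ℝ)} {a b b' R ℓ₀ δ c x : ℝ} {f : Fam} {s : ℤ} {E E' : IndexSet}
  {u g : ℝ → ℝ → ℝ → ℂ} {η : ℝ → ℝ → ℂ}

/-! ### Fourier coefficients of polyhomogeneous sources -/

theorem shiftCoef_apply (c a : ℂ × ℕ → Fam) (e : ℂ × ℕ) (k : Mode) (l t : ℝ) :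
    shiftCoef E c a e k l t = shiftCoef E (fun e => c e k l t) (fun e => a e k l t) e := by
  simp [shiftCoef, Finset.sum_apply]

theorem sm_shiftCoef {c a : ℂ × ℕ → Fam} (hc : ∀ e, Sm S (c e))
    (ha : ∀ e ∈ E.carrier, Sm S (a e)) (e : ℂ × ℕ) : Sm S (shiftCoef E c a e) :=
  Sm.sum _ fun e' he' => ((sm_cst _).mul (hc _)).mul
    (ha e' (IndexSet.mem_upTo.1 (Finset.mem_filter.1 he').1).1)

theorem clR_shiftCoef {σ : ℕ} (hS : IsDom S) {c a : ℂ × ℕ → Fam} (hc : ∀ e, ClM S σ 0 (c e))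
    (ha : ∀ e ∈ E.carrier, ClR S σ s (a e)) (e : ℂ × ℕ) : ClR S σ s (shiftCoef E c a e) :=
  ClR.sum hS _ fun e' he' => ((clM_const hS _).mul_zero hS (hc _)).mul_rap_zero hS
    (ha e' (IndexSet.mem_upTo.1 (Finset.mem_filter.1 he').1).1)

theorem uniqueDiffOn_Ioc_zero_one : UniqueDiffOn ℝ (Ioc (0 : ℝ) 1) :=
  uniqueDiffOn_convex (convex_Ioc 0 1) (by rw [interior_Ioc]; exact nonempty_Ioo.2 zero_lt_one)

theorem sq_le_of_mem_box (hb : 0 ≤ b) (l t : ℝ) (hp : (l, t) ∈ Ioo a R ×ˢ Ioo b 1) :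
    b ^ 2 ≤ t ^ 2 + l ^ 2 := by
  nlinarith [hp.2.1, sq_nonneg l]

/-- Families that are smooth up to `τ = 1`, for `ℓ` in a compact interval. -/
theorem clR_fhat_box {I : Set ℝ} (hI : UniqueDiffOn ℝ I) (hg : Smooth3 (I ×ˢ Ioc 0 1) g)
    (ha : 0 ≤ a) (haR : a < R) (hsub : Icc a R ⊆ I) (hb : 0 < b) (hb1 : b < 1) :
    ClR (Ioo a R ×ˢ Ioo b 1) 0 0 (fhat g) :=
  clR_fhat_of_compact hI uniqueDiffOn_Ioc_zero_one hg
    (isCompact_Icc.prod (isCompact_Icc (a := b) (b := 1)))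
    (prod_mono hsub fun _ ht => ⟨hb.trans_le ht.1, ht.2⟩)
    (prod_mono Ioo_subset_Icc_self Ioo_subset_Icc_self) (isDom_box ha)
    ((convex_Ioo a R).prod (convex_Ioo b 1)) ((nonempty_Ioo.2 haR).prod (nonempty_Ioo.2 hb1))
    (pow_pos hb 2) (sq_le_of_mem_box hb.le)

theorem interior_Ioo_prod_Ioc (hR : 0 < R) : (interior (Ioo 0 R ×ˢ Ioc (0 : ℝ) 1)).Nonempty := by
  rw [interior_prod_eq, interior_Ioo, interior_Ioc]
  exact (nonempty_Ioo.2 hR).prod (nonempty_Ioo.2 zero_lt_one)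

theorem sm_fhat_side (hR : 0 < R) (hg : Smooth3 (Ioo 0 R ×ˢ Ioc 0 1) g) :
    Sm (Ioo 0 R ×ˢ Ioc 0 1) (fhat g) :=
  sm_fhat ((convex_Ioo 0 R).prod (convex_Ioc 0 1)) (interior_Ioo_prod_Ioc hR) hg

/-- The change of coordinates `x = ℓ / τ`, `y = τ`. -/
def toCorner (g : ℝ → ℝ → ℝ → ℂ) : ℝ → ℝ → ℝ → ℂ := fun l t θ => g (l / t) t θ

theorem Smooth3.toCorner {S' : Set (ℝ × ℝ)} (hS : ∀ p ∈ S, 0 < p.2 ∧ (p.1 / p.2, p.2) ∈ S')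
    (hg : Smooth3 S' g) : Smooth3 S (toCorner g) := by
  refine ContDiffOn.comp hg (f := fun q : ℝ × ℝ × ℝ => (q.1 / q.2.1, q.2.1, q.2.2)) ?_
    fun q hq => (hS _ hq).2
  exact (contDiff_fst.contDiffOn.div (contDiff_fst.comp contDiff_snd).contDiffOn
    fun q hq => (hS _ hq).1.ne').prodMk contDiff_snd.contDiffOn

theorem eul1_toCorner {S' : Set (ℝ × ℝ)} (hS' : IsOpen S')
    (hS : ∀ p ∈ S, 0 < p.2 ∧ (p.1 / p.2, p.2) ∈ S') (hg : Smooth3 S' g) :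
    Eq3 S (eul1 (toCorner g)) (toCorner (eul1 g)) := fun l t hp θ => by
  have h1 := hg.hasDerivAt_comp hS' ((hasDerivAt_id l).div_const t) (hasDerivAt_const l t)
    (hasDerivAt_const l θ) (hS _ hp).2
  have h2 : ((1 / t, 0, 0) : ℝ × ℝ × ℝ) = (1 / t) • (1, 0, 0) := by simp
  have h3 := (hg.hasDerivAt_1 hS' (hS _ hp).2 θ).deriv
  simp only [id] at h1
  simp only [eul1, toCorner, h1.deriv, h2, map_smul, h3, Complex.real_smul]
  push_cast
  ring

theorem eul2_toCorner {S' : Set (ℝ × ℝ)} (hS' : IsOpen S')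
    (hS : ∀ p ∈ S, 0 < p.2 ∧ (p.1 / p.2, p.2) ∈ S') (hg : Smooth3 S' g) :
    Eq3 S (fun l t θ => eul1 (toCorner g) l t θ + eul2 (toCorner g) l t θ) (toCorner (eul2 g)) :=
  fun l t hp θ => by
  have ht : t ≠ 0 := (hS _ hp).1.ne'
  have h0 : HasDerivAt (fun x : ℝ => l / x) (-(l / t ^ 2)) t :=
    ((hasDerivAt_const t l).fun_div (hasDerivAt_id t) ht).congr_deriv (by simp [neg_div])
  have h1 := hg.hasDerivAt_comp hS' h0 (hasDerivAt_id t) (hasDerivAt_const t θ) (hS _ hp).2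
  have h2 : ((-(l / t ^ 2), 1, 0) : ℝ × ℝ × ℝ) = (-(l / t ^ 2)) • (1, 0, 0) + (0, 1, 0) := by simp
  have h3 := (hg.hasDerivAt_1 hS' (hS _ hp).2 θ).deriv
  have h4 := (hg.hasDerivAt_2 hS' (hS _ hp).2 θ).deriv
  have h5 : deriv (fun t' => g (l / t') t' θ) t = _ := h1.deriv
  simp only [id] at h5 h3 h4
  have ht' : (t : ℂ) ≠ 0 := by exact_mod_cast ht
  simp only [eul1_toCorner hS' hS hg l t hp θ]
  simp only [eul2, eul1, toCorner, h5, h3, h4]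
  rw [h2, map_add, map_smul, Complex.real_smul]
  push_cast
  field_simp
  ring

theorem eul_iterate_eq (hS : IsOpen S) (hg : Smooth3 S g) (i j : ℕ) :
    Eq3 S (eul2 (eul1^[i] (eul2^[j] g))) (eul1^[i] (eul2^[j + 1] g)) := by
  rw [Function.iterate_succ_apply']
  exact comm_iterate (fun g h e => e.eul1 hS) (fun g hg => hg.eul1 hS)
    (fun g hg => eul2_eul1_comm hS hg) (Smooth3.iterate (fun g hg => hg.eul2 hS) hg j) i

theorem dang_iterate_comm {A : (ℝ → ℝ → ℝ → ℂ) → ℝ → ℝ → ℝ → ℂ}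
    (hA : ∀ g h, Eq3 S g h → Eq3 S (A g) (A h)) (hAs : ∀ g, Smooth3 S g → Smooth3 S (A g))
    (hc : ∀ g, Smooth3 S g → Eq3 S (dang (A g)) (A (dang g))) (hS : IsOpen S) (hg : Smooth3 S g)
    (i n : ℕ) : Eq3 S (dang^[n] (A^[i] g)) (A^[i] (dang^[n] g)) := by
  induction n generalizing g with
  | zero => exact fun _ _ _ _ => rfl
  | succ n ih =>
    intro x y hp θ
    rw [Function.iterate_succ_apply, Function.iterate_succ_apply, ← ih (hg.dang hS) x y hp θ]
    exact Eq3.iterate (fun g h e => e.dang) (comm_iterate hA hAs hc hg i) n x y hp θ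

/-- `bDeriv` differentiates in θ first, whereas bounds on Fourier coefficients of Euler derivatives
need the θ-derivatives last; the three commuting fields reconcile the two. -/
theorem iteratedDeriv_eul (hS : IsOpen S) (hg : Smooth3 S g) (i j n : ℕ) {x y : ℝ}
    (hp : (x, y) ∈ S) (θ : ℝ) :
    iteratedDeriv n (eul1^[i] (eul2^[j] g) x y) θ = bDeriv i j n g x y θ := by
  rw [bDeriv_eq, ← dang_iterate, dang_iterate_comm (fun g h e => e.eul1 hS)
    (fun g hg => hg.eul1 hS) (fun g hg => dang_eul1_comm hS hg) hS
    (Smooth3.iterate (fun g hg => hg.eul2 hS) hg j) i n x y hp θ]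
  exact Eq3.iterate (fun g h e => e.eul1 hS) (dang_iterate_comm (fun g h e => e.eul2 hS)
    (fun g hg => hg.eul2 hS) (fun g hg => dang_eul2_comm hS hg) hS hg j n) i x y hp θ

theorem smooth3_phgTerm {A : ℝ → ℝ → ℝ → ℂ} (hA : Smooth3 S A) {φ : ℝ × ℝ → ℝ}
    (hφ : ContDiffOn ℝ (⊤ : ℕ∞) φ S) (hpos : ∀ p ∈ S, 0 < φ p) (e : ℂ × ℕ) :
    Smooth3 S fun l t θ => A l t θ * phgTerm e (φ (l, t)) :=
  ContDiffOn.mul hA ((contDiffOn_phgTerm e).comp (hφ.comp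
    (f := fun q : ℝ × ℝ × ℝ => (q.1, q.2.1)) (by fun_prop) fun q hq => hq) fun q hq => hpos _ hq)

theorem Smooth3.sum {ι : Type*} (T : Finset ι) {F : ι → ℝ → ℝ → ℝ → ℂ}
    (h : ∀ i ∈ T, Smooth3 S (F i)) : Smooth3 S fun l t θ => ∑ i ∈ T, F i l t θ :=
  ContDiffOn.sum h

/-- For τ bounded below, the expansion in x = ℓ/τ is an expansion in ℓ: (ℓ/τ)^z (log ℓ/τ)^p is
expanded by the binomial formula, and the powers and logarithms of τ⁻¹ go into smooth coefficients.
The loss y^(-m) at the front face is then only a constant. -/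
theorem phg_source (hℓ₀ : 0 < ℓ₀) (hu : Smooth3 (Ioo 0 ℓ₀ ×ˢ Icc (-1) 1) u)
    (hcorner : HasCornerExpansion E E' fun x y θ => u (x * y) y θ) (hc0 : 0 < c) (hc1 : c < 1) :
    Phg ℓ₀ E (tfun (cut (c / 2) c) * fhat u) := by
  obtain ⟨a, _, m, ha, _, hrem, _⟩ := hcorner
  have hu' : Smooth3 (Ioo 0 ℓ₀ ×ˢ Ioc 0 1) u := hu.mono
    (prod_mono_right fun t ht => ⟨by linarith [ht.1], ht.2⟩)
  set b := c / 4 with hb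
  have hb0 : 0 < b := by positivity
  have hb1 : b < 1 := by linarith
  have ha3 : ∀ (I : Set ℝ), ∀ e ∈ E.carrier, Smooth3 (I ×ˢ Ioc 0 1) fun _ t θ => a e t θ :=
    fun I e he => (ha e he).1.comp (f := fun q : ℝ × ℝ × ℝ => q.2) (by fun_prop)
      fun q hq => ⟨hq.2, mem_univ _⟩
  -- The nested thresholds c/8 < b = c/4 < c/2 < c leave room for this cutoff to be 1 on τ ≥ b,
  -- where all estimates take place, and for the outer cutoff to vanish for τ ≤ c/2.
  set φ : ℂ × ℕ → ℝ → ℂ := fun e t => cut (c / 8) b t * phgTerm e t⁻¹ with hφ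
  have hφd : ∀ e, ContDiff ℝ (⊤ : ℕ∞) (φ e) := fun e =>
    contDiff_cut_mul (by positivity) (by linarith) ((contDiffOn_phgTerm e).comp
      (contDiffOn_inv ℝ |>.mono fun t ht => ne_of_gt ht) fun t ht => mem_Ioi.2 (inv_pos.2 ht))
  set v := shiftCoef E (fun e => tfun (φ e)) (fun e => fhat fun _ t θ => a e t θ) with hv
  refine phg_of_side (b := b) (v := v) hb0 (by linarith) (contDiff_cut _ _)
    (fun t ht => cut_eq_zero (by linarith) ht) (sm_fhat_side hℓ₀ hu') (fun a q ha haq hq => ?_)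
    (fun e he => ⟨?_, ?_⟩) fun N => ?_
  · exact (clR_fhat_box isOpen_Ioo.uniqueDiffOn hu' ha.le haq
      (fun l hl => ⟨ha.trans_le hl.1, hl.2.trans_lt hq⟩) hb0 hb1).of_zero (isDom_box ha.le)
  · exact sm_shiftCoef (fun e k => ((hφd e).comp contDiff_snd).contDiffOn)
      (fun e he => sm_fhat_side zero_lt_one (ha3 _ e he)) e
  · exact clR_shiftCoef (isDom_box le_rfl) (fun e => clM_tfun (isDom_box le_rfl) (hφd e))
      (fun e he => clR_fhat_box uniqueDiffOn_univ (ha3 _ e he) le_rfl zero_lt_one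
        (subset_univ _) hb0 hb1) e
  set ρ : ℝ → ℝ → ℝ → ℂ := fun x y θ => u (x * y) y θ - ∑ e ∈ E.upTo N, a e y θ * phgTerm e x
    with hρ
  set δ₀ := min ℓ₀ 1 with hδ₀
  have hδ0 : 0 < δ₀ := lt_min hℓ₀ zero_lt_one
  have hδℓ : δ₀ ≤ ℓ₀ := min_le_left _ _
  set S' : Set (ℝ × ℝ) := Ioo 0 δ₀ ×ˢ Ioo 0 1 with hS'
  -- For τ > b and ℓ < δ₀ b the corner coordinate ℓ/τ stays below δ₀.
  set δ := δ₀ * b with hδ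
  have hδp : 0 < δ := by positivity
  have hδℓ' : δ < ℓ₀ := by nlinarith
  have ho' : IsOpen S' := isOpen_Ioo.prod isOpen_Ioo
  have hρs : Smooth3 S' ρ := by
    refine Smooth3.sub ?_ (Smooth3.sum _ fun e he => smooth3_phgTerm (φ := Prod.fst)
      ((ha3 _ e (IndexSet.mem_upTo.1 he).1).mono (prod_mono_right Ioo_subset_Ioc_self))
      contDiffOn_fst (fun p hp => hp.1.1) e)
    refine ContDiffOn.comp hu' (f := fun q : ℝ × ℝ × ℝ => (q.1 * q.2.1, q.2.1, q.2.2))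
      (by fun_prop) fun q hq => ⟨⟨mul_pos hq.1.1 hq.2.1, ?_⟩, hq.2.1, hq.2.2.le⟩
    exact (mul_lt_of_lt_one_right hq.1.1 hq.2.2).trans (hq.1.2.trans_le hδℓ)
  have hmap : ∀ p ∈ Ioo 0 δ ×ˢ Ioo b 1, 0 < p.2 ∧ (p.1 / p.2, p.2) ∈ S' := fun p hp => by
    have hp2 : 0 < p.2 := hb0.trans hp.2.1
    refine ⟨hp2, ⟨div_pos hp.1.1 hp2, (div_lt_iff₀ hp2).2 ?_⟩, hp2, hp.2.2⟩
    exact hp.1.2.trans (mul_lt_mul_of_pos_left hp.2.1 hδ0)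
  have hs1 := fun g => Smooth3.eul1 (g := g) ho'
  have hs2 := fun g => Smooth3.eul2 (g := g) ho'
  have hij : ∀ i j, Smooth3 S' (eul1^[i] (eul2^[j] ρ)) := fun i j =>
    Smooth3.iterate hs1 (Smooth3.iterate hs2 hρs j) i
  have hG : Smooth3 (Ioo 0 ℓ₀ ×ˢ Ioc 0 1) (toCorner ρ) := by
    have h1 : Smooth3 (Ioo 0 ℓ₀ ×ˢ Ioc 0 1) fun l t θ =>
        u l t θ - ∑ e ∈ E.upTo N, a e t θ * phgTerm e (l / t) :=
      Smooth3.sub hu' (Smooth3.sum _ fun e he => smooth3_phgTerm (φ := fun p => p.1 / p.2)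
        (ha3 _ e (IndexSet.mem_upTo.1 he).1)
        (contDiffOn_fst.div contDiffOn_snd fun p hp => hp.2.1.ne')
        (fun p hp => div_pos hp.1.1 hp.2.1) e)
    refine h1.congr fun l t hp θ => ?_
    simp only [toCorner, hρ, div_mul_cancel₀ l hp.2.1.ne']
  have key := clR_fhat_of_remainder (N := N) hb0 hb1 hδp rfl
    (G := fun i j => toCorner (eul1^[i] (eul2^[j] ρ))) (fun i j => (hij i j).toCorner hmap)
    (fun i j l t hp θ => ?_) (fun i j l t hp θ => ?_) (fun i j n => ?_) fun a ha haδ =>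
      (clR_fhat_box isOpen_Ioo.uniqueDiffOn hG ha.le haδ
        (fun l hl => ⟨ha.trans_le hl.1, hl.2.trans_lt hδℓ'⟩) hb0 hb1).of_zero (isDom_box ha.le)
  · refine ⟨δ, hδp, key.congr (isDom_box le_rfl) fun k l t hp => ?_⟩
    have ht : 0 < t := hb0.trans hp.2.1
    have hp' : (l, t) ∈ Ioo 0 ℓ₀ ×ˢ Ioc (0 : ℝ) 1 :=
      ⟨⟨hp.1.1, hp.1.2.trans hδℓ'⟩, ht, hp.2.2.le⟩
    have hterm : ∀ e ∈ E.upTo N, Smooth3 (Ioo 0 ℓ₀ ×ˢ Ioc 0 1) fun l t θ =>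
        phgTerm e (l / t) * a e t θ := fun e he => by
      refine (smooth3_phgTerm (φ := fun p => p.1 / p.2) (ha3 _ e (IndexSet.mem_upTo.1 he).1)
        (contDiffOn_fst.div contDiffOn_snd fun p hp => hp.2.1.ne')
        (fun p hp => div_pos hp.1.1 hp.2.1) e).congr fun l t _ θ => mul_comm _ _
    have e1 : Eq3 (Ioo 0 ℓ₀ ×ˢ Ioc 0 1) (toCorner ρ) fun l t θ =>
        u l t θ - ∑ e ∈ E.upTo N, phgTerm e (l / t) * a e t θ := fun l t hp θ => by
      simp only [toCorner, hρ, div_mul_cancel₀ l hp.2.1.ne', mul_comm]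
    simp only [Function.iterate_zero, id]
    rw [fhat_congr e1 k l t hp', fhat_sub hu' (Smooth3.sum _ hterm) k l t hp', Pi.sub_apply,
      Pi.sub_apply, Pi.sub_apply, fhat_sum _ hterm k l t hp']
    simp only [Pi.sub_apply, Finset.sum_apply, Pi.mul_apply, hv, shiftCoef_apply, lterm, lfun]
    congr 1
    rw [← sum_shiftCoef (φ := fun e => phgTerm e (l / t))]
    · exact Finset.sum_congr rfl fun e _ =>
        (fhat_const_mul (fun l t => phgTerm e (l / t)) (fun _ t θ => a e t θ) k l t).trans
          (mul_comm _ _)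
    · intro e
      simp only [tfun, hφ, cut_eq_one (show c / 8 < b by linarith) hp.2.1.le, one_mul]
      rw [div_eq_mul_inv]
      exact phgTerm_mul e hp.1.1 (inv_pos.2 ht)
  · simp only [Function.iterate_succ_apply']
    exact eul1_toCorner ho' hmap (hij i j) l t hp θ
  · rw [eul2_toCorner ho' hmap (hij i j) l t hp θ]
    exact eul_iterate_eq ho' hρs i j _ _ (hmap _ hp).2 θ
  · obtain ⟨C, ε, hε, h⟩ := hrem N i j n
    refine ⟨|C| / b ^ N / b ^ m, ε * b, by positivity, fun l t hp hl θ _ => ?_⟩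
    have ht : 0 < t := hb0.trans hp.2.1
    have hl0 : 0 < l := hp.1.1
    have h1 := h (l / t) ⟨div_pos hl0 ht, (div_lt_iff₀ ht).2
      (hl.trans (mul_lt_mul_of_pos_left hp.2.1 hε))⟩ t ⟨ht, hp.2.2⟩ θ
    have e : iteratedDeriv n (toCorner (eul1^[i] (eul2^[j] ρ)) l t) θ
        = bDeriv i j n ρ (l / t) t θ := iteratedDeriv_eul ho' hρs i j n (hmap _ hp).2 θ
    rw [e]
    refine h1.trans ?_
    have hbt : b ≤ t := hp.2.1.le
    calc C * (l / t) ^ N / t ^ m ≤ |C| * (l / b) ^ N / b ^ m := by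
          gcongr
          exact le_abs_self C
      _ = _ := by rw [div_pow]; ring

/-! ### Fourier coefficients of polyhomogeneous boundary data -/

/-- A boundary value is treated as a source independent of τ. As ∂_τ annihilates it, the fields ℓ
∂_ℓ and ℓ ∂_ℓ + τ ∂_τ coincide on it, and the double index (i, j) collapses to i + j. -/
theorem phg_boundary (hℓ₀ : 0 < ℓ₀) (hη : IsPhgBoundary ℓ₀ E η) :
    Phg ℓ₀ E (tfun (cut (1 / 2) (3 / 4)) * fhat fun l _ θ => η l θ) := by
  obtain ⟨_, hsm, a, ha, hrem⟩ := hη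
  have hη3 : ∀ J : Set ℝ, Smooth3 (Ioo 0 ℓ₀ ×ˢ J) fun l _ θ => η l θ := fun J =>
    hsm.comp (f := fun q : ℝ × ℝ × ℝ => (q.1, q.2.2)) (by fun_prop) fun q hq => ⟨hq.1, mem_univ _⟩
  have ha3 : ∀ K : Set (ℝ × ℝ), ∀ e ∈ E.carrier, Smooth3 K fun _ _ θ => a e θ := fun K e he =>
    (contDiff_angle (ha e he)).contDiffOn
  have hb0 : (0 : ℝ) < 1 / 4 := by norm_num
  have hb1 : (1 / 4 : ℝ) < 1 := by norm_num
  refine phg_of_side (b := 1 / 4) (v := fun e => fhat fun _ _ θ => a e θ) hb0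
    (by norm_num) (contDiff_cut _ _) (fun t ht => cut_eq_zero (by norm_num) ht)
    (sm_fhat_side hℓ₀ (hη3 _)) (fun a q ha haq hq => ?_) (fun e he => ⟨?_, ?_⟩) fun N => ?_
  · exact (clR_fhat_box isOpen_Ioo.uniqueDiffOn (hη3 _) ha.le haq
      (fun l hl => ⟨ha.trans_le hl.1, hl.2.trans_lt hq⟩) hb0 hb1).of_zero (isDom_box ha.le)
  · exact sm_fhat_side zero_lt_one (ha3 _ e he)
  · exact clR_fhat_box uniqueDiffOn_univ (ha3 _ e he) le_rfl zero_lt_one (subset_univ _) hb0 hb1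
  set ρ : ℝ → ℝ → ℝ → ℂ := fun l _ θ => η l θ - ∑ e ∈ E.upTo N, a e θ * phgTerm e l with hρ
  have hδ : 0 < ℓ₀ / 2 := by positivity
  have hterm : ∀ e ∈ E.upTo N, Smooth3 (Ioo 0 ℓ₀ ×ˢ Ioc 0 1) fun l _ θ => phgTerm e l * a e θ :=
    fun e he => (smooth3_phgTerm (φ := Prod.fst) (ha3 _ e (IndexSet.mem_upTo.1 he).1)
      contDiffOn_fst (fun p hp => hp.1.1) e).congr fun l t _ θ => mul_comm _ _
  have e1 : Eq3 (Ioo 0 ℓ₀ ×ˢ Ioc 0 1) (fun l _ θ => η l θ - ∑ e ∈ E.upTo N, phgTerm e l * a e θ) ρ :=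
    fun l t hp θ => by simp only [hρ, mul_comm]
  have hρs : Smooth3 (Ioo 0 ℓ₀ ×ˢ Ioc 0 1) ρ :=
    (Smooth3.sub (hη3 _) (Smooth3.sum _ hterm)).congr e1
  have hsub : Ioo 0 (ℓ₀ / 2) ×ˢ Ioo (1 / 4) 1 ⊆ Ioo 0 ℓ₀ ×ˢ Ioc (0 : ℝ) 1 :=
    prod_mono (Ioo_subset_Ioo_right (by linarith)) fun t ht => ⟨by linarith [ht.1], ht.2.le⟩
  have ho : IsOpen (Ioo 0 (ℓ₀ / 2) ×ˢ Ioo (1 / 4 : ℝ) 1) := isOpen_Ioo.prod isOpen_Ioo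
  have key := clR_fhat_of_remainder (N := N) hb0 hb1 hδ rfl (G := fun i j => eul1^[i + j] ρ)
    (fun i j => Smooth3.iterate (fun g hg => hg.eul1 ho) (hρs.mono hsub) (i + j))
    (fun i j l t hp θ => ?_) (fun i j l t hp θ => ?_) (fun i j n => ?_) fun a ha haδ =>
      (clR_fhat_box isOpen_Ioo.uniqueDiffOn hρs ha.le haδ
        (fun l hl => ⟨ha.trans_le hl.1, by linarith [hl.2]⟩) hb0 hb1).of_zero (isDom_box ha.le)
  · refine ⟨ℓ₀ / 2, hδ, key.congr (isDom_box le_rfl) fun k l t hp => ?_⟩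
    simp only [add_zero, Function.iterate_zero, id]
    rw [← fhat_congr e1 k l t (hsub hp), fhat_sub (hη3 _) (Smooth3.sum _ hterm) k l t (hsub hp),
      Pi.sub_apply, Pi.sub_apply, Pi.sub_apply, fhat_sum _ hterm k l t (hsub hp)]
    simp only [Pi.sub_apply, Finset.sum_apply, Pi.mul_apply, lterm, lfun]
    congr 1
    exact Finset.sum_congr rfl fun e _ =>
      (fhat_const_mul (fun l _ => phgTerm e l) (fun _ _ θ => a e θ) k l t).trans (mul_comm _ _)
  · rw [Nat.add_right_comm, Function.iterate_succ_apply']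
  · have h0 : eul2 (eul1^[i + j] ρ) l t θ = 0 := by
      have : (fun t' => (eul1^[i + j] ρ) l t' θ) = fun _ => (eul1^[i + j] ρ) l 0 θ := by
        ext t'
        rw [eul1_iterate, eul1_iterate]
      rw [eul2, this, deriv_const, mul_zero]
    simp only [h0, add_zero]
    rw [← add_assoc, Function.iterate_succ_apply']
  · obtain ⟨C, ε, hε, h⟩ := hrem N (i + j) n _ (isCompact_Icc (a := (-1 : ℝ)) (b := 2 * Real.pi + 2))
    refine ⟨C, ε, hε, fun l t hp hl θ hθ => ?_⟩
    refine le_trans (le_of_eq ?_) (h l ⟨hp.1.1, hl⟩ θ hθ)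
    rw [norm_iteratedFDeriv_eq_norm_iteratedDeriv]
    congr 2
    ext θ'
    rw [eul1_iterate]

end

end HypCyl

end

noncomputable section

namespace HypCyl
open Set Filter Topology

section

variable {S S' : Set (ℝ × ℝ)} {ℓ₀ c : ℝ} {f : Fam} {σ : ℕ} {s : ℤ} {E E' : IndexSet}
  {u : ℝ → ℝ → ℝ → ℂ} {I : IndexFamily}

/-! ### Sources on both sides -/

theorem ClR.reflect (hS : IsDom S) (hm : ∀ l t, (l, t) ∈ S' → (l, -t) ∈ S)
    (hf : ClR S σ s f) : ClR S' σ s (reflect f) := by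
  refine Cl.of_closed (Q := fun g => ∃ f, ClR S σ s f ∧ g = HypCyl.reflect f) ?_ ?_ ?_ ?_
    ⟨f, hf, rfl⟩
  · rintro _ ⟨f, hf, rfl⟩ k
    exact (hf.1 k).comp (f := fun p : ℝ × ℝ => (p.1, -p.2)) (by fun_prop) fun p hp => hm _ _ hp
  · rintro _ ⟨f, hf, rfl⟩ m
    obtain ⟨C, hC⟩ := hf.base m
    exact ⟨C, fun k l t hp => by simpa [HypCyl.reflect] using hC k l (-t) (hm l t hp)⟩
  · rintro _ ⟨f, hf, rfl⟩
    exact ⟨_, ClR.neg hS (Cl.pt hS.isOpen isAdditivePred_rap hf), pt_reflect f⟩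
  · rintro _ ⟨f, hf, rfl⟩
    exact ⟨_, Cl.pl hS.isOpen hf, rfl⟩

/-- A family supported in `τ > 0` has the trivial expansion for `τ < 0`. -/
theorem Phg.reflect_of_side (hℓ₀ : 0 < ℓ₀) (hf : Phg ℓ₀ E f)
    (h0 : ∀ k, ∀ l, ∀ t ≤ 0, f k l t = 0) : Phg ℓ₀ E' (reflect f) := by
  obtain ⟨s, hs⟩ := hf.bdd
  refine ⟨hf.sm.reflect, ⟨s, fun q hq => (hs q hq).reflect isDom_strip fun l t hp =>
    ⟨hp.1, by linarith [hp.2.2], by linarith [hp.2.1]⟩⟩, 0, fun e _ => ⟨Sm.zero, clR_zero⟩,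
    fun N => ⟨ℓ₀, hℓ₀, clR_zero.congr isDom_half fun k l t hp => ?_⟩⟩
  simp [reflect, h0 k l (-t) (by linarith [hp.2.1])]

/-- Because u vanishes for |τ| ≤ c, its transform is the sum of two pieces supported in τ > 0 and τ
< 0. Each has an expansion on its own side and is zero on the other; the expansion at the front face
is never used. -/
theorem phg_fhat (hℓ₀ : 0 < ℓ₀) (hc0 : 0 < c) (hc1 : c < 1) (hu : IsPhgOnBlowup ℓ₀ I u)
    (hvan : ∀ l ∈ Ioo 0 ℓ₀, ∀ t, |t| ≤ c → ∀ θ, u l t θ = 0) :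
    Phg ℓ₀ I.plus (fhat u) ∧ Phg ℓ₀ I.minus (reflect (fhat u)) := by
  obtain ⟨-, hsm, -, hp, hm⟩ := hu
  have h1 : Smooth3 (Ioo 0 ℓ₀ ×ˢ Icc (-1) 1) u := hsm.mono fun q hq => ⟨hq.1, hq.2, mem_univ _⟩
  have h2 : Smooth3 (Ioo 0 ℓ₀ ×ˢ Icc (-1) 1) fun l t θ => u l (-t) θ :=
    ContDiffOn.comp h1 (f := fun q : ℝ × ℝ × ℝ => (q.1, -q.2.1, q.2.2)) (by fun_prop)
      fun q hq => ⟨hq.1, by linarith [hq.2.2], by linarith [hq.2.1]⟩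
  have hA := phg_source hℓ₀ h1 hp hc0 hc1
  have hB := phg_source hℓ₀ h2 hm hc0 hc1
  set A := tfun (cut (c / 2) c) * fhat u with hAd
  set B := tfun (cut (c / 2) c) * fhat fun l t θ => u l (-t) θ with hBd
  have hz : ∀ g : Fam, ∀ k l, ∀ t ≤ 0, (tfun (cut (c / 2) c) * g) k l t = 0 := fun g k l t ht => by
    simp [tfun, cut_eq_zero (show c / 2 < c by linarith) (show t ≤ c / 2 by linarith)]
  have hA' := hA.reflect_of_side (E' := I.minus) hℓ₀ (hz _)
  have hB' := hB.reflect_of_side (E' := I.plus) hℓ₀ (hz _)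
  have key : ∀ k, ∀ l ∈ Ioo 0 ℓ₀, ∀ t, A k l t + B k l (-t) = fhat u k l t := fun k l hl t => by
    have e2 : fhat (fun l t θ => u l (-t) θ) k l (-t) = fhat u k l t := by simp [fhat]
    simp only [hAd, hBd, Pi.mul_apply, tfun, e2]
    rcases le_or_gt |t| c with h | h
    · have : fhat u k l t = 0 := by simp [fhat, fcoef, hvan l hl t h]
      simp [this]
    · rcases lt_abs.1 h with h | h
      · rw [cut_eq_one (by linarith) h.le, cut_eq_zero (by linarith) (by linarith)]; ring
      · rw [cut_eq_one (by linarith) h.le, cut_eq_zero (by linarith) (by linarith)]; ring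
  refine ⟨(hA.add hB').congr (fun k l hl t _ => key k l hl t) hℓ₀,
    (hA'.add hB).congr (fun k l hl t _ => ?_) hℓ₀⟩
  have := key k l hl (-t)
  rw [neg_neg] at this
  exact this

end

/-! ### Fourier series of smooth periodic functions -/

/-- With G periodic and F the smooth transition times G, the windowed integrand is F(θ) - F(θ - 2π).
The integral telescopes to one over [2, 2π + 2], where F = G, that is, over a full period. -/
theorem fcoef_win {g : ℝ → ℂ} (hg : Continuous g) (hp : ∀ θ, g (θ + 2 * Real.pi) = g θ) (k : ℤ) :
    fcoef k (fun θ => win θ * g θ) = fourierMode k g := by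
  have hpi := Real.pi_gt_three
  set G : ℝ → ℂ := fun θ => Complex.exp (-Complex.I * k * θ) * g θ with hG
  have hGc : Continuous G := (contDiff_exp_neg_mode k).continuous.mul hg
  have hGp : Function.Periodic G (2 * Real.pi) := fun θ => by
    simp only [hG, hp]
    congr 1
    have : -Complex.I * k * ((θ + 2 * Real.pi : ℝ) : ℂ)
        = -Complex.I * k * θ + (-k : ℤ) * (2 * Real.pi * Complex.I) := by push_cast; ring
    rw [this, Complex.exp_add, Complex.exp_int_mul_two_pi_mul_I, mul_one]
  set F : ℝ → ℂ := fun θ => (Real.smoothTransition θ : ℂ) * G θ with hF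
  have hFc : Continuous F := (Complex.continuous_ofReal.comp
    Real.smoothTransition.continuous).mul hGc
  have hi : ∀ a b, IntervalIntegrable F MeasureTheory.volume a b := fun a b =>
    hFc.intervalIntegrable a b
  have hF2 : Continuous fun θ => F (θ - 2 * Real.pi) := hFc.comp (continuous_id.sub continuous_const)
  have e1 : ∫ θ in (-1 : ℝ)..(2 * Real.pi + 2), Complex.exp (-Complex.I * k * θ) * (win θ * g θ)
      = (∫ θ in (-1 : ℝ)..(2 * Real.pi + 2), F θ)
        - ∫ θ in (-1 : ℝ)..(2 * Real.pi + 2), F (θ - 2 * Real.pi) := by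
    rw [← intervalIntegral.integral_sub (hi _ _) (hF2.intervalIntegrable _ _)]
    refine intervalIntegral.integral_congr fun θ _ => ?_
    have := hGp.sub_eq θ
    simp only [hF, this]
    simp only [hG, win]
    push_cast
    ring
  have e2 : ∫ θ in (-1 : ℝ)..(2 * Real.pi + 2), F (θ - 2 * Real.pi)
      = ∫ θ in (-1 - 2 * Real.pi)..(2 : ℝ), F θ := by
    rw [intervalIntegral.integral_comp_sub_right F]
    congr 1
    ring
  have e3 : ∫ θ in (-1 - 2 * Real.pi)..(-1 : ℝ), F θ = 0 := by
    rw [intervalIntegral.integral_congr (g := fun _ => 0), intervalIntegral.integral_zero]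
    intro θ hθ
    rw [uIcc_of_le (by linarith)] at hθ
    simp only [hF]
    rw [Real.smoothTransition.zero_of_nonpos (by linarith [hθ.2])]
    simp
  have e4 : ∫ θ in (2 : ℝ)..(2 * Real.pi + 2), F θ = ∫ θ in (2 : ℝ)..(2 * Real.pi + 2), G θ := by
    refine intervalIntegral.integral_congr fun θ hθ => ?_
    rw [uIcc_of_le (by linarith)] at hθ
    simp only [hF]
    rw [Real.smoothTransition.one_of_one_le (by linarith [hθ.1])]
    simp
  have e5 : ∫ θ in (2 : ℝ)..(2 * Real.pi + 2), G θ = ∫ θ in (0 : ℝ)..(2 * Real.pi), G θ := by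
    have := hGp.intervalIntegral_add_eq 2 0
    rwa [zero_add, add_comm (2 : ℝ)] at this
  rw [fcoef, fourierMode, e1, e2, ← e5, ← e4,
    ← intervalIntegral.integral_add_adjacent_intervals (hi (-1 - 2 * Real.pi) (-1)) (hi (-1) 2), e3,
    ← intervalIntegral.integral_add_adjacent_intervals (hi (-1) 2) (hi 2 _)]
  ring

/-- Two derivatives in θ make the coefficients summable, so the Fourier series converges pointwise
to g; the vanishing mean allows the sum to run over the nonzero modes only. -/
theorem hasSum_fourier {g : ℝ → ℂ} (hg : ContDiff ℝ (⊤ : ℕ∞) g)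
    (hp : ∀ θ, g (θ + 2 * Real.pi) = g θ) (h0 : fourierMode 0 g = 0) (θ : ℝ) :
    HasSum (fun k : Mode => fcoef k (fun θ => win θ * g θ) * Complex.exp (Complex.I * (k : ℤ) * θ))
      (g θ) := by
  have : Fact (0 < 2 * Real.pi) := ⟨Real.two_pi_pos⟩
  have hper : Function.Periodic g (2 * Real.pi) := hp
  set f : C(AddCircle (2 * Real.pi), ℂ) := ⟨hper.lift, continuous_coinduced_dom.2 hg.continuous⟩ with hf
  have hco : ∀ n : ℤ, fourierCoeff f n = fourierMode n g := fun n => by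
    rw [fourierCoeff_eq_intervalIntegral f n 0, fourierMode, zero_add, Complex.real_smul]
    push_cast
    congr 1
    refine intervalIntegral.integral_congr fun x _ => ?_
    simp only [fourier_coe_apply, smul_eq_mul]
    have e1 : f (x : AddCircle (2 * Real.pi)) = g x := rfl
    rw [e1]
    congr 2
    have := Real.pi_ne_zero
    push_cast
    field_simp
  have hmode : ∀ n : ℤ, fcoef n (fun θ => win θ * g θ) = fourierMode n g := fcoef_win hg.continuous hp
  have hgw : ContDiff ℝ (⊤ : ℕ∞) fun θ => (win θ : ℂ) * g θ := contDiff_win.mul hg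
  obtain ⟨C, hC⟩ := (isCompact_Icc (a := (-1 : ℝ)) (b := 2 * Real.pi + 2)).exists_bound_of_continuousOn
    ((contDiff_infty.1 hgw 2).continuous_iteratedDeriv 2 le_rfl).continuousOn
  have hbd := norm_fcoef_le hgw
    (fun θ hθ => by rw [win_eq_zero (hθ.imp le_of_lt le_of_lt)]; simp) 2 hC
  have hsum : Summable (fourierCoeff f) := by
    have h2 : Summable fun k : ℤ => 3 * C * (1 / (k : ℝ) ^ 2) :=
      (Real.summable_one_div_int_pow.2 one_lt_two).mul_left _
    refine Summable.of_norm_bounded h2 fun k => ?_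
    rw [hco]
    rcases eq_or_ne k 0 with rfl | hk
    · rw [h0]; simp
    · have h3 := hbd k
      rw [hmode, sq_abs] at h3
      have h4 : (0 : ℝ) < (k : ℝ) ^ 2 := by positivity
      rw [mul_one_div, le_div_iff₀ h4]
      linarith
  have h := has_pointwise_sum_fourier_series_of_summable hsum (θ : AddCircle (2 * Real.pi))
  have e1 : f (θ : AddCircle (2 * Real.pi)) = g θ := rfl
  rw [e1] at h
  have h5 : ∀ n : ℤ, fourierCoeff f n • fourier n (θ : AddCircle (2 * Real.pi))
      = fourierMode n g * Complex.exp (Complex.I * n * θ) := fun n => by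
    rw [hco, fourier_coe_apply, smul_eq_mul]
    congr 2
    have := Real.pi_ne_zero
    push_cast
    field_simp
  simp only [h5] at h
  have h6 : Function.support (fun n : ℤ => fourierMode n g * Complex.exp (Complex.I * n * θ))
      ⊆ {n : ℤ | n ≠ 0} := fun n hn => by
    rintro rfl
    simp [h0] at hn
  have h7 := (hasSum_subtype_iff_of_support_subset h6).2 h
  simp only [hmode]
  exact h7

end HypCyl

end

/-! ### Geometry of the cylinder: reduction of P to scalar operators, and uniqueness -/

noncomputable section

namespace HypCyl
open Set Filter Topology

/-! ### The geometry of the hyperbolic cylinders -/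

section

variable {ℓ : ℝ}

/-- `τ² + ℓ²` as a function on the chart. -/
def rad (ℓ : ℝ) (q : Pt) : ℝ := q 0 ^ 2 + ℓ ^ 2

theorem rad_pos (hl : 0 < ℓ) (q : Pt) : 0 < rad ℓ q := by unfold rad; positivity

theorem cylMetric_inv (hl : 0 < ℓ) (q : Pt) : (cylMetric ℓ q)⁻¹ = !![rad ℓ q, 0; 0, 1 / rad ℓ q] := by
  refine Matrix.inv_eq_right_inv ?_
  have h := (rad_pos hl q).ne'
  ext i j
  fin_cases i <;> fin_cases j <;> simp [cylMetric, Matrix.mul_apply, Fin.sum_univ_two] <;>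
    (unfold rad at h ⊢; field_simp)

theorem hasFDerivAt_proj (i : Fin 2) (q : Pt) :
    HasFDerivAt (fun q : Pt => q i) (ContinuousLinearMap.proj (R := ℝ) (φ := fun _ : Fin 2 => ℝ) i) q :=
  (ContinuousLinearMap.proj (R := ℝ) (φ := fun _ : Fin 2 => ℝ) i).hasFDerivAt

theorem pd_of_hasDerivAt {V : Type} [NormedAddCommGroup V] [NormedSpace ℝ V] {φ : ℝ → V} {φ' : V}
    {q : Pt} (h : HasDerivAt φ φ' (q 0)) (i : Fin 2) :
    pd i (fun q => φ (q 0)) q = (Pi.single i 1 : Pt) 0 • φ' := by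
  have := (h.hasFDerivAt.comp q (hasFDerivAt_proj 0 q)).fderiv
  have e : (φ ∘ fun q : Pt => q 0) = fun q => φ (q 0) := rfl
  rw [e] at this
  rw [pd, this]
  simp

theorem pd_const {V : Type} [NormedAddCommGroup V] [NormedSpace ℝ V] (c : V) (i : Fin 2) (q : Pt) :
    pd i (fun _ => c) q = 0 := by simp [pd]

theorem christoffel_cyl (hl : 0 < ℓ) (k i j : Fin 2) (q : Pt) : christoffel (cylMetric ℓ) k i j q =
    (![!![-q 0 / rad ℓ q, 0; 0, -(q 0 * rad ℓ q)], !![0, q 0 / rad ℓ q; q 0 / rad ℓ q, 0]] k) i j := by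
  have h := (rad_pos hl q).ne'
  have h' : q 0 ^ 2 + ℓ ^ 2 ≠ 0 := h
  have e0 : HasDerivAt (fun t : ℝ => t ^ 2 + ℓ ^ 2) (2 * q 0) (q 0) := by
    simpa using (hasDerivAt_pow 2 (q 0)).add_const (ℓ ^ 2)
  have e1 : HasDerivAt (fun t : ℝ => 1 / (t ^ 2 + ℓ ^ 2)) (-(2 * q 0) / (q 0 ^ 2 + ℓ ^ 2) ^ 2) (q 0) := by
    simpa using e0.fun_inv h'
  have d0 := fun i => pd_of_hasDerivAt e0 (q := q) i
  have d1 := fun i => pd_of_hasDerivAt e1 (q := q) i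
  have hm00 : (fun q => cylMetric ℓ q 0 0) = fun q => 1 / (q 0 ^ 2 + ℓ ^ 2) := rfl
  have hm01 : (fun q => cylMetric ℓ q 0 1) = fun q => 0 := rfl
  have hm10 : (fun q => cylMetric ℓ q 1 0) = fun q => 0 := rfl
  have hm11 : (fun q => cylMetric ℓ q 1 1) = fun q => q 0 ^ 2 + ℓ ^ 2 := rfl
  simp only [christoffel, Fin.sum_univ_two, cylMetric_inv hl]
  fin_cases k <;> fin_cases i <;> fin_cases j <;>
    simp [hm00, hm01, hm10, hm11, -one_div, d0, d1, pd_const] <;>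
    (unfold rad at h ⊢; field_simp)

theorem pd_add {f g : Pt → ℂ} {q : Pt} (hf : DifferentiableAt ℝ f q) (hg : DifferentiableAt ℝ g q)
    (i : Fin 2) : pd i (fun q => f q + g q) q = pd i f q + pd i g q := by
  simp only [pd, fderiv_fun_add hf hg, add_apply]

theorem pd_sub {f g : Pt → ℂ} {q : Pt} (hf : DifferentiableAt ℝ f q) (hg : DifferentiableAt ℝ g q)
    (i : Fin 2) : pd i (fun q => f q - g q) q = pd i f q - pd i g q := by
  simp only [pd, fderiv_fun_sub hf hg, sub_apply]

theorem pd_mul {f g : Pt → ℂ} {q : Pt} (hf : DifferentiableAt ℝ f q) (hg : DifferentiableAt ℝ g q)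
    (i : Fin 2) : pd i (fun q => f q * g q) q = pd i f q * g q + f q * pd i g q := by
  simp only [pd, fderiv_fun_mul hf hg, add_apply, smul_apply,
    smul_eq_mul]
  ring

theorem pd_const_mul {f : Pt → ℂ} {q : Pt} (hf : DifferentiableAt ℝ f q) (c : ℂ) (i : Fin 2) :
    pd i (fun q => c * f q) q = c * pd i f q := by
  rw [pd_mul (differentiableAt_const c) hf, pd_const]; ring

theorem pd_congr {f g : Pt → ℂ} {q : Pt} (h : f =ᶠ[𝓝 q] g) (i : Fin 2) : pd i f q = pd i g q := by
  simp only [pd, h.fderiv_eq]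

theorem pd_differentiableAt {f : Pt → ℂ} {q : Pt} (hf : ContDiffAt ℝ 2 f q) (i : Fin 2) :
    DifferentiableAt ℝ (pd i f) q :=
  ((hf.fderiv_right (m := 1) (by norm_num)).clm_apply contDiffAt_const).differentiableAt (by simp)

theorem pd_comm {f : Pt → ℂ} {q : Pt} (hf : ContDiffAt ℝ 2 f q) (i j : Fin 2) :
    pd i (pd j f) q = pd j (pd i f) q := by
  have h1 : DifferentiableAt ℝ (fderiv ℝ f) q :=
    (hf.fderiv_right (m := 1) (by norm_num)).differentiableAt (by simp)
  have h2 : ∀ i j, pd i (pd j f) q = fderiv ℝ (fderiv ℝ f) q (Pi.single i 1) (Pi.single j 1) :=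
    fun i j => by
    have := (h1.hasFDerivAt.clm_apply (hasFDerivAt_const (Pi.single j 1 : Pt) q)).fderiv
    have e : pd i (pd j f) q = fderiv ℝ (fun q => fderiv ℝ f q (Pi.single j 1)) q (Pi.single i 1) := rfl
    rw [e, this]
    simp
  rw [h2, h2]
  exact (hf.isSymmSndFDerivAt (by simp)).eq _ _

theorem differentiableAt_of_hasDerivAt {φ : ℝ → ℝ} {φ' : ℝ} {q : Pt} (h : HasDerivAt φ φ' (q 0)) :
    DifferentiableAt ℝ (fun q : Pt => ((φ (q 0) : ℝ) : ℂ)) q :=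
  (h.ofReal_comp.hasFDerivAt.comp q (hasFDerivAt_proj 0 q)).differentiableAt

theorem pd_zero_ofReal {φ : ℝ → ℝ} {φ' : ℝ} {q : Pt} (h : HasDerivAt φ φ' (q 0)) :
    pd 0 (fun q : Pt => ((φ (q 0) : ℝ) : ℂ)) q = φ' := by
  rw [pd_of_hasDerivAt h.ofReal_comp]; simp

theorem pd_one_ofReal {φ : ℝ → ℝ} {φ' : ℝ} {q : Pt} (h : HasDerivAt φ φ' (q 0)) :
    pd 1 (fun q : Pt => ((φ (q 0) : ℝ) : ℂ)) q = 0 := by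
  rw [pd_of_hasDerivAt h.ofReal_comp]; simp

theorem hasDerivAt_rad (ℓ t : ℝ) : HasDerivAt (fun t : ℝ => t ^ 2 + ℓ ^ 2) (2 * t) t := by
  simpa using (hasDerivAt_pow 2 t).add_const (ℓ ^ 2)

theorem hasDerivAt_inv_rad (hl : 0 < ℓ) (t : ℝ) :
    HasDerivAt (fun t : ℝ => 1 / (t ^ 2 + ℓ ^ 2)) (-(2 * t) / (t ^ 2 + ℓ ^ 2) ^ 2) t := by
  have h : t ^ 2 + ℓ ^ 2 ≠ 0 := by positivity
  simpa using (hasDerivAt_rad ℓ t).fun_inv h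

theorem hasDerivAt_div_rad (hl : 0 < ℓ) (t : ℝ) : HasDerivAt (fun t : ℝ => t / (t ^ 2 + ℓ ^ 2))
    (1 / (t ^ 2 + ℓ ^ 2) - 2 * t ^ 2 / (t ^ 2 + ℓ ^ 2) ^ 2) t := by
  have h : t ^ 2 + ℓ ^ 2 ≠ 0 := by positivity
  refine ((hasDerivAt_id t).fun_div (hasDerivAt_rad ℓ t) h).congr_deriv ?_
  simp only [id]
  field_simp

theorem hasDerivAt_mul_rad (ℓ t : ℝ) : HasDerivAt (fun t : ℝ => t * (t ^ 2 + ℓ ^ 2))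
    (t ^ 2 + ℓ ^ 2 + 2 * t ^ 2) t :=
  ((hasDerivAt_id t).fun_mul (hasDerivAt_rad ℓ t)).congr_deriv (by simp only [id]; ring)

theorem deltaStar_cyl (hl : 0 < ℓ) (ω : OneForm) (q : Pt) (i j : Fin 2) :
    deltaStar (cylMetric ℓ) ω q i j =
      (!![pd 0 (fun q => ω q 0) q + ((q 0 / rad ℓ q : ℝ) : ℂ) * ω q 0,
          (1 / 2) * (pd 0 (fun q => ω q 1) q + pd 1 (fun q => ω q 0) q)
            - ((q 0 / rad ℓ q : ℝ) : ℂ) * ω q 1;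
          (1 / 2) * (pd 0 (fun q => ω q 1) q + pd 1 (fun q => ω q 0) q)
            - ((q 0 / rad ℓ q : ℝ) : ℂ) * ω q 1,
          pd 1 (fun q => ω q 1) q + ((q 0 * rad ℓ q : ℝ) : ℂ) * ω q 0] :
        Matrix (Fin 2) (Fin 2) ℂ) i j := by
  simp only [deltaStar, covOne, Fin.sum_univ_two, christoffel_cyl hl]
  fin_cases i <;> fin_cases j <;> simp <;> ring

theorem bianchi_cyl (hl : 0 < ℓ) {H : TwoTensor} {q : Pt} (hsym : ∀ q, H q 1 0 = H q 0 1)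
    (hd : ∀ i j, DifferentiableAt ℝ (fun q => H q i j) q) :
    bianchi (cylMetric ℓ) H q 0 = -(1 / 2) * rad ℓ q * pd 0 (fun q => H q 0 0) q
        - 2 * q 0 * H q 0 0 - (1 / rad ℓ q) * pd 1 (fun q => H q 0 1) q
        + (1 / 2) * (1 / rad ℓ q) * pd 0 (fun q => H q 1 1) q ∧
    bianchi (cylMetric ℓ) H q 1 = -rad ℓ q * pd 0 (fun q => H q 0 1) q - 2 * q 0 * H q 0 1
        - (1 / 2) * (1 / rad ℓ q) * pd 1 (fun q => H q 1 1) q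
        + (1 / 2) * rad ℓ q * pd 1 (fun q => H q 0 0) q := by
  have hr : (rad ℓ q : ℂ) ≠ 0 := by exact_mod_cast (rad_pos hl q).ne'
  have ht : trace (cylMetric ℓ) H = fun q => ((rad ℓ q : ℝ) : ℂ) * H q 0 0
      + ((1 / rad ℓ q : ℝ) : ℂ) * H q 1 1 := by
    ext q
    simp [trace, Fin.sum_univ_two, cylMetric_inv hl]
  have d1 := hasDerivAt_rad ℓ (q 0)
  have d2 := hasDerivAt_inv_rad hl (q 0)
  have D1 : DifferentiableAt ℝ (fun q => ((rad ℓ q : ℝ) : ℂ)) q := differentiableAt_of_hasDerivAt d1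
  have D2 : DifferentiableAt ℝ (fun q => ((1 / rad ℓ q : ℝ) : ℂ)) q :=
    differentiableAt_of_hasDerivAt d2
  have e1 : pd 0 (fun q => ((rad ℓ q : ℝ) : ℂ)) q = _ := pd_zero_ofReal d1
  have e2 : pd 1 (fun q => ((rad ℓ q : ℝ) : ℂ)) q = _ := pd_one_ofReal d1
  have e3 : pd 0 (fun q => ((1 / rad ℓ q : ℝ) : ℂ)) q = _ := pd_zero_ofReal d2
  have e4 : pd 1 (fun q => ((1 / rad ℓ q : ℝ) : ℂ)) q = _ := pd_one_ofReal d2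
  have ht' : ∀ i, pd i (trace (cylMetric ℓ) H) q
      = pd i (fun q => ((rad ℓ q : ℝ) : ℂ)) q * H q 0 0
        + ((rad ℓ q : ℝ) : ℂ) * pd i (fun q => H q 0 0) q
        + (pd i (fun q => ((1 / rad ℓ q : ℝ) : ℂ)) q * H q 1 1
          + ((1 / rad ℓ q : ℝ) : ℂ) * pd i (fun q => H q 1 1) q) := fun i => by
    rw [ht, pd_add (D1.fun_mul (hd 0 0)) (D2.fun_mul (hd 1 1)), pd_mul D1 (hd 0 0),
      pd_mul D2 (hd 1 1)]
  have hr2 : ((q 0 ^ 2 + ℓ ^ 2 : ℝ) : ℂ) = rad ℓ q := rfl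
  constructor
  · simp only [bianchi, divergence, covTwo, Fin.sum_univ_two, christoffel_cyl hl, cylMetric_inv hl,
      ht', e1, e3, hsym]
    simp only [Complex.ofReal_div, Complex.ofReal_neg, Complex.ofReal_pow, Complex.ofReal_mul, hr2,
      Matrix.of_apply, Matrix.cons_val', Matrix.cons_val_zero, Matrix.cons_val_one,
      Matrix.cons_val_fin_one, Complex.ofReal_zero, Complex.ofReal_one, Complex.ofReal_ofNat]
    field_simp
    ring
  · simp only [bianchi, divergence, covTwo, Fin.sum_univ_two, christoffel_cyl hl, cylMetric_inv hl,
      ht', e2, e4, hsym]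
    simp only [Complex.ofReal_div, Complex.ofReal_neg, Complex.ofReal_mul,
      Matrix.of_apply, Matrix.cons_val', Matrix.cons_val_zero, Matrix.cons_val_one,
      Matrix.cons_val_fin_one, Complex.ofReal_zero, Complex.ofReal_one]
    field_simp
    ring

/-- The scalar function `r ω_τ + i ε ω_θ`. -/
def scal (ℓ : ℝ) (ε : ℂ) (ω : OneForm) (q : Pt) : ℂ := rad ℓ q * ω q 0 + Complex.I * ε * ω q 1

theorem contDiff_rad (ℓ : ℝ) : ContDiff ℝ (⊤ : ℕ∞) fun q : Pt => ((rad ℓ q : ℝ) : ℂ) :=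
  Complex.ofRealCLM.contDiff.comp (((contDiff_apply ℝ ℝ (0 : Fin 2)).pow 2).add contDiff_const)

theorem contDiffAt_scal {ω : OneForm} {q : Pt} (ε : ℂ)
    (h : ∀ i, ContDiffAt ℝ 2 (fun q => ω q i) q) : ContDiffAt ℝ 2 (scal ℓ ε ω) q :=
  ((contDiff_infty.1 (contDiff_rad ℓ) 2).contDiffAt.mul (h 0)).add
    (contDiffAt_const.mul (h 1))

/-- The operator `P` becomes a pair of scalar operators. -/
theorem scal_opP (hl : 0 < ℓ) {ε : ℂ} (hε : ε ^ 2 = 1) {ω : OneForm} {q : Pt}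
    (h : ∀ i, ContDiffAt ℝ 2 (fun q => ω q i) q) :
    -2 * rad ℓ q * scal ℓ ε (opP (cylMetric ℓ) ω) q =
      rad ℓ q ^ 2 * pd 0 (pd 0 (scal ℓ ε ω)) q + pd 1 (pd 1 (scal ℓ ε ω)) q
        + 2 * Complex.I * ε * q 0 * pd 1 (scal ℓ ε ω) q - 2 * rad ℓ q * scal ℓ ε ω q := by
  have hr : (rad ℓ q : ℂ) ≠ 0 := by exact_mod_cast (rad_pos hl q).ne'
  have hr2 : ((q 0 ^ 2 + ℓ ^ 2 : ℝ) : ℂ) = rad ℓ q := rfl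
  have d1 := fun q : Pt => hasDerivAt_rad ℓ (q 0)
  have d2 := hasDerivAt_div_rad hl (q 0)
  have d3 := hasDerivAt_mul_rad ℓ (q 0)
  have D1 : ∀ q, DifferentiableAt ℝ (fun q => ((rad ℓ q : ℝ) : ℂ)) q :=
    fun q => differentiableAt_of_hasDerivAt (d1 q)
  have D2 : DifferentiableAt ℝ (fun q => ((q 0 / rad ℓ q : ℝ) : ℂ)) q :=
    differentiableAt_of_hasDerivAt d2
  have D3 : DifferentiableAt ℝ (fun q => ((q 0 * rad ℓ q : ℝ) : ℂ)) q :=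
    differentiableAt_of_hasDerivAt d3
  have D4 : DifferentiableAt ℝ (fun q : Pt => ((q 0 : ℝ) : ℂ)) q :=
    differentiableAt_of_hasDerivAt (hasDerivAt_id _)
  have e1 : ∀ q, pd 0 (fun q => ((rad ℓ q : ℝ) : ℂ)) q = 2 * q 0 := fun q =>
    (pd_zero_ofReal (d1 q)).trans (by push_cast; ring)
  have e2 : ∀ q, pd 1 (fun q => ((rad ℓ q : ℝ) : ℂ)) q = _ := fun q => pd_one_ofReal (d1 q)
  have e3 : pd 0 (fun q => ((q 0 / rad ℓ q : ℝ) : ℂ)) q = _ := pd_zero_ofReal d2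
  have e4 : pd 1 (fun q => ((q 0 / rad ℓ q : ℝ) : ℂ)) q = _ := pd_one_ofReal d2
  have e5 : pd 0 (fun q => ((q 0 * rad ℓ q : ℝ) : ℂ)) q = _ := pd_zero_ofReal d3
  have e6 : pd 1 (fun q => ((q 0 * rad ℓ q : ℝ) : ℂ)) q = _ := pd_one_ofReal d3
  have e7 : pd 0 (fun q : Pt => ((q 0 : ℝ) : ℂ)) q = 1 := by
    exact (pd_zero_ofReal (hasDerivAt_id (q 0))).trans Complex.ofReal_one
  have hω : ∀ i, DifferentiableAt ℝ (fun q => ω q i) q := fun i => (h i).differentiableAt (by simp)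
  have hpd : ∀ i j, DifferentiableAt ℝ (pd j fun q => ω q i) q := fun i j => pd_differentiableAt (h i) j
  have hev : ∀ᶠ p in 𝓝 q, ∀ i, DifferentiableAt ℝ (fun q => ω q i) p := by
    refine Filter.eventually_all.2 fun i => ?_
    filter_upwards [(h i).eventually (by simp)] with p hp using hp.differentiableAt (by simp)
  have s0 : pd 0 (scal ℓ ε ω) =ᶠ[𝓝 q] fun p => 2 * p 0 * ω p 0
      + rad ℓ p * pd 0 (fun q => ω q 0) p + Complex.I * ε * pd 0 (fun q => ω q 1) p := by
    filter_upwards [hev] with p hp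
    have : scal ℓ ε ω = fun q => rad ℓ q * ω q 0 + Complex.I * ε * ω q 1 := rfl
    rw [this, pd_add ((D1 p).fun_mul (hp 0)) ((hp 1).const_mul _), pd_mul (D1 p) (hp 0),
      pd_const_mul (hp 1), e1]
  have s1 : pd 1 (scal ℓ ε ω) =ᶠ[𝓝 q] fun p =>
      rad ℓ p * pd 1 (fun q => ω q 0) p + Complex.I * ε * pd 1 (fun q => ω q 1) p := by
    filter_upwards [hev] with p hp
    have : scal ℓ ε ω = fun q => rad ℓ q * ω q 0 + Complex.I * ε * ω q 1 := rfl
    rw [this, pd_add ((D1 p).fun_mul (hp 0)) ((hp 1).const_mul _), pd_mul (D1 p) (hp 0),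
      pd_const_mul (hp 1), e2]
    ring
  have s00 : pd 0 (pd 0 (scal ℓ ε ω)) q = 2 * ω q 0 + 2 * q 0 * pd 0 (fun q => ω q 0) q
      + (2 * q 0 * pd 0 (fun q => ω q 0) q + rad ℓ q * pd 0 (pd 0 fun q => ω q 0) q)
      + Complex.I * ε * pd 0 (pd 0 fun q => ω q 1) q := by
    rw [pd_congr s0, pd_add (((D4.const_mul 2).fun_mul (hω 0)).fun_add ((D1 q).fun_mul (hpd 0 0)))
      ((hpd 1 0).const_mul _), pd_add ((D4.const_mul 2).fun_mul (hω 0)) ((D1 q).fun_mul (hpd 0 0)),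
      pd_mul (D4.const_mul 2) (hω 0), pd_mul (D1 q) (hpd 0 0), pd_const_mul (hpd 1 0),
      pd_const_mul D4, e1, e7, mul_one]
  have s11 : pd 1 (pd 1 (scal ℓ ε ω)) q = rad ℓ q * pd 1 (pd 1 fun q => ω q 0) q
      + Complex.I * ε * pd 1 (pd 1 fun q => ω q 1) q := by
    rw [pd_congr s1, pd_add ((D1 q).fun_mul (hpd 0 1)) ((hpd 1 1).const_mul _),
      pd_mul (D1 q) (hpd 0 1), pd_const_mul (hpd 1 1), e2]
    ring
  have H00 : (fun q => deltaStar (cylMetric ℓ) ω q 0 0) = fun q =>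
      pd 0 (fun q => ω q 0) q + ((q 0 / rad ℓ q : ℝ) : ℂ) * ω q 0 := by
    ext q; rw [deltaStar_cyl hl]; rfl
  have H01 : (fun q => deltaStar (cylMetric ℓ) ω q 0 1) = fun q =>
      (1 / 2) * (pd 0 (fun q => ω q 1) q + pd 1 (fun q => ω q 0) q)
            - ((q 0 / rad ℓ q : ℝ) : ℂ) * ω q 1 := by
    ext q; rw [deltaStar_cyl hl]; rfl
  have H11 : (fun q => deltaStar (cylMetric ℓ) ω q 1 1) = fun q =>
      pd 1 (fun q => ω q 1) q + ((q 0 * rad ℓ q : ℝ) : ℂ) * ω q 0 := by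
    ext q; rw [deltaStar_cyl hl]; rfl
  have hsym : ∀ q, deltaStar (cylMetric ℓ) ω q 1 0 = deltaStar (cylMetric ℓ) ω q 0 1 := fun q => by
    rw [deltaStar_cyl hl, deltaStar_cyl hl]; rfl
  have f00 := (hpd 0 0).fun_add (D2.fun_mul (hω 0))
  have f01 := (((hpd 1 0).fun_add (hpd 0 1)).const_mul (1 / 2)).fun_sub (D2.fun_mul (hω 1))
  have f11 := (hpd 1 1).fun_add (D3.fun_mul (hω 0))
  obtain ⟨b0, b1⟩ := bianchi_cyl hl (H := deltaStar (cylMetric ℓ) ω) (q := q) hsym fun i j => by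
    fin_cases i <;> fin_cases j
    · exact H00 ▸ f00
    · exact H01 ▸ f01
    · have : (fun q => deltaStar (cylMetric ℓ) ω q 1 0) = fun q => deltaStar (cylMetric ℓ) ω q 0 1 :=
        funext hsym
      exact (this.trans H01) ▸ f01
    · exact H11 ▸ f11
  have p00 : ∀ i, pd i (fun q => deltaStar (cylMetric ℓ) ω q 0 0) q = pd i (pd 0 fun q => ω q 0) q
      + (pd i (fun q => ((q 0 / rad ℓ q : ℝ) : ℂ)) q * ω q 0
        + ((q 0 / rad ℓ q : ℝ) : ℂ) * pd i (fun q => ω q 0) q) := fun i => by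
    rw [H00, pd_add (hpd 0 0) (D2.fun_mul (hω 0)), pd_mul D2 (hω 0)]
  have p01 : ∀ i, pd i (fun q => deltaStar (cylMetric ℓ) ω q 0 1) q =
      1 / 2 * (pd i (pd 0 fun q => ω q 1) q + pd i (pd 1 fun q => ω q 0) q)
      - (pd i (fun q => ((q 0 / rad ℓ q : ℝ) : ℂ)) q * ω q 1
        + ((q 0 / rad ℓ q : ℝ) : ℂ) * pd i (fun q => ω q 1) q) := fun i => by
    rw [H01, pd_sub (((hpd 1 0).fun_add (hpd 0 1)).const_mul (1 / 2)) (D2.fun_mul (hω 1)),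
      pd_const_mul ((hpd 1 0).fun_add (hpd 0 1)), pd_add (hpd 1 0) (hpd 0 1), pd_mul D2 (hω 1)]
  have p11 : ∀ i, pd i (fun q => deltaStar (cylMetric ℓ) ω q 1 1) q = pd i (pd 1 fun q => ω q 1) q
      + (pd i (fun q => ((q 0 * rad ℓ q : ℝ) : ℂ)) q * ω q 0
        + ((q 0 * rad ℓ q : ℝ) : ℂ) * pd i (fun q => ω q 0) q) := fun i => by
    rw [H11, pd_add (hpd 1 1) (D3.fun_mul (hω 0)), pd_mul D3 (hω 0)]
  rw [s00, s11, s1.self_of_nhds, scal, opP, b0, b1, p00, p00, p01, p01, p11, p11, e3, e4, e5, e6,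
    congrFun H00 q, congrFun H01 q, pd_comm (h 0) 1 0, pd_comm (h 1) 1 0, scal]
  have hI : Complex.I ^ 2 = -1 := Complex.I_sq
  simp only [Complex.ofReal_div, Complex.ofReal_mul, Complex.ofReal_sub, Complex.ofReal_add, hr2,
    Complex.ofReal_pow, Complex.ofReal_one, Complex.ofReal_ofNat]
  generalize (rad ℓ q : ℂ) = r at *
  field_simp
  -- After clearing denominators, the relations i² = -1 and ε² = 1 enter only through the
  -- first-order coupling term τ ∂_θ ω_θ.
  linear_combination (-2 * (q 0 : ℂ) * pd 1 (fun q => ω q 1) q) * (ε ^ 2 * hI - hε)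

end

end HypCyl

end

noncomputable section

namespace HypCyl
open Set Filter Topology

/-! ### Uniqueness -/

section

variable {ℓ : ℝ}

theorem hasDerivAt_pd_zero {g : Pt → ℂ} {τ θ : ℝ} (h : DifferentiableAt ℝ g ![τ, θ]) :
    HasDerivAt (fun s => g ![s, θ]) (pd 0 g ![τ, θ]) τ := by
  have h1 : HasDerivAt (fun s : ℝ => (![s, θ] : Pt)) (Pi.single 0 1) τ := by
    refine hasDerivAt_pi.2 fun i => ?_
    fin_cases i
    · simpa using hasDerivAt_id' τ
    · simpa using hasDerivAt_const τ θ
  exact h.hasFDerivAt.comp_hasDerivAt (f := fun s : ℝ => (![s, θ] : Pt)) τ h1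

theorem hasDerivAt_pd_one {g : Pt → ℂ} {τ θ : ℝ} (h : DifferentiableAt ℝ g ![τ, θ]) :
    HasDerivAt (fun s => g ![τ, s]) (pd 1 g ![τ, θ]) θ := by
  have h1 : HasDerivAt (fun s : ℝ => (![τ, s] : Pt)) (Pi.single 1 1) θ := by
    refine hasDerivAt_pi.2 fun i => ?_
    fin_cases i
    · simpa using hasDerivAt_const θ τ
    · simpa using hasDerivAt_id' θ
  exact h.hasFDerivAt.comp_hasDerivAt (f := fun s : ℝ => (![τ, s] : Pt)) θ h1

/-- The first and second order conditions at a maximum of `‖p‖² - M r`. -/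
theorem inner_of_isLocalMax {p p' : ℝ → ℂ} {p'' : ℂ} {ρ ρ' : ℝ → ℝ} {ρ'' x : ℝ}
    (h1 : ∀ᶠ s in 𝓝 x, HasDerivAt p (p' s) s) (h2 : HasDerivAt p' p'' x)
    (hρ1 : ∀ s, HasDerivAt ρ (ρ' s) s) (hρ2 : HasDerivAt ρ' ρ'' x)
    (hm : IsLocalMax (fun s => ‖p s‖ ^ 2 - ρ s) x) :
    2 * inner ℝ (p x) (p' x) = ρ' x ∧ 2 * (inner ℝ (p x) p'' + ‖p' x‖ ^ 2) ≤ ρ'' := by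
  have e1 : ∀ᶠ s in 𝓝 x, HasDerivAt (fun s => ‖p s‖ ^ 2 - ρ s) (2 * inner ℝ (p s) (p' s) - ρ' s) s :=
    h1.mono fun s hs => hs.norm_sq.sub (hρ1 s)
  have e2 : HasDerivAt (fun s => 2 * inner ℝ (p s) (p' s) - ρ' s)
      (2 * (inner ℝ (p x) p'' + inner ℝ (p' x) (p' x)) - ρ'') x :=
    ((h1.self_of_nhds.inner ℝ h2).const_mul 2).sub hρ2
  have h3 := hm.hasDerivAt_eq_zero e1.self_of_nhds
  have h4 := second_deriv_nonpos_of_isLocalMax hm e1 e2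
  rw [real_inner_self_eq_norm_sq] at h4
  constructor <;> linarith

/-- At an interior maximum M > 0 of |f|² / r the equation is paired with f. The second-order
conditions give ⟨f, f_ττ⟩ ≤ M - |f_τ|² and ⟨f, f_θθ⟩ ≤ -|f_θ|², and the cross term is at most τ²|f|²
+ |f_θ|². With |f|² = Mr there remains r²M + r²|f_τ|² ≤ rMτ². The first-order condition ⟨f, f_τ⟩ =
Mτ and Cauchy–Schwarz give r|f_τ|² ≥ Mτ², a contradiction. -/
theorem eq_zero_of_scalar_eq (hl : 0 < ℓ) {ε : ℂ} (hε : ‖ε‖ = 1) {f : Pt → ℂ}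
    (hc : ContinuousOn f {q | q 0 ∈ Icc (-1 : ℝ) 1}) (h2 : ContDiffOn ℝ 2 f {q | q 0 ∈ Ioo (-1 : ℝ) 1})
    (hper : ∀ τ ∈ Icc (-1 : ℝ) 1, ∀ θ, f ![τ, θ + 2 * Real.pi] = f ![τ, θ])
    (hb : ∀ θ, f ![1, θ] = 0 ∧ f ![-1, θ] = 0)
    (heq : ∀ q : Pt, q 0 ∈ Ioo (-1 : ℝ) 1 → rad ℓ q ^ 2 * pd 0 (pd 0 f) q + pd 1 (pd 1 f) q
      + 2 * Complex.I * ε * q 0 * pd 1 f q - 2 * rad ℓ q * f q = 0) :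
    ∀ τ ∈ Icc (-1 : ℝ) 1, ∀ θ, f ![τ, θ] = 0 := by
  by_contra! hcon
  obtain ⟨τ₁, hτ₁, θ₁, hne⟩ := hcon
  have hcv : ContinuousOn (fun p : ℝ × ℝ => f ![p.1, p.2]) (Icc (-1) 1 ×ˢ univ) := by
    refine hc.comp (f := fun p : ℝ × ℝ => (![p.1, p.2] : Pt)) ?_ fun p hp => hp.1
    refine (continuous_pi fun i => ?_).continuousOn
    fin_cases i
    exacts [continuous_fst, continuous_snd]
  have hr : ∀ τ : ℝ, 0 < τ ^ 2 + ℓ ^ 2 := fun τ => by positivity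
  set φ : ℝ × ℝ → ℝ := fun p => ‖f ![p.1, p.2]‖ ^ 2 / (p.1 ^ 2 + ℓ ^ 2) with hφ
  have hφc : ContinuousOn φ (Icc (-1) 1 ×ˢ Icc 0 (2 * Real.pi)) :=
    ((hcv.mono (prod_mono_right (subset_univ _))).norm.pow 2).div (by fun_prop)
      fun p _ => (hr p.1).ne'
  have hpi := Real.two_pi_pos
  obtain ⟨⟨τ₀, θ₀⟩, ⟨hτ₀, hθ₀⟩, hmax⟩ := (isCompact_Icc.prod isCompact_Icc).exists_isMaxOn
    (nonempty_Icc.2 (by norm_num : (-1 : ℝ) ≤ 1) |>.prod (nonempty_Icc.2 hpi.le)) hφc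
  -- Periodicity makes the maximum over one period global, so that it is interior in θ even when θ₀
  -- is an end point of the period.
  have hglob : ∀ τ ∈ Icc (-1 : ℝ) 1, ∀ θ, φ (τ, θ) ≤ φ (τ₀, θ₀) := fun τ hτ θ => by
    have hp : Function.Periodic (fun θ => φ (τ, θ)) (2 * Real.pi) := fun θ => by
      simp only [hφ, hper τ hτ]
    obtain ⟨θ', hθ', e⟩ := hp.exists_mem_Ico₀ hpi θ
    rw [show φ (τ, θ) = φ (τ, θ') from e]
    exact hmax ⟨hτ, Ico_subset_Icc_self hθ'⟩
  set M := φ (τ₀, θ₀) with hM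
  have hMpos : 0 < M := by
    refine lt_of_lt_of_le ?_ (hglob τ₁ hτ₁ θ₁)
    have := norm_pos_iff.2 hne
    have := hr τ₁
    simp only [hφ]
    positivity
  have hle : ∀ τ ∈ Icc (-1 : ℝ) 1, ∀ θ, ‖f ![τ, θ]‖ ^ 2 - M * (τ ^ 2 + ℓ ^ 2) ≤ 0 := fun τ hτ θ => by
    have := hglob τ hτ θ
    rw [hφ, div_le_iff₀ (hr τ)] at this
    linarith
  have hM0 : ‖f ![τ₀, θ₀]‖ ^ 2 = M * (τ₀ ^ 2 + ℓ ^ 2) := by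
    rw [hM, hφ]
    exact (div_mul_cancel₀ _ (hr τ₀).ne').symm
  have hτo : τ₀ ∈ Ioo (-1 : ℝ) 1 := by
    have hne0 : f ![τ₀, θ₀] ≠ 0 := fun h0 => by
      rw [h0] at hM0
      have := mul_pos hMpos (hr τ₀)
      simp at hM0
      rcases hM0 with h | h
      · exact hMpos.ne' h
      · exact (hr τ₀).ne' h
    refine ⟨lt_of_le_of_ne hτ₀.1 ?_, lt_of_le_of_ne hτ₀.2 ?_⟩
    · rintro rfl; exact hne0 (hb θ₀).2
    · rintro rfl; exact hne0 (hb θ₀).1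
  have ho : IsOpen {q : Pt | q 0 ∈ Ioo (-1 : ℝ) 1} := isOpen_Ioo.preimage (continuous_apply 0)
  have hcd : ∀ τ ∈ Ioo (-1 : ℝ) 1, ∀ θ, ContDiffAt ℝ 2 f ![τ, θ] := fun τ hτ θ =>
    h2.contDiffAt (ho.mem_nhds hτ)
  have hd : ∀ τ ∈ Ioo (-1 : ℝ) 1, ∀ θ, DifferentiableAt ℝ f ![τ, θ] := fun τ hτ θ =>
    (hcd τ hτ θ).differentiableAt (by simp)
  obtain ⟨c1, c2⟩ := inner_of_isLocalMax (x := τ₀) (p := fun s => f ![s, θ₀])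
    (p' := fun s => pd 0 f ![s, θ₀]) (ρ := fun s => M * (s ^ 2 + ℓ ^ 2)) (ρ' := fun s => M * (2 * s))
    (ρ'' := M * 2)
    (by filter_upwards [isOpen_Ioo.mem_nhds hτo] with s hs using hasDerivAt_pd_zero (hd s hs θ₀))
    (hasDerivAt_pd_zero (pd_differentiableAt (hcd τ₀ hτo θ₀) 0))
    (fun s => (hasDerivAt_rad ℓ s).const_mul M)
    (by simpa using ((hasDerivAt_id τ₀).const_mul 2).const_mul M) (by
      filter_upwards [isOpen_Ioo.mem_nhds hτo] with s hs
      rw [hM0, sub_self]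
      exact hle s (Ioo_subset_Icc_self hs) θ₀)
  obtain ⟨-, c3⟩ := inner_of_isLocalMax (x := θ₀) (p := fun s => f ![τ₀, s])
    (p' := fun s => pd 1 f ![τ₀, s]) (ρ := fun _ => M * (τ₀ ^ 2 + ℓ ^ 2)) (ρ' := fun _ => 0)
    (ρ'' := 0) (Eventually.of_forall fun s => hasDerivAt_pd_one (hd τ₀ hτo s))
    (hasDerivAt_pd_one (pd_differentiableAt (hcd τ₀ hτo θ₀) 1))
    (fun s => hasDerivAt_const s _) (hasDerivAt_const θ₀ _) (by
      refine Eventually.of_forall fun s => ?_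
      beta_reduce
      rw [hM0, sub_self]
      exact hle τ₀ hτ₀ s)
  have hE := heq ![τ₀, θ₀] hτo
  have hrad : rad ℓ ![τ₀, θ₀] = τ₀ ^ 2 + ℓ ^ 2 := by simp [rad]
  have hq0 : (![τ₀, θ₀] : Pt) 0 = τ₀ := rfl
  rw [hrad, hq0] at hE
  have hr0 := hr τ₀
  generalize hr' : τ₀ ^ 2 + ℓ ^ 2 = r at *
  generalize pd 0 (pd 0 f) ![τ₀, θ₀] = a2 at *
  generalize pd 1 (pd 1 f) ![τ₀, θ₀] = b2 at *
  generalize hA : pd 0 f ![τ₀, θ₀] = a1 at *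
  generalize hB : pd 1 f ![τ₀, θ₀] = b1 at *
  generalize hF : f ![τ₀, θ₀] = p at *
  have e1 : (r : ℂ) ^ 2 * a2 = (r ^ 2) • a2 := by rw [Complex.real_smul]; push_cast; ring
  have e2 : 2 * (r : ℂ) * p = (2 * r) • p := by rw [Complex.real_smul]; push_cast; ring
  rw [e1, e2] at hE
  have hI := congrArg (inner ℝ p) hE
  rw [inner_sub_right, inner_add_right, inner_add_right, inner_smul_right, inner_smul_right,
    real_inner_self_eq_norm_sq, inner_zero_right, hM0] at hI
  have h5 : inner ℝ p (2 * Complex.I * ε * τ₀ * b1) ≤ ‖p‖ * (2 * |τ₀| * ‖b1‖) := by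
    refine (real_inner_le_norm _ _).trans (le_of_eq ?_)
    simp [hε]
  have h6 : ‖p‖ * (2 * |τ₀| * ‖b1‖) ≤ τ₀ ^ 2 * ‖p‖ ^ 2 + ‖b1‖ ^ 2 := by
    nlinarith [sq_nonneg (|τ₀| * ‖p‖ - ‖b1‖), sq_abs τ₀]
  rw [hM0] at h6
  have h7 : M * τ₀ ^ 2 ≤ r * ‖a1‖ ^ 2 := by
    have h8 := abs_real_inner_le_norm p a1
    have h9 : inner ℝ p a1 = M * τ₀ := by linarith
    rw [h9] at h8
    have h10 : (M * τ₀) ^ 2 ≤ (‖p‖ * ‖a1‖) ^ 2 := by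
      rw [← sq_abs]; exact pow_le_pow_left₀ (abs_nonneg _) h8 2
    rw [mul_pow ‖p‖, hM0] at h10
    have : M * (M * τ₀ ^ 2) ≤ M * (r * ‖a1‖ ^ 2) := by linarith
    exact le_of_mul_le_mul_left this hMpos
  have h11 : r ^ 2 * (inner ℝ p a2 + ‖a1‖ ^ 2) ≤ r ^ 2 * M := by
    refine mul_le_mul_of_nonneg_left ?_ (by positivity)
    linarith
  have h12 : r * (M * τ₀ ^ 2) ≤ r * (r * ‖a1‖ ^ 2) := mul_le_mul_of_nonneg_left h7 hr0.le
  have h13 : 0 < r ^ 2 * M := by positivity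
  nlinarith

theorem contDiffAt_component {ω : OneForm} (h : ContDiffOn ℝ 2 ω {q | q 0 ∈ Ioo (-1 : ℝ) 1}) {q : Pt}
    (hq : q 0 ∈ Ioo (-1 : ℝ) 1) (i : Fin 2) : ContDiffAt ℝ 2 (fun q => ω q i) q :=
  contDiffAt_pi.1 (h.contDiffAt ((isOpen_Ioo.preimage (continuous_apply 0)).mem_nhds hq)) i

theorem pd_pd_sub {f g : Pt → ℂ} {q : Pt} (hf : ContDiffAt ℝ 2 f q) (hg : ContDiffAt ℝ 2 g q)
    (i : Fin 2) : pd i (pd i fun q => f q - g q) q = pd i (pd i f) q - pd i (pd i g) q := by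
  have : pd i (fun q => f q - g q) =ᶠ[𝓝 q] fun p => pd i f p - pd i g p := by
    filter_upwards [hf.eventually (by simp), hg.eventually (by simp)] with p h1 h2
    exact pd_sub (h1.differentiableAt (by simp)) (h2.differentiableAt (by simp)) i
  rw [pd_congr this, pd_sub (pd_differentiableAt hf i) (pd_differentiableAt hg i)]

theorem eq_zero_of_scal_eq_zero (hl : 0 < ℓ) {ω : OneForm} {q : Pt}
    (h1 : scal ℓ 1 ω q = 0) (h2 : scal ℓ (-1) ω q = 0) : ω q = 0 := by
  have hr : (rad ℓ q : ℂ) ≠ 0 := by exact_mod_cast (rad_pos hl q).ne'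
  simp only [scal] at h1 h2
  have e1 : (rad ℓ q : ℂ) * ω q 0 = 0 := by linear_combination (h1 + h2) / 2
  have e2 : Complex.I * ω q 1 = 0 := by linear_combination (h1 - h2) / 2
  ext i
  fin_cases i
  · exact (mul_eq_zero.1 e1).resolve_left hr
  · exact (mul_eq_zero.1 e2).resolve_left Complex.I_ne_zero

theorem eq_of_frameCoeff_eq (hl : 0 < ℓ) {ω ω' : OneForm} {τ θ : ℝ}
    (h : frameCoeff ℓ ω τ θ = frameCoeff ℓ ω' τ θ) : ω ![τ, θ] = ω' ![τ, θ] := by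
  have hr : ((Real.sqrt (τ ^ 2 + ℓ ^ 2) : ℝ) : ℂ) ≠ 0 := by
    have : 0 < τ ^ 2 + ℓ ^ 2 := by positivity
    exact_mod_cast (Real.sqrt_pos.2 this).ne'
  have h0 := congrFun h 0
  have h1 := congrFun h 1
  simp only [frameCoeff, Matrix.cons_val_zero, Matrix.cons_val_one] at h0 h1
  ext i
  fin_cases i
  · exact mul_left_cancel₀ hr h0
  · exact (div_left_inj' hr).1 h1

theorem IsSolution.unique (hl : 0 < ℓ) {h : OneForm} {ηp ηm : ℝ → Fin 2 → ℂ} {ω ω' : OneForm}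
    (s : IsSolution ℓ h ηp ηm ω) (s' : IsSolution ℓ h ηp ηm ω') :
    EqOn ω' ω {q | q 0 ∈ Icc (-1 : ℝ) 1} := by
  have key : ∀ ε : ℂ, ε ^ 2 = 1 → ‖ε‖ = 1 → ∀ τ ∈ Icc (-1 : ℝ) 1, ∀ θ,
      scal ℓ ε ω' ![τ, θ] - scal ℓ ε ω ![τ, θ] = 0 := fun ε hε hn => by
    have hcont : ∀ ω : OneForm, ContinuousOn ω {q | q 0 ∈ Icc (-1 : ℝ) 1} →
        ContinuousOn (scal ℓ ε ω) {q | q 0 ∈ Icc (-1 : ℝ) 1} := fun ω hω =>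
      ((contDiff_rad ℓ).continuous.continuousOn.mul (continuousOn_pi.1 hω 0)).add
        (continuousOn_const.mul (continuousOn_pi.1 hω 1))
    have hcd : ∀ ω : OneForm, ContDiffOn ℝ 2 ω {q | q 0 ∈ Ioo (-1 : ℝ) 1} →
        ∀ q : Pt, q 0 ∈ Ioo (-1 : ℝ) 1 → ContDiffAt ℝ 2 (scal ℓ ε ω) q := fun ω hω q hq =>
      contDiffAt_scal ε (contDiffAt_component hω hq)
    have hbd : ∀ τ : ℝ, ∀ θ, ω' ![τ, θ] = ω ![τ, θ] → scal ℓ ε ω' ![τ, θ] - scal ℓ ε ω ![τ, θ] = 0 :=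
      fun τ θ e => by simp only [scal, e, sub_self]
    refine eq_zero_of_scalar_eq hl hn (f := fun q => scal ℓ ε ω' q - scal ℓ ε ω q)
      ((hcont _ s'.continuousOn).sub (hcont _ s.continuousOn))
      (fun q hq => ((hcd _ s'.contDiffOn q hq).sub (hcd _ s.contDiffOn q hq)).contDiffWithinAt)
      (fun τ hτ θ => ?_) (fun θ => ⟨hbd _ _ (eq_of_frameCoeff_eq hl ?_),
        hbd _ _ (eq_of_frameCoeff_eq hl ?_)⟩) fun q hq => ?_
    · have hrad : rad ℓ ![τ, θ + 2 * Real.pi] = rad ℓ ![τ, θ] := rfl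
      simp only [scal, s'.periodic τ hτ, s.periodic τ hτ, hrad]
    · rw [s'.boundary_plus, s.boundary_plus]
    · rw [s'.boundary_minus, s.boundary_minus]
    · have e1 := scal_opP hl hε (contDiffAt_component s'.contDiffOn hq)
      have e2 := scal_opP hl hε (contDiffAt_component s.contDiffOn hq)
      have c1 := hcd _ s'.contDiffOn q hq
      have c2 := hcd _ s.contDiffOn q hq
      have e3 : scal ℓ ε (opP (cylMetric ℓ) ω') q = scal ℓ ε (opP (cylMetric ℓ) ω) q := by
        simp only [scal, s'.equation q hq, s.equation q hq]
      rw [pd_pd_sub c1 c2, pd_pd_sub c1 c2,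
        pd_sub (c1.differentiableAt (by simp)) (c2.differentiableAt (by simp))]
      rw [e3] at e1
      linear_combination e2 - e1
  intro q hq
  have hq' : q = ![q 0, q 1] := by ext i; fin_cases i <;> rfl
  have h1 := key 1 (by norm_num) (by simp) (q 0) hq (q 1)
  have h2 := key (-1) (by norm_num) (by simp) (q 0) hq (q 1)
  rw [← hq'] at h1 h2
  have h3 := eq_zero_of_scal_eq_zero hl (ω := fun q => ω' q - ω q) (q := q)
    (by simp only [scal, Pi.sub_apply] at h1 ⊢; linear_combination h1)
    (by simp only [scal, Pi.sub_apply] at h2 ⊢; linear_combination h2)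
  exact sub_eq_zero.1 h3

end

end HypCyl

end

/-! ### Boundary values, and assembly of the solution from its modes -/

noncomputable section

namespace HypCyl
open Set Filter Topology

/-! ### Multipliers -/

section

variable {m m' f g : Fam} {ℓ₀ ε : ℝ} {E E' : IndexSet}

theorem isOpen_Ioi_prod_univ : IsOpen (Ioi (0 : ℝ) ×ˢ (univ : Set ℝ)) := isOpen_Ioi.prod isOpen_univ

theorem strip_subset_Ioi {R : ℝ} : strip R ⊆ Ioi 0 ×ˢ univ :=
  prod_mono Ioo_subset_Ioi_self (subset_univ _)

theorem IsMult.mul (hm : IsMult m) (hm' : IsMult m') : IsMult (m * m') :=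
  ⟨hm.sm.mul hm'.sm, fun R σ => (hm.cl R σ).mul_zero isDom_strip (hm'.cl R σ)⟩

theorem IsMult.add (hm : IsMult m) (hm' : IsMult m') : IsMult (m + m') :=
  ⟨hm.sm.add hm'.sm, fun R σ => (hm.cl R σ).add isDom_strip (hm'.cl R σ)⟩

theorem IsMult.pt (hm : IsMult m) : IsMult (pt m) :=
  ⟨hm.sm.pt isOpen_Ioi_prod_univ,
    fun R σ => Cl.pt isDom_strip.isOpen (isAdditivePred_mod isDom_strip) (hm.cl R σ)⟩

theorem isMult_const (c : ℂ) : IsMult (cst fun _ => c) := ⟨sm_cst _, fun _ _ => clM_const isDom_strip c⟩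

theorem isMult_tfun {φ : ℝ → ℂ} (hφ : ContDiff ℝ (⊤ : ℕ∞) φ) : IsMult (tfun φ) :=
  ⟨fun _ => (hφ.comp contDiff_snd).contDiffOn, fun _ _ => clM_tfun isDom_strip hφ⟩

theorem contDiff_rr : ContDiff ℝ (⊤ : ℕ∞) fun p : ℝ × ℝ => p.2 ^ 2 + p.1 ^ 2 := by fun_prop

theorem rr_pos {p : ℝ × ℝ} (hp : p ∈ Ioi (0 : ℝ) ×ˢ (univ : Set ℝ)) : 0 < p.2 ^ 2 + p.1 ^ 2 := by
  have : 0 < p.1 := hp.1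
  positivity

theorem isMult_rr : IsMult rr :=
  ⟨fun _ => (Complex.ofRealCLM.contDiff.comp contDiff_rr).contDiffOn, fun _ _ => clM_rr isDom_strip⟩

theorem isMult_rinv : IsMult rinv :=
  ⟨fun _ => Complex.ofRealCLM.contDiff.comp_contDiffOn
    (contDiff_rr.contDiffOn.inv fun _ hp => (rr_pos hp).ne'), fun _ _ => clM_rinv isDom_strip⟩

theorem isMult_rsqrt : IsMult rsqrt :=
  ⟨fun _ => Complex.ofRealCLM.contDiff.comp_contDiffOn
    (contDiff_rr.contDiffOn.sqrt fun _ hp => (rr_pos hp).ne'), fun _ _ => clM_rsqrt isDom_strip⟩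

theorem isMult_pot : IsMult (pot ε) :=
  ⟨fun _ => (Complex.ofRealCLM.contDiff.comp (by fun_prop : ContDiff ℝ (⊤ : ℕ∞) fun p : ℝ × ℝ =>
    (p.2 + ε * _) ^ 2 + p.2 ^ 2 + 2 * p.1 ^ 2)).contDiffOn, fun _ _ => clM_pot isDom_strip ε⟩

/-! ### Lifting of boundary values -/

/-- A family that is supported near `τ = 1` and does not depend on `τ` near `τ = 1`. -/
structure IsCollar (B : Fam) : Prop where
  zero : ∀ k l, ∀ t ≤ 0, B k l t = 0
  eq_one : ∀ k l t, 3 / 4 ≤ t → B k l t = B k l 1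

/-- A multiplier that is supported near `τ = 1` and equals `√(τ² + ℓ²)` at `τ = 1`. -/
def collar : Fam := tfun (cut (4 / 5) (9 / 10)) * rsqrt

theorem isMult_collar : IsMult collar :=
  (isMult_tfun (contDiff_cut _ _)).mul isMult_rsqrt

theorem collar_eq_zero (k : Mode) (l : ℝ) {t : ℝ} (ht : t ≤ 4 / 5) : collar k l t = 0 := by
  simp [collar, tfun, cut_eq_zero (show (4 / 5 : ℝ) < 9 / 10 by norm_num) ht]

theorem collar_one (k : Mode) (l : ℝ) : collar k l 1 = rsqrt k l 1 := by
  simp [collar, tfun, cut_eq_one (show (4 / 5 : ℝ) < 9 / 10 by norm_num) (by norm_num : (9 / 10 : ℝ) ≤ 1)]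

/-- The model operator applied to the collar multiplier. -/
def collarOp (ε : ℝ) : Fam := rr * rr * pt (pt collar) + cst (fun _ => -1) * pot ε * collar

theorem isMult_collarOp : IsMult (collarOp ε) :=
  ((isMult_rr.mul isMult_rr).mul isMult_collar.pt.pt).add
    (((isMult_const _).mul isMult_pot).mul isMult_collar)

/-- The multiplier vanishes for τ < 4/5 and B is constant in τ beyond 3/4, so the derivative falls
on the multiplier alone. Consequently Q of a lifted boundary value is again a multiplier times B. -/
theorem IsCollar.pt_mul {B : Fam} (hB : IsCollar B) (hsB : Sm (strip ℓ₀) B) (hm : IsMult m)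
    (h0 : ∀ k l, ∀ t < (4 / 5 : ℝ), m k l t = 0) : EqF (strip ℓ₀) (pt (m * B)) (pt m * B) :=
  fun k l t hp => by
  have ho : IsOpen (strip ℓ₀) := isDom_strip.isOpen
  rw [HypCyl.pt_mul ho (hm.sm.mono strip_subset_Ioi) hsB k l t hp]
  simp only [Pi.add_apply, Pi.mul_apply, add_eq_left]
  rcases lt_or_ge t (4 / 5) with h | h
  · rw [h0 k l t h, zero_mul]
  · have : B k l =ᶠ[𝓝 t] fun _ => B k l 1 := by
      filter_upwards [lt_mem_nhds (show (3 / 4 : ℝ) < t by linarith)] with s hs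
        using hB.eq_one k l s hs.le
    rw [show pt B k l t = 0 by simp [HypCyl.pt, this.deriv_eq], mul_zero]

theorem pt_eq_zero_of_lt {c : ℝ} (h0 : ∀ k l, ∀ t < c, m k l t = 0) (k : Mode) (l : ℝ) :
    ∀ t < c, pt m k l t = 0 := fun t ht => by
  have : m k l =ᶠ[𝓝 t] fun _ => 0 := by
    filter_upwards [gt_mem_nhds ht] with s hs using h0 k l s hs
  simp [HypCyl.pt, this.deriv_eq]

theorem IsCollar.Qop_mul {B : Fam} (hB : IsCollar B) (hsB : Sm (strip ℓ₀) B) :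
    EqF (strip ℓ₀) (Qop ε (collar * B)) (collarOp ε * B) := fun k l t hp => by
  have ho : IsOpen (strip ℓ₀) := isDom_strip.isOpen
  have h0 : ∀ k l, ∀ t < (4 / 5 : ℝ), collar k l t = 0 := fun k l t ht => collar_eq_zero k l ht.le
  have h1 := hB.pt_mul hsB isMult_collar h0
  have h2 := ((h1.pt ho) k l t hp).trans
    (hB.pt_mul hsB isMult_collar.pt (pt_eq_zero_of_lt h0) k l t hp)
  rw [Qop_eq]
  simp only [collarOp, Pi.add_apply, Pi.mul_apply, h2]
  ring

theorem reflect_reflect (f : Fam) : reflect (reflect f) = f := by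
  ext k l t; simp [reflect]

theorem reflect_mul (f g : Fam) : reflect (f * g) = reflect f * reflect g := rfl

theorem reflect_add (f g : Fam) : reflect (f + g) = reflect f + reflect g := rfl

/-- The Dirichlet problem for the model operator. -/
theorem exists_Qop_eq (hℓ₀ : 0 < ℓ₀) (hε : |ε| = 1) {G Bp Bm : Fam} (h₁ : Phg ℓ₀ E G)
    (h₂ : Phg ℓ₀ E' (reflect G)) (hp : Phg ℓ₀ E Bp) (hp' : IsCollar Bp) (hm : Phg ℓ₀ E' Bm)
    (hm' : IsCollar Bm) : ∃ f : Fam, Phg ℓ₀ E f ∧ Phg ℓ₀ E' (reflect f) ∧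
      EqF (strip ℓ₀) (Qop ε f) G ∧ ∀ k, ∀ l ∈ Ioo 0 ℓ₀,
        f k l 1 = rsqrt k l 1 * Bp k l 1 ∧ f k l (-1) = rsqrt k l (-1) * Bm k l 1 := by
  have ho : IsOpen (strip ℓ₀) := isDom_strip.isOpen
  have z : ∀ {B : Fam} (m : Fam), IsCollar B → ∀ k l, ∀ t ≤ 0, (m * B) k l t = 0 := fun m hB k l t ht => by
    rw [Pi.mul_apply, Pi.mul_apply, Pi.mul_apply, hB.zero k l t ht, mul_zero]
  have c1 : IsMult (cst fun _ => -1) := isMult_const _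
  have P1 : Phg ℓ₀ E (collar * Bp) := hp.mul isMult_collar
  have P2 : Phg ℓ₀ E' (reflect (collar * Bp)) := P1.reflect_of_side hℓ₀ (z _ hp')
  have P3 : Phg ℓ₀ E' (collar * Bm) := hm.mul isMult_collar
  have P4 : Phg ℓ₀ E (reflect (collar * Bm)) := P3.reflect_of_side hℓ₀ (z _ hm')
  have Q1 : Phg ℓ₀ E (collarOp ε * Bp) := hp.mul isMult_collarOp
  have Q2 : Phg ℓ₀ E' (reflect (collarOp ε * Bp)) := Q1.reflect_of_side hℓ₀ (z _ hp')
  have Q3 : Phg ℓ₀ E' (collarOp (-ε) * Bm) := hm.mul isMult_collarOp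
  have Q4 : Phg ℓ₀ E (reflect (collarOp (-ε) * Bm)) := Q3.reflect_of_side hℓ₀ (z _ hm')
  set L := collar * Bp + reflect (collar * Bm) with hL
  set M := collarOp ε * Bp + reflect (collarOp (-ε) * Bm) with hM
  -- L carries the boundary values and M = Q L, so it remains to solve with source G - M and zero
  -- boundary values. The lift at τ = -1 is built at τ = 1 with -ε and reflected.
  set G' := G + cst (fun _ => -1) * M with hG'
  have S1 : Phg ℓ₀ E G' := h₁.add ((Q1.add Q4).mul c1)
  have S2 : Phg ℓ₀ E' (reflect G') := by
    refine h₂.add (Phg.mul (m := reflect (cst fun _ => -1)) (f := reflect M) c1 ?_)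
    rw [hM, reflect_add, reflect_reflect]
    exact Q2.add Q3
  obtain ⟨s1, s2⟩ := phg_solve hℓ₀ hε S1 S2
  have L1 : Phg ℓ₀ E L := P1.add P4
  have L2 : Phg ℓ₀ E' (reflect L) := by
    rw [hL, reflect_add, reflect_reflect]
    exact P2.add P3
  refine ⟨L + solve ε G', L1.add s1, L2.add s2, fun k l t hp₀ => ?_, fun k l hl => ⟨?_, ?_⟩⟩
  · rw [Qop_add ho (L1.sm.mono strip_subset_cstrip) (s1.sm.mono strip_subset_cstrip) k l t hp₀,
      Pi.add_apply, Pi.add_apply, Pi.add_apply, Qop_solve hℓ₀ S1.sm k l t hp₀,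
      Qop_add ho (P1.sm.mono strip_subset_cstrip) (P4.sm.mono strip_subset_cstrip) k l t hp₀]
    have e1 := hp'.Qop_mul (ε := ε) (hp.sm.mono strip_subset_cstrip) k l t hp₀
    have e2 := hm'.Qop_mul (ε := -ε) (hm.sm.mono strip_subset_cstrip) k l (-t)
      ⟨hp₀.1, by linarith [hp₀.2.2], by linarith [hp₀.2.1]⟩
    have e3 : Qop ε (reflect (collar * Bm)) k l t = Qop (-ε) (collar * Bm) k l (-t) := by
      conv_lhs => rw [← neg_neg ε, Qop_reflect]
      rfl
    simp only [Pi.add_apply, e1, e3, e2, hG', hM, cst, Pi.mul_apply, reflect]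
    ring
  · simp only [hL, Pi.add_apply, solve_one, add_zero]
    rw [show reflect (collar * Bm) k l 1 = 0 from z _ hm' k l (-1) (by norm_num), add_zero,
      Pi.mul_apply, Pi.mul_apply, Pi.mul_apply, collar_one]
  · simp only [hL, Pi.add_apply, solve_neg_one k hl.1, add_zero]
    rw [z _ hp' k l (-1) (by norm_num), zero_add]
    simp only [reflect, neg_neg, Pi.mul_apply, collar_one, rsqrt]
    norm_num

end

end HypCyl

end

noncomputable section

namespace HypCyl
open Set Filter Topology

/-! ### One-forms from their Fourier modes -/

section

variable {S : Set (ℝ × ℝ)} {f g : Fam} {ℓ₀ ℓ ε : ℝ} {E E' : IndexSet}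

theorem pd_synth (hS : IsDom S) (hf : RapF S f) {q : Pt} (hq : (ℓ, q 0) ∈ S) :
    pd 0 (fun q : Pt => synth f ℓ (q 0) (q 1)) q = synth (pt f) ℓ (q 0) (q 1) ∧
    pd 1 (fun q : Pt => synth f ℓ (q 0) (q 1)) q = synth (dθ f) ℓ (q 0) (q 1) := by
  have h1 : HasFDerivAt (fun q : Pt => (ℓ, q 0, q 1)) _ q :=
    (hasFDerivAt_const ℓ q).prodMk ((ContinuousLinearMap.proj (R := ℝ) (φ := fun _ : Fin 2 => ℝ)
      0).hasFDerivAt.prodMk (ContinuousLinearMap.proj (R := ℝ) (φ := fun _ : Fin 2 => ℝ) 1).hasFDerivAt)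
  have h2 := (hasFDerivAt_synth hS hf (q := (ℓ, q 0, q 1)) hq).comp q h1
  have h3 : fderiv ℝ (fun q : Pt => synth f ℓ (q 0) (q 1)) q = _ := h2.fderiv
  constructor <;> rw [pd, h3] <;> simp [Fin.sum_univ_three, coord3, dop]

theorem pd_eventuallyEq {f g : Pt → ℂ} {q : Pt} (h : f =ᶠ[𝓝 q] g) (i : Fin 2) :
    pd i f =ᶠ[𝓝 q] pd i g := h.eventuallyEq_nhds.mono fun _ h => pd_congr h i

theorem isOpen_slice (hS : IsOpen S) (ℓ : ℝ) : IsOpen {q : Pt | (ℓ, q 0) ∈ S} :=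
  hS.preimage (by fun_prop)

/-- On mode k the angular part ∂_θ² + 2iετ ∂_θ - 2r acts as -(k² + 2ετk + 2r), and ε² = 1 completes
the square to -((τ + εk)² + τ² + 2ℓ²). -/
theorem synth_Qop (hS : IsDom S) (hf : RapF S f) (hε : ε ^ 2 = 1) {F : Pt → ℂ}
    (hF : ∀ q : Pt, (ℓ, q 0) ∈ S → F q = synth f ℓ (q 0) (q 1)) {q : Pt} (hq : (ℓ, q 0) ∈ S) :
    rad ℓ q ^ 2 * pd 0 (pd 0 F) q + pd 1 (pd 1 F) q + 2 * Complex.I * ε * q 0 * pd 1 F q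
      - 2 * rad ℓ q * F q = synth (Qop ε f) ℓ (q 0) (q 1) := by
  have ho := isOpen_slice hS.isOpen ℓ
  have ev : ∀ {F : Pt → ℂ} {g : Fam}, (∀ q : Pt, (ℓ, q 0) ∈ S → F q = synth g ℓ (q 0) (q 1)) →
      F =ᶠ[𝓝 q] fun q => synth g ℓ (q 0) (q 1) := fun h => by
    filter_upwards [ho.mem_nhds hq] with p hp using h p hp
  have d0 := (pd_eventuallyEq (ev hF) 0).trans (ev fun p hp => (pd_synth hS hf hp).1)
  have d1 := (pd_eventuallyEq (ev hF) 1).trans (ev fun p hp => (pd_synth hS hf hp).2)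
  rw [(pd_congr d0 0).trans (pd_synth hS (hf.pt hS) hq).1,
    (pd_congr d1 1).trans (pd_synth hS (hf.dθ hS) hq).2, d1.eq_of_nhds, hF q hq]
  have hs : ∀ {g : Fam}, RapF S g → HasSum _ (synth g ℓ (q 0) (q 1)) := fun hg =>
    (hg.summable hS hq (q 1)).hasSum
  have key := ((((hs ((hf.pt hS).pt hS)).mul_left ((rad ℓ q : ℂ) ^ 2)).add
    (hs ((hf.dθ hS).dθ hS))).add ((hs (hf.dθ hS)).mul_left (2 * Complex.I * ε * q 0))).sub
      ((hs hf).mul_left (2 * (rad ℓ q : ℂ)))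
  rw [← key.tsum_eq]
  refine tsum_congr fun k => ?_
  have hε' : (ε : ℂ) ^ 2 = 1 := by exact_mod_cast hε
  simp only [Qop, dθ, cst, Pi.mul_apply, rad]
  push_cast
  linear_combination (Complex.exp (Complex.I * (k : ℤ) * (q 1)) * f k ℓ (q 0)) *
    (((k : ℤ) : ℂ) ^ 2 * hε' + (((k : ℤ) : ℂ) ^ 2 + 2 * ε * ((k : ℤ) : ℂ) * q 0) * Complex.I_sq)

theorem synth_mul {m : Fam} {l t : ℝ} {c : ℂ} (h : ∀ k, m k l t = c) (f : Fam) (θ : ℝ) :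
    synth (m * f) l t θ = c * synth f l t θ := by
  simp only [synth]
  rw [← tsum_mul_left]
  simp only [Pi.mul_apply, h, mul_assoc]

theorem RapF.const_mul (hS : IsDom S) (hf : RapF S f) (c : ℂ) : RapF S (cst (fun _ => c) * f) :=
  hf.imp fun _ h => (clM_const hS c).mul_rap_zero hS h

/-- The combination `a + i ε b`. -/
def comb (ε : ℝ) (a b : Fam) : Fam := a + cst (fun _ => Complex.I * ε) * b

theorem Phg.comb {a b : Fam} (ha : Phg ℓ₀ E a) (hb : Phg ℓ₀ E b) (ε : ℝ) : Phg ℓ₀ E (comb ε a b) :=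
  ha.add (hb.mul (isMult_const _))

theorem RapF.comb (hS : IsDom S) (hf : RapF S f) (hg : RapF S g) (ε : ℝ) : RapF S (comb ε f g) :=
  hf.add hS (hg.const_mul hS _)

theorem synth_comb (hS : IsDom S) (hf : RapF S f) (hg : RapF S g) {l t : ℝ} (hp : (l, t) ∈ S) (θ : ℝ) :
    synth (comb ε f g) l t θ = synth f l t θ + Complex.I * ε * synth g l t θ := by
  rw [comb, synth_add hS hf (hg.const_mul hS _) hp,
    synth_mul (m := cst _) (c := Complex.I * ε) fun _ => rfl]

theorem IsCollar.comb {a b : Fam} (ha : IsCollar a) (hb : IsCollar b) (ε : ℝ) :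
    IsCollar (comb ε a b) where
  zero k l t ht := by
    simp [HypCyl.comb, ha.zero k l t ht, hb.zero k l t ht]
  eq_one k l t ht := by
    simp only [HypCyl.comb, cst, Pi.add_apply, Pi.mul_apply, ha.eq_one k l t ht, hb.eq_one k l t ht]

theorem isCollar_cut_mul {c : Mode → ℝ → ℂ} :
    IsCollar (tfun (cut (1 / 2) (3 / 4)) * fun k l _ => c k l) where
  zero k l t ht := by
    have h : cut (1 / 2) (3 / 4) t = 0 := cut_eq_zero (by norm_num) (by linarith)
    simp only [tfun, Pi.mul_apply, h, zero_mul]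
  eq_one k l t ht := by
    have h : ∀ t, 3 / 4 ≤ t → cut (1 / 2) (3 / 4) t = 1 := fun t ht =>
      cut_eq_one (by norm_num) ht
    simp only [tfun, Pi.mul_apply, h t ht, h 1 (by norm_num)]

/-- The one-form with given Fourier modes of its components in the orthonormal coframe. -/
def formOf (U : Fin 2 → Fam) (ℓ : ℝ) : OneForm := fun q =>
  ![synth (U 0) ℓ (q 0) (q 1) / (Real.sqrt (rad ℓ q) : ℂ),
    (Real.sqrt (rad ℓ q) : ℂ) * synth (U 1) ℓ (q 0) (q 1)]

/-- The vanishing at τ = ℓ = 0 covers the point where √r = 0 and division returns 0. The identity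
then holds without restriction on ℓ and τ and can be used to rewrite whole functions. -/
theorem frameCoeff_formOf {U : Fin 2 → Fam} (h : ∀ i k, U i k 0 0 = 0) (ℓ τ θ : ℝ) (i : Fin 2) :
    frameCoeff ℓ (formOf U ℓ) τ θ i = synth (U i) ℓ τ θ := by
  by_cases hr : τ ^ 2 + ℓ ^ 2 = 0
  · have h1 : τ = 0 := by nlinarith [sq_nonneg τ, sq_nonneg ℓ]
    have h2 : ℓ = 0 := by nlinarith [sq_nonneg τ, sq_nonneg ℓ]
    subst h1 h2
    have : synth (U i) 0 0 θ = 0 := by simp [synth, h]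
    rw [this]
    fin_cases i <;> simp [frameCoeff]
  · have h1 : ((Real.sqrt (τ ^ 2 + ℓ ^ 2) : ℝ) : ℂ) ≠ 0 := by
      have : 0 < τ ^ 2 + ℓ ^ 2 := lt_of_le_of_ne (by positivity) (Ne.symm hr)
      exact_mod_cast (Real.sqrt_pos.2 this).ne'
    fin_cases i
    · simp only [frameCoeff, formOf, rad, Fin.zero_eta, Matrix.cons_val_zero, Matrix.cons_val_one]
      field_simp
    · simp only [frameCoeff, formOf, rad, Fin.mk_one, Matrix.cons_val_zero, Matrix.cons_val_one]
      field_simp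

theorem scal_formOf (hS : IsDom S) {U : Fin 2 → Fam} (hU : ∀ i, RapF S (U i)) (hl : 0 < ℓ) {q : Pt}
    (hq : (ℓ, q 0) ∈ S) :
    scal ℓ ε (formOf U ℓ) q = synth (rsqrt * comb ε (U 0) (U 1)) ℓ (q 0) (q 1) := by
  rw [synth_mul (m := rsqrt) (c := (Real.sqrt (rad ℓ q) : ℂ)) fun _ => rfl, synth_comb hS (hU 0) (hU 1) hq]
  have h0 := Real.sqrt_pos.2 (rad_pos hl q)
  have h1 : ((Real.sqrt (rad ℓ q) : ℝ) : ℂ) ≠ 0 := by exact_mod_cast h0.ne'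
  have h2 : ((rad ℓ q : ℝ) : ℂ) = (Real.sqrt (rad ℓ q) : ℂ) * (Real.sqrt (rad ℓ q) : ℂ) := by
    exact_mod_cast (Real.mul_self_sqrt (rad_pos hl q).le).symm
  simp only [scal, formOf, Matrix.cons_val_zero, Matrix.cons_val_one]
  rw [h2]
  field_simp

theorem scal_eq_frameCoeff (hl : 0 < ℓ) (ω : OneForm) (q : Pt) : scal ℓ ε ω q =
    (Real.sqrt (rad ℓ q) : ℂ) * (frameCoeff ℓ ω (q 0) (q 1) 0
      + Complex.I * ε * frameCoeff ℓ ω (q 0) (q 1) 1) := by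
  have h0 := Real.sqrt_pos.2 (rad_pos hl q)
  have h1 : ((Real.sqrt (rad ℓ q) : ℝ) : ℂ) ≠ 0 := by exact_mod_cast h0.ne'
  have h2 : ((rad ℓ q : ℝ) : ℂ) = (Real.sqrt (rad ℓ q) : ℂ) * (Real.sqrt (rad ℓ q) : ℂ) := by
    exact_mod_cast (Real.mul_self_sqrt (rad_pos hl q).le).symm
  have h3 : (![q 0, q 1] : Pt) = q := by ext i; fin_cases i <;> rfl
  simp only [scal, frameCoeff, Matrix.cons_val_zero, Matrix.cons_val_one, h3]
  rw [h2, show q 0 ^ 2 + ℓ ^ 2 = rad ℓ q from rfl]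
  field_simp

/-- The right hand side of the model equation. -/
def modelSource : Fam := cst (fun _ => -2) * rr * rsqrt

theorem isMult_modelSource : IsMult modelSource :=
  ((isMult_const _).mul isMult_rr).mul isMult_rsqrt

/-- The Dirichlet problem for `P` on the level of Fourier modes. -/
theorem exists_modes (hℓ₀ : 0 < ℓ₀) {H Np Nm : Fin 2 → Fam}
    (hH : ∀ i, Phg ℓ₀ E (H i)) (hH' : ∀ i, Phg ℓ₀ E' (reflect (H i)))
    (hp : ∀ i, Phg ℓ₀ E (Np i)) (hp' : ∀ i, IsCollar (Np i))
    (hm : ∀ i, Phg ℓ₀ E' (Nm i)) (hm' : ∀ i, IsCollar (Nm i)) :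
    ∃ U : Fin 2 → Fam, (∀ i, Phg ℓ₀ E (U i) ∧ Phg ℓ₀ E' (reflect (U i))) ∧
      (∀ ε : ℝ, ε ^ 2 = 1 → EqF (strip ℓ₀) (Qop ε (rsqrt * comb ε (U 0) (U 1)))
        (modelSource * comb ε (H 0) (H 1))) ∧
      (∀ i k, ∀ l ∈ Ioo 0 ℓ₀, U i k l 1 = Np i k l 1 ∧ U i k l (-1) = Nm i k l 1) ∧
      ∀ i k, U i k 0 0 = 0 := by
  have hMs : reflect modelSource = modelSource := by
    ext k l t; simp [reflect, modelSource, rr, rsqrt, cst]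
  have hs : ∀ ε : ℝ, |ε| = 1 → _ := fun ε hε => exists_Qop_eq hℓ₀ hε
    (((hH 0).comb (hH 1) ε).mul isMult_modelSource)
    (by rw [reflect_mul, hMs]; exact ((hH' 0).comb (hH' 1) ε).mul isMult_modelSource)
    ((hp 0).comb (hp 1) ε) ((hp' 0).comb (hp' 1) ε) ((hm 0).comb (hm 1) ε) ((hm' 0).comb (hm' 1) ε)
  obtain ⟨f, f1, f2, f3, f4⟩ := hs 1 (by simp)
  obtain ⟨g, g1, g2, g3, g4⟩ := hs (-1) (by simp)
  have hM : IsMult (rinv * rsqrt) := isMult_rinv.mul isMult_rsqrt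
  have hMr : reflect (rinv * rsqrt) = rinv * rsqrt := by
    ext k l t; simp [reflect, rinv, rsqrt]
  have hsq : ∀ k (l t : ℝ), 0 < l → rsqrt k l t * ((rinv * rsqrt) k l t) = 1 := fun k l t hl => by
    have h : 0 < t ^ 2 + l ^ 2 := by positivity
    have h2 : Real.sqrt (t ^ 2 + l ^ 2) * ((t ^ 2 + l ^ 2)⁻¹ * Real.sqrt (t ^ 2 + l ^ 2)) = 1 := by
      rw [mul_left_comm, Real.mul_self_sqrt h.le, inv_mul_cancel₀ h.ne']
    simp only [rsqrt, rinv, Pi.mul_apply]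
    exact_mod_cast h2
  have hphg : ∀ c d : ℂ, Phg ℓ₀ E (rinv * rsqrt * (cst (fun _ => c) * f + cst (fun _ => d) * g)) ∧
      Phg ℓ₀ E' (reflect (rinv * rsqrt * (cst (fun _ => c) * f + cst (fun _ => d) * g))) := fun c d => by
    refine ⟨((f1.mul (isMult_const c)).add (g1.mul (isMult_const d))).mul hM, ?_⟩
    rw [reflect_mul, hMr]
    exact ((f2.mul (isMult_const c)).add (g2.mul (isMult_const d))).mul hM
  -- f = √r (U₀ + iU₁) and g = √r (U₀ - iU₁) are the scalars for ε = 1 and ε = -1; this inverts the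
  -- relation, with r⁻¹ √r in the role of 1/√r.
  obtain ⟨U₀, hU₀⟩ : ∃ U : Fam, U = rinv * rsqrt * (cst (fun _ => 1 / 2) * f + cst (fun _ => 1 / 2) * g) :=
    ⟨_, rfl⟩
  obtain ⟨U₁, hU₁⟩ : ∃ U : Fam, U = rinv * rsqrt *
    (cst (fun _ => -Complex.I / 2) * f + cst (fun _ => Complex.I / 2) * g) := ⟨_, rfl⟩
  have v₀ : ∀ k l t, U₀ k l t = rinv k l t * rsqrt k l t * (1 / 2 * f k l t + 1 / 2 * g k l t) :=
    fun k l t => by rw [hU₀]; rfl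
  have v₁ : ∀ k l t, U₁ k l t = rinv k l t * rsqrt k l t *
      (-Complex.I / 2 * f k l t + Complex.I / 2 * g k l t) := fun k l t => by rw [hU₁]; rfl
  refine ⟨![U₀, U₁], fun i => ?_, fun ε hε => ?_, fun i k l hl => ?_, fun i k => ?_⟩
  · fin_cases i
    exacts [hU₀ ▸ hphg _ _, hU₁ ▸ hphg _ _]
  · have ho : IsOpen (strip ℓ₀) := isDom_strip.isOpen
    have hc : ∀ k l t, 0 < l → (rsqrt * comb ε U₀ U₁) k l t =
        (1 + ε) / 2 * f k l t + (1 - ε) / 2 * g k l t := fun k l t hl => by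
      have a := hsq k l t hl
      simp only [comb, cst, Pi.mul_apply, Pi.add_apply, v₀, v₁] at a ⊢
      linear_combination ((1 + ε) / 2 * f k l t + (1 - ε) / 2 * g k l t) * a
        + rsqrt k l t ^ 2 * rinv k l t * ε / 2 * (g k l t - f k l t) * Complex.I_sq
    rcases (by simpa using hε : ε = 1 ∨ ε = -1) with rfl | rfl
    · refine fun k l t hp => (EqF.Qop ho (fun k l t hp => ?_) k l t hp).trans (f3 k l t hp)
      refine (hc k l t hp.1.1).trans ?_
      push_cast; ring
    · refine fun k l t hp => (EqF.Qop ho (fun k l t hp => ?_) k l t hp).trans (g3 k l t hp)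
      refine (hc k l t hp.1.1).trans ?_
      push_cast; ring
  · have a1 := hsq k l 1 hl.1
    have a2 := hsq k l (-1) hl.1
    obtain ⟨b1, b2⟩ := f4 k l hl
    obtain ⟨b3, b4⟩ := g4 k l hl
    simp only [comb, cst, Pi.mul_apply, Pi.add_apply] at a1 a2 b1 b2 b3 b4
    push_cast at b1 b2 b3 b4
    fin_cases i
    · change U₀ k l 1 = Np 0 k l 1 ∧ U₀ k l (-1) = Nm 0 k l 1
      rw [v₀, v₀, b1, b2, b3, b4]
      constructor
      · linear_combination Np 0 k l 1 * a1
      · linear_combination Nm 0 k l 1 * a2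
    · change U₁ k l 1 = Np 1 k l 1 ∧ U₁ k l (-1) = Nm 1 k l 1
      rw [v₁, v₁, b1, b2, b3, b4]
      constructor
      · linear_combination Np 1 k l 1 * a1 -
          (rinv k l 1 * rsqrt k l 1 * rsqrt k l 1 * Np 1 k l 1) * Complex.I_sq
      · linear_combination Nm 1 k l 1 * a2 -
          (rinv k l (-1) * rsqrt k l (-1) * rsqrt k l (-1) * Nm 1 k l 1) * Complex.I_sq
  -- At ℓ = τ = 0 the multiplier r⁻¹ takes its default value 0.
  · fin_cases i
    exacts [(v₀ _ _ _).trans (by simp [rinv]), (v₁ _ _ _).trans (by simp [rinv])]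

end

end HypCyl

end

noncomputable section

namespace HypCyl
open Set Filter Topology

/-! ### Solutions of the Dirichlet problem -/

section

variable {ℓ₀ ℓ : ℝ} {E E' : IndexSet}

theorem contDiffOn_formOf (hℓ₀ : 0 < ℓ₀) {U : Fin 2 → Fam} (hU : ∀ i, Phg ℓ₀ E (U i)) (hl : ℓ ∈ Ioo 0 ℓ₀) :
    ContDiffOn ℝ (⊤ : ℕ∞) (formOf U ℓ) {q | q 0 ∈ Icc (-1 : ℝ) 1} := by
  have h1 : ∀ i, ContDiffOn ℝ (⊤ : ℕ∞) (fun q : Pt => synth (U i) ℓ (q 0) (q 1))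
      {q | q 0 ∈ Icc (-1 : ℝ) 1} := fun i =>
    (contDiffOn_synth_closed (hU i).sm (hU i).bdd hℓ₀).comp (f := fun q : Pt => (ℓ, q 0, q 1))
      (by fun_prop) fun q hq => ⟨hl, hq, mem_univ _⟩
  have h2 : ContDiff ℝ (⊤ : ℕ∞) fun q : Pt => (Real.sqrt (rad ℓ q) : ℂ) :=
    Complex.ofRealCLM.contDiff.comp (ContDiff.sqrt (by unfold rad; fun_prop)
      fun q => (rad_pos hl.1 q).ne')
  have h3 : ∀ q : Pt, (Real.sqrt (rad ℓ q) : ℂ) ≠ 0 := fun q => by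
    exact_mod_cast (Real.sqrt_pos.2 (rad_pos hl.1 q)).ne'
  refine contDiffOn_pi.2 fun i => ?_
  fin_cases i
  exacts [((h1 0).mul (h2.contDiffOn.inv fun q _ => h3 q)).congr fun q _ => div_eq_mul_inv _ _,
    h2.contDiffOn.mul (h1 1)]

theorem synth_fhat {u : ℝ → ℝ → ℝ → ℂ} {l t : ℝ} (hu : ContDiff ℝ (⊤ : ℕ∞) (u l t))
    (hp : ∀ θ, u l t (θ + 2 * Real.pi) = u l t θ) (h0 : fourierMode 0 (u l t) = 0) (θ : ℝ) :
    synth (fhat u) l t θ = u l t θ := (hasSum_fourier hu hp h0 θ).tsum_eq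

theorem synth_collar {f : Fam} {η : ℝ → ℝ → ℂ} {l t : ℝ}
    (hf : ∀ k, f k l t = (tfun (cut (1 / 2) (3 / 4)) * fhat fun l _ θ => η l θ) k l 1)
    (hη : ContDiff ℝ (⊤ : ℕ∞) (η l)) (hp : ∀ θ, η l (θ + 2 * Real.pi) = η l θ)
    (h0 : fourierMode 0 (η l) = 0) (θ : ℝ) : synth f l t θ = η l θ := by
  rw [← synth_fhat (u := fun l _ θ => η l θ) (t := 1) hη hp h0 θ]
  refine tsum_congr fun k => ?_
  have h : cut (1 / 2) (3 / 4) 1 = 1 := cut_eq_one (by norm_num) (by norm_num)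
  rw [hf, Pi.mul_apply, Pi.mul_apply, Pi.mul_apply, tfun, h, one_mul]

/-- The scalars for ε = 1 and ε = -1 together determine a one-form, so it suffices to compare them;
each comparison is the sum over the modes of the model equation, divided by -2r. -/
theorem opP_formOf (hl : ℓ ∈ Ioo 0 ℓ₀) {U H : Fin 2 → Fam} (hU : ∀ i, Phg ℓ₀ E (U i))
    (hH : ∀ i, Phg ℓ₀ E' (H i)) (hQ : ∀ ε : ℝ, ε ^ 2 = 1 →
      EqF (strip ℓ₀) (Qop ε (rsqrt * comb ε (U 0) (U 1))) (modelSource * comb ε (H 0) (H 1)))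
    {h : OneForm} {q : Pt} (hq : q 0 ∈ Ioo (-1 : ℝ) 1)
    (hh : ∀ i, synth (H i) ℓ (q 0) (q 1) = frameCoeff ℓ h (q 0) (q 1) i) :
    opP (cylMetric ℓ) (formOf U ℓ) q = h q := by
  -- Class bounds are available only on strips strictly shorter than ℓ₀.
  obtain ⟨R, hR1, hR2⟩ := exists_between hl.2
  have hS : IsDom (strip R) := isDom_strip
  have rU : ∀ i, RapF (strip R) (U i) := fun i => (hU i).bdd.imp fun _ h => h R hR2
  have rH : ∀ i, RapF (strip R) (H i) := fun i => (hH i).bdd.imp fun _ h => h R hR2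
  have hq' : (ℓ, q 0) ∈ strip R := ⟨⟨hl.1, hR1⟩, hq⟩
  have ho : IsOpen {q : Pt | q 0 ∈ Ioo (-1 : ℝ) 1} := isOpen_Ioo.preimage (continuous_apply 0)
  have hcd : ∀ i, ContDiffAt ℝ 2 (fun q => formOf U ℓ q i) q := fun i =>
    (contDiffOn_pi.1 ((contDiffOn_formOf (hl.1.trans hl.2) hU hl).mono fun q (hq : q 0 ∈ Ioo (-1 : ℝ) 1) =>
      Ioo_subset_Icc_self hq) i).contDiffAt (ho.mem_nhds hq) |>.of_le (by norm_cast)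
  have hr : (rad ℓ q : ℂ) ≠ 0 := by exact_mod_cast (rad_pos hl.1 q).ne'
  have key : ∀ ε : ℝ, ε ^ 2 = 1 →
      scal ℓ ε (opP (cylMetric ℓ) (formOf U ℓ)) q = scal ℓ ε h q := fun ε hε => by
    have e1 := scal_opP hl.1 (ε := (ε : ℂ)) (by exact_mod_cast hε) hcd
    have hrap : RapF (strip R) (rsqrt * comb ε (U 0) (U 1)) :=
      ((rU 0).comb hS (rU 1) ε).imp fun _ h => (clM_rsqrt hS).mul_rap_zero hS h
    rw [synth_Qop hS hrap hε (fun p hp => scal_formOf hS rU hl.1 hp) hq',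
      synth_congr (hQ ε hε) ⟨hl, hq⟩,
      synth_mul (m := modelSource) (c := -2 * (rad ℓ q : ℂ) * (Real.sqrt (rad ℓ q) : ℂ)) fun _ => rfl,
      synth_comb hS (rH 0) (rH 1) hq', hh, hh] at e1
    rw [scal_eq_frameCoeff hl.1 h]
    exact mul_left_cancel₀ (mul_ne_zero (by norm_num) hr) (e1.trans (mul_assoc _ _ _))
  have hsub : ∀ ε : ℂ, scal ℓ ε (opP (cylMetric ℓ) (formOf U ℓ) - h) q =
      scal ℓ ε (opP (cylMetric ℓ) (formOf U ℓ)) q - scal ℓ ε h q := fun ε => by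
    simp only [scal, Pi.sub_apply]; ring
  have k1 := key 1 (by norm_num)
  have k2 := key (-1) (by norm_num)
  push_cast at k1 k2
  exact sub_eq_zero.1 (eq_zero_of_scal_eq_zero hl.1 (by rw [hsub, k1, sub_self])
    (by rw [hsub, k2, sub_self]))

theorem IsPhgBoundary.contDiff {η : ℝ → ℝ → ℂ} (hη : IsPhgBoundary ℓ₀ E η) (hl : ℓ ∈ Ioo 0 ℓ₀) :
    ContDiff ℝ (⊤ : ℕ∞) (η ℓ) :=
  contDiffOn_univ.1 (hη.2.1.comp (f := fun θ : ℝ => (ℓ, θ)) (by fun_prop) fun θ _ => ⟨hl, mem_univ _⟩)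

theorem IsPhgOnBlowup.contDiff {I : IndexFamily} {u : ℝ → ℝ → ℝ → ℂ} (hu : IsPhgOnBlowup ℓ₀ I u)
    (hl : ℓ ∈ Ioo 0 ℓ₀) {t : ℝ} (ht : t ∈ Icc (-1 : ℝ) 1) : ContDiff ℝ (⊤ : ℕ∞) (u ℓ t) :=
  contDiffOn_univ.1 (hu.2.1.comp (f := fun θ : ℝ => (ℓ, t, θ)) (by fun_prop)
    fun θ _ => ⟨hl, ht, mem_univ _⟩)

end

end HypCyl

end

/-! ### The main theorem -/

open HypCyl Set

theorem mainTheorem6 (ℓ₀ c : ℝ) (hℓ₀ : 0 < ℓ₀) (hc0 : 0 < c) (hc1 : c < 1)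
    (h : ℝ → HypCyl.OneForm) (Ih : HypCyl.IndexFamily) (hh : HypCyl.IsPhgForm ℓ₀ Ih h)
    (hvanish : ∀ ℓ ∈ Set.Ioo 0 ℓ₀, ∀ q : HypCyl.Pt, |q 0| ≤ c → h ℓ q = 0)
    (hmode : ∀ ℓ ∈ Set.Ioo 0 ℓ₀, ∀ τ ∈ Set.Icc (-1 : ℝ) 1, ∀ i,
      HypCyl.fourierMode 0 (fun θ => HypCyl.frameCoeff ℓ (h ℓ) τ θ i) = 0)
    (ηp ηm : ℝ → ℝ → Fin 2 → ℂ) (Ep Em : HypCyl.IndexSet)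
    (hηp : ∀ i, HypCyl.IsPhgBoundary ℓ₀ Ep (fun ℓ θ => ηp ℓ θ i))
    (hηm : ∀ i, HypCyl.IsPhgBoundary ℓ₀ Em (fun ℓ θ => ηm ℓ θ i))
    (hηp_mode : ∀ ℓ ∈ Set.Ioo 0 ℓ₀, ∀ i, HypCyl.fourierMode 0 (fun θ => ηp ℓ θ i) = 0)
    (hηm_mode : ∀ ℓ ∈ Set.Ioo 0 ℓ₀, ∀ i, HypCyl.fourierMode 0 (fun θ => ηm ℓ θ i) = 0) :
    ∃ ω : ℝ → HypCyl.OneForm,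
      (∀ ℓ ∈ Set.Ioo 0 ℓ₀,
        HypCyl.IsSolution ℓ (h ℓ) (ηp ℓ) (ηm ℓ) (ω ℓ) ∧
        ∀ ω' : HypCyl.OneForm, HypCyl.IsSolution ℓ (h ℓ) (ηp ℓ) (ηm ℓ) ω' →
          Set.EqOn ω' (ω ℓ) {q | q 0 ∈ Set.Icc (-1 : ℝ) 1}) ∧
      ∃ I : HypCyl.IndexFamily, I.ff.carrier = ∅ ∧ HypCyl.IsPhgForm ℓ₀ I ω := by
  have hvan : ∀ i, ∀ l ∈ Ioo 0 ℓ₀, ∀ t, |t| ≤ c → ∀ θ, frameCoeff l (h l) t θ i = 0 := by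
    intro i l hl t ht θ
    have h0 := hvanish l hl ![t, θ] ht
    fin_cases i <;> simp [frameCoeff, h0]
  have hH := fun i => phg_fhat hℓ₀ hc0 hc1 (hh i) (hvan i)
  have hp : (Ih.plus.union Ep).carrier = Ih.plus.carrier ∪ Ep.carrier := rfl
  have hm : (Ih.minus.union Em).carrier = Ih.minus.carrier ∪ Em.carrier := rfl
  -- At each side face the solution inherits exponents from the source and from the boundary value
  -- on that side only, hence the union of the two index sets.
  obtain ⟨U, hU, hQ, hb, h0⟩ := exists_modes (E := Ih.plus.union Ep) (E' := Ih.minus.union Em) hℓ₀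
    (fun i => (hH i).1.mono (hp ▸ subset_union_left))
    (fun i => (hH i).2.mono (hm ▸ subset_union_left))
    (fun i => (phg_boundary hℓ₀ (hηp i)).mono (hp ▸ subset_union_right)) (fun i => isCollar_cut_mul)
    (fun i => (phg_boundary hℓ₀ (hηm i)).mono (hm ▸ subset_union_right)) (fun i => isCollar_cut_mul)
  refine ⟨formOf U, fun ℓ hℓ => ?_, ⟨emptyIndex, Ih.plus.union Ep, Ih.minus.union Em⟩, rfl, fun i => ?_⟩
  · have hcd := contDiffOn_formOf hℓ₀ (fun i => (hU i).1) hℓ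
    have hs : IsSolution ℓ (h ℓ) (ηp ℓ) (ηm ℓ) (formOf U ℓ) :=
      { periodic := fun τ _ θ => by
          ext i
          fin_cases i <;> simp [formOf, rad, synth_periodic]
        continuousOn := hcd.continuousOn
        contDiffOn := (hcd.mono fun q hq => Ioo_subset_Icc_self hq).of_le (by norm_cast)
        equation := fun q hq => opP_formOf (H := fun i => fhat fun ℓ τ θ => frameCoeff ℓ (h ℓ) τ θ i) hℓ
          (fun i => (hU i).1) (fun i => (hH i).1) hQ hq fun i =>
          synth_fhat (u := fun ℓ τ θ => frameCoeff ℓ (h ℓ) τ θ i) ((hh i).contDiff hℓ (Ioo_subset_Icc_self hq))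
            ((hh i).1 ℓ hℓ _ (Ioo_subset_Icc_self hq)) (hmode ℓ hℓ _ (Ioo_subset_Icc_self hq) i) _
        boundary_plus := fun θ => by
          ext i
          rw [frameCoeff_formOf h0]
          exact synth_collar (η := fun ℓ θ => ηp ℓ θ i) (fun k => (hb i k ℓ hℓ).1)
            ((hηp i).contDiff hℓ) ((hηp i).1 ℓ hℓ) (hηp_mode ℓ hℓ i) θ
        boundary_minus := fun θ => by
          ext i
          rw [frameCoeff_formOf h0]
          exact synth_collar (η := fun ℓ θ => ηm ℓ θ i) (fun k => (hb i k ℓ hℓ).2)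
            ((hηm i).contDiff hℓ) ((hηm i).1 ℓ hℓ) (hηm_mode ℓ hℓ i) θ }
    exact ⟨hs, fun ω' hω' => hs.unique hℓ.1 hω'⟩
  · simp only [frameCoeff_formOf h0]
    exact isPhgOnBlowup_synth hℓ₀ (hU i).1 (hU i).2
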